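/- **Setting.** Let $d\ge 1$, let $X\subset\mathbb R^d$ be a bounded open set of class $C^1$ with outward unit normal $\nu$ and surface measure $d\mu$ on $\partial X$. Let $V\subset\mathbb R^d$ be either a bounded open set with $0\notin\overline V$, equipped with Lebesgue measure $dv$, or a closed (compact, boundaryless, embedded, $C^1$) hypersurface with $0\notin V$, equipped with its surface measure $dv$ and such that $\{v\in V: v\cdot e=0\}$ has measure zero for every $e\neq 0$ (as holds for the unit sphere). Put $$\Gamma_\pm=\{(x,v)\in\partial X\times V:\ \pm v\cdot\nu(x)>0\},\quad \Gamma=\Gamma_+\cup\Gamma_-,\quad d\xi=|\nu(x)\cdot v|\,d\mu(x)\,dv,$$ $\tau_\pm(x,v)=\inf\{s>0: x\pm sv\notin X\}$ and $\tau=\tau_++\tau_-$. Let $\mathcal C_+\subset\Gamma_+$ be an arbitrary measurable set, $\mathcal C_-=\{(x,v)\in\Gamma_-:(x+\tau_+(x,v)v,v)\notin \mathcal C_+\}$ and $\mathcal C=\mathcal C_-\cup \mathcal C_+$. Let $1<p<\infty$, $p'=p/(p-1)$. Let $\sigma(x,v)$ and $k(x,v',v)$ be real-valued and measurable with $\tau\sigma\in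 L^\infty(X\times V)$ and $k\in C\big(\overline X,L^p(V_v,L^{p'}(V_{v'}))\big)$. Put $E_\pm(x,v,t)=\exp\big(\pm\int_0^t\sigma(x\pm sv,v)\,ds\big)$ and $Ku(x,v)=\int_V k(x,v',v)u(x,v')\,dv'$. For $\mathcal G\in\{\mathcal C,\Gamma\setminus\mathcal C\}$, with $\mathcal G_\pm=\mathcal G\cap\Gamma_\pm$, let $$T_{\mathcal G}^{-1}f(x,v)=\begin{cases}\int_0^{\tau_-(x,v)}E_-(x,v,t)f(x-tv,v)\,dt,&(x-\tau_-(x,v)v,v)\in \mathcal G_-,\\ -\int_0^{\tau_+(x,v)}E_+(x,v,t)f(x+tv,v)\,dt,&(x+\tau_+(x,v)v,v)\in \mathcal G_+,\end{cases}$$ $$L_{\mathcal G}g(x,v)=\begin{cases}g(x-\tau_-(x,v)v,v)\,E_-(x,v,\tau_-(x,v)),&(x-\tau_-(x,v)v,v)\in \mathcal G_-,\\ g(x+\tau_+(x,v)v,v)\,E_+(x,v,\tau_+(x,v)),&(x+\tau_+(x,v)v,v)\in \mathcal G_+.\end{cases}$$ Then $T_{\mathcal C}^{-1}K$ is a bounded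 operator in $L^p(X\times V)$ and in $\tau^{1/p}L^p(X\times V)=\{u:\tau^{-1/p}u\in L^p(X\times V)\}$, and $KT_{\Gamma\setminus\mathcal C}^{-1}$ is a bounded operator in $L^p(X\times V)$. The albedo operator is $Ag=\big((I-T_{\mathcal C}^{-1}K)^{-1}L_{\mathcal C}g\big)_{|\Gamma\setminus\mathcal C}$, where the restriction denotes the trace, i.e. the limit along the lines in direction $v$ from inside $X$. **Theorem.** 1. If $I-T_{\mathcal C}^{-1}K$ is invertible in $\mathcal L(L^p(X\times V))$, then $A$ is a well-defined bounded operator from $L^p(\mathcal C,\tau d\xi)$ to $L^p(\Gamma\setminus\mathcal C,\tau d\xi)$, it is Fredholm of index $0$, and $$\dim\ker A=\dim\ker\big(I-KT^{-1}_{\Gamma\setminus\mathcal C}\big),$$ where the second kernel is taken in $L^p(X\times V)$. 2. If $I-T_{\mathcal C}^{-1}K$ is invertible in $\mathcal L(\tau^{1/p}L^p(X\times V))$, then $A$ is a well-defined bounded operator from $L^p(\mathcal C,d\xi)$ to $L^p(\Gamma\setminus\mathcal C,d\xi)$, it is Fredholm of index $0$, and the same identity for $\dim\ker A$ holds. -/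

import Mathlib

open MeasureTheory Filter Set
open scoped Topology ENNReal RealInnerProductSpace

noncomputable section

namespace Transport

/-- The Euclidean space `ℝᵈ`. -/
abbrev Euc (d : ℕ) : Type := EuclideanSpace ℝ (Fin d)

variable {d : ℕ}

/-! ### The spatial domain, its outward normal, and the velocity set -/

/-- `φ` is a `C¹` defining function of the open set `X` at the point `x`: it is `C¹` near `x`,
vanishes at `x` with non-zero gradient, and `X = {φ < 0}` near `x`
(such an `x` is a boundary point of `X`). -/
structure IsDefiningFunctionAt (X : Set (Euc d)) (x : Euc d) (φ : Euc d → ℝ) : Prop where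
  contDiffAt : ContDiffAt ℝ 1 φ x
  eq_zero : φ x = 0
  gradient_ne : gradient φ x ≠ 0
  mem_iff : ∀ᶠ y in 𝓝 x, (y ∈ X ↔ φ y < 0)

/-- Bounded open sets of class `C¹`. -/
structure IsC1Domain (X : Set (Euc d)) : Prop where
  isOpen : IsOpen X
  isBounded : Bornology.IsBounded X
  exists_defining : ∀ x ∈ frontier X, ∃ φ, IsDefiningFunctionAt X x φ

open Classical in
/-- The outward unit normal `ν(x)` at a boundary point `x` of a set of class `C¹`, i.e. the
normalized gradient of any defining function (it is `0` at points that are not of this kind). -/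
def outwardNormal (X : Set (Euc d)) (x : Euc d) : Euc d :=
  if h : ∃ φ, IsDefiningFunctionAt X x φ then
    ‖gradient h.choose x‖⁻¹ • gradient h.choose x
  else 0

/-- `V ⊆ ℝᵈ` is an embedded hypersurface (co-dimension one, no boundary) of class `C¹`. -/
def IsC1Hypersurface (V : Set (Euc d)) : Prop :=
  ∀ v ∈ V, ∃ φ : Euc d → ℝ, ContDiffAt ℝ 1 φ v ∧ gradient φ v ≠ 0 ∧
    ∀ᶠ w in 𝓝 v, (w ∈ V ↔ φ w = 0)

/-- Admissible velocity sets `V` together with the canonical measure `m = dv` on `V`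
(regarded as a measure on `ℝᵈ` concentrated on `V`).
* `V` is a bounded open set away from the origin, with Lebesgue measure; or
* `V` is a closed (compact, without boundary) hypersurface away from the origin, with surface
  measure, such that the velocities orthogonal to a given direction have measure zero. -/
inductive IsVelocitySet (V : Set (Euc d)) (m : Measure (Euc d)) : Prop
  | ofOpen (isOpen : IsOpen V) (isBounded : Bornology.IsBounded V) (zero_notMem : 0 ∉ closure V)
      (measure_eq : m = (volume : Measure (Euc d)).restrict V)
  | ofSurface (isCompact : IsCompact V) (isSurface : IsC1Hypersurface V) (zero_notMem : 0 ∉ V)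
      (measure_eq : m = (Measure.euclideanHausdorffMeasure (d - 1) : Measure (Euc d)).restrict V)
      (null_orthogonal : ∀ e : Euc d, e ≠ 0 → m {v | ⟪v, e⟫ = 0} = 0)

/-! ### Travel times and the boundary sets -/

/-- The forward travel time `τ₊(x, v) = inf {s > 0 | x + s v ∉ X}`.
On `Γ₊` this infimum is `0`. -/
def tauPlus (X : Set (Euc d)) (z : Euc d × Euc d) : ℝ :=
  sInf {s : ℝ | 0 < s ∧ z.1 + s • z.2 ∉ X}

/-- The backward travel time `τ₋(x, v) = inf {s > 0 | x - s v ∉ X}`.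
On `Γ₋` this infimum is `0`. -/
def tauMinus (X : Set (Euc d)) (z : Euc d × Euc d) : ℝ :=
  sInf {s : ℝ | 0 < s ∧ z.1 - s • z.2 ∉ X}

/-- `τ = τ₋ + τ₊`. -/
def tau (X : Set (Euc d)) (z : Euc d × Euc d) : ℝ := tauMinus X z + tauPlus X z

/-- `(x + τ₊(x, v) v, v)`, the point where the line through `(x, v)` leaves `X`. -/
def exitPoint (X : Set (Euc d)) (z : Euc d × Euc d) : Euc d × Euc d :=
  (z.1 + tauPlus X z • z.2, z.2)

/-- `(x - τ₋(x, v) v, v)`, the point where the line through `(x, v)` enters `X`. -/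
def entryPoint (X : Set (Euc d)) (z : Euc d × Euc d) : Euc d × Euc d :=
  (z.1 - tauMinus X z • z.2, z.2)

/-- The outgoing boundary `Γ₊`. -/
def GammaPlus (X V : Set (Euc d)) : Set (Euc d × Euc d) :=
  {z | z.1 ∈ frontier X ∧ z.2 ∈ V ∧ 0 < ⟪z.2, outwardNormal X z.1⟫}

/-- The incoming boundary `Γ₋`. -/
def GammaMinus (X V : Set (Euc d)) : Set (Euc d × Euc d) :=
  {z | z.1 ∈ frontier X ∧ z.2 ∈ V ∧ ⟪z.2, outwardNormal X z.1⟫ < 0}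

/-- `Γ = Γ₊ ∪ Γ₋`. -/
def Gamma (X V : Set (Euc d)) : Set (Euc d × Euc d) := GammaPlus X V ∪ GammaMinus X V

/-- `C₋`: the points of `Γ₋` whose line does not leave `X` through `C₊`. -/
def CMinus (X V : Set (Euc d)) (Cp : Set (Euc d × Euc d)) : Set (Euc d × Euc d) :=
  GammaMinus X V \ {z ∈ GammaMinus X V | exitPoint X z ∈ Cp}

/-- The boundary set `𝒞 = C₋ ∪ C₊` determined by `C₊ ⊆ Γ₊`. -/
def bdrySet (X V : Set (Euc d)) (Cp : Set (Euc d × Euc d)) : Set (Euc d × Euc d) :=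
  CMinus X V Cp ∪ Cp

/-- The complementary boundary set `Γ \ 𝒞`. -/
def coBdrySet (X V : Set (Euc d)) (Cp : Set (Euc d × Euc d)) : Set (Euc d × Euc d) :=
  Gamma X V \ bdrySet X V Cp

/-! ### Measures and function spaces

`Lp ℝ p (phaseMeasure X m)` is `L^p(X × V)`; `Lp ℝ p (weightedPhaseMeasure X m)` is
`τ^{1/p} L^p(X × V)`, with norm `‖τ^{-1/p} u‖_{L^p}`; `Lp ℝ p ((xi X m).restrict G)` and
`Lp ℝ p ((tauXi X m).restrict G)` are `L^p(G, dξ)` and `L^p(G, τ dξ)` for `G ⊆ Γ`. -/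

/-- The measure `dx dv` on `X × V`. -/
def phaseMeasure (X : Set (Euc d)) (m : Measure (Euc d)) : Measure (Euc d × Euc d) :=
  ((volume : Measure (Euc d)).restrict X).prod m

/-- The measure `τ⁻¹ dx dv` on `X × V`. -/
def weightedPhaseMeasure (X : Set (Euc d)) (m : Measure (Euc d)) : Measure (Euc d × Euc d) :=
  (phaseMeasure X m).withDensity fun z => ENNReal.ofReal (tau X z)⁻¹

/-- The measure `dξ(x, v) = |ν(x) · v| dμ(x) dv`, with `dμ` the surface measure of `∂X`
(tangential pairs `(x, v)` carry no mass). -/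
def xi (X : Set (Euc d)) (m : Measure (Euc d)) : Measure (Euc d × Euc d) :=
  (((Measure.euclideanHausdorffMeasure (d - 1) : Measure (Euc d)).restrict (frontier X)).prod
    m).withDensity fun z => ENNReal.ofReal |⟪outwardNormal X z.1, z.2⟫|

/-- The measure `τ dξ`. -/
def tauXi (X : Set (Euc d)) (m : Measure (Euc d)) : Measure (Euc d × Euc d) :=
  (xi X m).withDensity fun z => ENNReal.ofReal (tau X z)

/-! ### Coefficients -/

/-- The norm of `κ(v', v)` in `L^p(V_v, L^{p'}(V_{v'}))`, `1/p + 1/p' = 1`. -/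
def mixedNorm (m : Measure (Euc d)) (p : ℝ≥0∞) (κ : Euc d → Euc d → ℝ) : ℝ≥0∞ :=
  eLpNorm (fun v => eLpNorm (fun v' => κ v' v) p.conjExponent m) p m

/-- `k(x, v', v)` belongs to `C(X̄, L^p(V_v, L^{p'}(V_{v'})))`. -/
structure IsContinuousKernel (X : Set (Euc d)) (m : Measure (Euc d)) (p : ℝ≥0∞)
    (k : Euc d → Euc d → Euc d → ℝ) : Prop where
  measurable : Measurable fun w : Euc d × Euc d × Euc d => k w.1 w.2.1 w.2.2
  finite : ∀ x ∈ closure X, mixedNorm m p (k x) < ⊤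
  continuous : ∀ x₀ ∈ closure X,
    Tendsto (fun x => mixedNorm m p fun v' v => k x v' v - k x₀ v' v) (𝓝[closure X] x₀) (𝓝 0)

/-! ### The operators of the transport equation, on functions -/

/-- `E₊(x, v, t) = exp (∫₀ᵗ σ(x + s v, v) ds)`. -/
def EPlus (σ : Euc d × Euc d → ℝ) (z : Euc d × Euc d) (t : ℝ) : ℝ :=
  Real.exp (∫ s in (0 : ℝ)..t, σ (z.1 + s • z.2, z.2))

/-- `E₋(x, v, t) = exp (-∫₀ᵗ σ(x - s v, v) ds)`. -/
def EMinus (σ : Euc d × Euc d → ℝ) (z : Euc d × Euc d) (t : ℝ) : ℝ :=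
  Real.exp (-∫ s in (0 : ℝ)..t, σ (z.1 - s • z.2, z.2))

/-- The scattering operator `K u(x, v) = ∫_V k(x, v', v) u(x, v') dv'`. -/
def scattering (m : Measure (Euc d)) (k : Euc d → Euc d → Euc d → ℝ)
    (u : Euc d × Euc d → ℝ) (z : Euc d × Euc d) : ℝ :=
  ∫ v', k z.1 v' z.2 * u (z.1, v') ∂m

open Classical in
/-- `L_G g`, for `G = 𝒞` or `G = Γ \ 𝒞`: the solution of `v · ∇u + σ u = 0`, `u = g` on `G`. -/
def lifting (X V : Set (Euc d)) (σ : Euc d × Euc d → ℝ) (G : Set (Euc d × Euc d))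
    (g : Euc d × Euc d → ℝ) (z : Euc d × Euc d) : ℝ :=
  if entryPoint X z ∈ G ∩ GammaMinus X V then
    g (entryPoint X z) * EMinus σ z (tauMinus X z)
  else if exitPoint X z ∈ G ∩ GammaPlus X V then
    g (exitPoint X z) * EPlus σ z (tauPlus X z)
  else 0

open Classical in
/-- `T_G⁻¹ f`, for `G = 𝒞` or `G = Γ \ 𝒞`: the solution of `v · ∇u + σ u = f`, `u = 0` on `G`. -/
def transportInv (X V : Set (Euc d)) (σ : Euc d × Euc d → ℝ) (G : Set (Euc d × Euc d))
    (f : Euc d × Euc d → ℝ) (z : Euc d × Euc d) : ℝ :=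
  if entryPoint X z ∈ G ∩ GammaMinus X V then
    ∫ t in (0 : ℝ)..tauMinus X z, EMinus σ z t * f (z.1 - t • z.2, z.2)
  else if exitPoint X z ∈ G ∩ GammaPlus X V then
    -∫ t in (0 : ℝ)..tauPlus X z, EPlus σ z t * f (z.1 + t • z.2, z.2)
  else 0

/-- The bounded operator `B` on `L^p(μ)` is the one given on functions by `F`. -/
def Realizes {μ : Measure (Euc d × Euc d)} {p : ℝ≥0∞} [Fact (1 ≤ p)]
    (B : Lp ℝ p μ →L[ℝ] Lp ℝ p μ)
    (F : (Euc d × Euc d → ℝ) → Euc d × Euc d → ℝ) : Prop :=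
  ∀ f : Lp ℝ p μ, B f =ᵐ[μ] F f

/-! ### Traces and the albedo operator -/

/-- `h` is the trace on `G ⊆ Γ` of the function `u` on `X × V`: at almost every point of `G`,
`h` is the limit of `u` along the line through that point, coming from inside `X`. The limit is
taken off a null set of parameters, so that it does not depend on the representative of `u`. -/
def HasTrace (X V : Set (Euc d)) (m : Measure (Euc d)) (G : Set (Euc d × Euc d))
    (u h : Euc d × Euc d → ℝ) : Prop :=
  ∀ᵐ z ∂(xi X m).restrict G,
    (z ∈ GammaMinus X V →
      Tendsto (fun t : ℝ => u (z.1 + t • z.2, z.2)) (𝓝[>] 0 ⊓ ae volume) (𝓝 (h z))) ∧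
    (z ∈ GammaPlus X V →
      Tendsto (fun t : ℝ => u (z.1 - t • z.2, z.2)) (𝓝[>] 0 ⊓ ae volume) (𝓝 (h z)))

/-- `A` is the albedo operator `A g = ((I - T_𝒞⁻¹ K)⁻¹ L_𝒞 g)|_{Γ \ 𝒞}`, from `L^p(𝒞, ρ)` to
`L^p(Γ \ 𝒞, ρ)`, where the integral equation `u - T_𝒞⁻¹ K u = L_𝒞 g` is solved in `L^p(μ)`. -/
def IsAlbedo (X V : Set (Euc d)) (m : Measure (Euc d)) (Cp : Set (Euc d × Euc d))
    (σ : Euc d × Euc d → ℝ) (k : Euc d → Euc d → Euc d → ℝ) {p : ℝ≥0∞} [Fact (1 ≤ p)]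
    (μ : Measure (Euc d × Euc d)) {ρ : Measure (Euc d × Euc d)}
    (A : Lp ℝ p (ρ.restrict (bdrySet X V Cp)) →L[ℝ] Lp ℝ p (ρ.restrict (coBdrySet X V Cp))) :
    Prop :=
  ∀ g : Lp ℝ p (ρ.restrict (bdrySet X V Cp)), ∃ u : Lp ℝ p μ,
    (fun z => u z - transportInv X V σ (bdrySet X V Cp) (scattering m k u) z)
      =ᵐ[μ] lifting X V σ (bdrySet X V Cp) g ∧
    HasTrace X V m (coBdrySet X V Cp) u (A g)

/-- Fredholm operators of index zero. -/
def IsFredholmIndexZero {F₁ F₂ : Type*} [NormedAddCommGroup F₁] [NormedSpace ℝ F₁]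
    [NormedAddCommGroup F₂] [NormedSpace ℝ F₂] (A : F₁ →L[ℝ] F₂) : Prop :=
  A.IsFredholm ∧ Module.finrank ℝ A.ker = Module.finrank ℝ (F₂ ⧸ A.range)

end Transport

end

open Transport

/-! Write T, L for the solution operators with data on 𝒞, and T', L' for those with data on Γ \ 𝒞.
Let J carry boundary values from 𝒞 to Γ \ 𝒞 along lines by the source-free equation, and let R be
the trace of T on Γ \ 𝒞. On each line the equation is an ordinary differential equation, so two
solutions with the same source differ by a source-free one. This gives T = T' + L'R, L = L'J, and
the invertibility of J (`transportInv_eq_add_lifting`, `lifting_lifting`). If u - TKu = Lg, the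
trace of u is Ag = Jg + RKu. With M = (1 - KT)⁻¹ and b = -MKL' one finds A = (1 - Rb)J, while 1 - bR
= M(1 - KT'). Since 1 - Rb and 1 - bR have isomorphic kernels and cokernels, A inherits the Fredholm
property, the index and the kernel dimension of 1 - KT' (`fredholm_response`). It remains to see
that KT' is a norm limit of operators of finite rank.

This is a velocity averaging argument. Approximating the kernel in the mixed norm by sums of
products 1_P(x) 1_D(v') 1_E(v) (`IsContinuousKernel.isCompacting`) reduces it to the map f ↦ ∫_D
T'f(x,v) dv (`isFiniteRankLimit_fiberIntegral`). Solutions vary little over short distances along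
lines, so T'f is close in L^p, uniformly for f in the unit ball, to its averages over backward
segments of length h (`exists_lintegral_sub_backwardAvg_le`). For fixed h the remaining operator
averages over velocities and over segments (`exists_velocityAvg_isFiniteRankLimit`). Subtracting its
means over the cells of a fine partition leaves an operator that is bounded on L¹ and L^∞
independently of the partition and small on L², hence small on L^p by interpolation
(`exists_interpolation_bound`).

The smallness on L² is dual to that of the segment integrals of functions φ with mean zero on each
cell (`exists_index_segInt_le`). The squared L² norm of the segment integrals is the convolution
form of the symmetric law ν of (s' - s)v, evaluated at φ. Repeated Cauchy–Schwarz bounds it by the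
form of the convolution power of order 2^k. For 2^k ≥ d this power is absolutely continuous, because
d independent velocities are almost surely linearly independent; here the nullity of the sets v · e
= 0 enters. A density is close in L¹ to a function that is almost constant at the scale of the
cells, and constants on cells are annihilated by φ.

All estimates along lines rest on comparing dx dv with dr dξ on chords (`exists_fib_comparison`).
Two-sided bounds up to constants are enough, so the exact change of variables is never computed:
boundary charts with Lipschitz and Jacobian bounds suffice. The weighted and unweighted cases are
treated together through `IsLinePair`. -/

open scoped NNReal

noncomputable section

namespace Transport

variable {d : ℕ}

set_option linter.unusedSectionVars false

section

/-! ### Fredholm operators of index zero and limits of finite rank operators. -/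

section Fredholm

variable {E F G : Type*} [NormedAddCommGroup E] [NormedSpace ℝ E]
  [NormedAddCommGroup F] [NormedSpace ℝ F] [NormedAddCommGroup G] [NormedSpace ℝ G]

/-- The kernels of `1 - ab` and `1 - ba` are isomorphic. -/
def kerOneSubSwap (a : F →L[ℝ] E) (b : E →L[ℝ] F) :
    (1 - a ∘L b).ker ≃ₗ[ℝ] (1 - b ∘L a).ker where
  toFun x := ⟨b x, by
    have hx : x.1 - a (b x.1) = 0 := x.2
    change b x.1 - b (a (b x.1)) = 0
    rw [← map_sub, hx, map_zero]⟩
  invFun y := ⟨a y, by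
    have hy : y.1 - b (a y.1) = 0 := y.2
    change a y.1 - a (b (a y.1)) = 0
    rw [← map_sub, hy, map_zero]⟩
  map_add' x y := by ext; exact map_add b _ _
  map_smul' c x := by ext; exact map_smul b _ _
  left_inv x := by
    have hx : x.1 - a (b x.1) = 0 := x.2
    ext
    exact (sub_eq_zero.1 hx).symm
  right_inv y := by
    have hy : y.1 - b (a y.1) = 0 := y.2
    ext
    exact (sub_eq_zero.1 hy).symm

/-- The cokernels of `1 - ab` and `1 - ba` are isomorphic. -/
def cokerOneSubSwap (a : F →L[ℝ] E) (b : E →L[ℝ] F) :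
    (E ⧸ (1 - a ∘L b).range) ≃ₗ[ℝ] (F ⧸ (1 - b ∘L a).range) := by
  refine LinearEquiv.ofLinearMap
    (Submodule.mapQ _ _ b.toLinearMap ?_) (Submodule.mapQ _ _ a.toLinearMap ?_) ?_ ?_
  · rintro _ ⟨x, rfl⟩
    exact ⟨b x, by simp⟩
  · rintro _ ⟨x, rfl⟩
    exact ⟨a x, by simp⟩
  · apply Submodule.linearMap_qext
    ext y
    simp only [LinearMap.comp_apply, Submodule.mkQ_apply, Submodule.mapQ_apply,
      LinearMap.id_comp]
    rw [Submodule.Quotient.eq]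
    exact ⟨-y, by simp; abel⟩
  · apply Submodule.linearMap_qext
    ext y
    simp only [LinearMap.comp_apply, Submodule.mkQ_apply, Submodule.mapQ_apply,
      LinearMap.id_comp]
    rw [Submodule.Quotient.eq]
    exact ⟨-y, by simp; abel⟩

lemma hasFiniteRange_congr {f g : E →ₗ[ℝ] F} (h : f.HasFiniteRange) (e : ∀ x, g x = f x) :
    g.HasFiniteRange := by
  rwa [LinearMap.ext e]

open scoped LinearMap.FiniteRangeSetoid in
lemma isFredholm_of_parametrix {u : E →L[ℝ] F} (v : F →L[ℝ] E)
    (h₁ : (v.toLinearMap ∘ₗ u.toLinearMap - LinearMap.id).HasFiniteRange)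
    (h₂ : (u.toLinearMap ∘ₗ v.toLinearMap - LinearMap.id).HasFiniteRange) : u.IsFredholm :=
  ContinuousLinearMap.IsFredholm.of_isQuasiInverse (v := v)
    ⟨LinearMap.FiniteRangeSetoid.equiv_iff_hasFiniteRange.2 h₁,
      LinearMap.FiniteRangeSetoid.equiv_iff_hasFiniteRange.2 h₂⟩

open scoped LinearMap.FiniteRangeSetoid in
lemma exists_parametrix {u : E →L[ℝ] F} (hu : u.IsFredholm) : ∃ v : F →L[ℝ] E,
    (v.toLinearMap ∘ₗ u.toLinearMap - LinearMap.id).HasFiniteRange ∧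
    (u.toLinearMap ∘ₗ v.toLinearMap - LinearMap.id).HasFiniteRange := by
  obtain ⟨v, h₁, h₂⟩ := hu.exists_isQuasiInverse
  exact ⟨v, LinearMap.FiniteRangeSetoid.equiv_iff_hasFiniteRange.1 h₁,
    LinearMap.FiniteRangeSetoid.equiv_iff_hasFiniteRange.1 h₂⟩

/-- If v is a parametrix of 1 - ab, then 1 + bva is one of 1 - ba: the errors are the old ones
composed with b on the left and a on the right. The index is transported by `kerOneSubSwap` and
`cokerOneSubSwap`. -/
lemma IsFredholmIndexZero.swap {a : F →L[ℝ] E} {b : E →L[ℝ] F}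
    (h : IsFredholmIndexZero (1 - a ∘L b)) : IsFredholmIndexZero (1 - b ∘L a) := by
  refine ⟨?_, ?_⟩
  · obtain ⟨v, h₁, h₂⟩ := exists_parametrix h.1
    refine isFredholm_of_parametrix (1 + b ∘L v ∘L a) ?_ ?_
    · have := (h₁.comp_right a.toLinearMap).comp_left b.toLinearMap
      refine hasFiniteRange_congr this fun y => ?_
      simp
      abel
    · have := (h₂.comp_right a.toLinearMap).comp_left b.toLinearMap
      refine hasFiniteRange_congr this fun y => ?_
      simp
      abel
  · rw [← (kerOneSubSwap a b).finrank_eq, ← (cokerOneSubSwap a b).finrank_eq]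
    exact h.2

/-- Composition with an isomorphism does not change the kernel, up to isomorphism. -/
def kerCompEquiv (u : E →L[ℝ] F) (e : G ≃L[ℝ] E) :
    (u ∘L (e : G →L[ℝ] E)).ker ≃ₗ[ℝ] u.ker := by
  refine LinearEquiv.ofSubmodules e.toLinearEquiv _ _ ?_
  ext y
  simp only [Submodule.mem_map]
  constructor
  · rintro ⟨x, hx, rfl⟩
    exact hx
  · intro hy
    refine ⟨e.symm y, ?_, e.apply_symm_apply y⟩
    change u (e (e.symm y)) = 0
    rw [e.apply_symm_apply]; exact hy

lemma IsFredholmIndexZero.comp_equiv {u : E →L[ℝ] F} (h : IsFredholmIndexZero u)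
    (e : G ≃L[ℝ] E) : IsFredholmIndexZero (u ∘L (e : G →L[ℝ] E)) := by
  refine ⟨?_, ?_⟩
  · obtain ⟨v, h₁, h₂⟩ := exists_parametrix h.1
    refine isFredholm_of_parametrix ((e.symm : E →L[ℝ] G) ∘L v) ?_ ?_
    · have := (h₁.comp_right e.toLinearMap).comp_left e.symm.toLinearMap
      refine hasFiniteRange_congr this fun y => ?_
      simp
    · refine hasFiniteRange_congr h₂ fun y => ?_
      simp
  · have h1 : (u ∘L (e : G →L[ℝ] E)).range = u.range := by
      ext y
      constructor
      · rintro ⟨x, rfl⟩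
        exact ⟨e x, rfl⟩
      · rintro ⟨x, rfl⟩
        exact ⟨e.symm x, by simp⟩
    rw [h1, ← h.2]
    exact (kerCompEquiv u e).finrank_eq

lemma IsFredholmIndexZero.equiv_comp {u : E →L[ℝ] F} (h : IsFredholmIndexZero u)
    (e : F ≃L[ℝ] G) : IsFredholmIndexZero ((e : F →L[ℝ] G) ∘L u) := by
  refine ⟨?_, ?_⟩
  · obtain ⟨v, h₁, h₂⟩ := exists_parametrix h.1
    refine isFredholm_of_parametrix (v ∘L (e.symm : G →L[ℝ] F)) ?_ ?_
    · refine hasFiniteRange_congr h₁ fun y => ?_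
      simp
    · have := (h₂.comp_right e.symm.toLinearMap).comp_left e.toLinearMap
      refine hasFiniteRange_congr this fun y => ?_
      simp
  · have h2 : ((e : F →L[ℝ] G) ∘L u).ker = u.ker := by
      ext x; simp
    rw [h2, h.2]
    refine LinearEquiv.finrank_eq (Submodule.Quotient.equiv _ _ e.toLinearEquiv ?_)
    ext y
    simp only [Submodule.mem_map, LinearMap.mem_range]
    constructor
    · rintro ⟨_, ⟨x, rfl⟩, rfl⟩
      exact ⟨x, rfl⟩
    · rintro ⟨x, rfl⟩
      exact ⟨u x, ⟨x, rfl⟩, rfl⟩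

lemma isFredholmIndexZero_of_finiteDimensional [FiniteDimensional ℝ E] (u : E →L[ℝ] E) :
    IsFredholmIndexZero u := by
  refine ⟨isFredholm_of_parametrix 0 ?_ ?_, ?_⟩
  · exact LinearMap.HasFiniteRange.of_finite_dom
  · exact LinearMap.HasFiniteRange.of_finite_dom
  · have h1 := u.toLinearMap.finrank_range_add_finrank_ker
    have h2 := Submodule.finrank_quotient_add_finrank u.range
    change Module.finrank ℝ u.toLinearMap.ker = Module.finrank ℝ (E ⧸ u.toLinearMap.range)
    change _ + Module.finrank ℝ u.toLinearMap.range = _ at h2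
    omega

/-- T factors through its finite-dimensional range, so `swap` reduces the claim to an endomorphism
of that range. -/
lemma isFredholmIndexZero_one_sub_of_finiteRange (T : E →L[ℝ] E)
    (hT : T.toLinearMap.HasFiniteRange) : IsFredholmIndexZero (1 - T) := by
  have : FiniteDimensional ℝ T.range := Module.Finite.of_fg hT
  exact IsFredholmIndexZero.swap
    (a := T.codRestrict T.range fun x => LinearMap.mem_range_self T.toLinearMap x)
    (b := T.range.subtypeL) (isFredholmIndexZero_of_finiteDimensional _)

/-- The operator `T` is a limit, in the operator norm, of operators of finite rank. -/
def IsFiniteRankLimit (T : E →L[ℝ] F) : Prop :=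
  ∀ ε > 0, ∃ S : E →L[ℝ] F, S.toLinearMap.HasFiniteRange ∧ ‖T - S‖ ≤ ε

lemma IsFiniteRankLimit.comp_left {T : E →L[ℝ] F} (hT : IsFiniteRankLimit T) (A : F →L[ℝ] G) :
    IsFiniteRankLimit (A ∘L T) := by
  intro ε hε
  obtain ⟨S, hS, h⟩ := hT (ε / (‖A‖ + 1)) (by positivity)
  refine ⟨A ∘L S, hS.comp_left A.toLinearMap, ?_⟩
  rw [← ContinuousLinearMap.comp_sub]
  calc ‖A ∘L (T - S)‖ ≤ ‖A‖ * (ε / (‖A‖ + 1)) :=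
        (ContinuousLinearMap.opNorm_comp_le _ _).trans (by gcongr)
    _ ≤ (‖A‖ + 1) * (ε / (‖A‖ + 1)) := by gcongr; linarith
    _ = ε := by field_simp

lemma IsFiniteRankLimit.comp_right {T : F →L[ℝ] G} (hT : IsFiniteRankLimit T) (A : E →L[ℝ] F) :
    IsFiniteRankLimit (T ∘L A) := by
  intro ε hε
  obtain ⟨S, hS, h⟩ := hT (ε / (‖A‖ + 1)) (by positivity)
  refine ⟨S ∘L A, hS.comp_right A.toLinearMap, ?_⟩
  rw [← ContinuousLinearMap.sub_comp]
  calc ‖(T - S) ∘L A‖ ≤ (ε / (‖A‖ + 1)) * ‖A‖ :=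
        (ContinuousLinearMap.opNorm_comp_le _ _).trans (by gcongr)
    _ ≤ (ε / (‖A‖ + 1)) * (‖A‖ + 1) := by gcongr; linarith
    _ = ε := by field_simp

lemma IsFiniteRankLimit.zero : IsFiniteRankLimit (0 : E →L[ℝ] F) :=
  fun ε hε => ⟨0, LinearMap.HasFiniteRange.zero, by simpa using hε.le⟩

lemma IsFiniteRankLimit.add {S T : E →L[ℝ] F} (hS : IsFiniteRankLimit S)
    (hT : IsFiniteRankLimit T) : IsFiniteRankLimit (S + T) := by
  intro ε hε
  obtain ⟨S', hS', h⟩ := hS (ε / 2) (by positivity)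
  obtain ⟨T', hT', h'⟩ := hT (ε / 2) (by positivity)
  refine ⟨S' + T', hS'.add hT', ?_⟩
  rw [add_sub_add_comm]
  exact (norm_add_le _ _).trans (by linarith)

lemma IsFiniteRankLimit.of_approx {T : E →L[ℝ] F}
    (h : ∀ ε > 0, ∃ S : E →L[ℝ] F, IsFiniteRankLimit S ∧ ‖T - S‖ ≤ ε) : IsFiniteRankLimit T := by
  intro ε hε
  obtain ⟨S, hS, h1⟩ := h (ε / 2) (by positivity)
  obtain ⟨S', hS', h2⟩ := hS (ε / 2) (by positivity)
  refine ⟨S', hS', ?_⟩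
  calc ‖T - S'‖ = ‖(T - S) + (S - S')‖ := by congr 1; abel
    _ ≤ ε := (norm_add_le _ _).trans (by linarith)

/-- With S of finite rank within 1/2 of T, the operator e = 1 - (T - S) is invertible by a Neumann
series, and 1 - T = e(1 - e⁻¹S). -/
lemma IsFiniteRankLimit.isFredholmIndexZero [CompleteSpace E] {T : E →L[ℝ] E}
    (hT : IsFiniteRankLimit T) : IsFredholmIndexZero (1 - T) := by
  obtain ⟨S, hS, h⟩ := hT (1 / 2) (by norm_num)
  let U : (E →L[ℝ] E)ˣ := Units.oneSub (T - S) (lt_of_le_of_lt h (by norm_num))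
  let e : E ≃L[ℝ] E := ContinuousLinearEquiv.unitsEquiv ℝ E U
  have h1 : IsFredholmIndexZero (1 - (e.symm : E →L[ℝ] E) ∘L S) :=
    isFredholmIndexZero_one_sub_of_finiteRange _ (hS.comp_left e.symm.toLinearMap)
  have h2 := h1.equiv_comp e
  convert h2 using 1
  ext x
  have : e x = x - (T x - S x) := by
    simp [e, U, ContinuousLinearEquiv.unitsEquiv, ContinuousLinearEquiv.ofUnit]
  simp [this]
  abel

end Fredholm

/-! ### The operator algebra behind the albedo operator. -/

section Abstract

-- A single universe, so that the cardinal-valued ranks of kernels in different spaces can be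
-- equated.
universe u

variable {Y Z G G' : Type u} [NormedAddCommGroup Y] [NormedSpace ℝ Y]
  [NormedAddCommGroup Z] [NormedSpace ℝ Z] [NormedAddCommGroup G] [NormedSpace ℝ G]
  [NormedAddCommGroup G'] [NormedSpace ℝ G']

/-- The abstract form of the duality between the response map `A = J + R K (1 - T K)⁻¹ L` and the
operator `1 - K T'`. -/
theorem fredholm_response (T T' : Z →L[ℝ] Y) (K : Y →L[ℝ] Z) (L : G →L[ℝ] Y) (L' : G' →L[ℝ] Y)
    (J : G ≃L[ℝ] G') (R : Z →L[ℝ] G') (hL : L' ∘L (J : G →L[ℝ] G') = L)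
    (hT : T = T' + L' ∘L R) (hunit : IsUnit (1 - T ∘L K))
    (hfred : IsFredholmIndexZero (1 - K ∘L T')) :
    ∃ A : G →L[ℝ] G', (∀ g, ∃ u : Y, u - T (K u) = L g ∧ A g = J g + R (K u)) ∧
      IsFredholmIndexZero A ∧
      Module.rank ℝ A.ker = Module.rank ℝ (1 - K ∘L T').ker := by
  obtain ⟨U, hU⟩ := hunit
  set N : Y →L[ℝ] Y := ((U⁻¹ : (Y →L[ℝ] Y)ˣ) : Y →L[ℝ] Y) with hN
  have hUN : ∀ y, N y - T (K (N y)) = y := fun y => by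
    have : ((U : Y →L[ℝ] Y) * N) y = y := by rw [hN, Units.mul_inv]; rfl
    rw [hU] at this
    simpa using this
  have hNU : ∀ y, N (y - T (K y)) = y := fun y => by
    have : (N * (U : Y →L[ℝ] Y)) y = y := by rw [hN, Units.inv_mul]; rfl
    rw [hU] at this
    simpa using this
  -- the inverse of `1 - K T`
  let M : Z ≃L[ℝ] Z := ContinuousLinearEquiv.equivOfInverse (1 + K ∘L N ∘L T) (1 - K ∘L T)
    (fun z => by
      have h := hUN (T z)
      have h2 := congrArg K h
      rw [map_sub] at h2
      simp only [add_apply, sub_apply, one_apply_eq_self,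
        ContinuousLinearMap.comp_apply, map_add]
      rw [← h2]; abel)
    (fun z => by
      have h := hNU (T z)
      simp only [add_apply, sub_apply,
        one_apply_eq_self, ContinuousLinearMap.comp_apply, map_sub] at h ⊢
      have h2 := congrArg K h
      rw [map_sub] at h2
      linear_combination (norm := module) h2)
  have hM : ∀ z, M z = z + K (N (T z)) := fun z => rfl
  have hMs : ∀ z, M.symm z = z - K (T z) := fun z => rfl
  have hMK : ∀ y, M (K y) = K (N y) := fun y => by
    have h := hNU y
    rw [hM, ← map_add]
    congr 1
    rw [map_sub] at h
    exact (sub_eq_iff_eq_add.1 h).symm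
  -- The response map will be (1 - ab)J. In the other order, 1 - KT = (1 - KT') - KL'R turns 1 - ba
  -- into M(1 - KT'), so that the swap of a and b links the two operators.
  let a : Z →L[ℝ] G' := R
  let b : G' →L[ℝ] Z := -((M : Z →L[ℝ] Z) ∘L K ∘L L')
  have hba : 1 - b ∘L a = (M : Z →L[ℝ] Z) ∘L (1 - K ∘L T') := by
    ext z
    have h : M (M.symm z) = z := M.apply_symm_apply z
    rw [hMs] at h
    have h2 : T z = T' z + L' (R z) := by rw [hT]; rfl
    simp only [a, b, sub_apply, one_apply_eq_self,
      ContinuousLinearMap.comp_apply, neg_apply,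
      ContinuousLinearEquiv.coe_coe, map_sub] at h ⊢
    rw [h2, map_add, map_add] at h
    nth_rewrite 1 [← h]
    abel
  have hab : ((1 - a ∘L b) ∘L (J : G →L[ℝ] G')) = (J : G →L[ℝ] G') + R ∘L K ∘L N ∘L L := by
    ext g
    have h3 : L' (J g) = L g := by rw [← hL]; rfl
    simp [a, b, hMK, h3]
  have h4 : IsFredholmIndexZero (1 - b ∘L a) := by
    rw [hba]; exact hfred.equiv_comp M
  refine ⟨(J : G →L[ℝ] G') + R ∘L K ∘L N ∘L L, fun g => ⟨N (L g), hUN _, rfl⟩, ?_, ?_⟩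
  · rw [← hab]
    exact h4.swap.comp_equiv J
  · rw [← hab]
    have e2 : (1 - b ∘L a).ker = (1 - K ∘L T').ker := by
      rw [hba]
      ext z
      simp only [LinearMap.mem_ker, ContinuousLinearMap.coe_coe, ContinuousLinearMap.comp_apply,
        ContinuousLinearEquiv.coe_coe]
      exact M.map_eq_zero_iff
    rw [(kerCompEquiv (1 - a ∘L b) J).rank_eq, (kerOneSubSwap a b).rank_eq, e2]

end Abstract

end

section

/-! ### Bounded operators on L^p given by formulas. -/

section LpOperators

variable {α β : Type*} [MeasurableSpace α] [MeasurableSpace β] {μ : Measure α} {ν : Measure β}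
  {p : ℝ≥0∞} [Fact (1 ≤ p)]

/-- A formula that is compatible with equality almost everywhere, linear and bounded in the `L^p`
norm defines a bounded operator between `L^p` spaces. -/
theorem exists_clm_of_formula (F : (α → ℝ) → β → ℝ) (C : ℝ) (hC : 0 ≤ C)
    (hmeas : ∀ f : Lp ℝ p μ, AEStronglyMeasurable (F f) ν)
    (hbd : ∀ f : Lp ℝ p μ, eLpNorm (F f) p ν ≤ ENNReal.ofReal C * eLpNorm f p μ)
    (hcongr : ∀ f g : α → ℝ, f =ᵐ[μ] g → F f =ᵐ[ν] F g)
    (hadd : ∀ f g : Lp ℝ p μ, F (fun x => f x + g x) =ᵐ[ν] fun y => F f y + F g y)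
    (hsmul : ∀ (c : ℝ) (f : Lp ℝ p μ), F (fun x => c * f x) =ᵐ[ν] fun y => c * F f y) :
    ∃ T : Lp ℝ p μ →L[ℝ] Lp ℝ p ν, (∀ f, T f =ᵐ[ν] F f) ∧ ‖T‖ ≤ C := by
  have hmem : ∀ f : Lp ℝ p μ, MemLp (F f) p ν := fun f =>
    ⟨hmeas f, (hbd f).trans_lt (ENNReal.mul_lt_top ENNReal.ofReal_lt_top (Lp.eLpNorm_lt_top f))⟩
  let T₀ : Lp ℝ p μ →ₗ[ℝ] Lp ℝ p ν :=
    { toFun := fun f => (hmem f).toLp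
      map_add' := fun f g => by
        apply Lp.ext
        have h1 := hcongr _ _ (Lp.coeFn_add f g)
        filter_upwards [(hmem (f + g)).coeFn_toLp, Lp.coeFn_add (hmem f).toLp (hmem g).toLp,
          (hmem f).coeFn_toLp, (hmem g).coeFn_toLp, h1, hadd f g] with y e1 e2 e3 e4 e5 e6
        rw [e1, e2, Pi.add_apply, e3, e4, e5]
        exact e6
      map_smul' := fun c f => by
        apply Lp.ext
        have h1 := hcongr _ _ (Lp.coeFn_smul c f)
        filter_upwards [(hmem (c • f)).coeFn_toLp, Lp.coeFn_smul c (hmem f).toLp,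
          (hmem f).coeFn_toLp, h1, hsmul c f] with y e1 e2 e3 e5 e6
        rw [e1, e5]
        refine e6.trans ?_
        simp only [RingHom.id_apply]
        rw [e2, Pi.smul_apply, e3, smul_eq_mul] }
  refine ⟨T₀.mkContinuous C fun f => ?_, fun f => (hmem f).coeFn_toLp,
    LinearMap.mkContinuous_norm_le _ hC _⟩
  change ‖(hmem f).toLp‖ ≤ _
  rw [Lp.norm_toLp, Lp.norm_def, ← ENNReal.toReal_ofReal hC, ← ENNReal.toReal_mul]
  exact ENNReal.toReal_mono (ENNReal.mul_ne_top ENNReal.ofReal_ne_top (Lp.eLpNorm_ne_top f))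
    (hbd f)

end LpOperators

/-! ### Real interpolation between L¹, L² and L^∞. -/

section Interpolation

variable {α β : Type*} [MeasurableSpace α] [MeasurableSpace β] {μ : Measure α} {ν : Measure β}

lemma lintegral_Ioo_rpow {s y : ℝ} (hs : 0 < s) (hy : 0 ≤ y) :
    ∫⁻ t in Ioo 0 y, ENNReal.ofReal (t ^ (s - 1)) = ENNReal.ofReal (s⁻¹ * y ^ s) := by
  have hint : IntervalIntegrable (fun t : ℝ => t ^ (s - 1)) volume 0 y :=
    intervalIntegral.intervalIntegrable_rpow' (by linarith)
  rw [intervalIntegrable_iff_integrableOn_Ioo_of_le hy] at hint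
  rw [← ofReal_integral_eq_lintegral_ofReal hint]
  · rw [← integral_Ioc_eq_integral_Ioo, ← intervalIntegral.integral_of_le hy,
      integral_rpow (Or.inl (by linarith))]
    congr 1
    rw [sub_add_cancel, Real.zero_rpow hs.ne', sub_zero]
    field_simp
  · filter_upwards [ae_restrict_mem measurableSet_Ioo] with t ht
    exact Real.rpow_nonneg ht.1.le _

lemma lintegral_Ici_rpow {s y : ℝ} (hs : 0 < s) (hy : 0 < y) :
    ∫⁻ t in Ioi y, ENNReal.ofReal (t ^ (-s - 1)) = ENNReal.ofReal (s⁻¹ * y ^ (-s)) := by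
  have hint := integrableOn_Ioi_rpow_of_lt (a := -s - 1) (by linarith) hy
  rw [← ofReal_integral_eq_lintegral_ofReal hint]
  · rw [integral_Ioi_rpow_of_lt (by linarith) hy]
    congr 1
    rw [sub_add_cancel]
    field_simp
  · filter_upwards [ae_restrict_mem measurableSet_Ioi] with t ht
    exact Real.rpow_nonneg (hy.trans ht).le _

/-- By Tonelli: for fixed x the condition confines t to (0, g x / b), where t^(p-q-1) is integrable
because q < p. -/
lemma lintegral_rpow_large_le [SFinite μ] {g : α → ℝ} (hg : Measurable g) (hg0 : ∀ x, 0 ≤ g x)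
    {p q b : ℝ} (hb : 0 < b) (hq : 0 < q) (hpq : q < p) :
    ∫⁻ t in Ioi (0 : ℝ), ENNReal.ofReal (t ^ (p - q - 1)) *
      ∫⁻ x, {x | b * t < g x}.indicator (fun x => ENNReal.ofReal (g x ^ q)) x ∂μ ≤
    ENNReal.ofReal ((p - q)⁻¹ * b⁻¹ ^ (p - q)) * ∫⁻ x, ENNReal.ofReal (g x ^ p) ∂μ := by
  have hm : Measurable fun w : ℝ × α => ENNReal.ofReal (w.1 ^ (p - q - 1)) *
      {w : ℝ × α | b * w.1 < g w.2}.indicator (fun w => ENNReal.ofReal (g w.2 ^ q)) w := by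
    refine Measurable.mul (by fun_prop) (Measurable.indicator (by fun_prop) ?_)
    exact measurableSet_lt (by fun_prop) (by fun_prop)
  calc _ = ∫⁻ t in Ioi (0 : ℝ), ∫⁻ x, ENNReal.ofReal (t ^ (p - q - 1)) *
      {w : ℝ × α | b * w.1 < g w.2}.indicator (fun w => ENNReal.ofReal (g w.2 ^ q)) (t, x) ∂μ := by
        refine lintegral_congr fun t => ?_
        rw [lintegral_const_mul']
        · rfl
        · exact ENNReal.ofReal_ne_top
    _ = ∫⁻ x, (∫⁻ t in Ioi (0 : ℝ), ENNReal.ofReal (t ^ (p - q - 1)) *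
      {w : ℝ × α | b * w.1 < g w.2}.indicator (fun w => ENNReal.ofReal (g w.2 ^ q)) (t, x)) ∂μ :=
        lintegral_lintegral_swap hm.aemeasurable
    _ ≤ ∫⁻ x, ENNReal.ofReal ((p - q)⁻¹ * b⁻¹ ^ (p - q)) * ENNReal.ofReal (g x ^ p) ∂μ := by
        refine lintegral_mono fun x => ?_
        have h1 : ∫⁻ t in Ioi (0 : ℝ), ENNReal.ofReal (t ^ (p - q - 1)) *
            {w : ℝ × α | b * w.1 < g w.2}.indicator (fun w => ENNReal.ofReal (g w.2 ^ q)) (t, x) ≤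
            ∫⁻ t in Ioi (0 : ℝ), (Ioo 0 (g x / b)).indicator
              (fun t => ENNReal.ofReal (t ^ (p - q - 1)) * ENNReal.ofReal (g x ^ q)) t := by
          refine setLIntegral_mono' measurableSet_Ioi fun t ht => ?_
          by_cases h : b * t < g x
          · rw [indicator_of_mem (by exact h), indicator_of_mem]
            exact ⟨ht, by rwa [lt_div_iff₀ hb, mul_comm]⟩
          · rw [indicator_of_notMem (by exact h)]; simp
        refine h1.trans ?_
        rw [setLIntegral_indicator measurableSet_Ioo, lintegral_mul_const' _ _ ENNReal.ofReal_ne_top]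
        rw [inter_eq_left.2 (fun t ht => ht.1), lintegral_Ioo_rpow (by linarith)
          (div_nonneg (hg0 x) hb.le)]
        rw [← ENNReal.ofReal_mul (by have := hg0 x; have : 0 < p - q := by linarith
                                     positivity), ← ENNReal.ofReal_mul (by
              have : 0 < p - q := by linarith
              positivity)]
        refine le_of_eq ?_
        congr 1
        rw [div_eq_mul_inv, Real.mul_rpow (hg0 x) (by positivity)]
        rcases (hg0 x).eq_or_lt with h | h
        · rw [← h, Real.zero_rpow hq.ne', Real.zero_rpow (by linarith : p ≠ 0)]; simp
        · have : g x ^ p = g x ^ (p - q) * g x ^ q := by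
            rw [← Real.rpow_add h]; congr 1; ring
          rw [this]; ring
    _ = _ := lintegral_const_mul' _ _ ENNReal.ofReal_ne_top

/-- By Tonelli again; now t runs over [g x / b, ∞), and the integral converges at infinity because q
> p. -/
lemma lintegral_rpow_small_le [SFinite μ] {g : α → ℝ} (hg : Measurable g) (hg0 : ∀ x, 0 ≤ g x)
    {p q b : ℝ} (hb : 0 < b) (hp : 0 < p) (hpq : p < q) :
    ∫⁻ t in Ioi (0 : ℝ), ENNReal.ofReal (t ^ (p - q - 1)) *
      ∫⁻ x, {x | g x ≤ b * t}.indicator (fun x => ENNReal.ofReal (g x ^ q)) x ∂μ ≤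
    ENNReal.ofReal ((q - p)⁻¹ * b ^ (q - p)) * ∫⁻ x, ENNReal.ofReal (g x ^ p) ∂μ := by
  have hm : Measurable fun w : ℝ × α => ENNReal.ofReal (w.1 ^ (p - q - 1)) *
      {w : ℝ × α | g w.2 ≤ b * w.1}.indicator (fun w => ENNReal.ofReal (g w.2 ^ q)) w := by
    refine Measurable.mul (by fun_prop) (Measurable.indicator (by fun_prop) ?_)
    exact measurableSet_le (by fun_prop) (by fun_prop)
  calc _ = ∫⁻ t in Ioi (0 : ℝ), ∫⁻ x, ENNReal.ofReal (t ^ (p - q - 1)) *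
      {w : ℝ × α | g w.2 ≤ b * w.1}.indicator (fun w => ENNReal.ofReal (g w.2 ^ q)) (t, x) ∂μ := by
        refine lintegral_congr fun t => ?_
        rw [lintegral_const_mul']
        · rfl
        · exact ENNReal.ofReal_ne_top
    _ = ∫⁻ x, (∫⁻ t in Ioi (0 : ℝ), ENNReal.ofReal (t ^ (p - q - 1)) *
      {w : ℝ × α | g w.2 ≤ b * w.1}.indicator (fun w => ENNReal.ofReal (g w.2 ^ q)) (t, x)) ∂μ :=
        lintegral_lintegral_swap hm.aemeasurable
    _ ≤ ∫⁻ x, ENNReal.ofReal ((q - p)⁻¹ * b ^ (q - p)) * ENNReal.ofReal (g x ^ p) ∂μ := by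
        refine lintegral_mono fun x => ?_
        -- If g x = 0 the range of t would reach down to 0, where the power is not integrable; but
        -- then the factor g x ^ q vanishes.
        rcases (hg0 x).eq_or_lt with h | h
        · rw [← ENNReal.ofReal_mul (by
              have : 0 < q - p := by linarith
              positivity)]
          refine le_of_eq_of_le ?_ (zero_le)
          refine (lintegral_congr fun t => ?_).trans lintegral_zero
          have : (fun w : ℝ × α => ENNReal.ofReal (g w.2 ^ q)) (t, x) = 0 := by
            simp [← h, Real.zero_rpow (by linarith : q ≠ 0)]
          by_cases ht : (t, x) ∈ {w : ℝ × α | g w.2 ≤ b * w.1}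
          · rw [indicator_of_mem ht]
            exact mul_eq_zero_of_right _ this
          · rw [indicator_of_notMem ht, mul_zero]
        have h1 : ∫⁻ t in Ioi (0 : ℝ), ENNReal.ofReal (t ^ (p - q - 1)) *
            {w : ℝ × α | g w.2 ≤ b * w.1}.indicator (fun w => ENNReal.ofReal (g w.2 ^ q)) (t, x) ≤
            ∫⁻ t in Ioi (0 : ℝ), (Ici (g x / b)).indicator
              (fun t => ENNReal.ofReal (t ^ (p - q - 1)) * ENNReal.ofReal (g x ^ q)) t := by
          refine setLIntegral_mono' measurableSet_Ioi fun t ht => ?_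
          by_cases h : g x ≤ b * t
          · rw [indicator_of_mem (by exact h), indicator_of_mem]
            rw [mem_Ici, div_le_iff₀ hb, mul_comm]; exact h
          · rw [indicator_of_notMem (by exact h)]; simp
        refine h1.trans ?_
        rw [setLIntegral_indicator measurableSet_Ici, lintegral_mul_const' _ _ ENNReal.ofReal_ne_top]
        have hgb : 0 < g x / b := by positivity
        have hsub : Ici (g x / b) ⊆ Ioi 0 := fun t ht => hgb.trans_le ht
        rw [inter_eq_left.2 hsub, setLIntegral_congr Ioi_ae_eq_Ici.symm]
        have e : p - q - 1 = -(q - p) - 1 := by ring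
        have hqp : 0 < q - p := by linarith
        rw [e, lintegral_Ici_rpow hqp hgb]
        rw [← ENNReal.ofReal_mul (by positivity), ← ENNReal.ofReal_mul (by positivity)]
        refine le_of_eq ?_
        congr 1
        rw [Real.div_rpow h.le hb.le, Real.rpow_neg hb.le, div_eq_mul_inv, inv_inv]
        have : g x ^ p = g x ^ (-(q - p)) * g x ^ q := by
          rw [← Real.rpow_add h]; congr 1; ring
        rw [this]; ring
    _ = _ := lintegral_const_mul' _ _ ENNReal.ofReal_ne_top

lemma measure_lt_abs_le {h : β → ℝ} (hh : AEMeasurable h ν) {q t : ℝ} (hq : 0 < q) (ht : 0 < t) :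
    ν {y | t < |h y|} ≤ ENNReal.ofReal (t⁻¹ ^ q) * ∫⁻ y, ENNReal.ofReal (|h y| ^ q) ∂ν := by
  have h1 := mul_meas_ge_le_lintegral₀ (μ := ν) (f := fun y => ENNReal.ofReal (|h y| ^ q))
    ((measurable_abs.comp_aemeasurable hh).pow_const q).ennreal_ofReal (ENNReal.ofReal (t ^ q))
  calc ν {y | t < |h y|} ≤ ν {y | ENNReal.ofReal (t ^ q) ≤ ENNReal.ofReal (|h y| ^ q)} := by
        refine measure_mono fun y hy => ENNReal.ofReal_le_ofReal ?_
        exact Real.rpow_le_rpow ht.le (le_of_lt hy) hq.le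
    _ = ENNReal.ofReal (t⁻¹ ^ q) * (ENNReal.ofReal (t ^ q) *
          ν {y | ENNReal.ofReal (t ^ q) ≤ ENNReal.ofReal (|h y| ^ q)}) := by
        rw [← mul_assoc, ← ENNReal.ofReal_mul (by positivity), ← Real.mul_rpow (by positivity) ht.le,
          inv_mul_cancel₀ ht.ne']
        simp
    _ ≤ _ := by gcongr

lemma lintegral_abs_rpow_eq {h : β → ℝ} (hh : AEMeasurable h ν) {p : ℝ} (hp : 0 < p) :
    ∫⁻ y, ENNReal.ofReal (|h y| ^ p) ∂ν =
      ENNReal.ofReal p * ∫⁻ t in Ioi (0 : ℝ), ν {y | t < |h y|} * ENNReal.ofReal (t ^ (p - 1)) :=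
  lintegral_rpow_eq_lintegral_meas_lt_mul ν (Eventually.of_forall fun _ => abs_nonneg _)
    (measurable_abs.comp_aemeasurable hh) hp

/-- The part of `f` where `|f| > c`. -/
noncomputable def largePart (f : α → ℝ) (c : ℝ) : α → ℝ := {x | c < |f x|}.indicator f

/-- The part of `f` where `|f| ≤ c`. -/
noncomputable def smallPart (f : α → ℝ) (c : ℝ) : α → ℝ := {x | |f x| ≤ c}.indicator f

lemma smallPart_add_largePart (f : α → ℝ) (c : ℝ) :
    (fun x => smallPart f c x + largePart f c x) = f := by
  ext x
  rcases le_or_gt (|f x|) c with h | h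
  · simp [smallPart, largePart, indicator, h, h.not_gt]
  · simp [smallPart, largePart, indicator, h, h.not_ge]

lemma measurable_largePart {f : α → ℝ} (hf : Measurable f) (c : ℝ) : Measurable (largePart f c) :=
  hf.indicator (measurableSet_lt measurable_const hf.abs)

lemma measurable_smallPart {f : α → ℝ} (hf : Measurable f) (c : ℝ) : Measurable (smallPart f c) :=
  hf.indicator (measurableSet_le hf.abs measurable_const)

lemma abs_smallPart_le (f : α → ℝ) {c : ℝ} (hc : 0 ≤ c) (x : α) : |smallPart f c x| ≤ c := by
  by_cases h : |f x| ≤ c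
  · simp [smallPart, indicator, h]
  · simpa [smallPart, indicator, h] using hc

lemma lintegral_largePart (f : α → ℝ) (c : ℝ) {q : ℝ} (hq : 0 < q) :
    ∫⁻ x, ENNReal.ofReal (|largePart f c x| ^ q) ∂μ =
      ∫⁻ x, {x | c < |f x|}.indicator (fun x => ENNReal.ofReal (|f x| ^ q)) x ∂μ := by
  refine lintegral_congr fun x => ?_
  by_cases h : c < |f x|
  · simp [largePart, indicator, h]
  · simp [largePart, indicator, h, Real.zero_rpow hq.ne']

lemma lintegral_smallPart (f : α → ℝ) (c : ℝ) {q : ℝ} (hq : 0 < q) :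
    ∫⁻ x, ENNReal.ofReal (|smallPart f c x| ^ q) ∂μ =
      ∫⁻ x, {x | |f x| ≤ c}.indicator (fun x => ENNReal.ofReal (|f x| ^ q)) x ∂μ := by
  refine lintegral_congr fun x => ?_
  by_cases h : |f x| ≤ c
  · simp [smallPart, indicator, h]
  · simp [smallPart, indicator, h, Real.zero_rpow hq.ne']

/-- A linear operator on the integrable functions which is bounded on `L¹` and `L^∞` with constant
`C`, and on `L²` with constant `ε ^ (1/2)`. -/
structure InterpolationBound (μ : Measure α) (ν : Measure β) (S : (α → ℝ) → β → ℝ) (C ε : ℝ) :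
    Prop where
  aemeasurable : ∀ f, Measurable f → Integrable f μ → AEMeasurable (S f) ν
  add : ∀ f g, Measurable f → Measurable g → Integrable f μ → Integrable g μ →
    S (fun x => f x + g x) =ᵐ[ν] fun y => S f y + S g y
  one : ∀ f, Measurable f → Integrable f μ →
    ∫⁻ y, ENNReal.ofReal (|S f y| ^ (1 : ℝ)) ∂ν ≤
      ENNReal.ofReal C * ∫⁻ x, ENNReal.ofReal (|f x| ^ (1 : ℝ)) ∂μ
  two : ∀ f, Measurable f → Integrable f μ →
    ∫⁻ y, ENNReal.ofReal (|S f y| ^ (2 : ℝ)) ∂ν ≤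
      ENNReal.ofReal ε * ∫⁻ x, ENNReal.ofReal (|f x| ^ (2 : ℝ)) ∂μ
  top : ∀ f, Measurable f → ∀ c, 0 ≤ c → (∀ x, |f x| ≤ c) → ∀ᵐ y ∂ν, |S f y| ≤ C * c

variable {S : (α → ℝ) → β → ℝ} {C ε p : ℝ}

lemma integrable_smallPart [IsFiniteMeasure μ] {f : α → ℝ} (hf : Measurable f) {c : ℝ} (hc : 0 ≤ c) :
    Integrable (smallPart f c) μ :=
  Integrable.of_bound (measurable_smallPart hf c).aestronglyMeasurable c
    (Eventually.of_forall (abs_smallPart_le f hc))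

lemma integrable_largePart {f : α → ℝ} (hf : Measurable f) (hi : Integrable f μ) (c : ℝ) :
    Integrable (largePart f c) μ :=
  hi.indicator (measurableSet_lt measurable_const hf.abs)

/-- At level t, cut f at height t/(2C). The L^∞ bound keeps the image of the small part below t/2,
so only the large part contributes to the distribution function, and the L² bound with Chebyshev's
inequality controls it. -/
lemma InterpolationBound.lintegral_le_of_two_lt [IsFiniteMeasure μ] (hS : InterpolationBound μ ν S C ε) (hC : 0 < C)
    (hε : 0 < ε) (hp : 2 < p) {f : α → ℝ} (hf : Measurable f) (hi : Integrable f μ) :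
    ∫⁻ y, ENNReal.ofReal (|S f y| ^ p) ∂ν ≤
      ENNReal.ofReal (p * (4 * ε * ((p - 2)⁻¹ * (2 * C) ^ (p - 2)))) *
        ∫⁻ x, ENNReal.ofReal (|f x| ^ p) ∂μ := by
  rw [lintegral_abs_rpow_eq (hS.aemeasurable f hf hi) (by linarith)]
  have key : ∀ t ∈ Ioi (0 : ℝ), ν {y | t < |S f y|} * ENNReal.ofReal (t ^ (p - 1)) ≤
      ENNReal.ofReal (4 * ε) * (ENNReal.ofReal (t ^ (p - 2 - 1)) *
        ∫⁻ x, {x | (2 * C)⁻¹ * t < |f x|}.indicator (fun x => ENNReal.ofReal (|f x| ^ (2 : ℝ))) x ∂μ) := by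
    intro t ht
    rw [mem_Ioi] at ht
    set c := (2 * C)⁻¹ * t with hc
    have hc0 : 0 ≤ c := by positivity
    have h1 : ν {y | t < |S f y|} ≤ ν {y | t / 2 < |S (largePart f c) y|} := by
      refine measure_mono_ae ?_
      have h2 := hS.add _ _ (measurable_smallPart hf c) (measurable_largePart hf c)
        (integrable_smallPart hf hc0) (integrable_largePart hf hi c)
      rw [smallPart_add_largePart] at h2
      filter_upwards [h2, hS.top _ (measurable_smallPart hf c) c hc0 (abs_smallPart_le f hc0)]
        with y h3 h4 h5
      have h5' : t < |S f y| := h5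
      change t / 2 < |S (largePart f c) y|
      rw [h3] at h5'
      have h6 := abs_add_le (S (smallPart f c) y) (S (largePart f c) y)
      have h7 : C * c = t / 2 := by rw [hc]; field_simp
      linarith
    have h2 := measure_lt_abs_le (hS.aemeasurable _ (measurable_largePart hf c)
      (integrable_largePart hf hi c)) (q := 2) two_pos (half_pos ht)
    have h3 := hS.two _ (measurable_largePart hf c) (integrable_largePart hf hi c)
    rw [lintegral_largePart f c two_pos] at h3
    calc _ ≤ (ENNReal.ofReal ((t / 2)⁻¹ ^ (2 : ℝ)) * (ENNReal.ofReal ε *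
          ∫⁻ x, {x | c < |f x|}.indicator (fun x => ENNReal.ofReal (|f x| ^ (2 : ℝ))) x ∂μ)) *
            ENNReal.ofReal (t ^ (p - 1)) := by
          gcongr
          exact h1.trans (h2.trans (by gcongr))
      _ = _ := by
          rw [← mul_assoc, ← ENNReal.ofReal_mul (by positivity), mul_right_comm,
            ← ENNReal.ofReal_mul (by positivity), ← mul_assoc, ← ENNReal.ofReal_mul (by positivity)]
          congr 2
          have : t ^ (p - 1) = t ^ (p - 2 - 1) * t ^ (2 : ℝ) := by
            rw [← Real.rpow_add ht]; congr 1; ring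
          rw [this]
          simp only [Real.rpow_two]
          field_simp
          ring
  calc _ ≤ ENNReal.ofReal p * ∫⁻ t in Ioi (0 : ℝ), ENNReal.ofReal (4 * ε) *
        (ENNReal.ofReal (t ^ (p - 2 - 1)) * ∫⁻ x, {x | (2 * C)⁻¹ * t < |f x|}.indicator
          (fun x => ENNReal.ofReal (|f x| ^ (2 : ℝ))) x ∂μ) := by
        exact mul_le_mul_right (setLIntegral_mono' measurableSet_Ioi key) _
    _ ≤ ENNReal.ofReal p * (ENNReal.ofReal (4 * ε) * (ENNReal.ofReal ((p - 2)⁻¹ *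
          (2 * C)⁻¹⁻¹ ^ (p - 2)) * ∫⁻ x, ENNReal.ofReal (|f x| ^ p) ∂μ)) := by
        rw [lintegral_const_mul' _ _ ENNReal.ofReal_ne_top]
        gcongr
        exact lintegral_rpow_large_le hf.abs (fun _ => abs_nonneg _) (by positivity) two_pos hp
    _ = _ := by
        have : 0 < p - 2 := by linarith
        rw [inv_inv, ← mul_assoc, ← mul_assoc, ← ENNReal.ofReal_mul (by positivity),
          ← ENNReal.ofReal_mul (by positivity)]
        congr 2
        ring

/-- Cut f at height a t; use the L¹ bound on the large part and the L² bound on the small part. The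
L¹ term does not contain ε, but decays as a grows; this is why a is left free. -/
lemma InterpolationBound.lintegral_le_of_lt_two [IsFiniteMeasure μ] (hS : InterpolationBound μ ν S C ε) (hC : 0 < C)
    (hε : 0 < ε) (hp1 : 1 < p) (hp : p < 2) {a : ℝ} (ha : 0 < a) {f : α → ℝ} (hf : Measurable f)
    (hi : Integrable f μ) :
    ∫⁻ y, ENNReal.ofReal (|S f y| ^ p) ∂ν ≤
      ENNReal.ofReal (p * (2 * C * ((p - 1)⁻¹ * a⁻¹ ^ (p - 1)) +
        4 * ε * ((2 - p)⁻¹ * a ^ (2 - p)))) * ∫⁻ x, ENNReal.ofReal (|f x| ^ p) ∂μ := by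
  rw [lintegral_abs_rpow_eq (hS.aemeasurable f hf hi) (by linarith)]
  have key : ∀ t ∈ Ioi (0 : ℝ), ν {y | t < |S f y|} * ENNReal.ofReal (t ^ (p - 1)) ≤
      ENNReal.ofReal (2 * C) * (ENNReal.ofReal (t ^ (p - 1 - 1)) *
        ∫⁻ x, {x | a * t < |f x|}.indicator (fun x => ENNReal.ofReal (|f x| ^ (1 : ℝ))) x ∂μ) +
      ENNReal.ofReal (4 * ε) * (ENNReal.ofReal (t ^ (p - 2 - 1)) *
        ∫⁻ x, {x | |f x| ≤ a * t}.indicator (fun x => ENNReal.ofReal (|f x| ^ (2 : ℝ))) x ∂μ) := by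
    intro t ht
    rw [mem_Ioi] at ht
    set c := a * t with hc
    have hc0 : 0 ≤ c := by positivity
    have h1 : ν {y | t < |S f y|} ≤ ν {y | t / 2 < |S (largePart f c) y|} +
        ν {y | t / 2 < |S (smallPart f c) y|} := by
      refine (measure_mono_ae ?_).trans (measure_union_le _ _)
      have h2 := hS.add _ _ (measurable_smallPart hf c) (measurable_largePart hf c)
        (integrable_smallPart hf hc0) (integrable_largePart hf hi c)
      rw [smallPart_add_largePart] at h2
      filter_upwards [h2] with y h3 h5
      have h5' : t < |S f y| := h5
      rw [h3] at h5'
      have h6 := abs_add_le (S (smallPart f c) y) (S (largePart f c) y)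
      by_contra hcon
      have hcon' : ¬ (t / 2 < |S (largePart f c) y| ∨ t / 2 < |S (smallPart f c) y|) := hcon
      push Not at hcon'
      linarith
    have h2 := measure_lt_abs_le (hS.aemeasurable _ (measurable_largePart hf c)
      (integrable_largePart hf hi c)) (q := 1) one_pos (half_pos ht)
    have h3 := hS.one _ (measurable_largePart hf c) (integrable_largePart hf hi c)
    rw [lintegral_largePart f c one_pos] at h3
    have h4 := measure_lt_abs_le (hS.aemeasurable _ (measurable_smallPart hf c)
      (integrable_smallPart hf hc0)) (q := 2) two_pos (half_pos ht)
    have h5 := hS.two _ (measurable_smallPart hf c) (integrable_smallPart hf hc0)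
    rw [lintegral_smallPart f c two_pos] at h5
    calc _ ≤ (ENNReal.ofReal ((t / 2)⁻¹ ^ (1 : ℝ)) * (ENNReal.ofReal C *
          ∫⁻ x, {x | c < |f x|}.indicator (fun x => ENNReal.ofReal (|f x| ^ (1 : ℝ))) x ∂μ) +
          ENNReal.ofReal ((t / 2)⁻¹ ^ (2 : ℝ)) * (ENNReal.ofReal ε *
          ∫⁻ x, {x | |f x| ≤ c}.indicator (fun x => ENNReal.ofReal (|f x| ^ (2 : ℝ))) x ∂μ)) *
            ENNReal.ofReal (t ^ (p - 1)) := by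
          gcongr
          exact h1.trans (add_le_add (h2.trans (by gcongr)) (h4.trans (by gcongr)))
      _ = _ := by
          rw [add_mul]
          congr 1
          · rw [← mul_assoc, ← ENNReal.ofReal_mul (by positivity), mul_right_comm,
              ← ENNReal.ofReal_mul (by positivity), ← mul_assoc,
              ← ENNReal.ofReal_mul (by positivity)]
            congr 2
            have : t ^ (p - 1) = t ^ (p - 1 - 1) * t ^ (1 : ℝ) := by
              rw [← Real.rpow_add ht]; congr 1; ring
            rw [this]
            simp only [Real.rpow_one]
            field_simp
          · rw [← mul_assoc, ← ENNReal.ofReal_mul (by positivity), mul_right_comm,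
              ← ENNReal.ofReal_mul (by positivity), ← mul_assoc,
              ← ENNReal.ofReal_mul (by positivity)]
            congr 2
            have : t ^ (p - 1) = t ^ (p - 2 - 1) * t ^ (2 : ℝ) := by
              rw [← Real.rpow_add ht]; congr 1; ring
            rw [this]
            simp only [Real.rpow_two]
            field_simp
            ring
  have hm : Measurable fun t : ℝ => ENNReal.ofReal (2 * C) * (ENNReal.ofReal (t ^ (p - 1 - 1)) *
        ∫⁻ x, {x | a * t < |f x|}.indicator (fun x => ENNReal.ofReal (|f x| ^ (1 : ℝ))) x ∂μ) := by
    refine Measurable.const_mul (Measurable.mul (by fun_prop) ?_) _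
    have : Measurable fun w : ℝ × α => {w : ℝ × α | a * w.1 < |f w.2|}.indicator
        (fun w => ENNReal.ofReal (|f w.2| ^ (1 : ℝ))) w :=
      Measurable.indicator (by fun_prop) (measurableSet_lt (by fun_prop) (by fun_prop))
    exact this.lintegral_prod_right'
  calc _ ≤ ENNReal.ofReal p * ∫⁻ t in Ioi (0 : ℝ), (ENNReal.ofReal (2 * C) *
        (ENNReal.ofReal (t ^ (p - 1 - 1)) *
        ∫⁻ x, {x | a * t < |f x|}.indicator (fun x => ENNReal.ofReal (|f x| ^ (1 : ℝ))) x ∂μ) +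
        ENNReal.ofReal (4 * ε) * (ENNReal.ofReal (t ^ (p - 2 - 1)) *
        ∫⁻ x, {x | |f x| ≤ a * t}.indicator (fun x => ENNReal.ofReal (|f x| ^ (2 : ℝ))) x ∂μ)) := by
        exact mul_le_mul_right (setLIntegral_mono' measurableSet_Ioi key) _
    _ ≤ ENNReal.ofReal p * (ENNReal.ofReal (2 * C) * (ENNReal.ofReal ((p - 1)⁻¹ *
          a⁻¹ ^ (p - 1)) * ∫⁻ x, ENNReal.ofReal (|f x| ^ p) ∂μ) +
          ENNReal.ofReal (4 * ε) * (ENNReal.ofReal ((2 - p)⁻¹ *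
          a ^ (2 - p)) * ∫⁻ x, ENNReal.ofReal (|f x| ^ p) ∂μ)) := by
        rw [lintegral_add_left hm, lintegral_const_mul' _ _ ENNReal.ofReal_ne_top,
          lintegral_const_mul' _ _ ENNReal.ofReal_ne_top]
        gcongr
        · exact lintegral_rpow_large_le hf.abs (fun _ => abs_nonneg _) (by positivity) one_pos hp1
        · exact lintegral_rpow_small_le hf.abs (fun _ => abs_nonneg _) (by positivity)
            (by linarith) hp
    _ = _ := by
        have : 0 < p - 1 := by linarith
        have : 0 < 2 - p := by linarith
        rw [← mul_assoc, ← mul_assoc, ← ENNReal.ofReal_mul (by positivity),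
          ← ENNReal.ofReal_mul (by positivity), ← add_mul,
          ← ENNReal.ofReal_add (by positivity) (by positivity), ← mul_assoc,
          ← ENNReal.ofReal_mul (by positivity)]

/-- Interpolation: if an operator is bounded on `L¹` and `L^∞` and small on `L²`, then it is small
on every `L^p`, `1 < p < ∞`. -/
theorem exists_interpolation_bound {p C δ : ℝ} (hp : 1 < p) (hC : 0 < C) (hδ : 0 < δ) :
    ∃ ε > 0, ∀ (μ : Measure α) (ν : Measure β) (S : (α → ℝ) → β → ℝ), IsFiniteMeasure μ →
      InterpolationBound μ ν S C ε → ∀ f, Measurable f → Integrable f μ →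
        ∫⁻ y, ENNReal.ofReal (|S f y| ^ p) ∂ν ≤
          ENNReal.ofReal δ * ∫⁻ x, ENNReal.ofReal (|f x| ^ p) ∂μ := by
  -- The threshold ε depends only on p, C and δ, not on the operator: later the partition, and with
  -- it the operator, is chosen after ε.
  rcases lt_trichotomy p 2 with h | h | h
  · have h1 : 0 < p - 1 := by linarith
    have h2 : 0 < 2 - p := by linarith
    -- First a is taken so large that the L¹ term is below δ/2; then ε is chosen to make the L² term
    -- equal to δ/2.
    have t1 : Tendsto (fun a : ℝ => p * (2 * C * ((p - 1)⁻¹ * a⁻¹ ^ (p - 1)))) atTop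
        (𝓝 (p * (2 * C * ((p - 1)⁻¹ * 0 ^ (p - 1))))) := by
      refine Tendsto.const_mul _ (Tendsto.const_mul _ (Tendsto.const_mul _ ?_))
      exact tendsto_inv_atTop_zero.rpow_const (Or.inr h1.le)
    rw [Real.zero_rpow h1.ne', mul_zero, mul_zero, mul_zero] at t1
    obtain ⟨a, ha, ha0⟩ := ((t1.eventually (gt_mem_nhds (half_pos hδ))).and
      (eventually_gt_atTop 0)).exists
    refine ⟨δ / 2 / (p * (4 * ((2 - p)⁻¹ * a ^ (2 - p)))), by positivity, ?_⟩
    intro μ ν S _ hS f hf hi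
    refine (hS.lintegral_le_of_lt_two hC (by positivity) hp h ha0 hf hi).trans ?_
    gcongr
    have e : p * (4 * (δ / 2 / (p * (4 * ((2 - p)⁻¹ * a ^ (2 - p))))) *
        ((2 - p)⁻¹ * a ^ (2 - p))) = δ / 2 := by field_simp
    rw [mul_add, e]
    linarith
  · refine ⟨δ, hδ, ?_⟩
    intro μ ν S _ hS f hf hi
    rw [h]
    exact hS.two f hf hi
  · have h2 : 0 < p - 2 := by linarith
    refine ⟨δ / (p * (4 * ((p - 2)⁻¹ * (2 * C) ^ (p - 2)))), by positivity, ?_⟩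
    intro μ ν S _ hS f hf hi
    refine (hS.lintegral_le_of_two_lt hC (by positivity) h hf hi).trans ?_
    gcongr
    refine le_of_eq ?_
    field_simp

end Interpolation

end

section

/-! ### Convolution powers of the law of (s' - s)v. -/

section ConvolutionPowers

/-- The `n`-fold convolution power of a measure. -/
def convPow (ν : Measure (Euc d)) : ℕ → Measure (Euc d)
  | 0 => Measure.dirac 0
  | n + 1 => ν ∗ convPow ν n

instance (ν : Measure (Euc d)) [IsFiniteMeasure ν] (n : ℕ) : IsFiniteMeasure (convPow ν n) := by
  induction n with
  | zero => unfold convPow; infer_instance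
  | succ n ih => unfold convPow; infer_instance

lemma convPow_add (ν : Measure (Euc d)) [IsFiniteMeasure ν] (m n : ℕ) :
    convPow ν (m + n) = convPow ν m ∗ convPow ν n := by
  induction m with
  | zero => rw [Nat.zero_add]; simp [convPow, Measure.dirac_zero_conv]
  | succ m ih =>
    rw [Nat.add_right_comm]
    change ν ∗ convPow ν (m + n) = (ν ∗ convPow ν m) ∗ convPow ν n
    rw [ih, Measure.conv_assoc]

lemma convPow_one (ν : Measure (Euc d)) [IsFiniteMeasure ν] : convPow ν 1 = ν := by
  simp [convPow, Measure.conv_dirac_zero]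

lemma convPow_map_neg (ν : Measure (Euc d)) [IsFiniteMeasure ν] (h : ν.map Neg.neg = ν) (n : ℕ) :
    (convPow ν n).map Neg.neg = convPow ν n := by
  induction n with
  | zero =>
    simp only [convPow]
    rw [Measure.map_dirac' measurable_neg, neg_zero]
  | succ n ih =>
    simp only [convPow]
    have := Measure.map_conv_addMonoidHom (μ := ν) (ν := convPow ν n)
      (negAddMonoidHom : Euc d →+ Euc d) measurable_neg
    rw [show ((negAddMonoidHom : Euc d →+ Euc d) : Euc d → Euc d) = Neg.neg from rfl] at this
    rw [this, h, ih]

variable {Ω : Type*} [MeasurableSpace Ω]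

lemma convPow_map_eq (κ : Measure Ω) [IsFiniteMeasure κ] {Y : Ω → Euc d} (hY : Measurable Y)
    (n : ℕ) : convPow (κ.map Y) n =
      (Measure.pi fun _ : Fin n => κ).map fun ω => ∑ i, Y (ω i) := by
  induction n with
  | zero =>
    have : (fun ω : Fin 0 → Ω => ∑ i, Y (ω i)) = fun _ => 0 := by ext1; simp
    rw [this, Measure.map_const]
    simp [convPow]
  | succ n ih =>
    have hmp := measurePreserving_piFinSuccAbove (fun _ : Fin (n + 1) => κ) 0
    have hS : Measurable fun ω : Fin n → Ω => ∑ i, Y (ω i) :=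
      Finset.measurable_sum _ fun i _ => hY.comp (measurable_pi_apply i)
    have e : (fun ω : Fin (n + 1) → Ω => ∑ i, Y (ω i)) =
        (fun w : Euc d × Euc d => w.1 + w.2) ∘ (Prod.map Y fun ω : Fin n → Ω => ∑ i, Y (ω i)) ∘
          (MeasurableEquiv.piFinSuccAbove (fun _ : Fin (n + 1) => Ω) 0) := by
      ext1 ω
      simp only [Function.comp_apply, Prod.map]
      rw [Fin.sum_univ_succ]
      rfl
    simp only [convPow]
    rw [ih, e, ← Measure.map_map (by fun_prop) (by fun_prop), ← Measure.map_map (by fun_prop)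
      (MeasurableEquiv.measurable _), hmp.map_eq, ← Measure.map_prod_map _ _ hY hS]
    rfl

lemma exists_orthogonal_of_finrank_lt (U : Submodule ℝ (Euc d)) (hU : Module.finrank ℝ U < d) :
    ∃ e : Euc d, e ≠ 0 ∧ ∀ v ∈ U, ⟪v, e⟫ = 0 := by
  have hne : Uᗮ ≠ ⊥ := by
    intro h
    rw [Submodule.orthogonal_eq_bot_iff] at h
    rw [h] at hU
    simp at hU
  obtain ⟨e, he, h0⟩ := Submodule.exists_mem_ne_zero_of_ne_bot hne
  exact ⟨e, h0, fun v hv => (Submodule.mem_orthogonal U e).1 he v hv⟩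

/-- Induction on n: the span of the earlier vectors has dimension below d, hence lies in some
hyperplane orthogonal to e ≠ 0, and the new vector falls into that hyperplane with probability zero.
-/
lemma ae_linearIndependent (m : Measure (Euc d)) [IsFiniteMeasure m]
    (hm : ∀ e : Euc d, e ≠ 0 → m {v | ⟪v, e⟫ = 0} = 0) (n : ℕ) (hn : n ≤ d) :
    ∀ᵐ v ∂(Measure.pi fun _ : Fin n => m), LinearIndependent ℝ v := by
  induction n with
  | zero => exact Eventually.of_forall fun v => linearIndependent_empty_type
  | succ n ih =>
    have hmp := measurePreserving_piFinSuccAbove (fun _ : Fin (n + 1) => m) 0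
    have hmeas : MeasurableSet {v : Fin (n + 1) → Euc d | LinearIndependent ℝ v} :=
      isOpen_setOfPred_linearIndependent.measurableSet
    have key : ∀ᵐ w ∂(m.prod (Measure.pi fun _ : Fin n => m)), LinearIndependent ℝ
        ((MeasurableEquiv.piFinSuccAbove (fun _ : Fin (n + 1) => Euc d) 0).symm w) := by
      have hmeas' : MeasurableSet {w : Euc d × (Fin n → Euc d) | LinearIndependent ℝ
        ((MeasurableEquiv.piFinSuccAbove (fun _ : Fin (n + 1) => Euc d) 0).symm w)} :=
        (MeasurableEquiv.measurable _) hmeas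
      rw [ae_iff, ← compl_ofPred, Measure.prod_apply_symm hmeas'.compl,
        lintegral_eq_zero_iff (measurable_measure_prodMk_right hmeas'.compl)]
      filter_upwards [ih (by omega)] with v hv
      obtain ⟨e, he, hort⟩ := exists_orthogonal_of_finrank_lt (Submodule.span ℝ (range v)) (by
        refine lt_of_le_of_lt (finrank_range_le_card v) ?_
        simp; omega)
      refine measure_mono_null (fun x hx => by_contra fun hx' => hx ?_) (hm e he)
      have e1 : (MeasurableEquiv.piFinSuccAbove (fun _ : Fin (n + 1) => Euc d) 0).symm (x, v) =
        Fin.cons x v := by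
        ext i
        refine Fin.cases ?_ (fun j => ?_) i
        · simp [MeasurableEquiv.piFinSuccAbove]
        · simp [MeasurableEquiv.piFinSuccAbove]
      change LinearIndependent ℝ _
      rw [e1, linearIndependent_finCons]
      exact ⟨hv, fun hmem => hx' (hort x hmem)⟩
    filter_upwards [hmp.quasiMeasurePreserving.ae key] with v hv
    rwa [MeasurableEquiv.symm_apply_apply] at hv

/-- The map r ↦ ∑ rᵢ vᵢ is a linear isomorphism, so it carries Lebesgue measure to a Haar measure.
-/
lemma pi_restrict_null_of_linearIndependent (hd : 1 ≤ d) {v : Fin d → Euc d} (hv : LinearIndependent ℝ v)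
    {A : Set (Euc d)} (hA : volume A = 0) (I : Set ℝ) (y : Euc d) :
    (Measure.pi fun _ : Fin d => (volume : Measure ℝ).restrict I) {r | y + ∑ i, r i • v i ∈ A} =
      0 := by
  rw [← Measure.restrict_pi_pi]
  refine Measure.absolutelyContinuous_of_le Measure.restrict_le_self ?_
  have : Nonempty (Fin d) := ⟨⟨0, hd⟩⟩
  let b := basisOfLinearIndependentOfCardEqFinrank hv (by simp)
  let L : (Fin d → ℝ) ≃L[ℝ] Euc d := b.equivFun.symm.toContinuousLinearEquiv
  have hL : ∀ r, L r = ∑ i, r i • v i := fun r => by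
    simp [L, b, Module.Basis.equivFun_symm_apply]
  have hA' : volume ((fun x => y + x) ⁻¹' A) = 0 := by
    rw [measure_preimage_add]; exact hA
  have h2 : {r : Fin d → ℝ | y + ∑ i, r i • v i ∈ A} = L ⁻¹' ((fun x => y + x) ⁻¹' A) := by
    ext r
    simp [hL]
  rw [h2]
  have hq : (volume.map L) ≪ (volume : Measure (Euc d)) := by
    have : (volume.map L).IsAddHaarMeasure := L.isAddHaarMeasure_map _
    exact Measure.absolutelyContinuous_isAddHaarMeasure _ _
  have h3 : (volume.map L.toHomeomorph.toMeasurableEquiv) ((fun x => y + x) ⁻¹' A) = 0 := hq hA'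
  rwa [MeasurableEquiv.map_apply] at h3

/-- The law of `(s' - s) v`, where `s`, `s'` are distributed uniformly in `(0, h]` and `v`
according to `m`. -/
def segmentLaw (m : Measure (Euc d)) (h : ℝ) : Measure (Euc d) :=
  (((volume : Measure ℝ).restrict (Ioc 0 h)).prod
    (((volume : Measure ℝ).restrict (Ioc 0 h)).prod m)).map fun w => (w.1 - w.2.1) • w.2.2

instance (m : Measure (Euc d)) [IsFiniteMeasure m] (h : ℝ) : IsFiniteMeasure (segmentLaw m h) := by
  unfold segmentLaw; infer_instance

lemma segmentLaw_map_neg (m : Measure (Euc d)) [IsFiniteMeasure m] (h : ℝ) :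
    (segmentLaw m h).map Neg.neg = segmentLaw m h := by
  unfold segmentLaw
  set I := (volume : Measure ℝ).restrict (Ioc 0 h)
  rw [Measure.map_map measurable_neg (by fun_prop)]
  have hmp : MeasurePreserving (fun w : ℝ × ℝ × Euc d => (w.2.1, w.1, w.2.2))
      (I.prod (I.prod m)) (I.prod (I.prod m)) := by
    have h1 := measurePreserving_prodAssoc I I m
    have h2 : MeasurePreserving (Prod.map Prod.swap id : (ℝ × ℝ) × Euc d → (ℝ × ℝ) × Euc d)
      ((I.prod I).prod m) ((I.prod I).prod m) :=
      Measure.measurePreserving_swap.prod (MeasurePreserving.id m)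
    exact (h1.comp h2).comp (h1.symm MeasurableEquiv.prodAssoc)
  conv_rhs => rw [← hmp.map_eq]
  rw [Measure.map_map (by fun_prop) (by fun_prop)]
  congr 1
  ext1 w
  simp only [Function.comp_apply]
  rw [← neg_smul, neg_sub]

/-- The d-fold power is the law of ∑ (sᵢ' - sᵢ) vᵢ. Once linearly independent velocities and one
family of times are frozen, the other family of times alone already makes the sum absolutely
continuous. -/
lemma convPow_segmentLaw_absolutelyContinuous (hd : 1 ≤ d) (m : Measure (Euc d))
    [IsFiniteMeasure m] (hm : ∀ e : Euc d, e ≠ 0 → m {v | ⟪v, e⟫ = 0} = 0) (h : ℝ) :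
    convPow (segmentLaw m h) d ≪ volume := by
  refine Measure.AbsolutelyContinuous.mk fun A hA hA0 => ?_
  set I := (volume : Measure ℝ).restrict (Ioc 0 h) with hI
  have hY : Measurable fun w : ℝ × ℝ × Euc d => (w.1 - w.2.1) • w.2.2 := by fun_prop
  unfold segmentLaw
  rw [convPow_map_eq _ hY, Measure.map_apply (by fun_prop) hA]
  have hmp := measurePreserving_arrowProdEquivProdArrow ℝ (ℝ × Euc d) (Fin d) (fun _ => I)
    fun _ => I.prod m
  have hmp2 := measurePreserving_arrowProdEquivProdArrow ℝ (Euc d) (Fin d) (fun _ => I)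
    fun _ => m
  have key : (((Measure.pi fun _ : Fin d => I).prod (Measure.pi fun _ : Fin d => I.prod m)))
      {w | ∑ i, (w.1 i - (w.2 i).1) • (w.2 i).2 ∈ A} = 0 := by
    have hms : MeasurableSet {w : (Fin d → ℝ) × (Fin d → ℝ × Euc d) |
        ∑ i, (w.1 i - (w.2 i).1) • (w.2 i).2 ∈ A} := by
      have : Measurable fun w : (Fin d → ℝ) × (Fin d → ℝ × Euc d) =>
        ∑ i, (w.1 i - (w.2 i).1) • (w.2 i).2 := by fun_prop
      exact this hA
    rw [Measure.prod_apply_symm hms, lintegral_eq_zero_iff (measurable_measure_prodMk_right hms)]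
    have hae : ∀ᵐ w ∂(Measure.pi fun _ : Fin d => I.prod m),
        LinearIndependent ℝ fun i => (w i).2 := by
      have h1 : ∀ᵐ w ∂((Measure.pi fun _ : Fin d => I).prod (Measure.pi fun _ : Fin d => m)),
          LinearIndependent ℝ w.2 :=
        Measure.quasiMeasurePreserving_snd.ae (ae_linearIndependent m hm d le_rfl)
      exact hmp2.quasiMeasurePreserving.ae h1
    filter_upwards [hae] with w hw
    have h2 := pi_restrict_null_of_linearIndependent hd hw hA0 (Ioc 0 h)
      (-∑ i, (w i).1 • (w i).2)
    refine Eq.trans ?_ h2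
    congr 1
    ext r
    simp only [mem_preimage, mem_ofPred_eq, sub_smul, Finset.sum_sub_distrib]
    rw [neg_add_eq_sub]
  have h3 := hmp.measure_preimage_equiv {w : (Fin d → ℝ) × (Fin d → ℝ × Euc d) |
        ∑ i, (w.1 i - (w.2 i).1) • (w.2 i).2 ∈ A}
  rw [key] at h3
  exact h3

/-- The exponent is a power of two because the Cauchy–Schwarz argument doubles it at each step; any
exponent beyond d keeps absolute continuity. -/
lemma exists_convPow_absolutelyContinuous (hd : 1 ≤ d) (m : Measure (Euc d))
    [IsFiniteMeasure m] (hm : ∀ e : Euc d, e ≠ 0 → m {v | ⟪v, e⟫ = 0} = 0) (h : ℝ) :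
    ∃ k : ℕ, convPow (segmentLaw m h) (2 ^ k) ≪ volume := by
  refine ⟨d, ?_⟩
  obtain ⟨j, hj⟩ := Nat.exists_eq_add_of_le (Nat.lt_two_pow_self (n := d)).le
  rw [hj, Nat.add_comm, convPow_add]
  exact Measure.conv_absolutelyContinuous (convPow_segmentLaw_absolutelyContinuous hd m hm h)

end ConvolutionPowers

end

section

/-! ### Finite measurable partitions into small cells. -/

section Partition

/-- A compact set, covered by prescribed neighbourhoods of its points, has a finite measurable
partition subordinate to the cover. -/
lemma exists_measurable_index {T : Type*} [TopologicalSpace T] [MeasurableSpace T]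
    [OpensMeasurableSpace T] [Nonempty T] {K : Set T} (hK : IsCompact K) (U : T → Set T)
    (hU : ∀ x ∈ K, U x ∈ 𝓝 x) :
    ∃ (N : ℕ) (c : T → ℕ) (x : ℕ → T), Measurable c ∧ (∀ y, c y ≤ N) ∧
      (∀ i < N, x i ∈ K) ∧ ∀ y ∈ K, c y < N ∧ y ∈ U (x (c y)) := by
  classical
  obtain ⟨t, htK, ht⟩ := hK.elim_nhds_subcover (fun x => interior (U x))
    fun x hx => interior_mem_nhds.2 (hU x hx)
  let l := t.toList
  let x : ℕ → T := fun i => l.getD i (Classical.arbitrary T)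
  -- The index of y will be the first i whose neighbourhood contains y. The alternative `l.length ≤
  -- i` makes the search always succeed and gives uncovered points the extra index `l.length`.
  let P : T → ℕ → Prop := fun y i => l.length ≤ i ∨ y ∈ interior (U (x i))
  have hP : ∀ y, ∃ i, P y i := fun y => ⟨l.length, Or.inl le_rfl⟩
  refine ⟨l.length, fun y => Nat.find (hP y), x, ?_, fun y => Nat.find_le (Or.inl le_rfl), ?_, ?_⟩
  · refine measurable_find hP fun k => ?_
    by_cases hk : l.length ≤ k
    · simp [P, hk]
    · simp only [P, hk, false_or]
      exact isOpen_interior.measurableSet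
  · intro i hi
    refine htK _ ?_
    rw [← Finset.mem_toList]
    simp only [x, List.getD_eq_getElem _ _ hi]
    exact List.getElem_mem hi
  · intro y hy
    obtain ⟨z, hz, hyz⟩ := mem_iUnion₂.1 (ht hy)
    obtain ⟨i, hi, hiz⟩ := List.getElem_of_mem (Finset.mem_toList.2 hz)
    have hPi : P y i := by
      right
      have : x i = z := by rw [← hiz]; exact List.getD_eq_getElem _ _ hi
      rw [this]; exact hyz
    have h1 : Nat.find (hP y) < l.length := (Nat.find_le hPi).trans_lt hi
    exact ⟨h1, interior_subset ((Nat.find_spec (hP y)).resolve_left (by omega))⟩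

lemma exists_measurable_index_dist {B : Set (Euc d)} (hB : Bornology.IsBounded B) {δ : ℝ}
    (hδ : 0 < δ) : ∃ (N : ℕ) (c : Euc d → ℕ), Measurable c ∧ (∀ y, c y ≤ N) ∧
      ∀ x ∈ B, ∀ y ∈ B, c x = c y → dist x y < δ := by
  obtain ⟨N, c, x, hc, hcN, -, h⟩ := exists_measurable_index hB.isCompact_closure
    (fun x => Metric.ball x (δ / 2)) fun x _ => Metric.ball_mem_nhds x (half_pos hδ)
  refine ⟨N, c, hc, hcN, fun y hy z hz hyz => ?_⟩
  have h1 := (h y (subset_closure hy)).2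
  have h2 := (h z (subset_closure hz)).2
  rw [← hyz] at h2
  rw [Metric.mem_ball] at h1 h2
  calc dist y z ≤ dist y (x (c y)) + dist z (x (c y)) := dist_triangle_right _ _ _
    _ < δ := by linarith

lemma integral_mul_comp_index_eq_zero {α : Type*} [MeasurableSpace α] {μ : Measure α} {φ : α → ℝ}
    (hφ : Integrable φ μ) {c : α → ℕ} (hc : Measurable c) {N : ℕ} (hcN : ∀ x, c x ≤ N)
    (h0 : ∀ i, ∫ x in c ⁻¹' {i}, φ x ∂μ = 0) (H : ℕ → ℝ) : ∫ x, φ x * H (c x) ∂μ = 0 := by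
  have hms : ∀ i, MeasurableSet (c ⁻¹' {i}) := fun i => hc (measurableSet_singleton i)
  have e : ∀ x, φ x * H (c x) =
      ∑ i ∈ Finset.range (N + 1), (c ⁻¹' {i}).indicator (fun x => φ x * H i) x := by
    intro x
    rw [Finset.sum_eq_single (c x)]
    · rw [indicator_of_mem (by simp)]
    · intro i _ hi
      rw [indicator_of_notMem (by simpa using Ne.symm hi)]
    · intro h
      exact absurd (Finset.mem_range.2 (Nat.lt_succ_of_le (hcN x))) h
  simp_rw [e]
  rw [integral_finsetSum _ fun i _ => (hφ.mul_const _).indicator (hms i)]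
  refine Finset.sum_eq_zero fun i _ => ?_
  rw [integral_indicator (hms i), integral_mul_const, h0 i, zero_mul]

lemma sq_integral_mul_le {α : Type*} [MeasurableSpace α] {μ : Measure α} {f g : α → ℝ}
    (hf : MemLp f 2 μ) (hg : MemLp g 2 μ) :
    (∫ x, f x * g x ∂μ) ^ 2 ≤ (∫ x, f x ^ 2 ∂μ) * ∫ x, g x ^ 2 ∂μ := by
  have h := real_inner_mul_inner_self_le (hf.toLp) (hg.toLp)
  have e : ∀ {f g : α → ℝ} (hf : MemLp f 2 μ) (hg : MemLp g 2 μ),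
      ⟪hf.toLp, hg.toLp⟫ = ∫ x, f x * g x ∂μ := by
    intro f g hf hg
    rw [L2.inner_def]
    refine integral_congr_ae ?_
    filter_upwards [hf.coeFn_toLp, hg.coeFn_toLp] with x h1 h2
    rw [h1, h2]
    simp [mul_comm]
  rw [e hf hg, e hf hf, e hg hg] at h
  simpa [sq] using h

end Partition

/-! ### The quadratic form of convolution with a symmetric measure. -/

section Bilinear

variable {Ω : Type*} [MeasurableSpace Ω]

lemma measurePreserving_shear (P : Measure Ω) [SFinite P] {a : Ω → Euc d} (ha : Measurable a) :
    MeasurePreserving (fun w : Ω × Euc d => (w.1, w.2 + a w.1)) (P.prod volume)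
      (P.prod volume) := by
  refine (MeasurePreserving.id P).skew_product (g := fun ω x => x + a ω) (by fun_prop) ?_
  exact Eventually.of_forall fun ω => (measurePreserving_add_right volume (a ω)).map_eq

lemma integrable_comp_shear (P : Measure Ω) [IsFiniteMeasure P] {a : Ω → Euc d}
    (ha : Measurable a) {f : Euc d → ℝ} (hf : Integrable f volume) :
    Integrable (fun w : Ω × Euc d => f (w.2 + a w.1)) (P.prod volume) := by
  have h1 : Integrable (fun w : Ω × Euc d => f w.2) (P.prod volume) := hf.comp_snd P
  exact (measurePreserving_shear P ha).integrable_comp_of_integrable h1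

lemma integrable_mul_shear (P : Measure Ω) [IsFiniteMeasure P] {a b : Ω → Euc d}
    (ha : Measurable a) (hb : Measurable b) {φ ψ : Euc d → ℝ} (hφm : Measurable φ)
    (hψm : Measurable ψ) (hφ : MemLp φ 2 volume) (hψ : MemLp ψ 2 volume) :
    Integrable (fun w : Ω × Euc d => φ (w.2 + a w.1) * ψ (w.2 + b w.1)) (P.prod volume) := by
  have h1 := integrable_comp_shear P ha hφ.integrable_sq
  have h2 := integrable_comp_shear P hb hψ.integrable_sq
  refine (h1.add h2).mono' (by fun_prop) (Eventually.of_forall fun w => ?_)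
  simp only [Pi.add_apply]
  rw [Real.norm_eq_abs, abs_mul, ← sq_abs (φ _), ← sq_abs (ψ _)]
  nlinarith [sq_nonneg (|φ (w.2 + a w.1)| - |ψ (w.2 + b w.1)|), sq_nonneg |φ (w.2 + a w.1)|,
    sq_nonneg |ψ (w.2 + b w.1)|]

lemma integral_mul_shear (P : Measure Ω) [IsFiniteMeasure P] {a b : Ω → Euc d}
    (ha : Measurable a) (φ ψ : Euc d → ℝ) :
    ∫ w : Ω × Euc d, φ (w.2 + a w.1) * ψ (w.2 + b w.1) ∂(P.prod volume) =
      ∫ w : Ω × Euc d, φ w.2 * ψ (w.2 + (b w.1 - a w.1)) ∂(P.prod volume) := by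
  have he : MeasurableEmbedding fun w : Ω × Euc d => (w.1, w.2 + a w.1) :=
    MeasurableEquiv.measurableEmbedding
      { toFun := fun w : Ω × Euc d => (w.1, w.2 + a w.1)
        invFun := fun w => (w.1, w.2 - a w.1)
        left_inv := fun w => by simp
        right_inv := fun w => by simp
        measurable_toFun := measurable_fst.prodMk (measurable_snd.add (ha.comp measurable_fst))
        measurable_invFun := measurable_fst.prodMk (measurable_snd.sub (ha.comp measurable_fst)) }
  rw [← (measurePreserving_shear P ha).integral_comp he
    fun w => φ w.2 * ψ (w.2 + (b w.1 - a w.1))]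
  refine integral_congr_ae (Eventually.of_forall fun w => ?_)
  simp

/-- The quadratic form of the convolution with the measure `ν`. -/
def convForm (ν : Measure (Euc d)) (φ : Euc d → ℝ) : ℝ :=
  ∫ w : Euc d × Euc d, φ w.2 * φ (w.2 + w.1) ∂(ν.prod volume)

lemma convForm_map (P : Measure Ω) [IsFiniteMeasure P] {Y : Ω → Euc d} (hY : Measurable Y)
    {φ : Euc d → ℝ} (hφm : Measurable φ) :
    convForm (P.map Y) φ = ∫ w : Ω × Euc d, φ w.2 * φ (w.2 + Y w.1) ∂(P.prod volume) := by
  have h : (P.map Y).prod (volume : Measure (Euc d)) = (P.prod volume).map (Prod.map Y id) := by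
    rw [← Measure.map_prod_map _ _ hY measurable_id, Measure.map_id]
  unfold convForm
  rw [h, integral_map (by fun_prop) (by fun_prop)]
  rfl

/-- The form is the scalar product of φ with g = ∫ φ(· + y) dν(y). Cauchy–Schwarz leaves ‖g‖², and
this is the form of ν ∗ ν. -/
lemma sq_convForm_le (ν : Measure (Euc d)) [IsFiniteMeasure ν] (hν : ν.map Neg.neg = ν)
    {φ : Euc d → ℝ} (hφm : Measurable φ) (hφ : MemLp φ 2 volume) :
    convForm ν φ ^ 2 ≤ (∫ x, φ x ^ 2) * convForm (ν ∗ ν) φ := by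
  set g : Euc d → ℝ := fun x => ∫ y, φ (x + y) ∂ν with hg
  have hgm : AEStronglyMeasurable g volume := by
    have : StronglyMeasurable fun w : Euc d × Euc d => φ (w.1 + w.2) :=
      (hφm.comp (by fun_prop)).stronglyMeasurable
    exact (this.integral_prod_right' (ν := ν)).aestronglyMeasurable
  have h1 : convForm ν φ = ∫ x, φ x * g x := by
    have hi := integrable_mul_shear ν (a := fun _ => 0) (b := fun y => y) measurable_const
      measurable_id hφm hφm hφ hφ
    simp only [add_zero] at hi
    unfold convForm
    rw [integral_prod_symm _ hi]
    refine integral_congr_ae (Eventually.of_forall fun x => ?_)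
    simp only [hg]
    rw [integral_const_mul]
  have hi2 := integrable_mul_shear (ν.prod ν) (a := Prod.fst) (b := Prod.snd) measurable_fst
    measurable_snd hφm hφm hφ hφ
  have hsq : ∀ x, g x ^ 2 = ∫ w : Euc d × Euc d, φ (x + w.1) * φ (x + w.2) ∂(ν.prod ν) := by
    intro x
    rw [integral_prod_mul (fun y => φ (x + y)) (fun y => φ (x + y)), sq]
  have h2 : ∫ x, g x ^ 2 = convForm (ν ∗ ν) φ := by
    simp_rw [hsq]
    have := integral_prod_symm _ hi2
    simp only at this
    rw [← this, integral_mul_shear (ν.prod ν) measurable_fst φ φ]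
    -- Expanding the square of g produces differences of two independent variables; by symmetry of ν
    -- these have the same law as sums.
    have e : ν ∗ ν = (ν.prod ν).map fun w => w.2 - w.1 := by
      conv_lhs => rw [← hν]
      unfold Measure.conv
      nth_rewrite 2 [hν]
      have : (ν.map Neg.neg).prod ν = (ν.prod ν).map (Prod.map Neg.neg id) := by
        rw [← Measure.map_prod_map _ _ measurable_neg measurable_id, Measure.map_id]
      rw [this, Measure.map_map (by fun_prop) (by fun_prop)]
      congr 1
      ext1 w
      simp [sub_eq_neg_add]
    rw [e, convForm_map _ (by fun_prop) hφm]
  have hg2 : MemLp g 2 volume := by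
    rw [memLp_two_iff_integrable_sq hgm]
    simp_rw [hsq]
    exact hi2.integral_prod_right
  rw [h1, ← h2]
  exact sq_integral_mul_le hφ hg2

/-- Each application of `sq_convForm_le` halves the exponent at the cost of a square root, so
ε^(2^k) at the power 2^k becomes ε for ν itself. -/
lemma convForm_le_of_convForm_pow_le (ν : Measure (Euc d)) [IsFiniteMeasure ν]
    (hν : ν.map Neg.neg = ν) {φ : Euc d → ℝ} (hφm : Measurable φ) (hφ : MemLp φ 2 volume) (k : ℕ)
    {ε : ℝ} (hε : 0 ≤ ε) (h : convForm (convPow ν (2 ^ k)) φ ≤ ε ^ (2 ^ k) * ∫ x, φ x ^ 2) :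
    convForm ν φ ≤ ε * ∫ x, φ x ^ 2 := by
  induction k with
  | zero => simpa [convPow_one] using h
  | succ k ih =>
    apply ih
    have hN : 0 ≤ ∫ x, φ x ^ 2 := integral_nonneg fun x => sq_nonneg _
    have h1 := sq_convForm_le (convPow ν (2 ^ k)) (convPow_map_neg ν hν _) hφm hφ
    rw [← convPow_add, ← two_mul, ← pow_succ'] at h1
    refine le_of_sq_le_sq ?_ (by positivity)
    calc _ ≤ _ := h1
      _ ≤ (∫ x, φ x ^ 2) * (ε ^ 2 ^ (k + 1) * ∫ x, φ x ^ 2) := by gcongr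
      _ = _ := by rw [pow_succ, pow_mul]; ring

end Bilinear

end

section

/-! ### Segment integrals of functions with mean zero on small cells. -/

section Smallness

lemma memLp_one_of_support {B : Set (Euc d)}
    (hBf : volume B ≠ ⊤) {φ : Euc d → ℝ} (hφ : MemLp φ 2 volume) (h0 : ∀ x ∉ B, φ x = 0) :
    Integrable φ volume := by
  have : IsFiniteMeasure (volume.restrict B) := ⟨by simpa using hBf.lt_top⟩
  have h1 : IntegrableOn φ B volume := (hφ.restrict B).integrable (by norm_num)
  exact (integrableOn_iff_integrable_of_support_subset (fun x hx => by_contra fun h => hx (h0 x h))).1 h1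

lemma sq_integral_abs_le {B : Set (Euc d)} (hB : MeasurableSet B)
    (hBf : volume B ≠ ⊤) {φ : Euc d → ℝ} (hφ : MemLp φ 2 volume) (h0 : ∀ x ∉ B, φ x = 0) :
    (∫ x, |φ x|) ^ 2 ≤ volume.real B * ∫ x, φ x ^ 2 := by
  have h1 : MemLp (B.indicator fun _ => (1 : ℝ)) 2 volume :=
    memLp_indicator_const 2 hB 1 (Or.inr hBf)
  have h := sq_integral_mul_le h1 hφ.abs
  have e1 : ∀ x, B.indicator (fun _ => (1 : ℝ)) x * |φ| x = |φ x| := fun x => by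
    by_cases hx : x ∈ B
    · simp [hx]
    · simp [hx, h0 x hx]
  have e2 : ∀ x, B.indicator (fun _ => (1 : ℝ)) x ^ 2 = B.indicator (fun _ => (1 : ℝ)) x := fun x => by
    by_cases hx : x ∈ B <;> simp [hx]
  simp only [e1, e2] at h
  rw [integral_indicator hB] at h
  simpa using h

/-- Replace the density κ of ν by a continuous compactly supported κc. The L¹ error costs at most
ε/2, since the autocorrelation of φ is bounded by ‖φ‖². By uniform continuity κc is nearly constant
on small cells, and φ annihilates functions that are constant on cells. -/
lemma exists_index_convForm_le (ν : Measure (Euc d)) [IsFiniteMeasure ν] (hν : ν ≪ volume)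
    {B : Set (Euc d)} (hB : MeasurableSet B) (hBb : Bornology.IsBounded B) {ε : ℝ} (hε : 0 < ε) :
    ∃ (N : ℕ) (c : Euc d → ℕ), Measurable c ∧ (∀ y, c y ≤ N) ∧
      ∀ φ : Euc d → ℝ, Measurable φ → MemLp φ 2 volume → (∀ x ∉ B, φ x = 0) →
        (∀ i, ∫ x in c ⁻¹' {i}, φ x = 0) → convForm ν φ ≤ ε * ∫ x, φ x ^ 2 := by
  classical
  have hBf : volume B ≠ ⊤ := hBb.measure_lt_top.ne
  set κ : Euc d → ℝ := fun y => (ν.rnDeriv volume y).toReal with hκ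
  have hκi : Integrable κ volume := Measure.integrable_toReal_rnDeriv
  obtain ⟨κc, hcs, hκκ, hcont, hκci⟩ := hκi.exists_hasCompactSupport_integral_sub_le (half_pos hε)
  have huc : UniformContinuous κc := hcs.uniformContinuous_of_continuous hcont
  obtain ⟨Cκ, hCκ⟩ := hcs.exists_bound_of_continuous hcont
  -- The volume of B enters through ‖φ‖₁² ≤ |B| ‖φ‖₂²; adding 1 avoids dividing by zero.
  set η : ℝ := ε / 2 / (volume.real B + 1) with hη
  have hη0 : 0 < η := by positivity
  obtain ⟨δ, hδ, hδκ⟩ := Metric.uniformContinuous_iff.1 huc η hη0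
  obtain ⟨N, c, hc, hcN, hcd⟩ := exists_measurable_index_dist hBb hδ
  refine ⟨N, c, hc, hcN, fun φ hφm hφ h0 hmean => ?_⟩
  have hφ1 := memLp_one_of_support hBf hφ h0
  set M : ℝ := ∫ x, φ x ^ 2 with hM
  have hM0 : 0 ≤ M := integral_nonneg fun x => sq_nonneg _
  set A : Euc d → ℝ := fun y => ∫ x, φ x * φ (x + y) with hA
  have hAm : AEStronglyMeasurable A volume := by
    have : StronglyMeasurable fun w : Euc d × Euc d => φ w.2 * φ (w.2 + w.1) :=
      Measurable.stronglyMeasurable (by fun_prop)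
    exact (this.integral_prod_right' (ν := volume)).aestronglyMeasurable
  have hAM : ∀ y, |A y| ≤ M := by
    intro y
    refine abs_le_of_sq_le_sq ?_ hM0
    have hmp := measurePreserving_add_right (volume : Measure (Euc d)) y
    have h1 := sq_integral_mul_le hφ (hφ.comp_measurePreserving hmp)
    refine h1.trans (le_of_eq ?_)
    have : ∫ x, (φ ∘ fun x => x + y) x ^ 2 = M := integral_add_right_eq_self (fun x => φ x ^ 2) y
    rw [this, sq]
  have hform : convForm ν φ = ∫ y, κ y * A y := by
    have hi := integrable_mul_shear ν (a := fun _ => 0) (b := fun y => y) measurable_const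
      measurable_id hφm hφm hφ hφ
    simp only [add_zero] at hi
    unfold convForm
    rw [integral_prod _ hi]
    exact (integral_rnDeriv_smul hν).symm
  have hint : ∀ {f : Euc d → ℝ}, Integrable f volume → Integrable (fun y => f y * A y) volume :=
    fun hf => hf.mul_bdd hAm (Eventually.of_forall hAM)
  have hsplit : ∫ y, κ y * A y = (∫ y, (κ y - κc y) * A y) + ∫ y, κc y * A y := by
    have hd : Integrable (fun y => (κ y - κc y) * A y) volume := hint (hκi.sub hκci)
    rw [← integral_add hd (hint hκci)]
    refine integral_congr_ae (Eventually.of_forall fun y => ?_)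
    simp only; ring
  have hpart1 : ∫ y, (κ y - κc y) * A y ≤ ε / 2 * M := by
    calc ∫ y, (κ y - κc y) * A y ≤ ∫ y, ‖κ y - κc y‖ * M := by
          refine integral_mono (hint (hκi.sub hκci)) ((hκi.sub hκci).norm.mul_const M) fun y => ?_
          refine (le_abs_self _).trans ?_
          rw [abs_mul]
          exact mul_le_mul_of_nonneg_left (hAM y) (abs_nonneg _)
      _ = (∫ y, ‖κ y - κc y‖) * M := integral_mul_const _ _
      _ ≤ _ := by gcongr
  have hHi : Integrable (fun w : Euc d × Euc d => φ w.1 * φ w.2 * κc (w.2 - w.1))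
      (volume.prod volume) := by
    refine (hφ1.mul_prod hφ1).mul_bdd ?_ (Eventually.of_forall fun w => hCκ _)
    exact (hcont.comp (by fun_prop)).aestronglyMeasurable
  have hpart2 : ∫ y, κc y * A y = ∫ z, φ z * ∫ x, φ x * κc (z - x) := by
    have h1 : Integrable (fun w : Euc d × Euc d => φ w.1 * φ (w.1 + w.2) * κc w.2)
        (volume.prod volume) := by
      have := (measurePreserving_prod_add (volume : Measure (Euc d))
        (volume : Measure (Euc d))).integrable_comp_of_integrable hHi
      refine this.congr (Eventually.of_forall fun w => ?_)
      simp [Function.comp_apply]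
    calc ∫ y, κc y * A y = ∫ y, ∫ x, φ x * φ (x + y) * κc y := by
          refine integral_congr_ae (Eventually.of_forall fun y => ?_)
          simp only [hA]
          rw [integral_mul_const, mul_comm]
      _ = ∫ x, ∫ y, φ x * φ (x + y) * κc y := (integral_integral_swap h1).symm
      _ = ∫ x, ∫ z, φ x * φ z * κc (z - x) := by
          refine integral_congr_ae (Eventually.of_forall fun x => ?_)
          simp only
          rw [← integral_add_left_eq_self (fun z => φ x * φ z * κc (z - x)) x]
          simp
      _ = ∫ z, ∫ x, φ x * φ z * κc (z - x) := integral_integral_swap hHi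
      _ = _ := by
          refine integral_congr_ae (Eventually.of_forall fun z => ?_)
          simp only
          rw [← integral_const_mul]
          congr 1; ext x; ring
  -- A representative in B for each cell that meets B. The value 0 for the other cells is harmless
  -- because φ vanishes off B.
  let rep : ℕ → Euc d := fun i => if h : ∃ x ∈ B, c x = i then h.choose else 0
  have hrep : ∀ x ∈ B, dist x (rep (c x)) < δ := by
    intro x hx
    have h : ∃ y ∈ B, c y = c x := ⟨x, hx, rfl⟩
    simp only [rep, dif_pos h]
    exact hcd _ hx _ h.choose_spec.1 h.choose_spec.2.symm
  have hinner : ∀ z, |∫ x, φ x * κc (z - x)| ≤ η * ∫ x, |φ x| := by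
    intro z
    have h1 := integral_mul_comp_index_eq_zero hφ1 hc hcN hmean fun i => κc (z - rep i)
    have hi1 : Integrable (fun x => φ x * κc (z - x)) volume :=
      hφ1.mul_bdd (hcont.comp (by fun_prop)).aestronglyMeasurable
        (Eventually.of_forall fun x => hCκ _)
    have hi2 : Integrable (fun x => φ x * κc (z - rep (c x))) volume := by
      refine hφ1.mul_bdd ?_ (Eventually.of_forall fun x => hCκ _)
      exact ((measurable_of_countable fun i => κc (z - rep i)).comp hc).aestronglyMeasurable
    have h2 : ∫ x, φ x * κc (z - x) = ∫ x, φ x * (κc (z - x) - κc (z - rep (c x))) := by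
      simp_rw [mul_sub]
      rw [integral_sub hi1 hi2, h1, sub_zero]
    rw [h2, ← integral_const_mul]
    refine (abs_integral_le_integral_abs).trans ?_
    refine integral_mono_of_nonneg (Eventually.of_forall fun x => abs_nonneg _)
      (hφ1.abs.const_mul η) (Eventually.of_forall fun x => ?_)
    simp only
    rw [abs_mul, mul_comm]
    by_cases hx : x ∈ B
    · refine mul_le_mul_of_nonneg_right ?_ (abs_nonneg _)
      refine le_of_lt (hδκ ?_)
      rw [dist_sub_left]
      exact hrep x hx
    · simp [h0 x hx]
  have hpart3 : ∫ z, φ z * ∫ x, φ x * κc (z - x) ≤ ε / 2 * M := by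
    calc ∫ z, φ z * ∫ x, φ x * κc (z - x) ≤ ∫ z, |φ z| * (η * ∫ x, |φ x|) := by
          refine (le_abs_self _).trans ((abs_integral_le_integral_abs).trans ?_)
          refine integral_mono_of_nonneg (Eventually.of_forall fun x => abs_nonneg _)
            (hφ1.abs.mul_const _) (Eventually.of_forall fun z => ?_)
          simp only
          rw [abs_mul]
          exact mul_le_mul_of_nonneg_left (hinner z) (abs_nonneg _)
      _ = η * (∫ x, |φ x|) ^ 2 := by rw [integral_mul_const]; ring
      _ ≤ η * (volume.real B * M) := by
          gcongr
          exact sq_integral_abs_le hB hBf hφ h0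
      _ ≤ ε / 2 * M := by
          rw [← mul_assoc]
          gcongr
          rw [hη, div_mul_eq_mul_div, div_le_iff₀ (by positivity)]
          gcongr
          linarith
  rw [hform, hsplit, hpart2]
  linarith

/-- The integral of `φ` over the segment from `x` to `x + h v`. -/
def segInt (h : ℝ) (φ : Euc d → ℝ) (w : Euc d × Euc d) : ℝ :=
  ∫ s in Ioc 0 h, φ (w.1 + s • w.2)

/-- Expand the square as a double integral over times s and s', then translate x by s v: only the
increment (s' - s)v remains, and its law is `segmentLaw`. -/
lemma integral_sq_segInt (m : Measure (Euc d)) [IsFiniteMeasure m] (h : ℝ)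
    {φ : Euc d → ℝ} (hφm : Measurable φ) (hφ : MemLp φ 2 volume) :
    Integrable (fun w => segInt h φ w ^ 2) (volume.prod m) ∧
      ∫ w, segInt h φ w ^ 2 ∂(volume.prod m) = convForm (segmentLaw m h) φ := by
  set I := (volume : Measure ℝ).restrict (Ioc 0 h) with hI
  have hi := integrable_mul_shear (I.prod (I.prod m)) (a := fun w => w.2.1 • w.2.2)
    (b := fun w => w.1 • w.2.2) (by fun_prop) (by fun_prop) hφm hφm hφ hφ
  have e : ∀ w : Euc d × Euc d, segInt h φ w ^ 2 =
      ∫ s : ℝ × ℝ, φ (w.1 + s.2 • w.2) * φ (w.1 + s.1 • w.2) ∂(I.prod I) := by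
    intro w
    have := integral_prod_mul (μ := I) (ν := I) (fun s => φ (w.1 + s • w.2)) fun s => φ (w.1 + s • w.2)
    rw [segInt, sq, ← hI, ← this]
    exact integral_congr_ae (Eventually.of_forall fun s => mul_comm _ _)
  -- rearrange the variables
  have hmp : MeasurePreserving (fun q : (Euc d × Euc d) × ℝ × ℝ => ((q.2.1, q.2.2, q.1.2), q.1.1))
      ((volume.prod m).prod (I.prod I)) ((I.prod (I.prod m)).prod volume) := by
    have h1 : MeasurePreserving (fun q : (Euc d × Euc d) × ℝ × ℝ => (q.1.1, q.1.2, q.2))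
      ((volume.prod m).prod (I.prod I)) (volume.prod (m.prod (I.prod I))) :=
      measurePreserving_prodAssoc _ _ _
    have h2 : MeasurePreserving (fun q : Euc d × Euc d × ℝ × ℝ => (q.2, q.1))
      (volume.prod (m.prod (I.prod I))) ((m.prod (I.prod I)).prod volume) :=
      Measure.measurePreserving_swap
    have h3 : MeasurePreserving (fun q : (Euc d × ℝ × ℝ) × Euc d => (((q.1.2, q.1.1), q.2)))
      ((m.prod (I.prod I)).prod volume) (((I.prod I).prod m).prod volume) :=
      Measure.measurePreserving_swap.prod (MeasurePreserving.id _)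
    have h4 : MeasurePreserving (fun q : ((ℝ × ℝ) × Euc d) × Euc d =>
        ((q.1.1.1, q.1.1.2, q.1.2), q.2))
      (((I.prod I).prod m).prod volume) ((I.prod (I.prod m)).prod volume) :=
      (measurePreserving_prodAssoc I I m).prod (MeasurePreserving.id _)
    exact h4.comp (h3.comp (h2.comp h1))
  have he : MeasurableEmbedding
      (fun q : (Euc d × Euc d) × ℝ × ℝ => ((q.2.1, q.2.2, q.1.2), q.1.1)) :=
    MeasurableEquiv.measurableEmbedding
      { toFun := fun q : (Euc d × Euc d) × ℝ × ℝ => ((q.2.1, q.2.2, q.1.2), q.1.1)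
        invFun := fun q : (ℝ × ℝ × Euc d) × Euc d => ((q.2, q.1.2.2), q.1.1, q.1.2.1)
        left_inv := fun q => rfl
        right_inv := fun q => rfl
        measurable_toFun := (by fun_prop : Measurable fun q : (Euc d × Euc d) × ℝ × ℝ =>
          ((q.2.1, q.2.2, q.1.2), q.1.1))
        measurable_invFun := (by fun_prop : Measurable fun q : (ℝ × ℝ × Euc d) × Euc d =>
          ((q.2, q.1.2.2), q.1.1, q.1.2.1)) }
  have hi2 := hmp.integrable_comp_of_integrable hi
  have hsq : (fun w => segInt h φ w ^ 2) = fun w : Euc d × Euc d => ∫ s : ℝ × ℝ,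
      φ (w.1 + s.2 • w.2) * φ (w.1 + s.1 • w.2) ∂(I.prod I) := funext e
  rw [hsq]
  refine ⟨hi2.integral_prod_left, ?_⟩
  have h5 := integral_prod _ hi2
  simp only [Function.comp_apply] at h5
  rw [← h5]
  unfold segmentLaw
  rw [convForm_map _ (by fun_prop) hφm, ← hI]
  have h6 := hmp.integral_comp he fun w => φ (w.2 + w.1.2.1 • w.1.2.2) * φ (w.2 + w.1.1 • w.1.2.2)
  simp only at h6
  have h7 := integral_mul_shear (I.prod (I.prod m)) (a := fun w => w.2.1 • w.2.2)
    (b := fun w => w.1 • w.2.2) (by fun_prop) φ φ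
  rw [h6, h7]
  simp_rw [← sub_smul]

/-- Segment integrals of functions with vanishing averages on the cells of a fine partition are
small. -/
theorem exists_index_segInt_le (hd : 1 ≤ d) (m : Measure (Euc d)) [IsFiniteMeasure m]
    (hm : ∀ e : Euc d, e ≠ 0 → m {v | ⟪v, e⟫ = 0} = 0) (h : ℝ) {B : Set (Euc d)}
    (hB : MeasurableSet B) (hBb : Bornology.IsBounded B) {ε : ℝ} (hε : 0 < ε) :
    ∃ (N : ℕ) (c : Euc d → ℕ), Measurable c ∧ (∀ y, c y ≤ N) ∧
      ∀ φ : Euc d → ℝ, Measurable φ → MemLp φ 2 volume → (∀ x ∉ B, φ x = 0) →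
        (∀ i, ∫ x in c ⁻¹' {i}, φ x = 0) →
        ∫ w, segInt h φ w ^ 2 ∂(volume.prod m) ≤ ε * ∫ x, φ x ^ 2 := by
  obtain ⟨k, hk⟩ := exists_convPow_absolutelyContinuous hd m hm h
  -- Precision ε^(2^k) at the absolutely continuous power is what k square roots turn into ε.
  obtain ⟨N, c, hc, hcN, H⟩ := exists_index_convForm_le _ hk hB hBb (pow_pos hε (2 ^ k))
  refine ⟨N, c, hc, hcN, fun φ hφm hφ h0 hmean => ?_⟩
  rw [(integral_sq_segInt m h hφm hφ).2]
  exact convForm_le_of_convForm_pow_le _ (segmentLaw_map_neg m h) hφm hφ k hε.le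
    (H φ hφm hφ h0 hmean)

end Smallness

end

section

lemma eLpNorm_le_of_lintegral_rpow_le {α β : Type*} [MeasurableSpace α] [MeasurableSpace β]
    {μ : Measure α} {ν : Measure β} {p : ℝ≥0∞} (hp0 : p ≠ 0) (hp : p ≠ ⊤) {δ : ℝ}
    (hδ : 0 ≤ δ) {f : α → ℝ} {g : β → ℝ}
    (h : ∫⁻ y, ‖g y‖ₑ ^ p.toReal ∂ν ≤ ENNReal.ofReal δ * ∫⁻ x, ‖f x‖ₑ ^ p.toReal ∂μ) :
    eLpNorm g p ν ≤ ENNReal.ofReal (δ ^ (1 / p.toReal)) * eLpNorm f p μ := by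
  rw [eLpNorm_eq_lintegral_rpow_enorm_toReal hp0 hp, eLpNorm_eq_lintegral_rpow_enorm_toReal hp0 hp,
    ← ENNReal.ofReal_rpow_of_nonneg hδ (by positivity),
    ← ENNReal.mul_rpow_of_nonneg _ _ (by positivity)]
  exact ENNReal.rpow_le_rpow h (by positivity)

lemma enorm_rpow_eq_ofReal (a : ℝ) {q : ℝ} (hq : 0 ≤ q) : ‖a‖ₑ ^ q = ENNReal.ofReal (|a| ^ q) := by
  rw [Real.enorm_eq_ofReal_abs, ENNReal.ofReal_rpow_of_nonneg (abs_nonneg _) hq]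

/-! ### Averages over the cells of a finite partition. -/

section CellAverage

variable {α : Type*} [MeasurableSpace α]

/-- The average of `g` over the cell `c = c x` containing `x`. -/
def cellAvg (ν : Measure α) (c : α → ℕ) (g : α → ℝ) (x : α) : ℝ :=
  -- On a cell of measure zero the inverse is 0, and so is the average.
  (ν.real (c ⁻¹' {c x}))⁻¹ * ∫ y in c ⁻¹' {c x}, g y ∂ν

variable {ν : Measure α} [IsFiniteMeasure ν] {c : α → ℕ} {N : ℕ}

lemma measurable_cellAvg (hc : Measurable c) (g : α → ℝ) : Measurable (cellAvg ν c g) :=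
  (measurable_of_countable fun i => (ν.real (c ⁻¹' {i}))⁻¹ * ∫ y in c ⁻¹' {i}, g y ∂ν).comp hc

lemma abs_cellAvg_le {g : α → ℝ} {b : ℝ} (hb : 0 ≤ b) (h : ∀ x, |g x| ≤ b) (x : α) :
    |cellAvg ν c g x| ≤ b := by
  unfold cellAvg
  rw [abs_mul, abs_inv, abs_of_nonneg measureReal_nonneg]
  have h1 : |∫ y in c ⁻¹' {c x}, g y ∂ν| ≤ b * ν.real (c ⁻¹' {c x}) :=
    norm_setIntegral_le_of_norm_le_const (f := g) (measure_lt_top _ _) fun y _ => h y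
  rcases (measureReal_nonneg (μ := ν) (s := c ⁻¹' {c x})).eq_or_lt with h0 | h0
  · rw [← h0]; simpa using hb
  · rw [inv_mul_le_iff₀ h0, mul_comm]; exact h1

/-- The constant depends on the partition, so the bound serves only qualitative purposes:
integrability, and continuity of the averaging operator. -/
lemma exists_abs_cellAvg_le (hcN : ∀ x, c x ≤ N) : ∃ A, 0 ≤ A ∧ ∀ g : α → ℝ, Integrable g ν →
    ∀ x, |cellAvg ν c g x| ≤ A * ∫ y, |g y| ∂ν := by
  refine ⟨∑ i ∈ Finset.range (N + 1), (ν.real (c ⁻¹' {i}))⁻¹,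
    Finset.sum_nonneg fun i _ => inv_nonneg.2 measureReal_nonneg, fun g hg x => ?_⟩
  unfold cellAvg
  rw [abs_mul, abs_inv, abs_of_nonneg measureReal_nonneg]
  gcongr
  · exact Finset.single_le_sum (f := fun i => (ν.real (c ⁻¹' {i}))⁻¹)
      (fun i _ => inv_nonneg.2 measureReal_nonneg) (Finset.mem_range.2 (Nat.lt_succ_of_le (hcN x)))
  · exact abs_integral_le_integral_abs.trans
      (setIntegral_le_integral hg.abs (Eventually.of_forall fun _ => abs_nonneg _))

lemma cellAvg_add {f g : α → ℝ} (hf : Integrable f ν) (hg : Integrable g ν) (x : α) :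
    cellAvg ν c (fun y => f y + g y) x = cellAvg ν c f x + cellAvg ν c g x := by
  unfold cellAvg
  rw [integral_add hf.integrableOn hg.integrableOn, mul_add]

lemma cellAvg_const_mul (a : ℝ) (g : α → ℝ) (x : α) :
    cellAvg ν c (fun y => a * g y) x = a * cellAvg ν c g x := by
  unfold cellAvg
  rw [integral_const_mul]; ring

lemma cellAvg_congr {f g : α → ℝ} (h : f =ᵐ[ν] g) : cellAvg ν c f = cellAvg ν c g := by
  ext x
  unfold cellAvg
  rw [integral_congr_ae (ae_restrict_of_ae h)]

lemma integrable_cellAvg (hc : Measurable c) (hcN : ∀ x, c x ≤ N) {g : α → ℝ}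
    (hg : Integrable g ν) : Integrable (cellAvg ν c g) ν := by
  obtain ⟨A, -, hA⟩ := exists_abs_cellAvg_le (ν := ν) hcN
  exact Integrable.of_bound (measurable_cellAvg hc g).aestronglyMeasurable _
    (Eventually.of_forall (hA g hg))

lemma setIntegral_cellAvg (hc : Measurable c) (g : α → ℝ) (i : ℕ) :
    ∫ x in c ⁻¹' {i}, cellAvg ν c g x ∂ν = ∫ x in c ⁻¹' {i}, g x ∂ν := by
  have hm : MeasurableSet (c ⁻¹' {i}) := hc (measurableSet_singleton i)
  have h1 : ∀ x ∈ c ⁻¹' {i}, cellAvg ν c g x =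
      (ν.real (c ⁻¹' {i}))⁻¹ * ∫ y in c ⁻¹' {i}, g y ∂ν := by
    intro x hx
    have : c x = i := hx
    unfold cellAvg; rw [this]
  rw [setIntegral_congr_fun hm h1, setIntegral_const, smul_eq_mul, ← mul_assoc]
  by_cases h0 : ν.real (c ⁻¹' {i}) = 0
  · have : ν.restrict (c ⁻¹' {i}) = 0 := by
      rw [Measure.restrict_eq_zero]
      exact (measureReal_eq_zero_iff).1 h0
    simp [this]
  · rw [mul_inv_cancel₀ h0, one_mul]

lemma setIntegral_sub_cellAvg (hc : Measurable c) (hcN : ∀ x, c x ≤ N) {g : α → ℝ}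
    (hg : Integrable g ν) (i : ℕ) : ∫ x in c ⁻¹' {i}, (g x - cellAvg ν c g x) ∂ν = 0 := by
  rw [integral_sub hg.integrableOn (integrable_cellAvg hc hcN hg).integrableOn,
    setIntegral_cellAvg hc, sub_self]

lemma integral_abs_cellAvg_le (hc : Measurable c) (hcN : ∀ x, c x ≤ N) {g : α → ℝ}
    (hg : Integrable g ν) : ∫ x, |cellAvg ν c g x| ∂ν ≤ ∫ x, |g x| ∂ν := by
  have h1 : ∀ x, |cellAvg ν c g x| ≤ cellAvg ν c (fun y => |g y|) x := by
    intro x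
    unfold cellAvg
    rw [abs_mul, abs_inv, abs_of_nonneg measureReal_nonneg]
    gcongr
    exact abs_integral_le_integral_abs
  refine (integral_mono (integrable_cellAvg hc hcN hg).abs
    (integrable_cellAvg hc hcN hg.abs) h1).trans (le_of_eq ?_)
  have h2 := integral_mul_comp_index_eq_zero (hg.abs.sub (integrable_cellAvg hc hcN hg.abs)) hc hcN
    (setIntegral_sub_cellAvg hc hcN hg.abs) fun _ => 1
  simp only [mul_one, Pi.sub_apply] at h2
  rw [integral_sub hg.abs (integrable_cellAvg hc hcN hg.abs)] at h2
  linarith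

/-- The difference has mean zero on each cell, hence is orthogonal to the cell average, which is
constant on cells. -/
lemma integral_sq_sub_cellAvg (hc : Measurable c) (hcN : ∀ x, c x ≤ N) {g : α → ℝ}
    (hg : MemLp g 2 ν) : MemLp (fun x => g x - cellAvg ν c g x) 2 ν ∧
      ∫ x, (g x - cellAvg ν c g x) ^ 2 ∂ν = ∫ x, (g x - cellAvg ν c g x) * g x ∂ν := by
  have hgi : Integrable g ν := hg.integrable (by norm_num)
  obtain ⟨A, -, hA⟩ := exists_abs_cellAvg_le (ν := ν) hcN
  have hcm : MemLp (cellAvg ν c g) 2 ν := MemLp.of_bound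
    (measurable_cellAvg hc g).aestronglyMeasurable _ (Eventually.of_forall (hA g hgi))
  have hs : MemLp (fun x => g x - cellAvg ν c g x) 2 ν := hg.sub hcm
  refine ⟨hs, ?_⟩
  have h2 := integral_mul_comp_index_eq_zero (hgi.sub (integrable_cellAvg hc hcN hgi)) hc hcN
    (setIntegral_sub_cellAvg hc hcN hgi)
    fun i => (ν.real (c ⁻¹' {i}))⁻¹ * ∫ y in c ⁻¹' {i}, g y ∂ν
  have h3 : ∫ x, (g x - cellAvg ν c g x) * cellAvg ν c g x ∂ν = 0 := h2
  have e : ∀ x, (g x - cellAvg ν c g x) ^ 2 =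
      (g x - cellAvg ν c g x) * g x - (g x - cellAvg ν c g x) * cellAvg ν c g x := fun x => by ring
  simp_rw [e]
  have i1 : Integrable (fun x => (g x - cellAvg ν c g x) * g x) ν := hs.integrable_mul hg
  have i2 : Integrable (fun x => (g x - cellAvg ν c g x) * cellAvg ν c g x) ν :=
    hs.integrable_mul hcm
  rw [integral_sub i1 i2, h3, sub_zero]

end CellAverage

/-! ### Averages over velocities and short segments. -/

section LineAverage

/-- The integral of `F` over the segments `(x - s v, v)`, `0 < s ≤ h`, and over the velocities. -/
def lineAvg (m : Measure (Euc d)) (h : ℝ) (F : Euc d × Euc d → ℝ) (x : Euc d) : ℝ :=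
  ∫ ω : Euc d × ℝ, F (x - ω.2 • ω.1, ω.1) ∂(m.prod (volume.restrict (Ioc 0 h)))

variable (m : Measure (Euc d)) [IsFiniteMeasure m] (h : ℝ)

/-- The change of variables `(x, (v, s)) ↦ ((x - s v, v), s)`. -/
def lineEquiv : (Euc d × Euc d × ℝ) ≃ᵐ (Euc d × Euc d) × ℝ where
  toFun w := ((w.1 - w.2.2 • w.2.1, w.2.1), w.2.2)
  invFun q := (q.1.1 + q.2 • q.1.2, q.1.2, q.2)
  left_inv w := by simp
  right_inv q := by simp
  measurable_toFun := (by fun_prop : Measurable fun w : Euc d × Euc d × ℝ =>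
    ((w.1 - w.2.2 • w.2.1, w.2.1), w.2.2))
  measurable_invFun := (by fun_prop : Measurable fun q : (Euc d × Euc d) × ℝ =>
    (q.1.1 + q.2 • q.1.2, q.1.2, q.2))

lemma measurePreserving_lineEquiv (I : Measure ℝ) [IsFiniteMeasure I] :
    MeasurePreserving (lineEquiv (d := d)) (volume.prod (m.prod I)) ((volume.prod m).prod I) := by
  have h1 : MeasurePreserving (Prod.swap : Euc d × Euc d × ℝ → _)
      (volume.prod (m.prod I)) ((m.prod I).prod volume) := Measure.measurePreserving_swap
  have h2 := measurePreserving_shear (m.prod I) (a := fun ω => -(ω.2 • ω.1)) (by fun_prop)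
  have h3 : MeasurePreserving (Prod.swap : (Euc d × ℝ) × Euc d → _)
      ((m.prod I).prod volume) (volume.prod (m.prod I)) := Measure.measurePreserving_swap
  have h4 : MeasurePreserving (fun w : Euc d × Euc d × ℝ => ((w.1, w.2.1), w.2.2))
      (volume.prod (m.prod I)) ((volume.prod m).prod I) :=
    (measurePreserving_prodAssoc volume m I).symm (e := MeasurableEquiv.prodAssoc)
  have := h4.comp (h3.comp (h2.comp h1))
  convert this using 1
  ext w <;> simp [lineEquiv, sub_eq_add_neg]

variable {m} {h}

lemma integrable_comp_lineEquiv {F : Euc d × Euc d → ℝ} (hF : Integrable F (volume.prod m)) :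
    Integrable (fun w : Euc d × Euc d × ℝ => F (w.1 - w.2.2 • w.2.1, w.2.1))
      (volume.prod (m.prod (volume.restrict (Ioc 0 h)))) := by
  have h1 : Integrable (fun q : (Euc d × Euc d) × ℝ => F q.1)
    ((volume.prod m).prod (volume.restrict (Ioc 0 h))) := hF.comp_fst _
  exact (measurePreserving_lineEquiv m (volume.restrict (Ioc 0 h))).integrable_comp_of_integrable h1

lemma integral_comp_lineEquiv (G : (Euc d × Euc d) × ℝ → ℝ) :
    ∫ w : Euc d × Euc d × ℝ, G ((w.1 - w.2.2 • w.2.1, w.2.1), w.2.2)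
        ∂(volume.prod (m.prod (volume.restrict (Ioc 0 h)))) =
      ∫ q, G q ∂((volume.prod m).prod (volume.restrict (Ioc 0 h))) :=
  (measurePreserving_lineEquiv m (volume.restrict (Ioc 0 h))).integral_comp
    lineEquiv.measurableEmbedding G

lemma integrable_lineAvg {F : Euc d × Euc d → ℝ} (hF : Integrable F (volume.prod m)) :
    Integrable (lineAvg m h F) volume :=
  (integrable_comp_lineEquiv (h := h) hF).integral_prod_left

lemma integral_abs_lineAvg_le (hh : 0 ≤ h) {F : Euc d × Euc d → ℝ}
    (hF : Integrable F (volume.prod m)) :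
    ∫ x, |lineAvg m h F x| ≤ h * ∫ z, |F z| ∂(volume.prod m) := by
  have hi := integrable_comp_lineEquiv (h := h) hF.abs
  calc ∫ x, |lineAvg m h F x| ≤ ∫ x, lineAvg m h (fun z => |F z|) x :=
        integral_mono (integrable_lineAvg hF).abs (integrable_lineAvg hF.abs)
          fun x => abs_integral_le_integral_abs
    _ = ∫ w : Euc d × Euc d × ℝ, |F (w.1 - w.2.2 • w.2.1, w.2.1)|
        ∂(volume.prod (m.prod (volume.restrict (Ioc 0 h)))) := (integral_prod _ hi).symm
    _ = ∫ q : (Euc d × Euc d) × ℝ, |F q.1| ∂((volume.prod m).prod (volume.restrict (Ioc 0 h))) :=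
        integral_comp_lineEquiv fun q => |F q.1|
    _ = _ := by
      rw [integral_fun_fst (f := fun z => |F z|)]
      simp [hh]

lemma abs_lineAvg_le (hh : 0 ≤ h) {F : Euc d × Euc d → ℝ} {b : ℝ}
    (hb : ∀ z, |F z| ≤ b) (x : Euc d) : |lineAvg m h F x| ≤ h * m.real univ * b := by
  have := norm_integral_le_of_norm_le_const
    (μ := m.prod (volume.restrict (Ioc 0 h))) (f := fun ω : Euc d × ℝ => F (x - ω.2 • ω.1, ω.1))
    (Eventually.of_forall fun ω => hb _)
  refine this.trans (le_of_eq ?_)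
  rw [← univ_prod_univ, measureReal_prod_prod]
  simp [hh]; ring

lemma lineAvg_add {F G : Euc d × Euc d → ℝ} (hF : Integrable F (volume.prod m))
    (hG : Integrable G (volume.prod m)) :
    lineAvg m h (fun z => F z + G z) =ᵐ[volume] fun x => lineAvg m h F x + lineAvg m h G x := by
  filter_upwards [(integrable_comp_lineEquiv (h := h) hF).prod_right_ae,
    (integrable_comp_lineEquiv (h := h) hG).prod_right_ae] with x h1 h2
  exact integral_add h1 h2

lemma lineAvg_congr {F G : Euc d × Euc d → ℝ} (hFG : F =ᵐ[volume.prod m] G) :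
    lineAvg m h F =ᵐ[volume] lineAvg m h G := by
  have h1 : ∀ᵐ q ∂((volume.prod m).prod (volume.restrict (Ioc 0 h))), F q.1 = G q.1 :=
    Measure.quasiMeasurePreserving_fst.ae hFG
  have h2 := (measurePreserving_lineEquiv m (volume.restrict (Ioc 0 h))).quasiMeasurePreserving.ae h1
  filter_upwards [Measure.ae_ae_of_ae_prod h2] with x hx
  exact integral_congr_ae hx

lemma lineAvg_const_mul (a : ℝ) (F : Euc d × Euc d → ℝ) (x : Euc d) :
    lineAvg m h (fun z => a * F z) x = a * lineAvg m h F x := integral_const_mul _ _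

lemma measurable_lineAvg {F : Euc d × Euc d → ℝ} (hF : Measurable F) :
    Measurable (lineAvg m h F) := by
  have : StronglyMeasurable fun w : Euc d × Euc d × ℝ => F (w.1 - w.2.2 • w.2.1, w.2.1) :=
    Measurable.stronglyMeasurable (by fun_prop)
  exact this.integral_prod_right'.measurable

lemma memLp_comp_lineEquiv {F : Euc d × Euc d → ℝ} (hF : MemLp F 2 (volume.prod m)) :
    MemLp (fun w : Euc d × Euc d × ℝ => F (w.1 - w.2.2 • w.2.1, w.2.1)) 2
      (volume.prod (m.prod (volume.restrict (Ioc 0 h)))) := by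
  have h1 : MemLp (fun q : (Euc d × Euc d) × ℝ => F q.1) 2
    ((volume.prod m).prod (volume.restrict (Ioc 0 h))) := hF.comp_fst _
  exact h1.comp_measurePreserving (measurePreserving_lineEquiv m (volume.restrict (Ioc 0 h)))

lemma memLp_lineAvg {F : Euc d × Euc d → ℝ} (hFm : Measurable F)
    (hF : MemLp F 2 (volume.prod m)) : MemLp (lineAvg m h F) 2 volume := by
  have hi := (memLp_comp_lineEquiv (h := h) hF)
  rw [memLp_two_iff_integrable_sq (measurable_lineAvg hFm).aestronglyMeasurable]
  have hi2 := hi.integrable_sq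
  refine (hi2.integral_prod_left.const_mul
    ((m.prod (volume.restrict (Ioc 0 h))).real univ)).mono'
    ((measurable_lineAvg hFm).pow_const 2).aestronglyMeasurable ?_
  filter_upwards [hi2.prod_right_ae] with x hx
  have hx2 : MemLp (fun ω : Euc d × ℝ => F (x - ω.2 • ω.1, ω.1)) 2
      (m.prod (volume.restrict (Ioc 0 h))) :=
    (memLp_two_iff_integrable_sq (hFm.comp (by fun_prop)).aestronglyMeasurable).2 hx
  have h1 : MemLp (fun _ : Euc d × ℝ => (1 : ℝ)) 2 (m.prod (volume.restrict (Ioc 0 h))) :=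
    memLp_const 1
  have := sq_integral_mul_le h1 hx2
  simp only [one_mul, one_pow, integral_const, smul_eq_mul, mul_one] at this
  rw [Real.norm_eq_abs, abs_of_nonneg (sq_nonneg _)]
  exact this

/-- The change of variables `lineEquiv` shows that averaging along lines is the adjoint of taking
segment integrals; through this duality the smallness of `segInt` passes to `lineAvg`. -/
lemma integral_mul_lineAvg {F : Euc d × Euc d → ℝ} (hF : MemLp F 2 (volume.prod m))
    {φ : Euc d → ℝ} (hφ : MemLp φ 2 volume) :
    ∫ x, φ x * lineAvg m h F x = ∫ z, F z * segInt h φ z ∂(volume.prod m) := by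
  have h1 : MemLp (fun w : Euc d × Euc d × ℝ => φ w.1) 2
      (volume.prod (m.prod (volume.restrict (Ioc 0 h)))) := hφ.comp_fst _
  have hi := h1.integrable_mul (memLp_comp_lineEquiv (h := h) hF)
  have hi' : Integrable (fun w : Euc d × Euc d × ℝ => φ w.1 * F (w.1 - w.2.2 • w.2.1, w.2.1))
      (volume.prod (m.prod (volume.restrict (Ioc 0 h)))) := hi
  have hmp := measurePreserving_lineEquiv m (volume.restrict (Ioc 0 h))
  have hi2 : Integrable (fun q : (Euc d × Euc d) × ℝ => F q.1 * φ (q.1.1 + q.2 • q.1.2))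
      ((volume.prod m).prod (volume.restrict (Ioc 0 h))) := by
    refine (hmp.integrable_comp_emb lineEquiv.measurableEmbedding).1
      (hi'.congr (Eventually.of_forall fun w => ?_))
    simp [lineEquiv, mul_comm]
  calc ∫ x, φ x * lineAvg m h F x
      = ∫ x, ∫ ω : Euc d × ℝ, φ x * F (x - ω.2 • ω.1, ω.1)
          ∂(m.prod (volume.restrict (Ioc 0 h))) := by
        refine integral_congr_ae (Eventually.of_forall fun x => ?_)
        exact (integral_const_mul _ _).symm
    _ = ∫ w : Euc d × Euc d × ℝ, φ w.1 * F (w.1 - w.2.2 • w.2.1, w.2.1)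
        ∂(volume.prod (m.prod (volume.restrict (Ioc 0 h)))) := (integral_prod _ hi').symm
    _ = ∫ q : (Euc d × Euc d) × ℝ, F q.1 * φ (q.1.1 + q.2 • q.1.2)
        ∂((volume.prod m).prod (volume.restrict (Ioc 0 h))) := by
        rw [← integral_comp_lineEquiv]
        refine integral_congr_ae (Eventually.of_forall fun w => ?_)
        simp [mul_comm]
    _ = _ := by
        rw [integral_prod _ hi2]
        refine integral_congr_ae (Eventually.of_forall fun z => ?_)
        exact integral_const_mul (F z) fun s : ℝ => φ (z.1 + s • z.2)

end LineAverage

end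

section

/-! ### Velocity averages over short segments are limits of finite rank operators. -/

section Averaging

/-- The extension by zero of a function on `X × V`. -/
def extendZero (X : Set (Euc d)) (f : Euc d × Euc d → ℝ) : Euc d × Euc d → ℝ :=
  (X ×ˢ univ).indicator f

variable {X : Set (Euc d)} {m : Measure (Euc d)} [IsFiniteMeasure m] {h : ℝ}

lemma phaseMeasure_eq (X : Set (Euc d)) (m : Measure (Euc d)) [IsFiniteMeasure m] :
    phaseMeasure X m = ((volume : Measure (Euc d)).prod m).restrict (X ×ˢ univ) := by
  rw [phaseMeasure, ← Measure.prod_restrict, Measure.restrict_univ]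

lemma measurable_extendZero (hX : MeasurableSet X) {f : Euc d × Euc d → ℝ} (hf : Measurable f) :
    Measurable (extendZero X f) := hf.indicator (hX.prod MeasurableSet.univ)

lemma integrable_extendZero (hX : MeasurableSet X) {f : Euc d × Euc d → ℝ}
    (hf : Integrable f (phaseMeasure X m)) : Integrable (extendZero X f) (volume.prod m) := by
  rw [extendZero, integrable_indicator_iff (hX.prod MeasurableSet.univ), IntegrableOn,
    ← phaseMeasure_eq]
  exact hf

lemma integral_abs_extendZero (hX : MeasurableSet X) (f : Euc d × Euc d → ℝ) :
    ∫ z, |extendZero X f z| ∂(volume.prod m) = ∫ z, |f z| ∂(phaseMeasure X m) := by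
  rw [phaseMeasure_eq, ← integral_indicator (hX.prod MeasurableSet.univ)]
  congr 1; ext z
  by_cases hz : z ∈ X ×ˢ (univ : Set (Euc d)) <;> simp [extendZero, hz]

lemma extendZero_congr (hX : MeasurableSet X) {f g : Euc d × Euc d → ℝ}
    (hfg : f =ᵐ[phaseMeasure X m] g) : extendZero X f =ᵐ[volume.prod m] extendZero X g := by
  rw [phaseMeasure_eq] at hfg
  filter_upwards [(ae_restrict_iff' (hX.prod MeasurableSet.univ)).1 hfg] with z hz
  by_cases hzX : z ∈ X ×ˢ (univ : Set (Euc d))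
  · simp only [extendZero, indicator_of_mem hzX, hz hzX]
  · simp only [extendZero, indicator_of_notMem hzX]

/-- The integral of `f` over the part in `X` of the segments `(x - s v, v)`, `0 < s ≤ h`, and over
the velocities. -/
def velocityAvg (X : Set (Euc d)) (m : Measure (Euc d)) (h : ℝ) (f : Euc d × Euc d → ℝ) :
    Euc d → ℝ := lineAvg m h (extendZero X f)

lemma velocityAvg_add (hX : MeasurableSet X) {f g : Euc d × Euc d → ℝ}
    (hf : Integrable f (phaseMeasure X m)) (hg : Integrable g (phaseMeasure X m)) :
    velocityAvg X m h (fun z => f z + g z) =ᵐ[volume.restrict X]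
      fun x => velocityAvg X m h f x + velocityAvg X m h g x := by
  have e : extendZero X (fun z => f z + g z) = fun z => extendZero X f z + extendZero X g z := by
    ext z
    by_cases hz : z ∈ X ×ˢ (univ : Set (Euc d)) <;> simp [extendZero, hz]
  unfold velocityAvg
  rw [e]
  exact ae_restrict_of_ae (lineAvg_add (integrable_extendZero hX hf) (integrable_extendZero hX hg))

lemma velocityAvg_congr (hX : MeasurableSet X) {f g : Euc d × Euc d → ℝ}
    (hfg : f =ᵐ[phaseMeasure X m] g) :
    velocityAvg X m h f =ᵐ[volume.restrict X] velocityAvg X m h g :=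
  ae_restrict_of_ae (lineAvg_congr (extendZero_congr hX hfg))

lemma velocityAvg_const_mul (a : ℝ) (f : Euc d × Euc d → ℝ) (x : Euc d) :
    velocityAvg X m h (fun z => a * f z) x = a * velocityAvg X m h f x := by
  have e : extendZero X (fun z => a * f z) = fun z => a * extendZero X f z := by
    ext z
    by_cases hz : z ∈ X ×ˢ (univ : Set (Euc d)) <;> simp [extendZero, hz]
  unfold velocityAvg
  rw [e, lineAvg_const_mul]

lemma measurable_velocityAvg (hX : MeasurableSet X) {f : Euc d × Euc d → ℝ} (hf : Measurable f) :
    Measurable (velocityAvg X m h f) := measurable_lineAvg (measurable_extendZero hX hf)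

lemma integrable_velocityAvg (hX : MeasurableSet X) {f : Euc d × Euc d → ℝ}
    (hf : Integrable f (phaseMeasure X m)) :
    Integrable (velocityAvg X m h f) (volume.restrict X) :=
  (integrable_lineAvg (integrable_extendZero hX hf)).restrict

lemma integral_abs_velocityAvg_le (hX : MeasurableSet X) (hh : 0 ≤ h) {f : Euc d × Euc d → ℝ}
    (hf : Integrable f (phaseMeasure X m)) :
    ∫ x in X, |velocityAvg X m h f x| ≤ h * ∫ z, |f z| ∂(phaseMeasure X m) := by
  rw [← integral_abs_extendZero hX]
  exact (setIntegral_le_integral (integrable_lineAvg (integrable_extendZero hX hf)).abs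
    (Eventually.of_forall fun _ => abs_nonneg _)).trans
    (integral_abs_lineAvg_le hh (integrable_extendZero hX hf))

/-- The difference between the velocity average and its averages on the cells `c = i`. -/
def velocityAvgOsc (X : Set (Euc d)) (m : Measure (Euc d)) (h : ℝ) (c : Euc d → ℕ)
    (f : Euc d × Euc d → ℝ) (x : Euc d) : ℝ :=
  velocityAvg X m h f x - cellAvg (volume.restrict X) c (velocityAvg X m h f) x

/-- Let φ be the oscillation, extended by zero. Orthogonality and duality give ‖φ‖² = ⟨φ, velocity
average of f⟩ = ⟨segment integral of φ, f⟩. As φ has mean zero on cells, `H` bounds the right side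
by ε^(1/2) ‖φ‖ ‖f‖, and one factor ‖φ‖ cancels. -/
lemma integral_sq_velocityAvgOsc_le (hX : MeasurableSet X) [IsFiniteMeasure (volume.restrict X)]
    {c : Euc d → ℕ} (hc : Measurable c) {N : ℕ} (hcN : ∀ x, c x ≤ N) {ε : ℝ} (hε : 0 < ε)
    (H : ∀ φ : Euc d → ℝ, Measurable φ → MemLp φ 2 volume → (∀ x ∉ X, φ x = 0) →
        (∀ i, ∫ x in c ⁻¹' {i}, φ x = 0) →
        ∫ w, segInt h φ w ^ 2 ∂(volume.prod m) ≤ ε * ∫ x, φ x ^ 2)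
    {f : Euc d × Euc d → ℝ} (hf : Measurable f) (hf2 : MemLp f 2 (phaseMeasure X m)) :
    Integrable (fun x => velocityAvgOsc X m h c f x ^ 2) (volume.restrict X) ∧
    ∫ x in X, velocityAvgOsc X m h c f x ^ 2 ≤ ε * ∫ z, f z ^ 2 ∂(phaseMeasure X m) := by
  have hext : MemLp (extendZero X f) 2 (volume.prod m) := by
    rw [extendZero, memLp_indicator_iff_restrict (hX.prod MeasurableSet.univ), ← phaseMeasure_eq]
    exact hf2
  have hA : MemLp (velocityAvg X m h f) 2 volume := memLp_lineAvg (measurable_extendZero hX hf) hext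
  obtain ⟨hS, hSsq⟩ := integral_sq_sub_cellAvg hc hcN (hA.restrict X)
  have hSm : Measurable (velocityAvgOsc X m h c f) :=
    (measurable_velocityAvg hX hf).sub (measurable_cellAvg hc _)
  refine ⟨hS.integrable_sq, ?_⟩
  set φ := X.indicator (velocityAvgOsc X m h c f) with hφ
  have hφm : Measurable φ := hSm.indicator hX
  have hφ2 : MemLp φ 2 volume := (memLp_indicator_iff_restrict hX).2 hS
  have hφ0 : ∀ x ∉ X, φ x = 0 := fun x hx => indicator_of_notMem hx _
  have hmean : ∀ i, ∫ x in c ⁻¹' {i}, φ x = 0 := by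
    intro i
    have h1 := setIntegral_sub_cellAvg hc hcN
      ((hA.restrict X).integrable (by norm_num) : Integrable (velocityAvg X m h f)
        (volume.restrict X)) i
    rw [hφ, setIntegral_indicator hX]
    rw [Measure.restrict_restrict (hc (measurableSet_singleton i))] at h1
    exact h1
  have hseg := H φ hφm hφ2 hφ0 hmean
  have hsegm : MemLp (segInt h φ) 2 (volume.prod m) := by
    refine (memLp_two_iff_integrable_sq ?_).2 (integral_sq_segInt m h hφm hφ2).1
    have : StronglyMeasurable fun w : (Euc d × Euc d) × ℝ => φ (w.1.1 + w.2 • w.1.2) :=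
      Measurable.stronglyMeasurable (by fun_prop)
    exact (this.integral_prod_right' (ν := volume.restrict (Ioc 0 h))).aestronglyMeasurable
  have e1 : ∫ x, φ x ^ 2 = ∫ x in X, velocityAvgOsc X m h c f x ^ 2 := by
    rw [← integral_indicator hX]
    congr 1; ext x
    by_cases hx : x ∈ X <;> simp [hφ, hx]
  have e2 : ∫ x, φ x ^ 2 = ∫ x, φ x * velocityAvg X m h f x := by
    rw [e1]
    refine hSsq.trans ?_
    rw [← integral_indicator hX]
    congr 1; ext x
    by_cases hx : x ∈ X <;> simp [hφ, hx, velocityAvgOsc]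
  have e3 : ∫ z, extendZero X f z ^ 2 ∂(volume.prod m) = ∫ z, f z ^ 2 ∂(phaseMeasure X m) := by
    rw [phaseMeasure_eq, ← integral_indicator (hX.prod MeasurableSet.univ)]
    congr 1; ext z
    by_cases hz : z ∈ X ×ˢ (univ : Set (Euc d)) <;> simp [extendZero, hz]
  have h3 := sq_integral_mul_le hext hsegm
  have h4 : ∫ x, φ x * velocityAvg X m h f x = _ := integral_mul_lineAvg hext hφ2
  rw [← h4, ← e2, e3] at h3
  rw [← e1]
  set P := ∫ x, φ x ^ 2
  have hP : 0 ≤ P := integral_nonneg fun x => sq_nonneg _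
  set Q := ∫ z, f z ^ 2 ∂(phaseMeasure X m)
  have hQ : 0 ≤ Q := integral_nonneg fun x => sq_nonneg _
  have h5 : P ^ 2 ≤ Q * (ε * P) := h3.trans (by gcongr)
  rcases hP.eq_or_lt with h0 | h0
  · rw [← h0]; positivity
  · nlinarith

/-- The average and its cell mean each have L¹ norm at most h and L^∞ norm at most h times the mass
of m. One constant covers both twice over and does not see the partition; the added 1 keeps it
positive. -/
lemma interpolationBound_velocityAvgOsc (hX : MeasurableSet X)
    [IsFiniteMeasure (volume.restrict X)] (hh : 0 ≤ h)
    {c : Euc d → ℕ} (hc : Measurable c) {N : ℕ} (hcN : ∀ x, c x ≤ N) {ε : ℝ} (hε : 0 < ε)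
    (H : ∀ φ : Euc d → ℝ, Measurable φ → MemLp φ 2 volume → (∀ x ∉ X, φ x = 0) →
        (∀ i, ∫ x in c ⁻¹' {i}, φ x = 0) →
        ∫ w, segInt h φ w ^ 2 ∂(volume.prod m) ≤ ε * ∫ x, φ x ^ 2) :
    InterpolationBound (phaseMeasure X m) (volume.restrict X) (velocityAvgOsc X m h c)
      (2 * h * (1 + m.real univ) + 1) ε where
  aemeasurable f hf _ :=
    ((measurable_velocityAvg hX hf).sub (measurable_cellAvg hc _)).aemeasurable
  add f g _ _ hfi hgi := by
    have h1 := velocityAvg_add (h := h) hX hfi hgi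
    filter_upwards [h1] with x hx
    unfold velocityAvgOsc
    rw [hx, cellAvg_congr h1,
      cellAvg_add (integrable_velocityAvg hX hfi) (integrable_velocityAvg hX hgi)]
    ring
  one f hf hfi := by
    simp only [Real.rpow_one]
    have hA := integrable_velocityAvg (h := h) hX hfi
    have hO : Integrable (velocityAvgOsc X m h c f) (volume.restrict X) :=
      hA.sub (integrable_cellAvg hc hcN hA)
    rw [← ofReal_integral_eq_lintegral_ofReal hO.abs (Eventually.of_forall fun _ => abs_nonneg _),
      ← ofReal_integral_eq_lintegral_ofReal hfi.abs (Eventually.of_forall fun _ => abs_nonneg _),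
      ← ENNReal.ofReal_mul (by positivity)]
    refine ENNReal.ofReal_le_ofReal ?_
    have h1 : ∫ x in X, |velocityAvgOsc X m h c f x| ≤ ∫ x in X, (|velocityAvg X m h f x| +
        |cellAvg (volume.restrict X) c (velocityAvg X m h f) x|) :=
      integral_mono hO.abs (hA.abs.add (integrable_cellAvg hc hcN hA).abs) fun x => abs_sub _ _
    rw [integral_add hA.abs (integrable_cellAvg hc hcN hA).abs] at h1
    have h2 := integral_abs_cellAvg_le hc hcN hA
    have h3 := integral_abs_velocityAvg_le (m := m) hX hh hfi
    have h4 : 0 ≤ ∫ z, |f z| ∂(phaseMeasure X m) := integral_nonneg fun _ => abs_nonneg _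
    have h5 : 0 ≤ h * m.real univ * ∫ z, |f z| ∂(phaseMeasure X m) := by positivity
    nlinarith
  two f hf hfi := by
    simp only [Real.rpow_two, sq_abs]
    by_cases hf2 : MemLp f 2 (phaseMeasure X m)
    · obtain ⟨h1, h2⟩ := integral_sq_velocityAvgOsc_le hX hc hcN hε H hf hf2
      rw [← ofReal_integral_eq_lintegral_ofReal h1 (Eventually.of_forall fun _ => sq_nonneg _),
        ← ofReal_integral_eq_lintegral_ofReal hf2.integrable_sq
          (Eventually.of_forall fun _ => sq_nonneg _), ← ENNReal.ofReal_mul hε.le]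
      exact ENNReal.ofReal_le_ofReal h2
    -- Outside L² the right side is infinite because ε > 0.
    · have : ∫⁻ z, ENNReal.ofReal (f z ^ 2) ∂(phaseMeasure X m) = ⊤ := by
        by_contra hne
        refine hf2 ((memLp_two_iff_integrable_sq hf.aestronglyMeasurable).2
          ⟨(hf.pow_const 2).aestronglyMeasurable, ?_⟩)
        rw [hasFiniteIntegral_iff_ofReal (Eventually.of_forall fun _ => sq_nonneg _)]
        exact lt_top_iff_ne_top.2 hne
      rw [this, ENNReal.mul_top (by simpa using hε)]
      exact le_top
  top f hf b hb hfb := by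
    refine Eventually.of_forall fun x => ?_
    have h1 : ∀ z, |extendZero X f z| ≤ b := fun z => by
      by_cases hz : z ∈ X ×ˢ (univ : Set (Euc d))
      · simpa [extendZero, hz] using hfb z
      · simpa [extendZero, hz] using hb
    have h2 : ∀ x, |velocityAvg X m h f x| ≤ h * m.real univ * b := abs_lineAvg_le hh h1
    have h3 : 0 ≤ h * m.real univ * b := by positivity
    have h4 := abs_cellAvg_le (ν := volume.restrict X) (c := c) h3 h2 x
    have h5 := (abs_sub (velocityAvg X m h f x)
      (cellAvg (volume.restrict X) c (velocityAvg X m h f) x)).trans (add_le_add (h2 x) h4)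
    refine h5.trans ?_
    nlinarith [mul_nonneg hh hb]

/-- The averages over small cells of the velocity average define an operator of finite rank. -/
lemma exists_finiteRange_cellAvg (hX : MeasurableSet X) [IsFiniteMeasure (volume.restrict X)]
    (hh : 0 ≤ h) {p : ℝ≥0∞} [Fact (1 ≤ p)]
    {c : Euc d → ℕ} (hc : Measurable c) {N : ℕ} (hcN : ∀ x, c x ≤ N) :
    ∃ P : Lp ℝ p (phaseMeasure X m) →L[ℝ] Lp ℝ p (volume.restrict X),
      P.toLinearMap.HasFiniteRange ∧ ∀ f : Lp ℝ p (phaseMeasure X m),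
        P f =ᵐ[volume.restrict X] cellAvg (volume.restrict X) c (velocityAvg X m h f) := by
  have : IsFiniteMeasure (phaseMeasure X m) := by unfold phaseMeasure; infer_instance
  set ν := (volume : Measure (Euc d)).restrict X
  set μ := phaseMeasure X m
  have hp : 1 ≤ p := Fact.out
  obtain ⟨A, hA0, hA⟩ := exists_abs_cellAvg_le (ν := ν) hcN
  have hint : ∀ f : Lp ℝ p μ, Integrable f μ := fun f => (Lp.memLp f).integrable hp
  set D : ℝ≥0∞ := μ univ ^ (1 - 1 / p.toReal) with hD
  have hDtop : D ≠ ⊤ := by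
    refine ENNReal.rpow_ne_top_of_nonneg ?_ (measure_ne_top _ _)
    rcases eq_or_ne p ⊤ with rfl | hpt
    · simp
    · rw [sub_nonneg]
      exact div_le_one_of_le₀ ((ENNReal.toReal_mono hpt hp)) ENNReal.toReal_nonneg
  set E : ℝ≥0∞ := ν univ ^ p.toReal⁻¹ with hE
  have hEtop : E ≠ ⊤ := ENNReal.rpow_ne_top_of_nonneg (by positivity) (measure_ne_top _ _)
  obtain ⟨P, hP, -⟩ := exists_clm_of_formula (μ := μ) (ν := ν) (p := p)
    (fun f => cellAvg ν c (velocityAvg X m h f)) (E.toReal * (A * h) * D.toReal) (by positivity)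
    (fun f => (measurable_cellAvg hc _).aestronglyMeasurable)
    (fun f => by
      have h1 : ∀ x, ‖cellAvg ν c (velocityAvg X m h f) x‖ ≤ A * (h * ∫ z, |f z| ∂μ) := by
        intro x
        refine (hA _ (integrable_velocityAvg hX (hint f)) x).trans ?_
        gcongr
        exact integral_abs_velocityAvg_le hX hh (hint f)
      refine (eLpNorm_le_of_ae_bound (Eventually.of_forall h1)).trans ?_
      have h2 : ENNReal.ofReal (∫ z, |f z| ∂μ) = eLpNorm f 1 μ := by
        rw [eLpNorm_one_eq_lintegral_enorm, ofReal_integral_eq_lintegral_ofReal (hint f).abs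
          (Eventually.of_forall fun _ => abs_nonneg _)]
        simp_rw [Real.enorm_eq_ofReal_abs]
      have h3 : eLpNorm f 1 μ ≤ eLpNorm f p μ * D := by
        have := eLpNorm_le_eLpNorm_mul_rpow_measure_univ hp (Lp.aestronglyMeasurable f)
        simpa [hD] using this
      have h4 : ENNReal.ofReal (A * (h * ∫ z, |f z| ∂μ)) = ENNReal.ofReal (A * h) * eLpNorm f 1 μ := by
        rw [← mul_assoc, ENNReal.ofReal_mul (by positivity), h2]
      have h5 : ENNReal.ofReal (E.toReal * (A * h) * D.toReal) = E * ENNReal.ofReal (A * h) * D := by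
        rw [ENNReal.ofReal_mul (by positivity), ENNReal.ofReal_mul (by positivity),
          ENNReal.ofReal_toReal hDtop, ENNReal.ofReal_toReal hEtop]
      rw [h4, h5]
      calc E * (ENNReal.ofReal (A * h) * eLpNorm f 1 μ)
          ≤ E * (ENNReal.ofReal (A * h) * (eLpNorm f p μ * D)) := by gcongr
        _ = _ := by ring)
    (fun f g hfg => by rw [cellAvg_congr (velocityAvg_congr hX hfg)])
    (fun f g => by
      rw [cellAvg_congr (velocityAvg_add hX (hint f) (hint g))]
      exact Eventually.of_forall (cellAvg_add (integrable_velocityAvg hX (hint f))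
        (integrable_velocityAvg hX (hint g))))
    (fun a f => by
      have : velocityAvg X m h (fun z => a * f z) = fun x => a * velocityAvg X m h f x :=
        funext fun x => velocityAvg_const_mul a f x
      rw [this]
      exact Eventually.of_forall (cellAvg_const_mul a _))
  refine ⟨P, ?_, hP⟩
  have hms : ∀ i, MeasurableSet (c ⁻¹' {i}) := fun i => hc (measurableSet_singleton i)
  let b : Fin (N + 1) → Lp ℝ p ν := fun i =>
    indicatorConstLp p (hms i) (measure_ne_top ν _) (1 : ℝ)
  -- A function constant on cells is a combination of the N + 1 cell indicators.
  have hle : P.toLinearMap.range ≤ Submodule.span ℝ (Set.range b) := by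
    rintro _ ⟨f, rfl⟩
    have key : P f = ∑ i : Fin (N + 1), ((ν.real (c ⁻¹' {(i : ℕ)}))⁻¹ *
        ∫ y in c ⁻¹' {(i : ℕ)}, velocityAvg X m h f y ∂ν) • b i := by
      apply Lp.ext
      have h1 : ∀ᵐ x ∂ν, ∀ i : Fin (N + 1), b i x = (c ⁻¹' {(i : ℕ)}).indicator (fun _ => 1) x :=
        ae_all_iff.2 fun i => indicatorConstLp_coeFn
      have h2 := Lp.coeFn_finsetSum (p := p) (μ := ν) Finset.univ fun i : Fin (N + 1) =>
        ((ν.real (c ⁻¹' {(i : ℕ)}))⁻¹ *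
        ∫ y in c ⁻¹' {(i : ℕ)}, velocityAvg X m h f y ∂ν) • b i
      have h3 : ∀ᵐ x ∂ν, ∀ i : Fin (N + 1), (((ν.real (c ⁻¹' {(i : ℕ)}))⁻¹ *
        ∫ y in c ⁻¹' {(i : ℕ)}, velocityAvg X m h f y ∂ν) • b i : Lp ℝ p ν) x =
        ((ν.real (c ⁻¹' {(i : ℕ)}))⁻¹ *
        ∫ y in c ⁻¹' {(i : ℕ)}, velocityAvg X m h f y ∂ν) * b i x :=
        ae_all_iff.2 fun i => Lp.coeFn_smul _ _
      filter_upwards [hP f, h1, h2, h3] with x e1 e2 e3 e4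
      rw [e1, e3]
      simp only [Finset.sum_apply, e4, e2]
      rw [Finset.sum_eq_single (⟨c x, Nat.lt_succ_of_le (hcN x)⟩ : Fin (N + 1))]
      · simp [cellAvg]
      · intro i _ hi
        rw [indicator_of_notMem, mul_zero]
        intro hx
        exact hi (Fin.ext (show c x = i from hx).symm)
      · simp
    change P f ∈ _
    rw [key]
    exact Submodule.sum_mem _ fun i _ => Submodule.smul_mem _ _ (Submodule.subset_span ⟨i, rfl⟩)
  have : FiniteDimensional ℝ (Submodule.span ℝ (Set.range b)) :=
    FiniteDimensional.span_of_finite ℝ (Set.finite_range b)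
  have : FiniteDimensional ℝ P.toLinearMap.range := Submodule.finiteDimensional_of_le hle
  exact Module.Finite.iff_fg.1 this

/-- Velocity averages over short segments are limits of operators of finite rank. -/
theorem exists_velocityAvg_isFiniteRankLimit (hd : 1 ≤ d) (hX : MeasurableSet X)
    (hXb : Bornology.IsBounded X)
    (hm : ∀ e : Euc d, e ≠ 0 → m {v | ⟪v, e⟫ = 0} = 0) (hh : 0 ≤ h) {p : ℝ≥0∞} [Fact (1 ≤ p)]
    (hp1 : 1 < p) (hp : p ≠ ⊤) :
    ∃ T : Lp ℝ p (phaseMeasure X m) →L[ℝ] Lp ℝ p (volume.restrict X), IsFiniteRankLimit T ∧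
      ∀ f : Lp ℝ p (phaseMeasure X m), T f =ᵐ[volume.restrict X] velocityAvg X m h f := by
  have : IsFiniteMeasure ((volume : Measure (Euc d)).restrict X) :=
    ⟨by simpa using hXb.measure_lt_top⟩
  have : IsFiniteMeasure (phaseMeasure X m) := by unfold phaseMeasure; infer_instance
  have hq : 1 < p.toReal := by
    rw [← ENNReal.toReal_one]; exact (ENNReal.toReal_lt_toReal (by simp) hp).2 hp1
  have hint : ∀ f : Lp ℝ p (phaseMeasure X m), Integrable f (phaseMeasure X m) :=
    fun f => (Lp.memLp f).integrable hp1.le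
  have key : ∀ δ > 0, ∃ (S P : Lp ℝ p (phaseMeasure X m) →L[ℝ] Lp ℝ p (volume.restrict X)),
      ‖S‖ ≤ δ ∧ P.toLinearMap.HasFiniteRange ∧ ∀ f : Lp ℝ p (phaseMeasure X m),
        (S + P) f =ᵐ[volume.restrict X] velocityAvg X m h f := by
    intro δ hδ
    obtain ⟨ε, hε, Hε⟩ := exists_interpolation_bound (α := Euc d × Euc d) (β := Euc d) hq
      (show 0 < 2 * h * (1 + m.real univ) + 1 by positivity) (Real.rpow_pos_of_pos hδ p.toReal)
    obtain ⟨N, c, hc, hcN, H⟩ := exists_index_segInt_le hd m hm h hX hXb hε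
    have hIB := interpolationBound_velocityAvgOsc hX hh hc hcN hε H
    obtain ⟨P, hPf, hP⟩ := exists_finiteRange_cellAvg (m := m) (p := p) hX hh hc hcN
    obtain ⟨S, hS, hSn⟩ := exists_clm_of_formula (μ := phaseMeasure X m)
      (ν := volume.restrict X) (p := p) (velocityAvgOsc X m h c) δ hδ.le
      (fun f => (hIB.aemeasurable f (Lp.stronglyMeasurable f).measurable
        (hint f)).aestronglyMeasurable)
      (fun f => by
        have h1 := Hε _ _ _ inferInstance hIB f (Lp.stronglyMeasurable f).measurable (hint f)
        have h2 := eLpNorm_le_of_lintegral_rpow_le (p := p) (zero_lt_one.trans hp1).ne' hp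
          (Real.rpow_nonneg hδ.le p.toReal) (f := f) (g := velocityAvgOsc X m h c f)
          (μ := phaseMeasure X m) (ν := volume.restrict X)
          (by simpa only [enorm_rpow_eq_ofReal _ (zero_le_one.trans hq.le)] using h1)
        rwa [← Real.rpow_mul hδ.le, mul_one_div_cancel (by positivity), Real.rpow_one] at h2)
      (fun f g hfg => by
        have h1 := velocityAvg_congr (h := h) hX hfg
        filter_upwards [h1] with x hx
        unfold velocityAvgOsc
        rw [hx, cellAvg_congr h1])
      (fun f g => hIB.add f g (Lp.stronglyMeasurable f).measurable
        (Lp.stronglyMeasurable g).measurable (hint f) (hint g))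
      (fun a f => Eventually.of_forall fun x => by
        have h1 : velocityAvg X m h (fun z => a * f z) = fun x => a * velocityAvg X m h f x :=
          funext fun x => velocityAvg_const_mul a f x
        unfold velocityAvgOsc
        rw [h1, cellAvg_const_mul]; ring)
    refine ⟨S, P, hSn, hPf, fun f => ?_⟩
    rw [add_apply]
    filter_upwards [Lp.coeFn_add (S f) (P f), hS f, hP f] with x h1 h2 h3
    rw [h1, Pi.add_apply, h2, h3, velocityAvgOsc]
    ring
  -- For every δ the sum S + P is the same operator, since it is given by the same formula; so the
  -- finite rank part P belonging to δ approximates this one operator within δ.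
  obtain ⟨S₁, P₁, -, -, h₁⟩ := key 1 one_pos
  refine ⟨S₁ + P₁, fun δ hδ => ?_, h₁⟩
  obtain ⟨S, P, hS, hP, h2⟩ := key δ hδ
  refine ⟨P, hP, ?_⟩
  have : S₁ + P₁ = S + P := by
    ext1 f
    exact Lp.ext ((h₁ f).trans (h2 f).symm)
  rw [this, add_sub_cancel_right]
  exact hS

end Averaging

end

section

/-! ### The outward normal does not depend on the defining function and is continuous. -/

section Normal

variable {X : Set (Euc d)} {x y w : Euc d} {φ ψ : Euc d → ℝ}

lemma inner_gradient_left (φ : Euc d → ℝ) (x w : Euc d) : ⟪gradient φ x, w⟫ = fderiv ℝ φ x w :=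
  InnerProductSpace.toDual_symm_apply

lemma eventually_neg_of_inner_gradient_neg (hφ : DifferentiableAt ℝ φ y) (h0 : φ y = 0)
    (hw : ⟪gradient φ y, w⟫ < 0) : ∀ᶠ t : ℝ in 𝓝[>] 0, φ (y + t • w) < 0 := by
  rw [inner_gradient_left] at hw
  have h1 : HasDerivAt (fun t : ℝ => φ (y + t • w)) (fderiv ℝ φ y w) 0 :=
    hφ.hasFDerivAt.hasLineDerivAt w
  have h2 := (hasDerivAt_iff_tendsto_slope.1 h1).mono_left
    (nhdsWithin_mono (0 : ℝ) fun t (ht : 0 < t) => ht.ne')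
  filter_upwards [h2.eventually (gt_mem_nhds hw), self_mem_nhdsWithin] with t h3 (ht : 0 < t)
  rw [slope_def_field] at h3
  simp only [zero_smul, add_zero, sub_zero, h0] at h3
  have := mul_neg_of_pos_of_neg ht h3
  rwa [mul_div_cancel₀ _ ht.ne'] at this

lemma tendsto_line_nhdsGT (y w : Euc d) : Tendsto (fun t : ℝ => y + t • w) (𝓝[>] 0) (𝓝 y) := by
  have : Continuous fun t : ℝ => y + t • w := by fun_prop
  have h := this.tendsto 0
  rw [zero_smul, add_zero] at h
  exact h.mono_left nhdsWithin_le_nhds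

lemma IsDefiningFunctionAt.eventually_mem (h : IsDefiningFunctionAt X y φ)
    (hw : ⟪gradient φ y, w⟫ < 0) : ∀ᶠ t : ℝ in 𝓝[>] 0, y + t • w ∈ X := by
  filter_upwards [eventually_neg_of_inner_gradient_neg (h.contDiffAt.differentiableAt one_ne_zero)
    h.eq_zero hw, (tendsto_line_nhdsGT y w).eventually h.mem_iff] with t h1 h2
  exact h2.2 h1

lemma IsDefiningFunctionAt.eventually_notMem (h : IsDefiningFunctionAt X y φ)
    (hw : 0 < ⟪gradient φ y, w⟫) : ∀ᶠ t : ℝ in 𝓝[>] 0, y + t • w ∉ X := by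
  have hd := h.contDiffAt.differentiableAt one_ne_zero
  have hg : ⟪gradient (fun x => -φ x) y, w⟫ < 0 := by
    rw [inner_gradient_left] at hw ⊢
    rw [fderiv_fun_neg]
    simpa using hw
  filter_upwards [eventually_neg_of_inner_gradient_neg hd.neg (by simp [h.eq_zero]) hg,
    (tendsto_line_nhdsGT y w).eventually h.mem_iff] with t h1 h2
  rw [h2]
  simp only [Pi.neg_apply, neg_neg_iff_pos] at h1
  exact not_lt.2 h1.le

lemma IsDefiningFunctionAt.notMem (h : IsDefiningFunctionAt X y φ) : y ∉ X := by
  rw [h.mem_iff.self_of_nhds, h.eq_zero]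
  exact lt_irrefl _

lemma IsDefiningFunctionAt.mem_frontier (h : IsDefiningFunctionAt X y φ) : y ∈ frontier X := by
  have hw : ⟪gradient φ y, -gradient φ y⟫ < 0 := by
    rw [inner_neg_right, real_inner_self_eq_norm_sq]
    have := norm_pos_iff.2 h.gradient_ne
    have := pow_pos this 2
    linarith
  refine ⟨mem_closure_of_tendsto (tendsto_line_nhdsGT y _) (h.eventually_mem hw), fun hi => ?_⟩
  exact h.notMem (interior_subset hi)

/-- If b' is the component of b orthogonal to a, then w = b' - ε a is admissible for every ε > 0,
and ε → 0 yields ‖b'‖² ≤ 0. The sign of the factor comes from w = -a. -/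
lemma exists_pos_smul_of_inner_nonpos {a b : Euc d} (ha : a ≠ 0) (hb : b ≠ 0)
    (h : ∀ w, ⟪a, w⟫ < 0 → ⟪b, w⟫ ≤ 0) : ∃ c : ℝ, 0 < c ∧ b = c • a := by
  have ha2 : 0 < ⟪a, a⟫ := real_inner_self_pos.2 ha
  set c : ℝ := ⟪a, b⟫ / ⟪a, a⟫ with hc
  set b' : Euc d := b - c • a with hb'
  have hab : ⟪a, b'⟫ = 0 := by
    rw [hb', inner_sub_right, inner_smul_right, hc, div_mul_cancel₀ _ ha2.ne', sub_self]
  have hbb : ⟪b, b'⟫ = ⟪b', b'⟫ := by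
    have : b = b' + c • a := by rw [hb']; abel
    conv_lhs => rw [this]
    rw [inner_add_left, real_inner_smul_left, hab, mul_zero, add_zero]
  have hle : ∀ ε : ℝ, 0 < ε → ⟪b', b'⟫ - ε * ⟪b, a⟫ ≤ 0 := by
    intro ε hε
    have h1 : ⟪a, b' - ε • a⟫ < 0 := by
      rw [inner_sub_right, inner_smul_right, hab]
      have := mul_pos hε ha2
      linarith
    have h2 := h _ h1
    rwa [inner_sub_right, inner_smul_right, hbb] at h2
  have hb0 : ⟪b', b'⟫ ≤ 0 := by
    have t1 : Tendsto (fun ε : ℝ => ⟪b', b'⟫ - ε * ⟪b, a⟫) (𝓝[>] 0)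
        (𝓝 (⟪b', b'⟫ - 0 * ⟪b, a⟫)) :=
      ((continuous_const.sub (continuous_id.mul continuous_const)).tendsto (0 : ℝ)).mono_left
        nhdsWithin_le_nhds
    rw [zero_mul, sub_zero] at t1
    exact le_of_tendsto t1 (by filter_upwards [self_mem_nhdsWithin] with ε hε using hle ε hε)
  have hb'0 : b' = 0 := inner_self_eq_zero.1 (le_antisymm hb0 real_inner_self_nonneg)
  have hbc : b = c • a := sub_eq_zero.1 hb'0
  refine ⟨c, lt_of_le_of_ne ?_ ?_, hbc⟩
  · have h1 : ⟪b, -a⟫ ≤ 0 := h _ (by rw [inner_neg_right]; linarith)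
    rw [hbc, inner_neg_right, real_inner_smul_left] at h1
    by_contra hneg
    nlinarith
  · rintro h0
    rw [← h0, zero_smul] at hbc
    exact hb hbc

/-- A direction pointing inward for one defining function and outward for another would lead, for
small times, to points both in X and outside. Hence the two gradients are positive multiples of each
other. -/
lemma IsDefiningFunctionAt.outwardNormal_eq (h : IsDefiningFunctionAt X y φ) :
    outwardNormal X y = ‖gradient φ y‖⁻¹ • gradient φ y := by
  have hex : ∃ φ, IsDefiningFunctionAt X y φ := ⟨φ, h⟩
  rw [outwardNormal, dif_pos hex]
  have h' := hex.choose_spec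
  set ψ := hex.choose
  obtain ⟨c, hc, e⟩ := exists_pos_smul_of_inner_nonpos h.gradient_ne h'.gradient_ne fun w hw => by
    by_contra hlt
    obtain ⟨t, h1, h2⟩ := ((h.eventually_mem hw).and (h'.eventually_notMem (not_le.1 hlt))).exists
    exact h2 h1
  rw [e, norm_smul, Real.norm_of_nonneg hc.le, mul_inv, smul_smul, mul_right_comm,
    inv_mul_cancel₀ hc.ne', one_mul]

variable (hX : IsC1Domain X)
include hX

lemma IsC1Domain.eventually_mem (hy : y ∈ frontier X) (hw : ⟪w, outwardNormal X y⟫ < 0) :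
    ∀ᶠ t : ℝ in 𝓝[>] 0, y + t • w ∈ X := by
  obtain ⟨φ, h⟩ := hX.exists_defining y hy
  refine h.eventually_mem ?_
  rw [h.outwardNormal_eq, inner_smul_right] at hw
  rw [real_inner_comm]
  exact (pos_iff_neg_of_mul_neg hw).1 (inv_pos.2 (norm_pos_iff.2 h.gradient_ne))

lemma IsC1Domain.eventually_notMem (hy : y ∈ frontier X) (hw : 0 < ⟪w, outwardNormal X y⟫) :
    ∀ᶠ t : ℝ in 𝓝[>] 0, y + t • w ∉ X := by
  obtain ⟨φ, h⟩ := hX.exists_defining y hy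
  refine h.eventually_notMem ?_
  rw [h.outwardNormal_eq, inner_smul_right] at hw
  rw [real_inner_comm]
  exact (pos_iff_pos_of_mul_pos hw).1 (inv_pos.2 (norm_pos_iff.2 h.gradient_ne))

-- At a nearby boundary point, φ > 0 would contradict the presence of points of X close by, and φ <
-- 0 would put the point into X. So one function describes the normal on a whole neighbourhood,
-- which gives its continuity.
omit hX in
lemma IsDefiningFunctionAt.eventually_isDefiningFunctionAt (hXo : IsOpen X)
    (h : IsDefiningFunctionAt X x φ) :
    ∀ᶠ y in 𝓝 x, y ∈ frontier X → IsDefiningFunctionAt X y φ := by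
  have hg : ContinuousAt (gradient φ) x := by
    have h1 : ContinuousAt (fderiv ℝ φ) x :=
      (h.contDiffAt.fderiv_right (m := 0) (by norm_num)).continuousAt
    exact (InnerProductSpace.toDual ℝ (Euc d)).symm.continuous.continuousAt.comp h1
  filter_upwards [h.contDiffAt.eventually (by simp), h.mem_iff.eventually_nhds,
    hg.eventually_ne h.gradient_ne] with y h1 h2 h3 hy
  refine ⟨h1, le_antisymm ?_ ?_, h3, h2⟩
  · have hc := h1.continuousAt
    by_contra hlt
    have h4 := hc.eventually (lt_mem_nhds (not_le.1 hlt))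
    obtain ⟨z, hz, hzX⟩ := mem_closure_iff_nhds.1 (frontier_subset_closure hy) _
      (inter_mem h4 h2)
    exact absurd (hz.2.1 hzX) (not_lt.2 (le_of_lt hz.1))
  · have hyX : y ∉ X := fun hyX => (hXo.frontier_eq ▸ hy).2 hyX
    rw [h2.self_of_nhds] at hyX
    exact not_lt.1 hyX

lemma IsC1Domain.continuousOn_outwardNormal : ContinuousOn (outwardNormal X) (frontier X) := by
  intro x hx
  obtain ⟨φ, h⟩ := hX.exists_defining x hx
  have hg : ContinuousAt (gradient φ) x := by
    have h1 : ContinuousAt (fderiv ℝ φ) x :=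
      (h.contDiffAt.fderiv_right (m := 0) (by norm_num)).continuousAt
    exact (InnerProductSpace.toDual ℝ (Euc d)).symm.continuous.continuousAt.comp h1
  have h2 : ContinuousAt (fun y => ‖gradient φ y‖⁻¹ • gradient φ y) x :=
    (hg.norm.inv₀ (norm_ne_zero_iff.2 h.gradient_ne)).smul hg
  refine h2.continuousWithinAt.congr_of_eventuallyEq ?_ h.outwardNormal_eq
  filter_upwards [nhdsWithin_le_nhds (h.eventually_isDefiningFunctionAt hX.isOpen),
    self_mem_nhdsWithin] with y hy hyX
  exact (hy hyX).outwardNormal_eq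

omit hX in
lemma outwardNormal_eq_zero (hx : x ∉ frontier X) : outwardNormal X x = 0 := by
  rw [outwardNormal, dif_neg]
  rintro ⟨φ, h⟩
  exact hx h.mem_frontier

lemma IsC1Domain.measurable_outwardNormal : Measurable (outwardNormal X) := by
  classical
  have h := hX.continuousOn_outwardNormal.measurable_piecewise
    (g := fun _ => (0 : Euc d)) continuousOn_const isClosed_frontier.measurableSet
  convert h using 1
  ext1 x
  by_cases hx : x ∈ frontier X
  · simp [hx]
  · simp [hx, outwardNormal_eq_zero hx]

end Normal

/-! ### Travel times: measurability and exit points. -/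

section TravelTime

variable {X : Set (Euc d)} {z : Euc d × Euc d} {t : ℝ}

lemma tauMinus_eq (X : Set (Euc d)) (z : Euc d × Euc d) :
    tauMinus X z = tauPlus X (z.1, -z.2) := by
  simp [tauMinus, tauPlus, sub_eq_add_neg]

lemma tauPlus_nonneg (X : Set (Euc d)) (z : Euc d × Euc d) : 0 ≤ tauPlus X z :=
  Real.sInf_nonneg fun _ hs => hs.1.le

lemma tauMinus_nonneg (X : Set (Euc d)) (z : Euc d × Euc d) : 0 ≤ tauMinus X z :=
  Real.sInf_nonneg fun _ hs => hs.1.le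

lemma tauPlus_le (h0 : 0 < t) (h : z.1 + t • z.2 ∉ X) : tauPlus X z ≤ t :=
  csInf_le (show BddBelow {s : ℝ | 0 < s ∧ z.1 + s • z.2 ∉ X} from ⟨0, fun _ hs => hs.1.le⟩) ⟨h0, h⟩

lemma mem_of_lt_tauPlus (h0 : 0 < t) (ht : t < tauPlus X z) : z.1 + t • z.2 ∈ X := by
  by_contra h
  exact absurd (tauPlus_le h0 h) (not_le.2 ht)

lemma mem_of_lt_tauMinus (h0 : 0 < t) (ht : t < tauMinus X z) : z.1 - t • z.2 ∈ X := by
  rw [tauMinus_eq] at ht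
  have := mem_of_lt_tauPlus h0 ht
  simpa [sub_eq_add_neg] using this

lemma exists_bound_smul (hX : Bornology.IsBounded X) : ∃ D > 0, ∀ x ∈ X, ∀ (v : Euc d) (t : ℝ),
    x + t • v ∈ X → |t| * ‖v‖ ≤ D := by
  obtain ⟨D, hD⟩ := hX.exists_norm_le
  refine ⟨2 * |D| + 1, by positivity, fun x hx v t ht => ?_⟩
  have h1 := norm_sub_le (x + t • v) x
  rw [add_sub_cancel_left, norm_smul, Real.norm_eq_abs] at h1
  linarith [hD x hx, hD _ ht, le_abs_self D]

lemma exists_notMem_line (hX : Bornology.IsBounded X) (hz : z.2 ≠ 0) (a : ℝ) :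
    ∃ s, a < s ∧ 0 < s ∧ z.1 + s • z.2 ∉ X := by
  obtain ⟨D, hD⟩ := hX.exists_norm_le
  have hn := norm_pos_iff.2 hz
  refine ⟨|a| + (|D| + ‖z.1‖ + 1) / ‖z.2‖, ?_, by positivity, fun hmem => ?_⟩
  · have : 0 < (|D| + ‖z.1‖ + 1) / ‖z.2‖ := by positivity
    linarith [le_abs_self a]
  · have h1 := hD _ hmem
    have h2 := norm_sub_le (z.1 + (|a| + (|D| + ‖z.1‖ + 1) / ‖z.2‖) • z.2) z.1
    rw [add_sub_cancel_left, norm_smul, Real.norm_of_nonneg (by positivity), add_mul,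
      div_mul_cancel₀ _ hn.ne'] at h2
    have : 0 ≤ |a| * ‖z.2‖ := by positivity
    linarith [le_abs_self D]

/-- The rational witness makes the superlevel sets of the travel time countable unions. Boundedness
of X and nonzero velocity guarantee that exit times exist, so the infimum is not the default value
of the empty set. -/
lemma lt_tauPlus_iff (hX : Bornology.IsBounded X) (hz : z.2 ≠ 0) {a : ℝ} :
    a < tauPlus X z ↔ ∃ q : ℚ, a < q ∧ ∀ s : ℝ, 0 < s → s ≤ q → z.1 + s • z.2 ∈ X := by
  constructor
  · intro h
    obtain ⟨q, h1, h2⟩ := exists_rat_btwn h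
    exact ⟨q, h1, fun s hs0 hs => mem_of_lt_tauPlus hs0 (hs.trans_lt h2)⟩
  · rintro ⟨q, hq, h⟩
    refine hq.trans_le (le_csInf ?_ fun s hs => ?_)
    · obtain ⟨s, -, h0, hs⟩ := exists_notMem_line hX hz 0
      exact ⟨s, h0, hs⟩
    · by_contra hlt
      exact hs.2 (h s hs.1 (not_le.1 hlt).le)

/-- Inside X a particle at rest has no exit time, and the infimum of the empty set is 0 by
convention; outside X all positive times are exit times. -/
lemma tauPlus_of_eq_zero (hz : z.2 = 0) : tauPlus X z = 0 := by
  unfold tauPlus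
  by_cases h : z.1 ∈ X
  · simp [hz, h]
  · have : {s : ℝ | 0 < s ∧ z.1 + s • z.2 ∉ X} = Ioi 0 := by
      ext s; simp [hz, h]
    rw [this, csInf_Ioi]

/-- Exhaust (0, q] by compact intervals. By compactness the condition on each of these is open in z.
-/
lemma measurableSet_forall_mem_line (hX : IsOpen X) (q : ℝ) :
    MeasurableSet {z : Euc d × Euc d | ∀ s : ℝ, 0 < s → s ≤ q → z.1 + s • z.2 ∈ X} := by
  have e : {z : Euc d × Euc d | ∀ s : ℝ, 0 < s → s ≤ q → z.1 + s • z.2 ∈ X} =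
      ⋂ n : ℕ, {z | ∀ s ∈ Icc (1 / ((n : ℝ) + 1)) q, z.1 + s • z.2 ∈ X} := by
    ext z
    simp only [mem_ofPred_eq, mem_iInter, mem_Icc]
    constructor
    · intro h n s hs
      exact h s (lt_of_lt_of_le (by positivity) hs.1) hs.2
    · intro h s hs0 hs
      obtain ⟨n, hn⟩ := exists_nat_one_div_lt hs0
      exact h n s ⟨hn.le, hs⟩
  rw [e]
  refine MeasurableSet.iInter fun n => IsOpen.measurableSet ?_
  rw [isOpen_iff_mem_nhds]
  intro z hz
  have hcont : Continuous fun w : (Euc d × Euc d) × ℝ => w.1.1 + w.2 • w.1.2 := by fun_prop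
  exact isCompact_Icc.eventually_forall_of_forall_eventually fun s hs =>
    (hcont.tendsto (z, s)).eventually (hX.mem_nhds (hz s hs))

lemma measurable_tauPlus (hX : IsOpen X) (hXb : Bornology.IsBounded X) :
    Measurable (tauPlus X) := by
  refine measurable_of_Ioi fun a => ?_
  rcases lt_or_ge a 0 with ha | ha
  · have : tauPlus X ⁻¹' Ioi a = univ := by
      ext z; simpa using ha.trans_le (tauPlus_nonneg X z)
    rw [this]; exact MeasurableSet.univ
  · have : tauPlus X ⁻¹' Ioi a = {z | z.2 ≠ 0} ∩ ⋃ q : ℚ, ⋃ _ : a < q,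
        {z | ∀ s : ℝ, 0 < s → s ≤ q → z.1 + s • z.2 ∈ X} := by
      ext z
      simp only [mem_preimage, mem_Ioi, mem_inter_iff, mem_ofPred_eq, mem_iUnion, exists_prop]
      by_cases hz : z.2 = 0
      · simp [hz, tauPlus_of_eq_zero hz, ha]
      · simp only [ne_eq, hz, not_false_eq_true, true_and]
        exact lt_tauPlus_iff hXb hz
    rw [this]
    refine MeasurableSet.inter ?_ (MeasurableSet.iUnion fun q => MeasurableSet.iUnion fun _ =>
      measurableSet_forall_mem_line hX q)
    exact (measurableSet_eq_fun measurable_snd measurable_const).compl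

lemma measurable_tauMinus (hX : IsOpen X) (hXb : Bornology.IsBounded X) :
    Measurable (tauMinus X) := by
  have : tauMinus X = fun z => tauPlus X (z.1, -z.2) := funext (tauMinus_eq X)
  rw [this]
  exact (measurable_tauPlus hX hXb).comp (by fun_prop)

lemma exit_notMem (hX : IsOpen X) (hXb : Bornology.IsBounded X) (hz : z.2 ≠ 0) :
    z.1 + tauPlus X z • z.2 ∉ X := by
  intro hmem
  have hc : Continuous fun s : ℝ => z.1 + s • z.2 := by fun_prop
  obtain ⟨ε, hε, h⟩ := Metric.mem_nhds_iff.1 ((hc.tendsto (tauPlus X z)).eventually (hX.mem_nhds hmem))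
  obtain ⟨s, hs, hlt⟩ := exists_lt_of_csInf_lt (s := {s : ℝ | 0 < s ∧ z.1 + s • z.2 ∉ X})
    (b := tauPlus X z + ε)
    (by obtain ⟨s, -, h0, hs⟩ := exists_notMem_line hXb hz 0
        exact ⟨s, h0, hs⟩) (by change tauPlus X z < _; linarith)
  have h1 : tauPlus X z ≤ s := tauPlus_le hs.1 hs.2
  refine hs.2 (h ?_)
  rw [Metric.mem_ball, Real.dist_eq, abs_lt]
  constructor <;> linarith

lemma exit_mem_frontier (hX : IsOpen X) (hXb : Bornology.IsBounded X) (hz : z.2 ≠ 0)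
    (hpos : 0 < tauPlus X z) : z.1 + tauPlus X z • z.2 ∈ frontier X := by
  rw [hX.frontier_eq]
  refine ⟨?_, exit_notMem hX hXb hz⟩
  have hc : Continuous fun s : ℝ => z.1 + s • z.2 := by fun_prop
  refine mem_closure_of_tendsto ((hc.tendsto (tauPlus X z)).mono_left nhdsWithin_le_nhds)
    (b := 𝓝[<] (tauPlus X z)) ?_
  filter_upwards [Ioo_mem_nhdsLT hpos] with s hs
  exact mem_of_lt_tauPlus hs.1 hs.2

lemma tauPlus_pos_of_mem (hXb : Bornology.IsBounded X) (hz : z.2 ≠ 0)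
    (h : ∀ᶠ t : ℝ in 𝓝[>] 0, z.1 + t • z.2 ∈ X) : 0 < tauPlus X z := by
  obtain ⟨ε, hε, h⟩ := (mem_nhdsGT_iff_exists_Ioc_subset).1 h
  rw [lt_tauPlus_iff hXb hz]
  obtain ⟨q, hq0, hq⟩ := exists_rat_btwn (show (0 : ℝ) < ε from hε)
  exact ⟨q, hq0, fun s hs0 hs => h ⟨hs0, hs.trans hq.le⟩⟩

lemma tauPlus_eq_zero_of_frequently (h : ∃ᶠ t : ℝ in 𝓝[>] 0, z.1 + t • z.2 ∉ X) :
    tauPlus X z = 0 := by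
  refine le_antisymm (le_of_forall_pos_le_add fun ε hε => ?_) (tauPlus_nonneg X z)
  obtain ⟨t, ht, h1⟩ := (h.and_eventually (Ioo_mem_nhdsGT hε)).exists
  rw [zero_add]
  exact (tauPlus_le h1.1 ht).trans h1.2.le

lemma tauPlus_eq_of_Ioo {a : ℝ} (ha : 0 < a) (h : ∀ s ∈ Ioo 0 a, z.1 + s • z.2 ∈ X)
    (hn : z.1 + a • z.2 ∉ X) : tauPlus X z = a := by
  refine le_antisymm (tauPlus_le ha hn) (le_csInf ⟨a, ha, hn⟩ fun s hs => ?_)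
  by_contra hlt
  exact hs.2 (h s ⟨hs.1, not_le.1 hlt⟩)

end TravelTime

end

/-! ### Charts of the boundary and Jacobians of slanted coordinates. -/

section

/-- The hyperplane orthogonal to `n`. -/
def hyperplane (n : Euc d) : Set (Euc d) := {w | ⟪n, w⟫ = 0}

/-- Fubini's theorem for the decomposition of the space along a unit vector. -/
lemma lintegral_eq_lintegral_hyperplane {n : Euc d} (hn : ‖n‖ = 1) {F : Euc d → ℝ≥0∞}
    (hF : Measurable F) :
    ∫⁻ x, F x = ∫⁻ w, (∫⁻ t : ℝ, F (w + t • n))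
      ∂(Measure.euclideanHausdorffMeasure (d - 1) : Measure (Euc d)).restrict (hyperplane n) := by
  have hn0 : n ≠ 0 := norm_ne_zero_iff.1 (by rw [hn]; exact one_ne_zero)
  set s : Submodule ℝ (Euc d) := Submodule.span ℝ {n}
  have h1 := (s.measurePreserving_measurableEquivProd (0 : Euc d)).symm
  rw [InnerProductSpace.euclideanHausdorffMeasure_eq_volume] at h1
  have h2 : ∫⁻ x, F x = ∫⁻ q : s × sᗮ, F (q.1 + q.2) := by
    rw [← h1.lintegral_comp hF]
    refine lintegral_congr fun q => ?_
    rw [Submodule.measurableEquivProd_symm_apply]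
    simp
  have hFm : Measurable fun q : s × sᗮ => F (q.1 + q.2) := by fun_prop
  have h3 : ∀ w : sᗮ, ∫⁻ a : s, F (a + w) = ∫⁻ t : ℝ, F (w + t • n) := by
    intro w
    have hFw : Measurable fun a : s => F (a + w) := by fun_prop
    rw [← (LinearIsometryEquiv.toSpanUnitSingleton (𝕜 := ℝ) n hn).measurePreserving.lintegral_comp hFw]
    refine lintegral_congr fun t => ?_
    rw [add_comm]
    rfl
  have hfr : Module.finrank ℝ sᗮ = d - 1 := by
    have h4 := s.finrank_add_finrank_orthogonal
    rw [finrank_span_singleton hn0, finrank_euclideanSpace_fin] at h4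
    omega
  have hiso : Isometry (Subtype.val : sᗮ → Euc d) := isometry_subtype_coe
  have hrange : Set.range (Subtype.val : sᗮ → Euc d) = hyperplane n := by
    ext w
    simp [hyperplane, s, Submodule.mem_orthogonal_singleton_iff_inner_right]
  rw [h2, Measure.volume_eq_prod, lintegral_prod_symm _ hFm.aemeasurable]
  simp_rw [h3]
  rw [← InnerProductSpace.euclideanHausdorffMeasure_eq_volume, hfr, ← hrange,
    ← hiso.map_euclideanHausdorffMeasure]
  have hm : Measurable fun w : Euc d => ∫⁻ t : ℝ, F (w + t • n) := by
    have : Measurable fun q : Euc d × ℝ => F (q.1 + q.2 • n) := by fun_prop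
    exact this.lintegral_prod_right'
  rw [lintegral_map hm measurable_subtype_coe]

lemma euclideanHausdorffMeasure_image_le {K : ℝ≥0} {f : Euc d → Euc d}
    {s : Set (Euc d)} (h : LipschitzOnWith K f s) (k : ℕ) :
    (Measure.euclideanHausdorffMeasure k : Measure (Euc d)) (f '' s) ≤
      (K : ℝ≥0∞) ^ k * (Measure.euclideanHausdorffMeasure k : Measure (Euc d)) s := by
  have := h.hausdorffMeasure_image_le (d := k) (Nat.cast_nonneg k)
  rw [ENNReal.rpow_natCast] at this
  rw [Measure.euclideanHausdorffMeasure_def, Measure.smul_apply, Measure.smul_apply,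
    ENNReal.smul_def, ENNReal.smul_def, smul_eq_mul, smul_eq_mul, mul_left_comm]
  gcongr

/-- The restriction to a hyperplane of the surface measure is finite on bounded sets. -/
lemma euclideanHausdorffMeasure_lt_top {n : Euc d} (hn : ‖n‖ = 1) {W : Set (Euc d)}
    (hW : W ⊆ hyperplane n) (hWb : Bornology.IsBounded W) :
    (Measure.euclideanHausdorffMeasure (d - 1) : Measure (Euc d)) W < ⊤ := by
  have hn0 : n ≠ 0 := norm_ne_zero_iff.1 (by rw [hn]; exact one_ne_zero)
  set s : Submodule ℝ (Euc d) := Submodule.span ℝ {n}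
  have hfr : Module.finrank ℝ sᗮ = d - 1 := by
    have h4 := s.finrank_add_finrank_orthogonal
    rw [finrank_span_singleton hn0, finrank_euclideanSpace_fin] at h4
    omega
  have hrange : Set.range (Subtype.val : sᗮ → Euc d) = hyperplane n := by
    ext w
    simp [hyperplane, s, Submodule.mem_orthogonal_singleton_iff_inner_right]
  have hiso : Isometry (Subtype.val : sᗮ → Euc d) := isometry_subtype_coe
  have h1 := hiso.euclideanHausdorffMeasure_preimage (d := d - 1) W
  rw [hrange, inter_eq_self_of_subset_left hW] at h1
  rw [← h1, ← hfr, InnerProductSpace.euclideanHausdorffMeasure_eq_volume]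
  exact (hiso.antilipschitz.isBounded_preimage hWb).measure_lt_top

/-- The projection onto the hyperplane orthogonal to the unit vector `n`. -/
def hyperplaneProj (n : Euc d) : Euc d →L[ℝ] Euc d :=
  ContinuousLinearMap.id ℝ (Euc d) - (innerSL ℝ n).smulRight n

lemma hyperplaneProj_apply (n q : Euc d) : hyperplaneProj n q = q - ⟪n, q⟫ • n := by
  simp [hyperplaneProj]

lemma hyperplaneProj_add_smul {n w : Euc d} (hn : ‖n‖ = 1) (hw : w ∈ hyperplane n) (t : ℝ) :
    hyperplaneProj n (w + t • n) = w := by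
  have : ⟪n, w⟫ = 0 := hw
  simp [hyperplaneProj_apply, inner_add_right, inner_smul_right, this, hn]

lemma inner_add_smul_of_mem_hyperplane {n w : Euc d} (hn : ‖n‖ = 1) (hw : w ∈ hyperplane n)
    (t : ℝ) : ⟪n, w + t • n⟫ = t := by
  have : ⟪n, w⟫ = 0 := hw
  simp [inner_add_right, inner_smul_right, this, hn]

/-- The derivative of the map `w + t n ↦ Θ(w) + t v`. -/
def slantDeriv (n v : Euc d) (L : Euc d →L[ℝ] Euc d) : Euc d →L[ℝ] Euc d :=
  L.comp (hyperplaneProj n) + (innerSL ℝ n).smulRight v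

/-- A parametrization, with good properties, of the part in `U` of the boundary of `X` by a subset
of a hyperplane. -/
structure BoundaryChart (X U : Set (Euc d)) where
  n : Euc d
  W : Set (Euc d)
  Θ : Euc d → Euc d
  Ψ : Euc d → Euc d
  Θ' : Euc d → Euc d →L[ℝ] Euc d
  K : ℝ≥0
  norm_n : ‖n‖ = 1
  measurableSet_W : MeasurableSet W
  W_subset : W ⊆ hyperplane n
  isBounded_W : Bornology.IsBounded W
  measurable_Θ : Measurable Θ
  image_eq : Θ '' W = U ∩ frontier X
  leftInvOn : LeftInvOn Ψ Θ W
  lipschitz : LipschitzOnWith K Θ W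
  lipschitz_symm : LipschitzOnWith K Ψ (U ∩ frontier X)
  hasFDerivWithinAt : ∀ w ∈ W, HasFDerivWithinAt Θ (Θ' w) W w
  -- The Jacobian of w + t n ↦ Θ w + t v and the flux density |v · ν| control each other uniformly
  -- in v. These two bounds make |v · ν| dμ dt comparable with Lebesgue measure.
  abs_det_le : ∀ w ∈ W, ∀ v, |(slantDeriv n v (Θ' w)).det| ≤ K * |⟪v, outwardNormal X (Θ w)⟫|
  le_abs_det : ∀ w ∈ W, ∀ v, |⟪v, outwardNormal X (Θ w)⟫| ≤ K * |(slantDeriv n v (Θ' w)).det|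

lemma det_id_add_smulRight (f : Euc d →L[ℝ] ℝ) (v : Euc d) :
    (ContinuousLinearMap.id ℝ (Euc d) + f.smulRight v).det = 1 + f v := by
  have h := LinearMap.transvection.det (R := ℝ) (V := Euc d) f.toLinearMap v
  have e : ((ContinuousLinearMap.id ℝ (Euc d) + f.smulRight v : Euc d →L[ℝ] Euc d) :
      Euc d →ₗ[ℝ] Euc d) = LinearMap.transvection f.toLinearMap v := by
    ext x : 1
    simp [LinearMap.transvection.apply]
  rw [ContinuousLinearMap.det, e, h]
  rfl

/-- The derivative of the map `x ↦ x - x₀ + (φ x - ⟨n, x - x₀⟩) n`, for a function `φ` with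
derivative `ℓ`. -/
def flattenDeriv (n : Euc d) (ℓ : Euc d →L[ℝ] ℝ) : Euc d →L[ℝ] Euc d :=
  ContinuousLinearMap.id ℝ (Euc d) + (ℓ - innerSL ℝ n).smulRight n

lemma det_flattenDeriv {n : Euc d} (hn : ‖n‖ = 1) (ℓ : Euc d →L[ℝ] ℝ) :
    (flattenDeriv n ℓ).det = ℓ n := by
  rw [flattenDeriv, det_id_add_smulRight]
  simp [hn]

/-- Composed with the flattening derivative, the slanted derivative becomes a rank-one perturbation
of the identity, whose determinant is explicit. The flattening derivative itself has determinant ℓ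
n. -/
lemma det_slantDeriv {n : Euc d} (hn : ‖n‖ = 1) (ℓ : Euc d →L[ℝ] ℝ) (v : Euc d)
    {L : Euc d →L[ℝ] Euc d} (hL : (flattenDeriv n ℓ).comp L = ContinuousLinearMap.id ℝ _) :
    ℓ n * (slantDeriv n v L).det = ℓ v := by
  have e : (flattenDeriv n ℓ).comp (slantDeriv n v L) =
      ContinuousLinearMap.id ℝ (Euc d) + (innerSL ℝ n).smulRight (flattenDeriv n ℓ v - n) := by
    rw [slantDeriv, ContinuousLinearMap.comp_add, ← ContinuousLinearMap.comp_assoc, hL]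
    ext1 x
    simp only [add_apply, ContinuousLinearMap.comp_apply,
      ContinuousLinearMap.id_apply, ContinuousLinearMap.smulRight_apply, map_smul,
      hyperplaneProj_apply, innerSL_apply_apply, smul_sub]
    abel
  have h1 := congrArg ContinuousLinearMap.det e
  have h3 : (((flattenDeriv n ℓ).comp (slantDeriv n v L) : Euc d →L[ℝ] Euc d) :
      Euc d →ₗ[ℝ] Euc d) = (flattenDeriv n ℓ).toLinearMap ∘ₗ (slantDeriv n v L).toLinearMap := rfl
  rw [det_id_add_smulRight, ContinuousLinearMap.det, h3, LinearMap.det_comp] at h1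
  have h2 : LinearMap.det ((flattenDeriv n ℓ : Euc d →L[ℝ] Euc d) : Euc d →ₗ[ℝ] Euc d) = ℓ n :=
    det_flattenDeriv hn ℓ
  rw [h2] at h1
  refine h1.trans ?_
  simp [flattenDeriv, hn, inner_add_right, inner_sub_right, inner_smul_right]

/-- The map Ψ replaces the coordinate along n by φ, so it flattens the boundary onto the hyperplane
orthogonal to n, and the inverse function theorem inverts it. On a small ball the derivative of φ
along n and the norm of its gradient stay within a factor 2 of their common value g at the centre;
this bounds the Jacobians. -/
theorem IsDefiningFunctionAt.exists_boundaryChart {X : Set (Euc d)} (hX : IsOpen X) {x₀ : Euc d}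
    {φ : Euc d → ℝ} (h : IsDefiningFunctionAt X x₀ φ) :
    ∃ U ∈ 𝓝 x₀, Nonempty (BoundaryChart X U) := by
  classical
  set g : ℝ := ‖gradient φ x₀‖ with hg
  have hg0 : 0 < g := norm_pos_iff.2 h.gradient_ne
  set n : Euc d := g⁻¹ • gradient φ x₀ with hn_def
  have hn : ‖n‖ = 1 := norm_smul_inv_norm h.gradient_ne
  have hgn : fderiv ℝ φ x₀ n = g := by
    rw [← inner_gradient_left, hn_def, inner_smul_right, real_inner_self_eq_norm_sq, ← hg]
    field_simp
  let Ψ : Euc d → Euc d := fun x => x - x₀ + (φ x - ⟪n, x - x₀⟫) • n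
  have hΨd : ∀ y, ContDiffAt ℝ 1 φ y →
      HasStrictFDerivAt Ψ (flattenDeriv n (fderiv ℝ φ y)) y := by
    intro y hy
    have h1 := hy.hasStrictFDerivAt one_ne_zero
    have h2 : HasStrictFDerivAt (fun x : Euc d => x - x₀) (ContinuousLinearMap.id ℝ (Euc d)) y :=
      (hasStrictFDerivAt_id y).sub_const x₀
    have h3 : HasStrictFDerivAt (fun x : Euc d => ⟪n, x - x₀⟫) (innerSL ℝ n) y := by
      have := (innerSL ℝ n).hasStrictFDerivAt.comp y h2
      simpa [Function.comp_def] using this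
    exact h2.add ((h1.sub h3).smul_const n)
  have hdet : ∀ y, (flattenDeriv n (fderiv ℝ φ y)).det = fderiv ℝ φ y n :=
    fun y => det_flattenDeriv hn _
  let D : (y : Euc d) → fderiv ℝ φ y n ≠ 0 → (Euc d ≃L[ℝ] Euc d) := fun y hy =>
    (flattenDeriv n (fderiv ℝ φ y)).toContinuousLinearEquivOfDetNeZero (by rwa [hdet])
  have hD : ∀ y hy, ((D y hy : Euc d ≃L[ℝ] Euc d) : Euc d →L[ℝ] Euc d) =
      flattenDeriv n (fderiv ℝ φ y) := fun y hy => by simp [D]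
  have h0 : fderiv ℝ φ x₀ n ≠ 0 := by rw [hgn]; exact hg0.ne'
  have hS : HasStrictFDerivAt Ψ ((D x₀ h0 : Euc d ≃L[ℝ] Euc d) : Euc d →L[ℝ] Euc d) x₀ := by
    rw [hD x₀ h0]; exact hΨd x₀ h.contDiffAt
  let e := hS.toOpenPartialHomeomorph Ψ
  have hes : x₀ ∈ e.source := hS.mem_toOpenPartialHomeomorph_source
  have heΨ : ∀ x, e x = Ψ x := fun x => rfl
  have hesymm : HasStrictFDerivAt e.symm
      ((D x₀ h0).symm : Euc d →L[ℝ] Euc d) (e x₀) := by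
    refine e.hasStrictFDerivAt_symm (e.map_source hes) ?_
    rw [e.left_inv hes]; exact hS
  obtain ⟨K₁, S, hSn, hK₁⟩ := hS.exists_lipschitzOnWith
  obtain ⟨K₂, T, hTn, hK₂⟩ := hesymm.exists_lipschitzOnWith
  have hcont : ContinuousAt (fderiv ℝ φ) x₀ :=
    (h.contDiffAt.fderiv_right (m := 0) (by norm_num)).continuousAt
  have hgc : ContinuousAt (gradient φ) x₀ :=
    (InnerProductSpace.toDual ℝ (Euc d)).symm.continuous.continuousAt.comp hcont
  have hfn : ContinuousAt (fun y => fderiv ℝ φ y n) x₀ := hcont.clm_apply continuousAt_const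
  have hev : ∀ᶠ y in 𝓝 x₀, y ∈ S ∧ Ψ y ∈ T ∧ y ∈ e.source ∧ ContDiffAt ℝ 1 φ y ∧
      (y ∈ frontier X → IsDefiningFunctionAt X y φ) ∧
      fderiv ℝ φ y n ∈ Ioo (g / 2) (2 * g) ∧ ‖gradient φ y‖ ∈ Ioo (g / 2) (2 * g) := by
    have hSn' : ∀ᶠ y in 𝓝 x₀, y ∈ S := hSn
    have hTn' : ∀ᶠ y in 𝓝 (Ψ x₀), y ∈ T := hTn
    have hes' : ∀ᶠ y in 𝓝 x₀, y ∈ e.source := e.open_source.mem_nhds hes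
    have i1 : ∀ᶠ y in 𝓝 x₀, fderiv ℝ φ y n ∈ Ioo (g / 2) (2 * g) :=
      hfn.eventually (Ioo_mem_nhds (by simp only [hgn]; linarith) (by simp only [hgn]; linarith))
    have i2 : ∀ᶠ y in 𝓝 x₀, ‖gradient φ y‖ ∈ Ioo (g / 2) (2 * g) :=
      hgc.norm.eventually (Ioo_mem_nhds (show g / 2 < g by linarith) (show g < 2 * g by linarith))
    filter_upwards [hSn', hS.continuousAt.tendsto.eventually hTn', hes',
      h.contDiffAt.eventually (by simp), h.eventually_isDefiningFunctionAt hX, i1, i2]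
      with y a1 a2 a3 a4 a5 a6 a7
    exact ⟨a1, a2, a3, a4, a5, a6, a7⟩
  obtain ⟨ε, hε, hball⟩ := Metric.eventually_nhds_iff_ball.1 hev
  set U := Metric.ball x₀ ε with hU
  set W := e.target ∩ e.symm ⁻¹' (U ∩ frontier X) with hW
  have hUf : MeasurableSet (U ∩ frontier X) :=
    Metric.isOpen_ball.measurableSet.inter isClosed_frontier.measurableSet
  have hWm : MeasurableSet W := by
    have h1 := e.continuousOn_symm.measurable_piecewise (g := fun _ => (0 : Euc d))
      continuousOn_const e.open_target.measurableSet
    have h2 : W = e.target ∩ (e.target.piecewise e.symm fun _ => 0) ⁻¹' (U ∩ frontier X) := by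
      ext w
      by_cases hw : w ∈ e.target <;> simp [hW, hw]
    rw [h2]
    exact e.open_target.measurableSet.inter (h1 hUf)
  have hWt : W ⊆ e.target := inter_subset_left
  have hWU : ∀ w ∈ W, e.symm w ∈ U ∩ frontier X := fun w hw => hw.2
  have hΨW : ∀ w ∈ W, Ψ (e.symm w) = w := fun w hw => e.right_inv (hWt hw)
  have himg : e.symm '' W = U ∩ frontier X := by
    ext y
    constructor
    · rintro ⟨w, hw, rfl⟩; exact hWU w hw
    · intro hy
      have hys : y ∈ e.source := (hball y hy.1).2.2.1
      exact ⟨e y, ⟨e.map_source hys, by simpa [e.left_inv hys] using hy⟩, e.left_inv hys⟩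
  have hΨU : LipschitzOnWith K₁ Ψ (U ∩ frontier X) := hK₁.mono fun y hy => (hball y hy.1).1
  have hWimg : W = Ψ '' (U ∩ frontier X) := by
    rw [← himg, image_image]
    ext w
    constructor
    · exact fun hw => ⟨w, hw, hΨW w hw⟩
    · rintro ⟨w', hw', rfl⟩
      simp only
      rwa [hΨW w' hw']
  -- Extended by 0 off the target, the local inverse becomes globally measurable.
  let Θ : Euc d → Euc d := e.target.piecewise e.symm fun _ => 0
  have hΘ : ∀ w ∈ W, Θ w = e.symm w := fun w hw => piecewise_eq_of_mem _ _ _ (hWt hw)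
  let Θ' : Euc d → Euc d →L[ℝ] Euc d := fun w =>
    if hy : fderiv ℝ φ (e.symm w) n ≠ 0 then ((D (e.symm w) hy).symm : Euc d →L[ℝ] Euc d) else 0
  have hne : ∀ w ∈ W, fderiv ℝ φ (e.symm w) n ≠ 0 := fun w hw => by
    have := (hball _ (hWU w hw).1).2.2.2.2.2.1.1
    exact (lt_trans (by positivity) this).ne'
  have hdetW : ∀ w ∈ W, ∀ v, fderiv ℝ φ (e.symm w) n * (slantDeriv n v (Θ' w)).det =
      fderiv ℝ φ (e.symm w) v := by
    intro w hw v
    refine det_slantDeriv hn _ v ?_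
    simp only [Θ', dif_pos (hne w hw)]
    rw [← hD _ (hne w hw)]
    exact (D _ (hne w hw)).coe_comp_coe_symm
  have habs : ∀ w ∈ W, ∀ v, fderiv ℝ φ (e.symm w) n * |(slantDeriv n v (Θ' w)).det| =
      ‖gradient φ (e.symm w)‖ * |⟪v, outwardNormal X (Θ w)⟫| := by
    intro w hw v
    have h1 := (hball _ (hWU w hw).1).2.2.2.2.2.1.1
    have h2 : 0 < fderiv ℝ φ (e.symm w) n := lt_trans (by positivity) h1
    have h3 := (hball _ (hWU w hw).1).2.2.2.2.1 (hWU w hw).2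
    have h4 := norm_pos_iff.2 h3.gradient_ne
    have h5 : |fderiv ℝ φ (e.symm w) n * (slantDeriv n v (Θ' w)).det| =
      |fderiv ℝ φ (e.symm w) v| := by rw [hdetW w hw v]
    rw [abs_mul, abs_of_pos h2] at h5
    rw [h5, hΘ w hw, h3.outwardNormal_eq, inner_smul_right, abs_mul, abs_of_pos (inv_pos.2 h4),
      ← mul_assoc, mul_inv_cancel₀ h4.ne', one_mul, real_inner_comm, inner_gradient_left]
  have hbd : ∀ w ∈ W, fderiv ℝ φ (e.symm w) n ∈ Ioo (g / 2) (2 * g) ∧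
      ‖gradient φ (e.symm w)‖ ∈ Ioo (g / 2) (2 * g) := fun w hw =>
    (hball _ (hWU w hw).1).2.2.2.2.2
  refine ⟨U, Metric.ball_mem_nhds x₀ hε, ⟨?_⟩⟩
  exact
    { n := n
      W := W
      Θ := Θ
      Ψ := Ψ
      Θ' := Θ'
      -- K₁ and K₂ are Lipschitz constants of Ψ and of its inverse; 4 is the ratio of 2g to g/2.
      K := K₁ + K₂ + 4
      norm_n := hn
      measurableSet_W := hWm
      W_subset := by
        intro w hw
        have h1 := ((hball _ (hWU w hw).1).2.2.2.2.1 (hWU w hw).2).eq_zero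
        have h2 : ⟪n, Ψ (e.symm w)⟫ = 0 := by
          simp only [Ψ, h1, zero_sub, inner_add_right, inner_smul_right, real_inner_self_eq_norm_sq,
            hn]
          ring
        rwa [hΨW w hw] at h2
      isBounded_W := by
        rw [hWimg]
        rw [Metric.isBounded_iff]
        refine ⟨K₁ * (2 * ε), ?_⟩
        rintro _ ⟨y, hy, rfl⟩ _ ⟨z, hz, rfl⟩
        refine (hΨU.dist_le_mul y hy z hz).trans ?_
        gcongr
        exact (dist_triangle_right y z x₀).trans
          (by linarith [Metric.mem_ball.1 hy.1, Metric.mem_ball.1 hz.1])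
      measurable_Θ := e.continuousOn_symm.measurable_piecewise (g := fun _ => (0 : Euc d))
        continuousOn_const e.open_target.measurableSet
      image_eq := by rw [← himg]; exact image_congr hΘ
      leftInvOn := fun w hw => by rw [hΘ w hw, hΨW w hw]
      lipschitz := by
        have h1 : LipschitzOnWith K₂ e.symm W := hK₂.mono fun w hw => by
          have := (hball _ (hWU w hw).1).2.1
          rwa [hΨW w hw] at this
        have h2 : LipschitzOnWith (K₁ + K₂ + 4) e.symm W :=
          h1.weaken (le_add_right (le_add_left le_rfl))
        intro w hw w' hw'
        rw [hΘ w hw, hΘ w' hw']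
        exact h2 hw hw'
      lipschitz_symm := hΨU.weaken (le_add_right (le_add_right le_rfl))
      hasFDerivWithinAt := by
        intro w hw
        have h1 : HasFDerivAt e.symm (Θ' w) w := by
          simp only [Θ', dif_pos (hne w hw)]
          refine e.hasFDerivAt_symm (hWt hw) ?_
          rw [hD _ (hne w hw)]
          exact (hΨd _ (hball _ (hWU w hw).1).2.2.2.1).hasFDerivAt
        exact h1.hasFDerivWithinAt.congr hΘ (hΘ w hw)
      abs_det_le := by
        intro w hw v
        obtain ⟨⟨b1, b2⟩, b3, b4⟩ := hbd w hw
        have h1 := habs w hw v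
        set A := |(slantDeriv n v (Θ' w)).det|
        set B := |⟪v, outwardNormal X (Θ w)⟫|
        have hA : 0 ≤ A := abs_nonneg _
        have hB : 0 ≤ B := abs_nonneg _
        have h2 : g / 2 * A ≤ 2 * g * B :=
          (mul_le_mul_of_nonneg_right b1.le hA).trans (h1.le.trans (mul_le_mul_of_nonneg_right b4.le hB))
        have h3 : A ≤ 4 * B := by
          by_contra hlt
          nlinarith
        refine h3.trans (mul_le_mul_of_nonneg_right ?_ hB)
        push_cast
        linarith [K₁.2, K₂.2, K₁.coe_nonneg, K₂.coe_nonneg]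
      le_abs_det := by
        intro w hw v
        obtain ⟨⟨b1, b2⟩, b3, b4⟩ := hbd w hw
        have h1 := habs w hw v
        set A := |(slantDeriv n v (Θ' w)).det|
        set B := |⟪v, outwardNormal X (Θ w)⟫|
        have hA : 0 ≤ A := abs_nonneg _
        have hB : 0 ≤ B := abs_nonneg _
        have h2 : g / 2 * B ≤ 2 * g * A :=
          (mul_le_mul_of_nonneg_right b3.le hB).trans (h1.symm.le.trans (mul_le_mul_of_nonneg_right b2.le hA))
        have h3 : B ≤ 4 * A := by
          by_contra hlt
          nlinarith
        refine h3.trans (mul_le_mul_of_nonneg_right ?_ hA)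
        push_cast
        linarith [K₁.2, K₂.2, K₁.coe_nonneg, K₂.coe_nonneg] }

end

/-! ### Integration along the chords of a fixed direction. -/

section

/-- The surface measure of codimension one. -/
abbrev surfaceMeasure (d : ℕ) : Measure (Euc d) := Measure.euclideanHausdorffMeasure (d - 1)

/-- The integral of `F` over the chord of direction `v` starting at `y`. -/
def chordInt (X : Set (Euc d)) (v : Euc d) (F : Euc d → ℝ≥0∞) (y : Euc d) : ℝ≥0∞ :=
  ∫⁻ t in Ioo 0 (tauPlus X (y, v)), F (y + t • v)

/-- The flux of `F` through the boundary point `y`, if `v` points inward at `y`. -/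
def inflow (X : Set (Euc d)) (v : Euc d) (F : Euc d → ℝ≥0∞) (y : Euc d) : ℝ≥0∞ :=
  {y | ⟪v, outwardNormal X y⟫ < 0}.indicator
    (fun y => ENNReal.ofReal |⟪v, outwardNormal X y⟫| * chordInt X v F y) y

section

variable {X U : Set (Euc d)} (hX : IsC1Domain X)
include hX

lemma measurable_chordInt (v : Euc d) {F : Euc d → ℝ≥0∞} (hF : Measurable F) :
    Measurable (chordInt X v F) := by
  have hτ : Measurable fun y => tauPlus X (y, v) :=
    (measurable_tauPlus hX.isOpen hX.isBounded).comp (by fun_prop)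
  have hS : MeasurableSet {q : Euc d × ℝ | q.2 ∈ Ioo 0 (tauPlus X (q.1, v))} :=
    (measurableSet_lt measurable_const measurable_snd).inter
      (measurableSet_lt measurable_snd (hτ.comp measurable_fst))
  have h1 : Measurable ({q : Euc d × ℝ | q.2 ∈ Ioo 0 (tauPlus X (q.1, v))}.indicator
      fun q => F (q.1 + q.2 • v)) := (by fun_prop : Measurable fun q : Euc d × ℝ =>
        F (q.1 + q.2 • v)).indicator hS
  have h2 := h1.lintegral_prod_right' (ν := volume)
  convert h2 using 1
  ext1 y
  rw [chordInt, ← lintegral_indicator measurableSet_Ioo]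
  rfl

lemma measurable_inner_outwardNormal (v : Euc d) :
    Measurable fun y => ⟪v, outwardNormal X y⟫ :=
  measurable_const.inner hX.measurable_outwardNormal

lemma measurableSet_inflow (v : Euc d) : MeasurableSet {y | ⟪v, outwardNormal X y⟫ < 0} :=
  measurableSet_lt (measurable_inner_outwardNormal hX v) measurable_const

lemma measurable_inflow (v : Euc d) {F : Euc d → ℝ≥0∞} (hF : Measurable F) :
    Measurable (inflow X v F) :=
  (((measurable_inner_outwardNormal hX v).abs.ennreal_ofReal).mul
    (measurable_chordInt hX v hF)).indicator (measurableSet_inflow hX v)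

variable (c : BoundaryChart X U) (v : Euc d)

/-- The parameters of the points on the chords of direction `v` entering through `U`. -/
def slab (c : BoundaryChart X U) (v : Euc d) : Set (Euc d) :=
  {q | hyperplaneProj c.n q ∈ c.W ∧ ⟪v, outwardNormal X (c.Θ (hyperplaneProj c.n q))⟫ < 0 ∧
    ⟪c.n, q⟫ ∈ Ioo 0 (tauPlus X (c.Θ (hyperplaneProj c.n q), v))}

/-- The parametrization of the points on the chords of direction `v` entering through `U`. -/
def slant (c : BoundaryChart X U) (v : Euc d) (q : Euc d) : Euc d :=
  c.Θ (hyperplaneProj c.n q) + ⟪c.n, q⟫ • v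

lemma measurableSet_slab : MeasurableSet (slab c v) := by
  have hP : Measurable (hyperplaneProj c.n) := (hyperplaneProj c.n).measurable
  have hn : Measurable fun q : Euc d => ⟪c.n, q⟫ := measurable_const.inner measurable_id
  have hτ : Measurable fun y => tauPlus X (y, v) :=
    (measurable_tauPlus hX.isOpen hX.isBounded).comp (by fun_prop)
  refine (hP c.measurableSet_W).inter (((c.measurable_Θ.comp hP) (measurableSet_inflow hX v)).inter
    ((measurableSet_lt measurable_const hn).inter
      (measurableSet_lt hn (hτ.comp (c.measurable_Θ.comp hP)))))

omit hX in
lemma hasFDerivWithinAt_slant {q : Euc d} {s : Set (Euc d)}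
    (hs : s ⊆ {q | hyperplaneProj c.n q ∈ c.W}) (hq : q ∈ s) :
    HasFDerivWithinAt (slant c v) (slantDeriv c.n v (c.Θ' (hyperplaneProj c.n q))) s q := by
  have h1 : HasFDerivWithinAt (fun q => c.Θ (hyperplaneProj c.n q))
      ((c.Θ' (hyperplaneProj c.n q)).comp (hyperplaneProj c.n)) s q :=
    (c.hasFDerivWithinAt _ (hs hq)).comp q (hyperplaneProj c.n).hasFDerivAt.hasFDerivWithinAt
      fun x hx => hs hx
  have h2 : HasFDerivWithinAt (fun q : Euc d => ⟪c.n, q⟫ • v) ((innerSL ℝ c.n).smulRight v) s q :=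
    (innerSL ℝ c.n).hasFDerivAt.hasFDerivWithinAt.smul_const v
  exact h1.add h2

omit hX in
lemma Θ_mem_frontier {w : Euc d} (hw : w ∈ c.W) : c.Θ w ∈ U ∩ frontier X := by
  rw [← c.image_eq]; exact mem_image_of_mem _ hw

omit hX in
lemma eq_hyperplaneProj_add (c : BoundaryChart X U) (q : Euc d) :
    q = hyperplaneProj c.n q + ⟪c.n, q⟫ • c.n := by
  rw [hyperplaneProj_apply]; abel

lemma frontier_notMem {y : Euc d} (hy : y ∈ frontier X) : y ∉ X := by
  rw [hX.isOpen.frontier_eq] at hy; exact hy.2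

/-- Two representations of a point with different times would place the starting point of one chord
in the interior of the other, hence in X; but boundary points of an open set lie outside it. -/
lemma injOn_slant : InjOn (slant c v) (slab c v) := by
  have key : ∀ y ∈ frontier X, ∀ y' ∈ frontier X, ∀ t t' : ℝ, 0 < t →
      t' < tauPlus X (y', v) → y + t • v = y' + t' • v → t < t' → False := by
    intro y hy y' hy' t t' ht ht' he hlt
    refine frontier_notMem hX hy ?_
    have : y = y' + (t' - t) • v := by rw [sub_smul, ← add_sub_assoc, ← he]; abel
    rw [this]
    exact mem_of_lt_tauPlus (z := (y', v)) (by linarith) (by linarith)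
  rintro q ⟨h1, h2, h3⟩ q' ⟨h1', h2', h3'⟩ he
  have hy := (Θ_mem_frontier c h1).2
  have hy' := (Θ_mem_frontier c h1').2
  have ht : ⟪c.n, q⟫ = ⟪c.n, q'⟫ := by
    rcases lt_trichotomy ⟪c.n, q⟫ ⟪c.n, q'⟫ with h | h | h
    · exact (key _ hy _ hy' _ _ h3.1 h3'.2 he h).elim
    · exact h
    · exact (key _ hy' _ hy _ _ h3'.1 h3.2 he.symm h).elim
  have hΘ : c.Θ (hyperplaneProj c.n q) = c.Θ (hyperplaneProj c.n q') := by
    have he' : c.Θ (hyperplaneProj c.n q) + ⟪c.n, q⟫ • v =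
      c.Θ (hyperplaneProj c.n q') + ⟪c.n, q'⟫ • v := he
    rw [ht] at he'
    exact add_right_cancel he'
  have hP := c.leftInvOn.injOn h1 h1' hΘ
  rw [eq_hyperplaneProj_add c q, eq_hyperplaneProj_add c q', hP, ht]

omit hX in
lemma slant_image_subset : slant c v '' slab c v ⊆ X := by
  rintro _ ⟨q, ⟨-, -, h3⟩, rfl⟩
  exact mem_of_lt_tauPlus (z := (c.Θ (hyperplaneProj c.n q), v)) h3.1 h3.2

variable {v}

lemma tauMinus_pos (hv : v ≠ 0) {x : Euc d} (hx : x ∈ X) : 0 < tauMinus X (x, v) := by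
  rw [tauMinus_eq]
  exact tauPlus_pos_of_mem hX.isBounded (neg_ne_zero.2 hv)
    ((tendsto_line_nhdsGT x (-v)).eventually (hX.isOpen.mem_nhds hx))

lemma entry_mem_frontier (hv : v ≠ 0) {x : Euc d} (hx : x ∈ X) :
    x - tauMinus X (x, v) • v ∈ frontier X := by
  have h := exit_mem_frontier (z := (x, -v)) hX.isOpen hX.isBounded (neg_ne_zero.2 hv)
    (by have := tauMinus_pos hX hv hx; rwa [tauMinus_eq] at this)
  rw [tauMinus_eq]
  simpa [sub_eq_add_neg] using h

omit hX in
lemma entry_add_mem {x : Euc d} (hx : x ∈ X) {s : ℝ} (hs0 : 0 < s)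
    (hs : s ≤ tauMinus X (x, v)) : x - tauMinus X (x, v) • v + s • v ∈ X := by
  have e : x - tauMinus X (x, v) • v + s • v = x - (tauMinus X (x, v) - s) • v := by
    rw [sub_smul]; abel
  rw [e]
  rcases hs.eq_or_lt with h | h
  · rw [h, sub_self, zero_smul, sub_zero]; exact hx
  · exact mem_of_lt_tauMinus (z := (x, v)) (by linarith) (by linarith)

/-- An outward direction at the entry point would be outside X for small times, whereas the line is
inside X right after entry. -/
lemma inner_entry_nonpos (hv : v ≠ 0) {x : Euc d} (hx : x ∈ X) :
    ⟪v, outwardNormal X (x - tauMinus X (x, v) • v)⟫ ≤ 0 := by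
  by_contra h
  have h1 := hX.eventually_notMem (entry_mem_frontier hX hv hx) (not_le.1 h)
  obtain ⟨t, h2, h3⟩ := (h1.and (Ioc_mem_nhdsGT (tauMinus_pos hX hv hx))).exists
  exact h2 (entry_add_mem hx h3.1 h3.2)

lemma mem_slant_image (hv : v ≠ 0) {x : Euc d} (hx : x ∈ X)
    (hU : x - tauMinus X (x, v) • v ∈ U)
    (hneg : ⟪v, outwardNormal X (x - tauMinus X (x, v) • v)⟫ < 0) :
    x ∈ slant c v '' slab c v := by
  set t := tauMinus X (x, v) with ht
  have ht0 : 0 < t := tauMinus_pos hX hv hx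
  have hy : x - t • v ∈ U ∩ frontier X := ⟨hU, entry_mem_frontier hX hv hx⟩
  obtain ⟨w, hw, hwy⟩ := c.image_eq.symm ▸ hy
  have hP := hyperplaneProj_add_smul c.norm_n (c.W_subset hw) t
  have hn := inner_add_smul_of_mem_hyperplane c.norm_n (c.W_subset hw) t
  have hlt : t < tauPlus X (x - t • v, v) := by
    by_contra h
    have hpos : 0 < tauPlus X (x - t • v, v) :=
      tauPlus_pos_of_mem hX.isBounded hv (hX.eventually_mem hy.2 hneg)
    exact exit_notMem (z := (x - t • v, v)) hX.isOpen hX.isBounded hv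
      (entry_add_mem hx hpos (not_lt.1 h))
  refine ⟨w + t • c.n, ⟨?_, ?_, ?_⟩, ?_⟩
  · rw [hP]; exact hw
  · rw [hP, hwy]; exact hneg
  · rw [hP, hn, hwy]; exact ⟨ht0, hlt⟩
  · rw [slant, hP, hn, hwy]; abel

-- A Sard argument: where v is tangential the Jacobian of the slanted map vanishes, so the image of
-- these parameters is null.
include c in
lemma volume_tangential_eq_zero (hv : v ≠ 0) : volume {x ∈ X |
    x - tauMinus X (x, v) • v ∈ U ∧ ⟪v, outwardNormal X (x - tauMinus X (x, v) • v)⟫ = 0} = 0 := by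
  set s : Set (Euc d) := {q | hyperplaneProj c.n q ∈ c.W ∧
    ⟪v, outwardNormal X (c.Θ (hyperplaneProj c.n q))⟫ = 0}
  have h0 : volume (slant c v '' s) = 0 := by
    refine addHaar_image_eq_zero_of_det_fderivWithin_eq_zero volume
      (fun q hq => hasFDerivWithinAt_slant c v (fun q hq => hq.1) hq) fun q hq => ?_
    have := c.abs_det_le _ hq.1 v
    rw [hq.2, abs_zero, mul_zero] at this
    exact abs_nonpos_iff.1 this
  refine measure_mono_null ?_ h0
  rintro x ⟨hx, hU, hz⟩
  set t := tauMinus X (x, v) with ht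
  have hy : x - t • v ∈ U ∩ frontier X := ⟨hU, entry_mem_frontier hX hv hx⟩
  obtain ⟨w, hw, hwy⟩ := c.image_eq.symm ▸ hy
  have hP := hyperplaneProj_add_smul c.norm_n (c.W_subset hw) t
  have hn := inner_add_smul_of_mem_hyperplane c.norm_n (c.W_subset hw) t
  refine ⟨w + t • c.n, ⟨?_, ?_⟩, ?_⟩
  · rw [hP]; exact hw
  · rw [hP, hwy]; exact hz
  · rw [slant, hP, hn, hwy]; abel

/-- Fubini in the coordinates w + t n: over w in W with v inward at Θ w, the slab consists exactly
of the times of the chord issuing from Θ w. -/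
lemma lintegral_slab (v : Euc d) {F : Euc d → ℝ≥0∞} (hF : Measurable F) :
    ∫⁻ q in slab c v, ENNReal.ofReal |⟪v, outwardNormal X (c.Θ (hyperplaneProj c.n q))⟫| *
      F (slant c v q) = ∫⁻ w in c.W, inflow X v F (c.Θ w) ∂(surfaceMeasure d) := by
  have hP : Measurable (hyperplaneProj c.n) := (hyperplaneProj c.n).measurable
  have hn : Measurable fun q : Euc d => ⟪c.n, q⟫ := measurable_const.inner measurable_id
  have hΘP := c.measurable_Θ.comp hP
  have hm : Measurable fun q => ENNReal.ofReal
      |⟪v, outwardNormal X (c.Θ (hyperplaneProj c.n q))⟫| * F (slant c v q) := by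
    refine ((measurable_inner_outwardNormal hX v).comp hΘP).abs.ennreal_ofReal.mul (hF.comp ?_)
    exact hΘP.add (hn.smul_const v)
  rw [← lintegral_indicator (measurableSet_slab hX c v),
    lintegral_eq_lintegral_hyperplane c.norm_n (hm.indicator (measurableSet_slab hX c v))]
  have hH : MeasurableSet (hyperplane c.n) := measurableSet_eq_fun hn measurable_const
  rw [← lintegral_indicator hH, ← lintegral_indicator c.measurableSet_W]
  refine lintegral_congr fun w => ?_
  by_cases hw : w ∈ hyperplane c.n
  · rw [indicator_of_mem hw]
    by_cases hwW : w ∈ c.W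
    · rw [indicator_of_mem hwW]
      by_cases hneg : ⟪v, outwardNormal X (c.Θ w)⟫ < 0
      · rw [inflow, indicator_of_mem (show c.Θ w ∈ {y | ⟪v, outwardNormal X y⟫ < 0} from hneg),
          chordInt, ← lintegral_const_mul' _ _ ENNReal.ofReal_ne_top,
          ← lintegral_indicator measurableSet_Ioo]
        refine lintegral_congr fun t => ?_
        have h1 := hyperplaneProj_add_smul c.norm_n hw t
        have h2 := inner_add_smul_of_mem_hyperplane c.norm_n hw t
        by_cases ht : t ∈ Ioo 0 (tauPlus X (c.Θ w, v))
        · rw [indicator_of_mem ht, indicator_of_mem]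
          · rw [slant, h1, h2]
          · refine ⟨?_, ?_, ?_⟩
            · rw [h1]; exact hwW
            · rw [h1]; exact hneg
            · rw [h1, h2]; exact ht
        · rw [indicator_of_notMem ht, indicator_of_notMem]
          rintro ⟨-, -, h3⟩
          rw [h1, h2] at h3
          exact ht h3
      · rw [inflow, indicator_of_notMem (show c.Θ w ∉ {y | ⟪v, outwardNormal X y⟫ < 0} from hneg)]
        refine (lintegral_congr fun t => ?_).trans lintegral_zero
        rw [indicator_of_notMem]
        rintro ⟨-, h3, -⟩
        rw [hyperplaneProj_add_smul c.norm_n hw t] at h3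
        exact hneg h3
    · rw [indicator_of_notMem hwW]
      refine (lintegral_congr fun t => ?_).trans lintegral_zero
      rw [indicator_of_notMem]
      rintro ⟨h3, -, -⟩
      rw [hyperplaneProj_add_smul c.norm_n hw t] at h3
      exact hwW h3
  · rw [indicator_of_notMem hw, indicator_of_notMem fun h => hw (c.W_subset h)]

lemma lintegral_slant_image (v : Euc d) (F : Euc d → ℝ≥0∞) :
    ∫⁻ x in slant c v '' slab c v, F x = ∫⁻ q in slab c v,
      ENNReal.ofReal |(slantDeriv c.n v (c.Θ' (hyperplaneProj c.n q))).det| * F (slant c v q) :=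
  lintegral_image_eq_lintegral_abs_det_fderiv_mul volume (measurableSet_slab hX c v)
    (fun _ hq => hasFDerivWithinAt_slant c v (fun _ hq => hq.1) hq) (injOn_slant hX c v) F

lemma lintegral_chart_le (v : Euc d) {F : Euc d → ℝ≥0∞} (hF : Measurable F) :
    ∫⁻ w in c.W, inflow X v F (c.Θ w) ∂(surfaceMeasure d) ≤ c.K * ∫⁻ x in X, F x := by
  rw [← lintegral_slab hX c v hF]
  calc _ ≤ ∫⁻ q in slab c v, (c.K : ℝ≥0∞) * (ENNReal.ofReal
        |(slantDeriv c.n v (c.Θ' (hyperplaneProj c.n q))).det| * F (slant c v q)) := by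
        refine setLIntegral_mono' (measurableSet_slab hX c v) fun q hq => ?_
        rw [← mul_assoc]
        gcongr
        rw [← ENNReal.ofReal_coe_nnreal, ← ENNReal.ofReal_mul c.K.coe_nonneg]
        exact ENNReal.ofReal_le_ofReal (c.le_abs_det _ hq.1 v)
    _ = c.K * ∫⁻ x in slant c v '' slab c v, F x := by
        rw [lintegral_const_mul' _ _ ENNReal.coe_ne_top, lintegral_slant_image hX c v]
    _ ≤ _ := by
        gcongr
        exact slant_image_subset c v

lemma lintegral_le_chart (hv : v ≠ 0) {F : Euc d → ℝ≥0∞} (hF : Measurable F) :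
    ∫⁻ x in {x ∈ X | x - tauMinus X (x, v) • v ∈ U}, F x ≤
      c.K * ∫⁻ w in c.W, inflow X v F (c.Θ w) ∂(surfaceMeasure d) := by
  have hsub : {x ∈ X | x - tauMinus X (x, v) • v ∈ U} ⊆ slant c v '' slab c v ∪ {x ∈ X |
    x - tauMinus X (x, v) • v ∈ U ∧ ⟪v, outwardNormal X (x - tauMinus X (x, v) • v)⟫ = 0} := by
    rintro x ⟨hx, hU⟩
    rcases (inner_entry_nonpos hX hv hx).eq_or_lt with h | h
    · exact Or.inr ⟨hx, hU, h⟩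
    · exact Or.inl (mem_slant_image hX c hv hx hU h)
  rw [← lintegral_slab hX c v hF]
  calc _ ≤ ∫⁻ x in slant c v '' slab c v ∪ {x ∈ X | x - tauMinus X (x, v) • v ∈ U ∧
          ⟪v, outwardNormal X (x - tauMinus X (x, v) • v)⟫ = 0}, F x := lintegral_mono_set hsub
    _ ≤ (∫⁻ x in slant c v '' slab c v, F x) + 0 := by
        refine (lintegral_union_le _ _ _).trans (le_of_eq ?_)
        rw [setLIntegral_measure_zero _ _ (volume_tangential_eq_zero hX c hv)]
    _ ≤ ∫⁻ q in slab c v, (c.K : ℝ≥0∞) * (ENNReal.ofReal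
          |⟪v, outwardNormal X (c.Θ (hyperplaneProj c.n q))⟫| * F (slant c v q)) := by
        rw [add_zero, lintegral_slant_image hX c v]
        refine setLIntegral_mono' (measurableSet_slab hX c v) fun q hq => ?_
        rw [← mul_assoc]
        gcongr
        rw [← ENNReal.ofReal_coe_nnreal, ← ENNReal.ofReal_mul c.K.coe_nonneg]
        exact ENNReal.ofReal_le_ofReal (c.abs_det_le _ hq.1 v)
    _ = _ := lintegral_const_mul' _ _ ENNReal.coe_ne_top

-- No area formula is needed: a Lipschitz map multiplies the (d-1)-dimensional Hausdorff measure by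
-- at most K^(d-1). Applied to the inverse of the chart it gives this inequality, applied to the
-- chart the converse one.
omit hX in
lemma map_chart_le : ((surfaceMeasure d).restrict c.W).map c.Θ ≤
    (c.K : ℝ≥0∞) ^ (d - 1) • (surfaceMeasure d).restrict (U ∩ frontier X) := by
  refine Measure.le_iff.2 fun A hA => ?_
  rw [Measure.map_apply c.measurable_Θ hA, Measure.restrict_apply (c.measurable_Θ hA),
    Measure.smul_apply, Measure.restrict_apply hA, smul_eq_mul]
  have e : c.Θ ⁻¹' A ∩ c.W = c.Ψ '' (A ∩ (U ∩ frontier X)) := by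
    rw [← c.image_eq]
    ext w
    constructor
    · rintro ⟨h1, h2⟩
      exact ⟨c.Θ w, ⟨h1, mem_image_of_mem _ h2⟩, c.leftInvOn h2⟩
    · rintro ⟨_, ⟨h1, w', hw', rfl⟩, rfl⟩
      rw [c.leftInvOn hw']
      exact ⟨h1, hw'⟩
  rw [e]
  exact euclideanHausdorffMeasure_image_le (c.lipschitz_symm.mono inter_subset_right) _

omit hX in
lemma le_map_chart : (surfaceMeasure d).restrict (U ∩ frontier X) ≤
    (c.K : ℝ≥0∞) ^ (d - 1) • ((surfaceMeasure d).restrict c.W).map c.Θ := by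
  refine Measure.le_iff.2 fun A hA => ?_
  rw [Measure.smul_apply, Measure.map_apply c.measurable_Θ hA,
    Measure.restrict_apply (c.measurable_Θ hA), Measure.restrict_apply hA, smul_eq_mul]
  have e : A ∩ (U ∩ frontier X) = c.Θ '' (c.Θ ⁻¹' A ∩ c.W) := by
    rw [← c.image_eq, inter_comm, image_inter_preimage c.Θ c.W A |>.symm, inter_comm]
  rw [e]
  exact euclideanHausdorffMeasure_image_le (c.lipschitz.mono inter_subset_right) _

omit hX in
include c in
lemma surfaceMeasure_chart_lt_top : surfaceMeasure d (U ∩ frontier X) < ⊤ := by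
  rw [← c.image_eq]
  refine (euclideanHausdorffMeasure_image_le c.lipschitz _).trans_lt (ENNReal.mul_lt_top ?_
    (euclideanHausdorffMeasure_lt_top c.norm_n c.W_subset c.isBounded_W))
  exact ENNReal.pow_lt_top ENNReal.coe_lt_top

lemma local_inflow_le (v : Euc d) {F : Euc d → ℝ≥0∞} (hF : Measurable F) :
    ∫⁻ y in U ∩ frontier X, inflow X v F y ∂(surfaceMeasure d) ≤
      (c.K : ℝ≥0∞) ^ (d - 1) * c.K * ∫⁻ x in X, F x := by
  refine (lintegral_mono' (le_map_chart c) le_rfl).trans ?_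
  rw [lintegral_smul_measure, lintegral_map (measurable_inflow hX v hF) c.measurable_Θ,
    smul_eq_mul, mul_assoc]
  gcongr
  exact lintegral_chart_le hX c v hF

lemma local_le_inflow (hv : v ≠ 0) {F : Euc d → ℝ≥0∞} (hF : Measurable F) :
    ∫⁻ x in {x ∈ X | x - tauMinus X (x, v) • v ∈ U}, F x ≤
      (c.K : ℝ≥0∞) ^ (d - 1) * c.K *
        ∫⁻ y in U ∩ frontier X, inflow X v F y ∂(surfaceMeasure d) := by
  refine (lintegral_le_chart hX c hv hF).trans ?_
  rw [mul_comm _ (c.K : ℝ≥0∞), mul_assoc]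
  gcongr
  rw [← smul_eq_mul, ← lintegral_smul_measure,
    ← lintegral_map (measurable_inflow hX v hF) c.measurable_Θ]
  exact lintegral_mono' (map_chart_le c) le_rfl

/-- Integration along the chords of direction `v`: up to constants, the measure
`|v · ν| dμ dt` is Lebesgue measure. -/
theorem IsC1Domain.exists_inflow_comparison : ∃ C : ℝ≥0∞, C ≠ ⊤ ∧
    surfaceMeasure d (frontier X) < ⊤ ∧ ∀ v : Euc d, v ≠ 0 → ∀ F : Euc d → ℝ≥0∞, Measurable F →
      ∫⁻ y in frontier X, inflow X v F y ∂(surfaceMeasure d) ≤ C * ∫⁻ x in X, F x ∧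
      ∫⁻ x in X, F x ≤ C * ∫⁻ y in frontier X, inflow X v F y ∂(surfaceMeasure d) := by
  have hcomp : IsCompact (frontier X) :=
    hX.isBounded.isCompact_closure.of_isClosed_subset isClosed_frontier frontier_subset_closure
  choose! U hU hUc using fun x (hx : x ∈ frontier X) => show ∃ U ∈ 𝓝 x, Nonempty (BoundaryChart X U)
    from (hX.exists_defining x hx).elim fun φ h => h.exists_boundaryChart hX.isOpen
  -- Finitely many charts cover the compact boundary. Since only inequalities are wanted, overlaps
  -- do no harm and the local constants are simply added.
  obtain ⟨t, ht, hcov⟩ := hcomp.elim_nhds_subcover U hU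
  let c : ∀ x : t, BoundaryChart X (U x) := fun x => (hUc x (ht x x.2)).some
  have hcov' : ∀ y ∈ frontier X, ∃ x : t, y ∈ U x := fun y hy => by
    obtain ⟨x, hx, hy⟩ := mem_iUnion₂.1 (hcov hy)
    exact ⟨⟨x, hx⟩, hy⟩
  have hfr : frontier X ⊆ ⋃ x : t, U x ∩ frontier X := fun y hy => by
    obtain ⟨x, hx⟩ := hcov' y hy
    exact mem_iUnion.2 ⟨x, hx, hy⟩
  refine ⟨∑ x : t, ((c x).K : ℝ≥0∞) ^ (d - 1) * (c x).K, ?_, ?_, fun v hv F hF => ⟨?_, ?_⟩⟩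
  · exact (ENNReal.sum_lt_top.2 fun x _ => ENNReal.mul_lt_top
      (ENNReal.pow_lt_top ENNReal.coe_lt_top) ENNReal.coe_lt_top).ne
  · refine ((measure_mono hfr).trans (measure_iUnion_le _)).trans_lt ?_
    rw [tsum_fintype]
    exact ENNReal.sum_lt_top.2 fun x _ => surfaceMeasure_chart_lt_top (c x)
  · refine ((lintegral_mono_set hfr).trans (lintegral_iUnion_le _ _)).trans ?_
    rw [tsum_fintype, Finset.sum_mul]
    exact Finset.sum_le_sum fun x _ => local_inflow_le hX (c x) v hF
  · have hXU : X ⊆ ⋃ x : t, {y ∈ X | y - tauMinus X (y, v) • v ∈ U x} := fun y hy => by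
      obtain ⟨x, hx⟩ := hcov' _ (entry_mem_frontier hX hv hy)
      exact mem_iUnion.2 ⟨x, hy, hx⟩
    refine ((lintegral_mono_set hXU).trans (lintegral_iUnion_le _ _)).trans ?_
    rw [tsum_fintype, Finset.sum_mul]
    refine Finset.sum_le_sum fun x _ => (local_le_inflow hX (c x) hv hF).trans ?_
    gcongr
    exact inter_subset_right

end

end

section

/-! ### Velocity sets: finite measure and speeds bounded below. -/

section Velocities

/-- Near each of its points V lies in the boundary of an open set φ < 0, so a boundary chart shows
that the surface measure is locally finite on V; compactness does the rest. -/
lemma IsC1Hypersurface.surfaceMeasure_lt_top {V : Set (Euc d)} (hV : IsC1Hypersurface V)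
    (hc : IsCompact V) : surfaceMeasure d V < ⊤ := by
  refine hc.measure_lt_top_of_nhdsWithin fun v hv => ?_
  obtain ⟨φ, h1, h2, h3⟩ := hV v hv
  have hφ0 : φ v = 0 := h3.self_of_nhds.1 hv
  obtain ⟨ε, hε, hball⟩ := Metric.eventually_nhds_iff_ball.1 (h1.eventually (by simp))
  set X : Set (Euc d) := Metric.ball v ε ∩ φ ⁻¹' Iio 0 with hXdef
  have hX : IsOpen X := ContinuousOn.isOpen_inter_preimage
    (fun y hy => (hball y hy).continuousAt.continuousWithinAt) Metric.isOpen_ball isOpen_Iio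
  have hmem : ∀ y ∈ Metric.ball v ε, (y ∈ X ↔ φ y < 0) := fun y hy => by
    simp only [hXdef, mem_inter_iff, mem_preimage, mem_Iio, hy, true_and]
  have hdef : IsDefiningFunctionAt X v φ := ⟨h1, hφ0, h2, by
    filter_upwards [Metric.ball_mem_nhds v hε] with y hy using hmem y hy⟩
  obtain ⟨U, hU, ⟨c⟩⟩ := hdef.exists_boundaryChart hX
  have hg : ContinuousAt (gradient φ) v :=
    (InnerProductSpace.toDual ℝ (Euc d)).symm.continuous.continuousAt.comp
      (h1.fderiv_right (m := 0) (by norm_num)).continuousAt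
  have hnhds : ∀ᶠ y in 𝓝 v, y ∈ V → y ∈ U ∩ frontier X := by
    filter_upwards [hU, h3, Metric.ball_mem_nhds v hε, hg.eventually_ne h2] with y a1 a2 a3 a4 hy
    refine ⟨a1, IsDefiningFunctionAt.mem_frontier (φ := φ) ⟨hball y a3, a2.1 hy, a4, ?_⟩⟩
    filter_upwards [Metric.isOpen_ball.mem_nhds a3] with w hw using hmem w hw
  refine ⟨_, ?_, surfaceMeasure_chart_lt_top c⟩
  rw [mem_nhdsWithin_iff_eventually]
  exact hnhds

/-- The properties of a velocity set used below. -/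
structure VelocityBounds (V : Set (Euc d)) (m : Measure (Euc d)) : Prop where
  isFiniteMeasure : IsFiniteMeasure m
  measurableSet : MeasurableSet V
  ae_mem : ∀ᵐ v ∂m, v ∈ V
  null_orthogonal : ∀ e : Euc d, e ≠ 0 → m {v | ⟪v, e⟫ = 0} = 0
  exists_le_norm : ∃ r > 0, ∀ v ∈ V, r ≤ ‖v‖

lemma VelocityBounds.ne_zero {V : Set (Euc d)} {m : Measure (Euc d)} (h : VelocityBounds V m)
    {v : Euc d} (hv : v ∈ V) : v ≠ 0 := by
  obtain ⟨r, hr, h⟩ := h.exists_le_norm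
  exact norm_pos_iff.1 (hr.trans_le (h v hv))

lemma exists_le_norm_of_zero_notMem_closure {V : Set (Euc d)} (h : 0 ∉ closure V) :
    ∃ r > 0, ∀ v ∈ V, r ≤ ‖v‖ := by
  obtain ⟨r, hr, h⟩ := Metric.mem_nhds_iff.1 (isClosed_closure.isOpen_compl.mem_nhds h)
  refine ⟨r, hr, fun v hv => ?_⟩
  by_contra hlt
  exact h (mem_ball_zero_iff.2 (not_le.1 hlt)) (subset_closure hv)

lemma IsVelocitySet.velocityBounds {V : Set (Euc d)} {m : Measure (Euc d)}
    (h : IsVelocitySet V m) : VelocityBounds V m := by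
  cases h with
  | ofOpen isOpen isBounded zero_notMem measure_eq =>
    subst measure_eq
    refine ⟨⟨by simpa using isBounded.measure_lt_top⟩, isOpen.measurableSet,
      ae_restrict_mem isOpen.measurableSet, fun e he => ?_,
      exists_le_norm_of_zero_notMem_closure zero_notMem⟩
    refine Measure.restrict_le_self.absolutelyContinuous ?_
    have e1 : {v : Euc d | ⟪v, e⟫ = 0} = ((Submodule.span ℝ {e})ᗮ : Submodule ℝ (Euc d)) := by
      ext v
      simp [Submodule.mem_orthogonal_singleton_iff_inner_left]
    rw [e1]
    refine Measure.addHaar_submodule _ _ fun htop => he ?_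
    have : e ∈ (Submodule.span ℝ {e})ᗮ := by rw [htop]; trivial
    exact inner_self_eq_zero.1 (Submodule.mem_orthogonal_singleton_iff_inner_left.1 this)
  | ofSurface isCompact isSurface zero_notMem measure_eq null_orthogonal =>
    subst measure_eq
    exact ⟨⟨by simpa using isSurface.surfaceMeasure_lt_top isCompact⟩, isCompact.measurableSet,
      ae_restrict_mem isCompact.measurableSet, null_orthogonal,
      exists_le_norm_of_zero_notMem_closure (by rwa [isCompact.isClosed.closure_eq])⟩

end Velocities

/-! ### Chords, and quantities that are constant along them. -/

section Lines

/-- The point reached from `z = (x, v)` at time `r`. -/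
def flow (z : Euc d × Euc d) (r : ℝ) : Euc d × Euc d := (z.1 + r • z.2, z.2)

lemma flow_zero (z : Euc d × Euc d) : flow z 0 = z := by simp [flow]

lemma flow_flow (z : Euc d × Euc d) (r s : ℝ) : flow (flow z r) s = flow z (r + s) := by
  simp [flow, add_smul, add_assoc]

@[fun_prop]
lemma measurable_flow : Measurable fun w : (Euc d × Euc d) × ℝ => flow w.1 w.2 := by
  unfold flow; fun_prop

lemma measurable_flow_right (z : Euc d × Euc d) : Measurable (flow z) := by
  unfold flow; fun_prop

lemma exitPoint_eq_flow (X : Set (Euc d)) (z : Euc d × Euc d) :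
    exitPoint X z = flow z (tauPlus X z) := rfl

lemma entryPoint_eq_flow (X : Set (Euc d)) (z : Euc d × Euc d) :
    entryPoint X z = flow z (-tauMinus X z) := by simp [entryPoint, flow, sub_eq_add_neg]

/-- The points of lines that meet `X` in an open segment and enter and leave `X` transversally. -/
def goodSet (X V : Set (Euc d)) : Set (Euc d × Euc d) :=
  {z | (z.1 ∈ X ∨ z ∈ Gamma X V) ∧ entryPoint X z ∈ GammaMinus X V ∧ exitPoint X z ∈ GammaPlus X V}

/-- The parameters of the part in `X` of the line through `z`. -/
def chord (X : Set (Euc d)) (z : Euc d × Euc d) : Set ℝ := Ioo (-tauMinus X z) (tauPlus X z)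

lemma measurableSet_chord (X : Set (Euc d)) (z : Euc d × Euc d) : MeasurableSet (chord X z) :=
  measurableSet_Ioo

variable {X V : Set (Euc d)} {m : Measure (Euc d)} (hX : IsC1Domain X) {z : Euc d × Euc d} {r : ℝ}

include hX in
lemma tauMinus_of_mem_GammaMinus (hz : z ∈ GammaMinus X V) : tauMinus X z = 0 := by
  rw [tauMinus_eq]
  refine tauPlus_eq_zero_of_frequently (Eventually.frequently ?_)
  exact hX.eventually_notMem hz.1 (by rw [inner_neg_left]; linarith [hz.2.2])

include hX in
lemma tauPlus_of_mem_GammaPlus (hz : z ∈ GammaPlus X V) : tauPlus X z = 0 :=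
  tauPlus_eq_zero_of_frequently (hX.eventually_notMem hz.1 hz.2.2).frequently

include hX in
lemma entryPoint_of_mem_GammaMinus (hz : z ∈ GammaMinus X V) : entryPoint X z = z := by
  rw [entryPoint_eq_flow, tauMinus_of_mem_GammaMinus hX hz, neg_zero, flow_zero]

include hX in
lemma exitPoint_of_mem_GammaPlus (hz : z ∈ GammaPlus X V) : exitPoint X z = z := by
  rw [exitPoint_eq_flow, tauPlus_of_mem_GammaPlus hX hz, flow_zero]

lemma disjoint_Gamma (h1 : z ∈ GammaMinus X V) (h2 : z ∈ GammaPlus X V) : False :=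
  lt_asymm h1.2.2 h2.2.2

lemma snd_mem_of_goodSet (hz : z ∈ goodSet X V) : z.2 ∈ V := hz.2.1.2.1

include hX in
lemma mem_of_mem_chord (hz : z ∈ goodSet X V) (hr : r ∈ chord X z) : (flow z r).1 ∈ X := by
  rcases lt_trichotomy r 0 with h | h | h
  · have := mem_of_lt_tauMinus (X := X) (z := z) (t := -r) (by linarith) (by linarith [hr.1])
    simpa [flow] using this
  · subst h
    rw [flow_zero]
    -- For a boundary point one of the travel times is 0, and then 0 does not belong to the open
    -- interval.
    rcases hz.1 with h1 | h1 | h1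
    · exact h1
    · have := hr.2; rw [tauPlus_of_mem_GammaPlus hX h1] at this; exact absurd this (lt_irrefl _)
    · have := hr.1; rw [tauMinus_of_mem_GammaMinus hX h1, neg_zero] at this
      exact absurd this (lt_irrefl _)
  · exact mem_of_lt_tauPlus (X := X) (z := z) h hr.2

variable (hV : VelocityBounds V m)
include hX hV

lemma tauPlus_pos_of_goodSet_of_mem_GammaMinus (hz : z ∈ GammaMinus X V) : 0 < tauPlus X z :=
  tauPlus_pos_of_mem hX.isBounded (hV.ne_zero hz.2.1) (hX.eventually_mem hz.1 hz.2.2)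

lemma tauMinus_pos_of_mem_GammaPlus (hz : z ∈ GammaPlus X V) : 0 < tauMinus X z := by
  rw [tauMinus_eq]
  exact tauPlus_pos_of_mem hX.isBounded (neg_ne_zero.2 (hV.ne_zero hz.2.1))
    (hX.eventually_mem hz.1 (by rw [inner_neg_left]; linarith [hz.2.2]))

lemma tau_pos (hz : z ∈ goodSet X V) : 0 < tau X z := by
  have h1 := tauMinus_nonneg X z
  have h2 := tauPlus_nonneg X z
  unfold tau
  rcases hz.1 with h | h | h
  · have := tauMinus_pos hX (hV.ne_zero (snd_mem_of_goodSet hz)) h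
    have : 0 < tauMinus X z := this
    linarith
  · linarith [tauMinus_pos_of_mem_GammaPlus hX hV h]
  · linarith [tauPlus_pos_of_goodSet_of_mem_GammaMinus hX hV h]

/-- From a good point the line is inside X on the whole open chord and outside at its end. At the
end itself the travel time is 0 by transversality, so the closed interval of parameters is allowed.
-/
lemma tauPlus_flow (hz : z ∈ goodSet X V) (hr : r ∈ Icc (-tauMinus X z) (tauPlus X z)) :
    tauPlus X (flow z r) = tauPlus X z - r := by
  rcases hr.2.eq_or_lt with h | h
  · rw [h, sub_self, ← exitPoint_eq_flow]
    exact tauPlus_of_mem_GammaPlus hX hz.2.2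
  · refine tauPlus_eq_of_Ioo (by linarith) (fun s hs => ?_) ?_
    · change (flow (flow z r) s).1 ∈ X
      rw [flow_flow]
      exact mem_of_mem_chord hX hz ⟨by linarith [hs.1, hr.1], by linarith [hs.2]⟩
    · change (flow (flow z r) (tauPlus X z - r)).1 ∉ X
      rw [flow_flow, add_sub_cancel]
      exact frontier_notMem hX hz.2.2.1

lemma tauMinus_flow (hz : z ∈ goodSet X V) (hr : r ∈ Icc (-tauMinus X z) (tauPlus X z)) :
    tauMinus X (flow z r) = tauMinus X z + r := by
  rcases hr.1.eq_or_lt with h | h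
  · rw [← h, add_neg_cancel, ← entryPoint_eq_flow]
    exact tauMinus_of_mem_GammaMinus hX hz.2.1
  · rw [tauMinus_eq]
    refine tauPlus_eq_of_Ioo (by linarith) (fun s hs => ?_) ?_
    · have : (flow z (r - s)).1 ∈ X :=
        mem_of_mem_chord hX hz ⟨by linarith [hs.2], by linarith [hs.1, hr.2]⟩
      have e : (flow z r).1 + s • -(flow z r).2 = (flow z (r - s)).1 := by
        simp only [flow, sub_smul, smul_neg]; abel
      rw [← e] at this
      exact this
    · have h1 : (flow z (-tauMinus X z)).1 ∉ X := by
        rw [← entryPoint_eq_flow]; exact frontier_notMem hX hz.2.1.1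
      have e : (flow z r).1 + (tauMinus X z + r) • -(flow z r).2 =
        (flow z (-tauMinus X z)).1 := by
        simp only [flow, add_smul, smul_neg, neg_smul]; abel
      rw [← e] at h1
      exact h1

lemma tau_flow (hz : z ∈ goodSet X V) (hr : r ∈ Icc (-tauMinus X z) (tauPlus X z)) :
    tau X (flow z r) = tau X z := by
  rw [tau, tau, tauPlus_flow hX hV hz hr, tauMinus_flow hX hV hz hr]; ring

lemma exitPoint_flow (hz : z ∈ goodSet X V) (hr : r ∈ Icc (-tauMinus X z) (tauPlus X z)) :
    exitPoint X (flow z r) = exitPoint X z := by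
  rw [exitPoint_eq_flow, exitPoint_eq_flow, tauPlus_flow hX hV hz hr, flow_flow, add_sub_cancel]

lemma entryPoint_flow (hz : z ∈ goodSet X V) (hr : r ∈ Icc (-tauMinus X z) (tauPlus X z)) :
    entryPoint X (flow z r) = entryPoint X z := by
  rw [entryPoint_eq_flow, entryPoint_eq_flow, tauMinus_flow hX hV hz hr, flow_flow]
  congr 1; ring

lemma flow_mem_goodSet (hz : z ∈ goodSet X V) (hr : r ∈ Icc (-tauMinus X z) (tauPlus X z)) :
    flow z r ∈ goodSet X V := by
  refine ⟨?_, by rw [entryPoint_flow hX hV hz hr]; exact hz.2.1,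
    by rw [exitPoint_flow hX hV hz hr]; exact hz.2.2⟩
  rcases hr.1.eq_or_lt with h | h
  · rw [← h, ← entryPoint_eq_flow]; exact Or.inr (Or.inr hz.2.1)
  rcases hr.2.eq_or_lt with h' | h'
  · rw [h', ← exitPoint_eq_flow]; exact Or.inr (Or.inl hz.2.2)
  · exact Or.inl (mem_of_mem_chord hX hz ⟨h, h'⟩)

omit hX hV in
lemma zero_mem_Icc (X : Set (Euc d)) (z : Euc d × Euc d) :
    (0 : ℝ) ∈ Icc (-tauMinus X z) (tauPlus X z) :=
  ⟨by linarith [tauMinus_nonneg X z], tauPlus_nonneg X z⟩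

omit hX hV in
lemma chord_subset_Icc (X : Set (Euc d)) (z : Euc d × Euc d) :
    chord X z ⊆ Icc (-tauMinus X z) (tauPlus X z) := Ioo_subset_Icc_self

lemma chord_flow (hz : z ∈ goodSet X V) (hr : r ∈ Icc (-tauMinus X z) (tauPlus X z)) :
    chord X (flow z r) = (fun s => r + s) ⁻¹' chord X z := by
  ext s
  simp only [chord, tauPlus_flow hX hV hz hr, tauMinus_flow hX hV hz hr, mem_Ioo, mem_preimage]
  constructor <;> rintro ⟨h1, h2⟩ <;> constructor <;> linarith

/-- Almost every point of a chord, seen from another point of the chord. -/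
lemma ae_chord_flow (hz : z ∈ goodSet X V) (hr : r ∈ Icc (-tauMinus X z) (tauPlus X z))
    (P : Euc d × Euc d → Prop) :
    (∀ᵐ s ∂volume.restrict (chord X (flow z r)), P (flow (flow z r) s)) ↔
      ∀ᵐ s ∂volume.restrict (chord X z), P (flow z s) := by
  have hmp : MeasurePreserving (fun s : ℝ => r + s) (volume.restrict (chord X (flow z r)))
      (volume.restrict (chord X z)) := by
    rw [chord_flow hX hV hz hr]
    exact (measurePreserving_add_left volume r).restrict_preimage measurableSet_Ioo
  have e := hmp.map_eq
  have he : MeasurableEmbedding fun s : ℝ => r + s :=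
    (MeasurableEquiv.addLeft r).measurableEmbedding
  rw [← e, he.ae_map_iff]
  simp only [flow_flow]

/-- The integral of `F` over the part in `X` of the line through `z`. -/
def fib (X : Set (Euc d)) (F : Euc d × Euc d → ℝ≥0∞) (z : Euc d × Euc d) : ℝ≥0∞ :=
  ∫⁻ r in chord X z, F (flow z r)

lemma fib_flow (hz : z ∈ goodSet X V) (hr : r ∈ Icc (-tauMinus X z) (tauPlus X z))
    (F : Euc d × Euc d → ℝ≥0∞) : fib X F (flow z r) = fib X F z := by
  have hmp : MeasurePreserving (fun s : ℝ => r + s) (volume.restrict (chord X (flow z r)))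
      (volume.restrict (chord X z)) := by
    rw [chord_flow hX hV hz hr]
    exact (measurePreserving_add_left volume r).restrict_preimage measurableSet_Ioo
  unfold fib
  rw [← hmp.lintegral_comp_emb (MeasurableEquiv.addLeft r).measurableEmbedding]
  simp only [flow_flow]

omit hX hV in
lemma volume_chord (X : Set (Euc d)) (z : Euc d × Euc d) :
    volume (chord X z) = ENNReal.ofReal (tau X z) := by
  rw [chord, Real.volume_Ioo, tau]
  congr 1; ring

omit hV in
lemma measurable_fib {F : Euc d × Euc d → ℝ≥0∞} (hF : Measurable F) : Measurable (fib X F) := by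
  have h1 : Measurable (tauPlus X) := measurable_tauPlus hX.isOpen hX.isBounded
  have h2 : Measurable (tauMinus X) := measurable_tauMinus hX.isOpen hX.isBounded
  have hS : MeasurableSet {q : (Euc d × Euc d) × ℝ | q.2 ∈ chord X q.1} :=
    (measurableSet_lt (h2.comp measurable_fst).neg measurable_snd).inter
      (measurableSet_lt measurable_snd (h1.comp measurable_fst))
  have h3 : Measurable ({q : (Euc d × Euc d) × ℝ | q.2 ∈ chord X q.1}.indicator
      fun q => F (flow q.1 q.2)) := (hF.comp measurable_flow).indicator hS
  have h4 := h3.lintegral_prod_right' (ν := volume)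
  convert h4 using 1
  ext1 z
  rw [fib, ← lintegral_indicator (measurableSet_chord X z)]
  rfl

omit hX hV in
/-- The line integral of a function that is constant along the line. -/
lemma fib_of_const {F : Euc d × Euc d → ℝ≥0∞} {c : ℝ≥0∞}
    (h : ∀ r ∈ chord X z, F (flow z r) = c) : fib X F z = ENNReal.ofReal (tau X z) * c := by
  unfold fib
  rw [setLIntegral_congr_fun (measurableSet_chord X z) h, setLIntegral_const, volume_chord,
    mul_comm]

omit hX hV in
lemma fib_mul_of_const {F W : Euc d × Euc d → ℝ≥0∞} {c : ℝ≥0∞} (hF : Measurable F)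
    (h : ∀ r ∈ chord X z, W (flow z r) = c) : fib X (fun z => W z * F z) z = c * fib X F z := by
  unfold fib
  have hm : Measurable fun r => F (flow z r) := hF.comp (measurable_flow_right z)
  rw [← lintegral_const_mul _ hm]
  exact setLIntegral_congr_fun (measurableSet_chord X z) fun r hr => by simp only [h r hr]

lemma exists_tau_le : ∃ D : ℝ, 0 < D ∧ ∀ z ∈ goodSet X V, tau X z ≤ D := by
  obtain ⟨D, hD, h⟩ := exists_bound_smul hX.isBounded
  obtain ⟨r, hr, hrV⟩ := hV.exists_le_norm
  refine ⟨D / r, by positivity, fun z hz => ?_⟩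
  refine le_of_forall_lt fun a ha => ?_
  have hτ := tau_pos hX hV hz
  rcases lt_or_ge a 0 with h0 | h0
  · exact h0.trans_le (by positivity)
  unfold tau at ha
  -- Moving both ends inward by δ gives two points of X whose time distance is a + δ, still larger
  -- than a.
  set δ := (tauMinus X z + tauPlus X z - a) / 3 with hδ
  have hδ0 : 0 < δ := by rw [hδ]; linarith
  have m1 : (flow z (-tauMinus X z + δ)).1 ∈ X :=
    mem_of_mem_chord hX hz ⟨by linarith, by linarith⟩
  have m2 : (flow z (tauPlus X z - δ)).1 ∈ X :=
    mem_of_mem_chord hX hz ⟨by linarith, by linarith⟩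
  have e : flow z (tauPlus X z - δ) =
      flow (flow z (-tauMinus X z + δ)) (tauMinus X z + tauPlus X z - 2 * δ) := by
    rw [flow_flow]; congr 1; ring
  rw [e] at m2
  have h3 := h _ m1 _ _ m2
  have h4 : r ≤ ‖(flow z (-tauMinus X z + δ)).2‖ := hrV z.2 (snd_mem_of_goodSet hz)
  rw [abs_of_pos (by linarith)] at h3
  rw [lt_div_iff₀ hr]
  nlinarith

end Lines

end

/-! ### Comparison of the phase space measure with the boundary measure along lines. -/

section

variable {X V : Set (Euc d)} {m : Measure (Euc d)} (hX : IsC1Domain X)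

section Measurability

include hX

lemma measurable_inner_outwardNormal_prod :
    Measurable fun z : Euc d × Euc d => ⟪z.2, outwardNormal X z.1⟫ :=
  measurable_snd.inner (hX.measurable_outwardNormal.comp measurable_fst)

lemma measurableSet_GammaMinus (hV : MeasurableSet V) : MeasurableSet (GammaMinus X V) :=
  (isClosed_frontier.measurableSet.preimage measurable_fst).inter
    ((hV.preimage measurable_snd).inter
      (measurableSet_lt (measurable_inner_outwardNormal_prod hX) measurable_const))

lemma measurableSet_GammaPlus (hV : MeasurableSet V) : MeasurableSet (GammaPlus X V) :=
  (isClosed_frontier.measurableSet.preimage measurable_fst).inter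
    ((hV.preimage measurable_snd).inter
      (measurableSet_lt measurable_const (measurable_inner_outwardNormal_prod hX)))

lemma IsC1Domain.measurable_tauPlus : Measurable (tauPlus X) :=
  Transport.measurable_tauPlus hX.isOpen hX.isBounded

lemma IsC1Domain.measurable_tauMinus : Measurable (tauMinus X) :=
  Transport.measurable_tauMinus hX.isOpen hX.isBounded

lemma IsC1Domain.measurable_tau : Measurable (tau X) :=
  hX.measurable_tauMinus.add hX.measurable_tauPlus

lemma measurable_entryPoint : Measurable (entryPoint X) := by
  have h := hX.measurable_tauMinus
  unfold entryPoint
  fun_prop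

lemma measurable_exitPoint : Measurable (exitPoint X) := by
  have h := hX.measurable_tauPlus
  unfold exitPoint
  fun_prop

lemma tauMinus_flow_of_mem_GammaMinus {z : Euc d × Euc d} (hz : z ∈ GammaMinus X V) {r : ℝ}
    (hr : r ∈ chord X z) : tauMinus X (flow z r) = r := by
  have h0 := tauMinus_of_mem_GammaMinus hX hz
  have hr' : 0 < r ∧ r < tauPlus X z := by simpa [chord, h0] using hr
  rw [tauMinus_eq]
  refine tauPlus_eq_of_Ioo hr'.1 (fun s hs => ?_) ?_
  · have := mem_of_lt_tauPlus (X := X) (z := z) (t := r - s) (by linarith [hs.2])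
      (by linarith [hs.1])
    have e : (flow z r).1 + s • -(flow z r).2 = z.1 + (r - s) • z.2 := by
      simp only [flow, sub_smul, smul_neg]; abel
    rw [← e] at this
    exact this
  · have e : (flow z r).1 + r • -(flow z r).2 = z.1 := by simp [flow]
    have := frontier_notMem hX hz.1
    rw [← e] at this
    exact this

lemma tauPlus_flow_of_mem_GammaPlus {z : Euc d × Euc d} (hz : z ∈ GammaPlus X V) {r : ℝ}
    (hr : r ∈ chord X z) : tauPlus X (flow z r) = -r := by
  have h0 := tauPlus_of_mem_GammaPlus hX hz
  have hr' : -tauMinus X z < r ∧ r < 0 := by simpa [chord, h0] using hr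
  refine tauPlus_eq_of_Ioo (by linarith) (fun s hs => ?_) ?_
  · have := mem_of_lt_tauMinus (X := X) (z := z) (t := -r - s) (by linarith [hs.2])
      (by linarith [hs.1])
    have e : (flow z r).1 + s • (flow z r).2 = z.1 - (-r - s) • z.2 := by
      simp only [flow, sub_smul, neg_smul]; abel
    rw [← e] at this
    exact this
  · have e : (flow z r).1 + (-r) • (flow z r).2 = z.1 := by simp [flow]
    have := frontier_notMem hX hz.1
    rw [← e] at this
    exact this

end Measurability

section Comparison

variable (hV : VelocityBounds V m)
include hX hV

lemma isFiniteMeasure_surfaceMeasure :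
    IsFiniteMeasure ((surfaceMeasure d).restrict (frontier X)) := by
  obtain ⟨C, -, h, -⟩ := hX.exists_inflow_comparison
  exact ⟨by simpa using h⟩

lemma lintegral_xi {H : Euc d × Euc d → ℝ≥0∞} (hH : Measurable H) :
    ∫⁻ z, H z ∂(xi X m) = ∫⁻ v, ∫⁻ y in frontier X,
      ENNReal.ofReal |⟪v, outwardNormal X y⟫| * H (y, v) ∂(surfaceMeasure d) ∂m := by
  have := isFiniteMeasure_surfaceMeasure hX hV
  have := hV.isFiniteMeasure
  have h1 : Measurable fun z : Euc d × Euc d => ENNReal.ofReal |⟪outwardNormal X z.1, z.2⟫| := by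
    simp only [real_inner_comm _ (outwardNormal X _)]
    exact (measurable_inner_outwardNormal_prod hX).abs.ennreal_ofReal
  rw [xi, lintegral_withDensity_eq_lintegral_mul _ h1 hH, lintegral_prod_symm _
    (h1.mul hH).aemeasurable]
  simp only [Pi.mul_apply, real_inner_comm (outwardNormal X _)]

lemma lintegral_phase {F : Euc d × Euc d → ℝ≥0∞} (hF : Measurable F) :
    ∫⁻ z, F z ∂(phaseMeasure X m) = ∫⁻ v, (∫⁻ x in X, F (x, v)) ∂m := by
  have := hV.isFiniteMeasure
  rw [phaseMeasure, lintegral_prod_symm _ hF.aemeasurable]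

lemma isFiniteMeasure_phaseMeasure : IsFiniteMeasure (phaseMeasure X m) := by
  have := hV.isFiniteMeasure
  have : IsFiniteMeasure ((volume : Measure (Euc d)).restrict X) :=
    ⟨by simpa using hX.isBounded.measure_lt_top⟩
  unfold phaseMeasure
  infer_instance

lemma ae_xi_mem_Gamma : ∀ᵐ z ∂(xi X m), z ∈ Gamma X V := by
  have hm : MeasurableSet (Gamma X V)ᶜ := ((measurableSet_GammaPlus hX hV.measurableSet).union
    (measurableSet_GammaMinus hX hV.measurableSet)).compl
  rw [ae_iff]
  change xi X m (Gamma X V)ᶜ = 0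
  rw [← lintegral_indicator_one hm, lintegral_xi hX hV (measurable_one.indicator hm),
    lintegral_eq_zero_of_ae_eq_zero]
  filter_upwards [hV.ae_mem] with v hv
  refine (setLIntegral_congr_fun (g := fun _ => 0) isClosed_frontier.measurableSet
    fun y hy => ?_).trans (by simp)
  by_cases h : ((y, v) : Euc d × Euc d) ∈ (Gamma X V)ᶜ
  · have h0 : ⟪v, outwardNormal X y⟫ = 0 := by
      by_contra h0
      rcases lt_or_gt_of_ne h0 with h0 | h0
      · exact h (Or.inr ⟨hy, hv, h0⟩)
      · exact h (Or.inl ⟨hy, hv, h0⟩)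
    simp [h0]
  · simp [indicator_of_notMem h]

/-- For each velocity this is `exists_inflow_comparison`. At Γ₊ the line is followed backwards, that
is, with velocity -v and reversed time. -/
lemma exists_fib_comparison : ∃ C : ℝ≥0∞, C ≠ ⊤ ∧ ∀ F : Euc d × Euc d → ℝ≥0∞, Measurable F →
    (∫⁻ z in GammaMinus X V, fib X F z ∂(xi X m) ≤ C * ∫⁻ z, F z ∂(phaseMeasure X m) ∧
      ∫⁻ z, F z ∂(phaseMeasure X m) ≤ C * ∫⁻ z in GammaMinus X V, fib X F z ∂(xi X m)) ∧
    (∫⁻ z in GammaPlus X V, fib X F z ∂(xi X m) ≤ C * ∫⁻ z, F z ∂(phaseMeasure X m) ∧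
      ∫⁻ z, F z ∂(phaseMeasure X m) ≤ C * ∫⁻ z in GammaPlus X V, fib X F z ∂(xi X m)) := by
  obtain ⟨C, hC, -, h⟩ := hX.exists_inflow_comparison
  refine ⟨C, hC, fun F hF => ?_⟩
  have hfib := measurable_fib hX hF
  have e1 : ∫⁻ z in GammaMinus X V, fib X F z ∂(xi X m) = ∫⁻ v, ∫⁻ y in frontier X,
      inflow X v (fun x => F (x, v)) y ∂(surfaceMeasure d) ∂m := by
    have hG := measurableSet_GammaMinus hX hV.measurableSet
    rw [← lintegral_indicator hG, lintegral_xi hX hV (hfib.indicator hG)]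
    refine lintegral_congr_ae ?_
    filter_upwards [hV.ae_mem] with v hv
    refine setLIntegral_congr_fun isClosed_frontier.measurableSet fun y hy => ?_
    by_cases hi : ⟪v, outwardNormal X y⟫ < 0
    · have hz : ((y, v) : Euc d × Euc d) ∈ GammaMinus X V := ⟨hy, hv, hi⟩
      simp only [inflow, indicator_of_mem hz, indicator_of_mem (show y ∈ {y |
        ⟪v, outwardNormal X y⟫ < 0} from hi), fib, chordInt, chord,
        tauMinus_of_mem_GammaMinus hX hz, neg_zero, flow]
    · have hz : ((y, v) : Euc d × Euc d) ∉ GammaMinus X V := fun h => hi h.2.2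
      simp only [inflow, indicator_of_notMem hz, indicator_of_notMem (show y ∉ {y |
        ⟪v, outwardNormal X y⟫ < 0} from hi), mul_zero]
  have e2 : ∫⁻ z in GammaPlus X V, fib X F z ∂(xi X m) = ∫⁻ v, ∫⁻ y in frontier X,
      inflow X (-v) (fun x => F (x, v)) y ∂(surfaceMeasure d) ∂m := by
    have hG := measurableSet_GammaPlus hX hV.measurableSet
    rw [← lintegral_indicator hG, lintegral_xi hX hV (hfib.indicator hG)]
    refine lintegral_congr_ae ?_
    filter_upwards [hV.ae_mem] with v hv
    refine setLIntegral_congr_fun isClosed_frontier.measurableSet fun y hy => ?_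
    by_cases hi : 0 < ⟪v, outwardNormal X y⟫
    · have hz : ((y, v) : Euc d × Euc d) ∈ GammaPlus X V := ⟨hy, hv, hi⟩
      have hi' : y ∈ {y | ⟪-v, outwardNormal X y⟫ < 0} := by
        rw [mem_ofPred_eq, inner_neg_left]; linarith
      have e3 : fib X F (y, v) = chordInt X (-v) (fun x => F (x, v)) y := by
        have := (Measure.measurePreserving_neg (volume : Measure ℝ)).setLIntegral_comp_preimage_emb
          (MeasurableEquiv.neg ℝ).measurableEmbedding (fun r => F (flow (y, v) r))
          (chord X (y, v))
        rw [fib, ← this]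
        simp only [chord, tauPlus_of_mem_GammaPlus hX hz, chordInt, flow, smul_neg, neg_smul]
        rw [tauMinus_eq]
        simp
      rw [indicator_of_mem hz, e3, inflow, indicator_of_mem hi', inner_neg_left, abs_neg]
    · have hz : ((y, v) : Euc d × Euc d) ∉ GammaPlus X V := fun h => hi h.2.2
      have hi' : y ∉ {y | ⟪-v, outwardNormal X y⟫ < 0} := by
        rw [mem_ofPred_eq, inner_neg_left]; linarith
      simp only [inflow, indicator_of_notMem hz, indicator_of_notMem hi', mul_zero]
  have hFv : ∀ v, Measurable fun x => F (x, v) := fun v => hF.comp (by fun_prop)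
  rw [e1, e2, lintegral_phase hX hV hF, ← lintegral_const_mul' _ _ hC,
    ← lintegral_const_mul' _ _ hC, ← lintegral_const_mul' _ _ hC]
  refine ⟨⟨?_, ?_⟩, ?_, ?_⟩ <;> refine lintegral_mono_ae ?_ <;>
    filter_upwards [hV.ae_mem] with v hv
  · exact (h v (hV.ne_zero hv) _ (hFv v)).1
  · exact (h v (hV.ne_zero hv) _ (hFv v)).2
  · exact (h (-v) (neg_ne_zero.2 (hV.ne_zero hv)) _ (hFv v)).1
  · exact (h (-v) (neg_ne_zero.2 (hV.ne_zero hv)) _ (hFv v)).2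

omit hX hV in
lemma ae_phase_mem (hX : IsC1Domain X) (hV : VelocityBounds V m) :
    ∀ᵐ z ∂(phaseMeasure X m), z.1 ∈ X ∧ z.2 ∈ V := by
  have := hV.isFiniteMeasure
  have h1 : ∀ᵐ x ∂((volume : Measure (Euc d)).restrict X), x ∈ X :=
    ae_restrict_mem hX.isOpen.measurableSet
  exact (Measure.quasiMeasurePreserving_fst.ae h1).and
    (Measure.quasiMeasurePreserving_snd.ae hV.ae_mem)

/-- On a chord issuing from a point of Γ₋ every point has that point as its entry point. So the
points with entry point outside Γ₋ have zero integral along all such chords, and the comparison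
makes them a null set. Exit points are treated in the same way from Γ₊. -/
lemma ae_phase_goodSet : ∀ᵐ z ∂(phaseMeasure X m), z ∈ goodSet X V := by
  obtain ⟨C, hC, h⟩ := exists_fib_comparison hX hV
  have h1 : phaseMeasure X m {z | entryPoint X z ∉ GammaMinus X V} = 0 := by
    have hm : MeasurableSet {z | entryPoint X z ∉ GammaMinus X V} :=
      ((measurableSet_GammaMinus hX hV.measurableSet).preimage (measurable_entryPoint hX)).compl
    rw [← lintegral_indicator_one hm, ← nonpos_iff_eq_zero]
    refine (h _ (measurable_one.indicator hm)).1.2.trans ?_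
    rw [setLIntegral_congr_fun (g := fun _ => 0) (measurableSet_GammaMinus hX hV.measurableSet)]
    · simp
    intro z hz
    refine (fib_of_const (c := 0) fun r hr => indicator_of_notMem ?_ _).trans (mul_zero _)
    have e : entryPoint X (flow z r) = z := by
      rw [entryPoint_eq_flow, flow_flow, tauMinus_flow_of_mem_GammaMinus hX hz hr,
        add_neg_cancel, flow_zero]
    simpa [e] using hz
  have h2 : phaseMeasure X m {z | exitPoint X z ∉ GammaPlus X V} = 0 := by
    have hm : MeasurableSet {z | exitPoint X z ∉ GammaPlus X V} :=
      ((measurableSet_GammaPlus hX hV.measurableSet).preimage (measurable_exitPoint hX)).compl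
    rw [← lintegral_indicator_one hm, ← nonpos_iff_eq_zero]
    refine (h _ (measurable_one.indicator hm)).2.2.trans ?_
    rw [setLIntegral_congr_fun (g := fun _ => 0) (measurableSet_GammaPlus hX hV.measurableSet)]
    · simp
    intro z hz
    refine (fib_of_const (c := 0) fun r hr => indicator_of_notMem ?_ _).trans (mul_zero _)
    have e : exitPoint X (flow z r) = z := by
      rw [exitPoint_eq_flow, flow_flow, tauPlus_flow_of_mem_GammaPlus hX hz hr,
        add_neg_cancel, flow_zero]
    simpa [e] using hz
  have h1' : ∀ᵐ z ∂(phaseMeasure X m), entryPoint X z ∈ GammaMinus X V := h1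
  have h2' : ∀ᵐ z ∂(phaseMeasure X m), exitPoint X z ∈ GammaPlus X V := h2
  filter_upwards [ae_phase_mem hX hV, h1', h2'] with z a b c using ⟨Or.inl a.1, b, c⟩

/-- Properties that hold almost everywhere hold almost everywhere along almost every line. -/
lemma ae_xi_Gamma_chord {P : Euc d × Euc d → Prop} (hP : ∀ᵐ z ∂(phaseMeasure X m), P z) :
    ∀ᵐ z ∂(xi X m), ∀ᵐ r ∂volume.restrict (chord X z), P (flow z r) := by
  obtain ⟨C, hC, h⟩ := exists_fib_comparison hX hV
  obtain ⟨N, hPN, hN, hN0⟩ := exists_measurable_superset_of_null (ae_iff.1 hP)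
  have hF : Measurable (N.indicator (1 : Euc d × Euc d → ℝ≥0∞)) := measurable_one.indicator hN
  have h0 : ∫⁻ z, N.indicator (1 : Euc d × Euc d → ℝ≥0∞) z ∂(phaseMeasure X m) = 0 := by
    rw [lintegral_indicator_one hN, hN0]
  have key : ∀ z, fib X (N.indicator 1) z = 0 →
      ∀ᵐ r ∂volume.restrict (chord X z), P (flow z r) := fun z hz => by
    have hm : Measurable fun r => N.indicator (1 : Euc d × Euc d → ℝ≥0∞) (flow z r) :=
      hF.comp (measurable_flow_right z)
    filter_upwards [(lintegral_eq_zero_iff hm).1 hz] with r hr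
    by_contra hc
    have : flow z r ∈ N := hPN hc
    simp [this] at hr
  have h1 := (h _ hF).1.1
  have h2 := (h _ hF).2.1
  rw [h0, mul_zero, nonpos_iff_eq_zero, lintegral_eq_zero_iff (measurable_fib hX hF)] at h1 h2
  have h1' := (ae_restrict_iff' (measurableSet_GammaMinus hX hV.measurableSet)).1 h1
  have h2' := (ae_restrict_iff' (measurableSet_GammaPlus hX hV.measurableSet)).1 h2
  filter_upwards [h1', h2', ae_xi_mem_Gamma hX hV] with z a b c
  rcases c with c | c
  · exact key z (b c)
  · exact key z (a c)

lemma nonempty_chord_of_mem_Gamma {z : Euc d × Euc d} (hz : z ∈ Gamma X V) :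
    volume (chord X z) ≠ 0 := by
  rw [volume_chord, ne_eq, ENNReal.ofReal_eq_zero, not_le, tau]
  rcases hz with hz | hz
  · linarith [tauMinus_pos_of_mem_GammaPlus hX hV hz, tauPlus_nonneg X z]
  · linarith [tauPlus_pos_of_goodSet_of_mem_GammaMinus hX hV hz, tauMinus_nonneg X z]

omit hX hV in
lemma exists_mem_chord_of_ae {z : Euc d × Euc d} (hz : volume (chord X z) ≠ 0) {P : ℝ → Prop}
    (h : ∀ᵐ r ∂volume.restrict (chord X z), P r) : ∃ r ∈ chord X z, P r := by
  have : (ae (volume.restrict (chord X z))).NeBot := ae_neBot.2 (by simpa using hz)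
  obtain ⟨r, h1, h2⟩ := (h.and (ae_restrict_mem (measurableSet_chord X z))).exists
  exact ⟨r, h2, h1⟩

/-- Almost every chord carries a good point. Goodness is shared by the whole closed chord, so it
flows from there back to the boundary point. -/
lemma ae_xi_goodSet : ∀ᵐ z ∂(xi X m), z ∈ goodSet X V := by
  filter_upwards [ae_xi_Gamma_chord hX hV (ae_phase_goodSet hX hV), ae_xi_mem_Gamma hX hV]
    with z h hz
  obtain ⟨r, hr, hg⟩ := exists_mem_chord_of_ae (nonempty_chord_of_mem_Gamma hX hV hz) h
  rcases hz with hz | hz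
  · have h1 := flow_mem_goodSet hX hV hg (r := tauPlus X (flow z r))
      ⟨by linarith [tauPlus_nonneg X (flow z r), tauMinus_nonneg X (flow z r)], le_rfl⟩
    rwa [flow_flow, tauPlus_flow_of_mem_GammaPlus hX hz hr, add_neg_cancel, flow_zero] at h1
  · have h1 := flow_mem_goodSet hX hV hg (r := -tauMinus X (flow z r))
      ⟨le_rfl, by linarith [tauPlus_nonneg X (flow z r), tauMinus_nonneg X (flow z r)]⟩
    rwa [flow_flow, tauMinus_flow_of_mem_GammaMinus hX hz hr, add_neg_cancel, flow_zero] at h1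

/-- Whether the exceptional set has positive length on the chord of z depends only on the chord.
Thus the bad points form a union of chords, and almost every boundary point lies on none of them. -/
lemma ae_phase_chord {P : Euc d × Euc d → Prop} (hP : ∀ᵐ z ∂(phaseMeasure X m), P z) :
    ∀ᵐ z ∂(phaseMeasure X m), ∀ᵐ r ∂volume.restrict (chord X z), P (flow z r) := by
  obtain ⟨C, hC, h⟩ := exists_fib_comparison hX hV
  obtain ⟨N, hPN, hN, hN0⟩ := exists_measurable_superset_of_null (ae_iff.1 hP)
  have hF : Measurable (N.indicator (1 : Euc d × Euc d → ℝ≥0∞)) := measurable_one.indicator hN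
  have hB : MeasurableSet {z | fib X (N.indicator 1) z ≠ 0} :=
    (measurable_fib hX hF (measurableSet_singleton 0)).compl
  have hae : ∀ᵐ z ∂(phaseMeasure X m), z ∉ N := by
    simpa [ae_iff] using hN0
  have key : phaseMeasure X m {z | fib X (N.indicator 1) z ≠ 0} = 0 := by
    rw [← lintegral_indicator_one hB, ← nonpos_iff_eq_zero]
    refine (h _ (measurable_one.indicator hB)).1.2.trans ?_
    rw [lintegral_eq_zero_of_ae_eq_zero, mul_zero]
    refine ae_restrict_of_ae ?_
    filter_upwards [ae_xi_Gamma_chord hX hV hae, ae_xi_goodSet hX hV] with z hz hg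
    refine (fib_of_const (c := 0) fun r hr => indicator_of_notMem ?_ _).trans (mul_zero _)
    simp only [mem_ofPred_eq, not_not, fib_flow hX hV hg (chord_subset_Icc X z hr)]
    refine lintegral_eq_zero_of_ae_eq_zero ?_
    filter_upwards [hz] with s hs using indicator_of_notMem hs _
  have key' : ∀ᵐ z ∂(phaseMeasure X m), fib X (N.indicator 1) z = 0 := key
  filter_upwards [key'] with z hz
  have hm : Measurable fun r => N.indicator (1 : Euc d × Euc d → ℝ≥0∞) (flow z r) :=
    hF.comp (measurable_flow_right z)
  filter_upwards [(lintegral_eq_zero_iff hm).1 hz] with r hr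
  by_contra hc
  have : flow z r ∈ N := hPN hc
  simp [this] at hr

/-- Properties that hold almost everywhere on the boundary hold at the end points of almost every
line. -/
lemma ae_phase_endpoints {P : Euc d × Euc d → Prop} (hP : ∀ᵐ z ∂(xi X m), P z) :
    ∀ᵐ z ∂(phaseMeasure X m), P (entryPoint X z) ∧ P (exitPoint X z) := by
  obtain ⟨C, hC, h⟩ := exists_fib_comparison hX hV
  obtain ⟨N, hPN, hN, hN0⟩ := exists_measurable_superset_of_null (ae_iff.1 hP)
  have hae : ∀ᵐ z ∂(xi X m), z ∉ N := by simpa [ae_iff] using hN0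
  have h1 : ∀ᵐ z ∂(phaseMeasure X m), entryPoint X z ∉ N := by
    have hB : MeasurableSet (entryPoint X ⁻¹' N) := hN.preimage (measurable_entryPoint hX)
    suffices phaseMeasure X m (entryPoint X ⁻¹' N) = 0 by
      simpa [ae_iff, preimage] using this
    rw [← lintegral_indicator_one hB, ← nonpos_iff_eq_zero]
    refine (h _ (measurable_one.indicator hB)).1.2.trans ?_
    rw [lintegral_eq_zero_of_ae_eq_zero, mul_zero]
    rw [EventuallyEq, ae_restrict_iff' (measurableSet_GammaMinus hX hV.measurableSet)]
    filter_upwards [hae, ae_xi_goodSet hX hV] with z hz hg hG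
    refine (fib_of_const (c := 0) fun r hr => indicator_of_notMem ?_ _).trans (mul_zero _)
    rwa [mem_preimage, entryPoint_flow hX hV hg (chord_subset_Icc X z hr),
      entryPoint_of_mem_GammaMinus hX hG]
  have h2 : ∀ᵐ z ∂(phaseMeasure X m), exitPoint X z ∉ N := by
    have hB : MeasurableSet (exitPoint X ⁻¹' N) := hN.preimage (measurable_exitPoint hX)
    suffices phaseMeasure X m (exitPoint X ⁻¹' N) = 0 by
      simpa [ae_iff, preimage] using this
    rw [← lintegral_indicator_one hB, ← nonpos_iff_eq_zero]
    refine (h _ (measurable_one.indicator hB)).2.2.trans ?_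
    rw [lintegral_eq_zero_of_ae_eq_zero, mul_zero]
    rw [EventuallyEq, ae_restrict_iff' (measurableSet_GammaPlus hX hV.measurableSet)]
    filter_upwards [hae, ae_xi_goodSet hX hV] with z hz hg hG
    refine (fib_of_const (c := 0) fun r hr => indicator_of_notMem ?_ _).trans (mul_zero _)
    rwa [mem_preimage, exitPoint_flow hX hV hg (chord_subset_Icc X z hr),
      exitPoint_of_mem_GammaPlus hX hG]
  filter_upwards [h1, h2] with z a b
  exact ⟨by_contra fun hc => a (hPN hc), by_contra fun hc => b (hPN hc)⟩

end Comparison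

end

/-! ### Solution formulas on a single line. -/

section

variable {X V : Set (Euc d)} {m : Measure (Euc d)}

/-- Boundary sets that contain exactly one of the two end points of every good line. -/
structure IsSection (X V : Set (Euc d)) (G : Set (Euc d × Euc d)) : Prop where
  measurableSet : MeasurableSet G
  subset : G ⊆ Gamma X V
  exit_mem_iff : ∀ z ∈ goodSet X V, (exitPoint X z ∈ G ↔ entryPoint X z ∉ G)

open Classical in
/-- The signed time at which the line through `z` meets the boundary set `G`. -/
def lineEnd (X : Set (Euc d)) (G : Set (Euc d × Euc d)) (z : Euc d × Euc d) : ℝ :=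
  if entryPoint X z ∈ G then -tauMinus X z else if exitPoint X z ∈ G then tauPlus X z else 0

/-- The integral of `σ` along the line through `z`. -/
def lineInt (σ : Euc d × Euc d → ℝ) (z : Euc d × Euc d) (r : ℝ) : ℝ :=
  ∫ s in (0 : ℝ)..r, σ (flow z s)

section Lines

variable (hX : IsC1Domain X) (hV : VelocityBounds V m) {G : Set (Euc d × Euc d)}
  {z : Euc d × Euc d} {r : ℝ} {σ f : Euc d × Euc d → ℝ}

lemma lineEnd_mem_Icc (X : Set (Euc d)) (G : Set (Euc d × Euc d)) (z : Euc d × Euc d) :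
    lineEnd X G z ∈ Icc (-tauMinus X z) (tauPlus X z) := by
  have h1 := tauMinus_nonneg X z
  have h2 := tauPlus_nonneg X z
  unfold lineEnd
  split_ifs <;> constructor <;> linarith

include hX hV

lemma lineEnd_flow (hG : IsSection X V G) (hz : z ∈ goodSet X V)
    (hr : r ∈ Icc (-tauMinus X z) (tauPlus X z)) :
    lineEnd X G (flow z r) = lineEnd X G z - r := by
  unfold lineEnd
  rw [entryPoint_flow hX hV hz hr, exitPoint_flow hX hV hz hr, tauPlus_flow hX hV hz hr,
    tauMinus_flow hX hV hz hr]
  split_ifs with h1 h2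
  · ring
  · rfl
  · exact absurd ((hG.exit_mem_iff z hz).2 h1) h2

omit hV in
lemma lineEnd_eq_zero (hG : IsSection X V G) (hz : z ∈ goodSet X V) (hzG : z ∈ G) :
    lineEnd X G z = 0 := by
  unfold lineEnd
  rcases hG.subset hzG with h | h
  · have e := exitPoint_of_mem_GammaPlus hX h
    have h1 : exitPoint X z ∈ G := by rwa [e]
    rw [if_neg ((hG.exit_mem_iff z hz).1 h1), if_pos h1, tauPlus_of_mem_GammaPlus hX h]
  · have e := entryPoint_of_mem_GammaMinus hX h
    have h1 : entryPoint X z ∈ G := by rwa [e]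
    rw [if_pos h1, tauMinus_of_mem_GammaMinus hX h, neg_zero]

omit hV in
lemma measurable_lineEnd (hG : MeasurableSet G) : Measurable (lineEnd X G) := by
  classical
  unfold lineEnd
  exact Measurable.ite (hG.preimage (measurable_entryPoint hX)) hX.measurable_tauMinus.neg
    (Measurable.ite (hG.preimage (measurable_exitPoint hX)) hX.measurable_tauPlus
      measurable_const)

omit hX hV in
lemma lineInt_neg (σ : Euc d × Euc d → ℝ) (z : Euc d × Euc d) (t : ℝ) :
    lineInt σ z (-t) = -∫ s in (0 : ℝ)..t, σ (z.1 - s • z.2, z.2) := by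
  have := intervalIntegral.integral_comp_neg (a := 0) (b := t) (fun s => σ (z.1 + s • z.2, z.2))
  simp only [neg_smul, neg_zero, ← sub_eq_add_neg] at this
  rw [lineInt, intervalIntegral.integral_symm, this]
  rfl

-- With the signed time of `lineEnd`, the entry and exit cases and the factors `EMinus` and `EPlus`
-- merge into one formula.
omit hX hV in
lemma lifting_eq (hG : IsSection X V G) (hz : z ∈ goodSet X V) (g : Euc d × Euc d → ℝ) :
    lifting X V σ G g z =
      g (flow z (lineEnd X G z)) * Real.exp (lineInt σ z (lineEnd X G z)) := by
  unfold lifting lineEnd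
  by_cases h1 : entryPoint X z ∈ G
  · rw [if_pos (show _ ∈ G ∩ GammaMinus X V from ⟨h1, hz.2.1⟩), if_pos h1, lineInt_neg,
      ← entryPoint_eq_flow, EMinus]
  · have h2 := (hG.exit_mem_iff z hz).2 h1
    rw [if_neg (show _ ∉ G ∩ GammaMinus X V from fun h => h1 h.1), if_neg h1,
      if_pos (show _ ∈ G ∩ GammaPlus X V from ⟨h2, hz.2.2⟩), if_pos h2, ← exitPoint_eq_flow, EPlus]
    rfl

omit hX hV in
lemma transportInv_eq (hG : IsSection X V G) (hz : z ∈ goodSet X V) (f : Euc d × Euc d → ℝ) :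
    transportInv X V σ G f z =
      -∫ r in (0 : ℝ)..lineEnd X G z, Real.exp (lineInt σ z r) * f (flow z r) := by
  unfold transportInv lineEnd
  by_cases h1 : entryPoint X z ∈ G
  · rw [if_pos (show _ ∈ G ∩ GammaMinus X V from ⟨h1, hz.2.1⟩), if_pos h1]
    have := intervalIntegral.integral_comp_neg (a := 0) (b := tauMinus X z)
      (fun r => Real.exp (lineInt σ z r) * f (flow z r))
    rw [neg_zero] at this
    rw [intervalIntegral.integral_symm (-tauMinus X z) 0, neg_neg, ← this]
    simp only [lineInt_neg, EMinus, flow, neg_smul, ← sub_eq_add_neg]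
  · have h2 := (hG.exit_mem_iff z hz).2 h1
    rw [if_neg (show _ ∉ G ∩ GammaMinus X V from fun h => h1 h.1), if_neg h1,
      if_pos (show _ ∈ G ∩ GammaPlus X V from ⟨h2, hz.2.2⟩), if_pos h2]
    rfl

omit hX hV in
lemma integrableOn_chord_iff {h : ℝ → ℝ} : IntegrableOn h (chord X z) ↔
    IntegrableOn h (Icc (-tauMinus X z) (tauPlus X z)) := by
  rw [IntegrableOn, IntegrableOn, chord, restrict_Ioo_eq_restrict_Icc]

omit hX hV in
lemma intervalIntegrable_of_chord {h : ℝ → ℝ} (hh : IntegrableOn h (chord X z)) {a b : ℝ}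
    (ha : a ∈ Icc (-tauMinus X z) (tauPlus X z)) (hb : b ∈ Icc (-tauMinus X z) (tauPlus X z)) :
    IntervalIntegrable h volume a b := by
  rw [intervalIntegrable_iff]
  refine (integrableOn_chord_iff.1 hh).mono_set ?_
  exact uIoc_subset_uIcc.trans (uIcc_subset_Icc ha hb)

lemma measurePreserving_chord (hz : z ∈ goodSet X V)
    (hr : r ∈ Icc (-tauMinus X z) (tauPlus X z)) :
    MeasurePreserving (fun s : ℝ => r + s) (volume.restrict (chord X (flow z r)))
      (volume.restrict (chord X z)) := by
  rw [chord_flow hX hV hz hr]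
  exact (measurePreserving_add_left volume r).restrict_preimage measurableSet_Ioo

lemma integrableOn_flow_iff (hz : z ∈ goodSet X V)
    (hr : r ∈ Icc (-tauMinus X z) (tauPlus X z)) :
    IntegrableOn (fun s => f (flow (flow z r) s)) (chord X (flow z r)) ↔
      IntegrableOn (fun s => f (flow z s)) (chord X z) := by
  simp only [flow_flow]
  exact (measurePreserving_chord hX hV hz hr).integrable_comp_emb
    (g := fun s => f (flow z s)) (MeasurableEquiv.addLeft r).measurableEmbedding

/-- Lines along which `τ |σ|` is at most `M`. -/
structure IsRegularLine (X V : Set (Euc d)) (σ : Euc d × Euc d → ℝ) (M : ℝ)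
    (z : Euc d × Euc d) : Prop where
  good : z ∈ goodSet X V
  integrableOn : IntegrableOn (fun r => σ (flow z r)) (chord X z)
  integral_le : ∫ r in chord X z, |σ (flow z r)| ≤ M
  ae_le : ∀ᵐ r ∂volume.restrict (chord X z), |σ (flow z r)| ≤ M / tau X z

variable {M : ℝ}

lemma IsRegularLine.flow (hz : IsRegularLine X V σ M z)
    (hr : r ∈ Icc (-tauMinus X z) (tauPlus X z)) : IsRegularLine X V σ M (flow z r) := by
  refine ⟨flow_mem_goodSet hX hV hz.good hr, (integrableOn_flow_iff hX hV hz.good hr).2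
    hz.integrableOn, ?_, ?_⟩
  swap
  · rw [tau_flow hX hV hz.good hr]
    exact (ae_chord_flow hX hV hz.good hr fun w => |σ w| ≤ M / tau X z).2 hz.ae_le
  have := (measurePreserving_chord hX hV hz.good hr).integral_comp
    (MeasurableEquiv.addLeft r).measurableEmbedding fun s => |σ (Transport.flow z s)|
  simp only [flow_flow]
  rw [this]
  exact hz.integral_le

omit hX hV in
lemma IsRegularLine.continuousOn (hz : IsRegularLine X V σ M z) :
    ContinuousOn (lineInt σ z) (Icc (-tauMinus X z) (tauPlus X z)) := by
  have h0 := zero_mem_Icc X z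
  have hle : -tauMinus X z ≤ tauPlus X z := h0.1.trans h0.2
  rw [← uIcc_of_le hle] at h0 ⊢
  refine intervalIntegral.continuousOn_primitive_interval'
    (intervalIntegrable_of_chord hz.integrableOn ?_ ?_) h0
  · exact ⟨le_rfl, hle⟩
  · exact ⟨hle, le_rfl⟩

omit hX hV in
lemma abs_intervalIntegral_le {h : ℝ → ℝ} (hh : IntegrableOn h (chord X z))
    (hr : r ∈ Icc (-tauMinus X z) (tauPlus X z)) :
    |∫ s in (0 : ℝ)..r, h s| ≤ ∫ s in chord X z, |h s| := by
  refine (intervalIntegral.norm_integral_le_integral_norm_uIoc (f := h) (μ := volume)).trans ?_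
  rw [chord, ← integral_Icc_eq_integral_Ioo]
  refine setIntegral_mono_set ?_ (ae_of_all _ fun s => abs_nonneg _) (Eventually.of_forall ?_)
  · exact (integrableOn_chord_iff.1 hh).abs
  · exact uIoc_subset_uIcc.trans (uIcc_subset_Icc (zero_mem_Icc X z) hr)

omit hX hV in
lemma IsRegularLine.abs_lineInt_le (hz : IsRegularLine X V σ M z)
    (hr : r ∈ Icc (-tauMinus X z) (tauPlus X z)) : |lineInt σ z r| ≤ M :=
  (abs_intervalIntegral_le hz.integrableOn hr).trans hz.integral_le

omit hX hV in
lemma IsRegularLine.lineInt_flow (hz : IsRegularLine X V σ M z) {s : ℝ}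
    (hr : r ∈ Icc (-tauMinus X z) (tauPlus X z))
    (hs : r + s ∈ Icc (-tauMinus X z) (tauPlus X z)) :
    lineInt σ (Transport.flow z r) s = lineInt σ z (r + s) - lineInt σ z r := by
  unfold lineInt
  simp only [flow_flow]
  rw [intervalIntegral.integral_comp_add_left (fun t => σ (Transport.flow z t)), add_zero,
    intervalIntegral.integral_interval_sub_left
      (intervalIntegrable_of_chord hz.integrableOn (zero_mem_Icc X z) hs)
      (intervalIntegrable_of_chord hz.integrableOn (zero_mem_Icc X z) hr)]

omit hX hV in
lemma IsRegularLine.integrableOn_exp_mul (hz : IsRegularLine X V σ M z)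
    (hf : IntegrableOn (fun r => f (Transport.flow z r)) (chord X z)) :
    IntegrableOn (fun r => Real.exp (lineInt σ z r) * f (Transport.flow z r)) (chord X z) := by
  rw [integrableOn_chord_iff] at *
  exact hf.continuousOn_mul (hz.continuousOn.rexp) isCompact_Icc

variable {g : Euc d × Euc d → ℝ} (hG : IsSection X V G)
include hG

lemma lifting_flow (hz : IsRegularLine X V σ M z)
    (hr : r ∈ Icc (-tauMinus X z) (tauPlus X z)) :
    lifting X V σ G g (flow z r) = Real.exp (-lineInt σ z r) * lifting X V σ G g z := by
  rw [lifting_eq hG (flow_mem_goodSet hX hV hz.good hr), lifting_eq hG hz.good,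
    lineEnd_flow hX hV hG hz.good hr, flow_flow, add_sub_cancel, hz.lineInt_flow hr
    (by rw [add_sub_cancel]; exact lineEnd_mem_Icc X G z), add_sub_cancel, sub_eq_add_neg,
    Real.exp_add]
  ring

/-- Duhamel's formula based at z instead of at the end point in G. Its right side is continuous in r
up to both ends of the chord, which is what gives traces. -/
lemma transportInv_flow (hz : IsRegularLine X V σ M z)
    (hf : IntegrableOn (fun r => f (flow z r)) (chord X z))
    (hr : r ∈ Icc (-tauMinus X z) (tauPlus X z)) :
    transportInv X V σ G f (flow z r) = Real.exp (-lineInt σ z r) *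
      (transportInv X V σ G f z +
        ∫ s in (0 : ℝ)..r, Real.exp (lineInt σ z s) * f (flow z s)) := by
  have he := lineEnd_mem_Icc X G z
  have hi := hz.integrableOn_exp_mul hf
  rw [transportInv_eq hG (flow_mem_goodSet hX hV hz.good hr), transportInv_eq hG hz.good,
    lineEnd_flow hX hV hG hz.good hr]
  have e1 : ∫ s in (0 : ℝ)..lineEnd X G z - r,
      Real.exp (lineInt σ (flow z r) s) * f (flow (flow z r) s) =
      ∫ s in (0 : ℝ)..lineEnd X G z - r,
        Real.exp (-lineInt σ z r) * (Real.exp (lineInt σ z (r + s)) * f (flow z (r + s))) := by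
    refine intervalIntegral.integral_congr fun s hs => ?_
    have hrs : r + s ∈ Icc (-tauMinus X z) (tauPlus X z) := by
      have h2 : r + s ∈ uIcc r (lineEnd X G z) := by
        rw [mem_uIcc] at hs ⊢
        rcases hs with hs | hs
        · exact Or.inl ⟨by linarith, by linarith⟩
        · exact Or.inr ⟨by linarith, by linarith⟩
      exact uIcc_subset_Icc hr he h2
    change Real.exp (lineInt σ (Transport.flow z r) s) * _ = _
    rw [hz.lineInt_flow hr hrs, flow_flow, sub_eq_add_neg, Real.exp_add]
    ring
  rw [e1, intervalIntegral.integral_const_mul, intervalIntegral.integral_comp_add_left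
    (fun t => Real.exp (lineInt σ z t) * f (flow z t)), add_zero, add_sub_cancel,
    ← intervalIntegral.integral_interval_sub_left
      (intervalIntegrable_of_chord hi (zero_mem_Icc X z) he)
      (intervalIntegrable_of_chord hi (zero_mem_Icc X z) hr)]
  ring

omit hX hV in
lemma abs_lifting_le (hz : IsRegularLine X V σ M z) :
    |lifting X V σ G g z| ≤ Real.exp M * |g (flow z (lineEnd X G z))| := by
  rw [lifting_eq hG hz.good, abs_mul, mul_comm, Real.abs_exp]
  gcongr
  exact (le_abs_self _).trans (hz.abs_lineInt_le (lineEnd_mem_Icc X G z))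

omit hX hV in
lemma abs_transportInv_le (hz : IsRegularLine X V σ M z)
    (hf : IntegrableOn (fun r => f (flow z r)) (chord X z)) :
    |transportInv X V σ G f z| ≤ Real.exp M * ∫ r in chord X z, |f (flow z r)| := by
  have hi := hz.integrableOn_exp_mul hf
  rw [transportInv_eq hG hz.good, abs_neg, ← integral_const_mul]
  refine (abs_intervalIntegral_le hi (lineEnd_mem_Icc X G z)).trans ?_
  refine setIntegral_mono_on hi.abs (hf.abs.const_mul _) (measurableSet_chord X z) fun r hr => ?_
  rw [abs_mul, Real.abs_exp]
  gcongr
  exact (le_abs_self _).trans (hz.abs_lineInt_le (chord_subset_Icc X z hr))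

omit hX hV in
lemma transportInv_congr {f₁ f₂ : Euc d × Euc d → ℝ} (hz : z ∈ goodSet X V)
    (h : ∀ᵐ r ∂volume.restrict (chord X z), f₁ (flow z r) = f₂ (flow z r)) :
    transportInv X V σ G f₁ z = transportInv X V σ G f₂ z := by
  rw [transportInv_eq hG hz, transportInv_eq hG hz]
  congr 1
  refine intervalIntegral.integral_congr_ae ?_
  rw [chord, restrict_Ioo_eq_restrict_Icc, ae_restrict_iff' measurableSet_Icc] at h
  filter_upwards [h] with r hr hr'
  rw [hr (uIcc_subset_Icc (zero_mem_Icc X z) (lineEnd_mem_Icc X G z) (uIoc_subset_uIcc hr'))]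

lemma lifting_of_mem (hz : z ∈ goodSet X V) (hzG : z ∈ G) : lifting X V σ G g z = g z := by
  rw [lifting_eq hG hz, lineEnd_eq_zero hX hG hz hzG]
  simp [flow_zero, lineInt]

variable {G' : Set (Euc d × Euc d)} (hG' : IsSection X V G')
include hG'

/-- A source-free solution is recovered from its values at either end of the line. Hence boundary
values pass invertibly from G to G'. -/
lemma lifting_lifting (hz : IsRegularLine X V σ M z) :
    lifting X V σ G' (lifting X V σ G g) z = lifting X V σ G g z := by
  rw [lifting_eq hG' hz.good, lifting_flow hX hV hG hz (lineEnd_mem_Icc X G' z), mul_right_comm,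
    ← Real.exp_add, neg_add_cancel, Real.exp_zero, one_mul]

/-- Two solutions with the same source differ by a source-free one; it is determined by its values
on G', where the solution vanishing on G' does not contribute. -/
lemma transportInv_eq_add_lifting (hz : IsRegularLine X V σ M z)
    (hf : IntegrableOn (fun r => f (flow z r)) (chord X z)) :
    transportInv X V σ G f z =
      transportInv X V σ G' f z + lifting X V σ G' (transportInv X V σ G f) z := by
  rw [lifting_eq hG' hz.good, transportInv_flow hX hV hG hz hf (lineEnd_mem_Icc X G' z),
    transportInv_eq hG' hz.good, mul_right_comm, ← Real.exp_add, neg_add_cancel, Real.exp_zero,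
    one_mul]
  ring

end Lines

end

/-! ### The solution operators on L^p spaces over phase space and boundary. -/

section

lemma lintegral_rpow_le {α : Type*} [MeasurableSpace α] (μ : Measure α) {f : α → ℝ≥0∞}
    (hf : AEMeasurable f μ) {q : ℝ} (hq : 1 < q) :
    (∫⁻ x, f x ∂μ) ^ q ≤ μ univ ^ (q - 1) * ∫⁻ x, f x ^ q ∂μ := by
  have hpq := Real.HolderConjugate.conjExponent hq
  have h := ENNReal.lintegral_mul_le_Lp_mul_Lq μ hpq hf (aemeasurable_const (b := 1))
  simp only [Pi.mul_apply, mul_one, ENNReal.one_rpow, lintegral_one] at h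
  calc (∫⁻ x, f x ∂μ) ^ q ≤ ((∫⁻ x, f x ^ q ∂μ) ^ (1 / q) *
        μ univ ^ (1 / q.conjExponent)) ^ q := by gcongr
    _ = μ univ ^ (q - 1) * ∫⁻ x, f x ^ q ∂μ := by
        rw [ENNReal.mul_rpow_of_nonneg _ _ hpq.nonneg, ← ENNReal.rpow_mul, ← ENNReal.rpow_mul,
          one_div_mul_cancel hpq.ne_zero, ENNReal.rpow_one, mul_comm]
        congr 2
        rw [one_div, Real.conjExponent, inv_div, div_mul_cancel₀ _ hpq.ne_zero]

lemma measurable_intervalIntegral {α : Type*} [MeasurableSpace α] {h : α → ℝ → ℝ} {a : α → ℝ}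
    (hh : Measurable (Function.uncurry h)) (ha : Measurable a) :
    Measurable fun x => ∫ s in (0 : ℝ)..a x, h x s := by
  have h1 : MeasurableSet {q : α × ℝ | q.2 ∈ Ioc 0 (a q.1)} :=
    (measurableSet_lt measurable_const measurable_snd).inter
      (measurableSet_le measurable_snd (ha.comp measurable_fst))
  have h2 : MeasurableSet {q : α × ℝ | q.2 ∈ Ioc (a q.1) 0} :=
    (measurableSet_lt (ha.comp measurable_fst) measurable_snd).inter
      (measurableSet_le measurable_snd measurable_const)
  have e1 := ((hh.indicator h1).stronglyMeasurable.integral_prod_right' (ν := volume)).measurable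
  have e2 := ((hh.indicator h2).stronglyMeasurable.integral_prod_right' (ν := volume)).measurable
  convert e1.sub e2 using 1
  ext1 x
  simp only [intervalIntegral, Pi.sub_apply]
  rw [← integral_indicator measurableSet_Ioc, ← integral_indicator measurableSet_Ioc]
  rfl

variable {X V : Set (Euc d)} {m : Measure (Euc d)} (hX : IsC1Domain X) (hV : VelocityBounds V m)
  {σ : Euc d × Euc d → ℝ}

section Generic

include hX hV

/-- Measures ν of this kind include those on phase space and those on the boundary, so solution
operators and their traces can be constructed by the same argument. -/
lemma ae_of_absolutelyContinuous {ν : Measure (Euc d × Euc d)}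
    (hν : ν ≪ phaseMeasure X m + xi X m) {P : Euc d × Euc d → Prop}
    (h1 : ∀ᵐ z ∂(phaseMeasure X m), P z) (h2 : ∀ᵐ z ∂(xi X m), P z) : ∀ᵐ z ∂ν, P z :=
  hν.ae_le (ae_add_measure_iff.2 ⟨h1, h2⟩)

/-- Split F according to whether the line enters through G. The lines that do are counted from Γ₋,
the others leave through G and are counted from Γ₊. -/
lemma exists_section_comparison : ∃ C : ℝ≥0∞, C ≠ ⊤ ∧ ∀ G, IsSection X V G →
    ∀ F : Euc d × Euc d → ℝ≥0∞, Measurable F →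
    ∫⁻ z in G, fib X F z ∂(xi X m) ≤ C * ∫⁻ z, F z ∂(phaseMeasure X m) ∧
      ∫⁻ z, F z ∂(phaseMeasure X m) ≤ C * ∫⁻ z in G, fib X F z ∂(xi X m) := by
  obtain ⟨C, hC, h⟩ := exists_fib_comparison hX hV
  refine ⟨C, hC, fun G hG F hF => ?_⟩
  have hS : MeasurableSet (entryPoint X ⁻¹' G) :=
    hG.measurableSet.preimage (measurable_entryPoint hX)
  have hF1 : Measurable ((entryPoint X ⁻¹' G).indicator F) := hF.indicator hS
  have hF2 : Measurable ((entryPoint X ⁻¹' G)ᶜ.indicator F) := hF.indicator hS.compl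
  have h1 := (h _ hF1).1
  have h2 := (h _ hF2).2
  have hGm := measurableSet_GammaMinus hX hV.measurableSet
  have hGp := measurableSet_GammaPlus hX hV.measurableSet
  have e1 : ∫⁻ z in G, fib X F z ∂(xi X m) =
      ∫⁻ z in GammaMinus X V, fib X ((entryPoint X ⁻¹' G).indicator F) z ∂(xi X m) +
      ∫⁻ z in GammaPlus X V, fib X ((entryPoint X ⁻¹' G)ᶜ.indicator F) z ∂(xi X m) := by
    rw [← lintegral_indicator hG.measurableSet, ← lintegral_indicator hGm,
      ← lintegral_indicator hGp,
      ← lintegral_add_left ((measurable_fib hX hF1).indicator hGm)]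
    refine lintegral_congr_ae ?_
    filter_upwards [ae_xi_goodSet hX hV, ae_xi_mem_Gamma hX hV] with z hz hzG
    have a1 : entryPoint X z ∈ G → fib X ((entryPoint X ⁻¹' G).indicator F) z = fib X F z :=
      fun hh => setLIntegral_congr_fun (measurableSet_chord X z) fun r hr =>
        indicator_of_mem (by rwa [mem_preimage, entryPoint_flow hX hV hz
          (chord_subset_Icc X z hr)]) _
    have a2 : entryPoint X z ∉ G → fib X ((entryPoint X ⁻¹' G).indicator F) z = 0 := fun hh =>
      (fib_of_const (c := 0) fun r hr => indicator_of_notMem (by rwa [mem_preimage,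
        entryPoint_flow hX hV hz (chord_subset_Icc X z hr)]) _).trans (mul_zero _)
    have a3 : entryPoint X z ∈ G → fib X ((entryPoint X ⁻¹' G)ᶜ.indicator F) z = 0 := fun hh =>
      (fib_of_const (c := 0) fun r hr => indicator_of_notMem (by rwa [mem_compl_iff, mem_preimage,
        entryPoint_flow hX hV hz (chord_subset_Icc X z hr), not_not]) _).trans (mul_zero _)
    have a4 : entryPoint X z ∉ G → fib X ((entryPoint X ⁻¹' G)ᶜ.indicator F) z = fib X F z :=
      fun hh => setLIntegral_congr_fun (measurableSet_chord X z) fun r hr =>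
        indicator_of_mem (by rwa [mem_compl_iff, mem_preimage, entryPoint_flow hX hV hz
          (chord_subset_Icc X z hr)]) _
    have hs := hG.exit_mem_iff z hz
    rcases hzG with hzp | hzm
    · have b1 : z ∉ GammaMinus X V := fun hh => disjoint_Gamma hh hzp
      rw [indicator_of_notMem b1, indicator_of_mem hzp, zero_add]
      rw [exitPoint_of_mem_GammaPlus hX hzp] at hs
      by_cases hh : entryPoint X z ∈ G
      · rw [a3 hh, indicator_of_notMem fun h0 => hs.1 h0 hh]
      · rw [a4 hh, indicator_of_mem (hs.2 hh)]
    · have b1 : z ∉ GammaPlus X V := fun hh => disjoint_Gamma hzm hh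
      rw [indicator_of_notMem b1, indicator_of_mem hzm, add_zero]
      have e := entryPoint_of_mem_GammaMinus hX hzm
      by_cases hh : z ∈ G
      · rw [a1 (by rwa [e]), indicator_of_mem hh]
      · rw [a2 (by rwa [e]), indicator_of_notMem hh]
  have e2 : ∫⁻ z, F z ∂(phaseMeasure X m) =
      ∫⁻ z, (entryPoint X ⁻¹' G).indicator F z ∂(phaseMeasure X m) +
      ∫⁻ z, (entryPoint X ⁻¹' G)ᶜ.indicator F z ∂(phaseMeasure X m) := by
    rw [lintegral_indicator hS, lintegral_indicator hS.compl, lintegral_add_compl _ hS]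
  rw [e1, e2, mul_add, mul_add]
  exact ⟨add_le_add h1.1 h2.1, add_le_add h1.2 h2.2⟩

lemma ae_fib_ne_top {F : Euc d × Euc d → ℝ≥0∞} (hF : Measurable F)
    (hi : ∫⁻ z, F z ∂(phaseMeasure X m) ≠ ⊤) :
    (∀ᵐ z ∂(phaseMeasure X m), fib X F z ≠ ⊤) ∧ ∀ᵐ z ∂(xi X m), fib X F z ≠ ⊤ := by
  obtain ⟨C, hC, h⟩ := exists_fib_comparison hX hV
  have h1 : ∀ᵐ z ∂(xi X m), fib X F z ≠ ⊤ := by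
    have a1 := ae_lt_top (measurable_fib hX hF)
      ((h F hF).1.1.trans_lt (ENNReal.mul_lt_top hC.lt_top hi.lt_top)).ne
    have a2 := ae_lt_top (measurable_fib hX hF)
      ((h F hF).2.1.trans_lt (ENNReal.mul_lt_top hC.lt_top hi.lt_top)).ne
    rw [ae_restrict_iff' (measurableSet_GammaMinus hX hV.measurableSet)] at a1
    rw [ae_restrict_iff' (measurableSet_GammaPlus hX hV.measurableSet)] at a2
    filter_upwards [a1, a2, ae_xi_mem_Gamma hX hV] with z b1 b2 b3
    rcases b3 with b3 | b3
    · exact (b2 b3).ne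
    · exact (b1 b3).ne
  refine ⟨?_, h1⟩
  filter_upwards [ae_phase_endpoints hX hV h1, ae_phase_goodSet hX hV] with z hz hg
  rw [← fib_flow hX hV hg (r := -tauMinus X z)
    ⟨le_rfl, by linarith [tauMinus_nonneg X z, tauPlus_nonneg X z]⟩, ← entryPoint_eq_flow]
  exact hz.1

lemma ae_integrableOn_chord {f : Euc d × Euc d → ℝ} (hf : Measurable f)
    (hi : Integrable f (phaseMeasure X m)) :
    (∀ᵐ z ∂(phaseMeasure X m), IntegrableOn (fun r => f (flow z r)) (chord X z)) ∧
      ∀ᵐ z ∂(xi X m), IntegrableOn (fun r => f (flow z r)) (chord X z) := by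
  obtain ⟨h1, h2⟩ := ae_fib_ne_top hX hV (F := fun z => ‖f z‖ₑ) hf.enorm hi.2.ne
  have key : ∀ z, fib X (fun z => ‖f z‖ₑ) z ≠ ⊤ →
      IntegrableOn (fun r => f (flow z r)) (chord X z) := fun z hz =>
    ⟨(hf.comp (measurable_flow_right z)).aestronglyMeasurable, hz.lt_top⟩
  exact ⟨h1.mono key, h2.mono key⟩

/-- Since τ is constant along a chord, |σ| ≤ M/τ there; the chord has length τ, so the integral of
|σ| over it is at most M. -/
lemma exists_ae_isRegularLine (hσm : Measurable σ)
    (hσ : MemLp (fun z => tau X z * σ z) ⊤ (phaseMeasure X m)) : ∃ M : ℝ,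
    (∀ᵐ z ∂(phaseMeasure X m), IsRegularLine X V σ M z) ∧
      ∀ᵐ z ∂(xi X m), IsRegularLine X V σ M z := by
  set M := (eLpNormEssSup (fun z => tau X z * σ z) (phaseMeasure X m)).toReal with hM
  have hfin : eLpNormEssSup (fun z => tau X z * σ z) (phaseMeasure X m) ≠ ⊤ := by
    simpa using hσ.eLpNorm_ne_top
  have hb : ∀ᵐ z ∂(phaseMeasure X m), |tau X z * σ z| ≤ M := by
    filter_upwards [ae_le_eLpNormEssSup (f := fun z => tau X z * σ z) (μ := phaseMeasure X m)]
      with z hz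
    have := ENNReal.toReal_mono hfin hz
    simpa using this
  have key : ∀ z ∈ goodSet X V, (∀ᵐ r ∂volume.restrict (chord X z),
      |tau X (flow z r) * σ (flow z r)| ≤ M) → IsRegularLine X V σ M z := fun z hz h => by
    have hτ := tau_pos hX hV hz
    have h' : ∀ᵐ r ∂volume.restrict (chord X z), |σ (flow z r)| ≤ M / tau X z := by
      filter_upwards [h, ae_restrict_mem (measurableSet_chord X z)] with r hr hrc
      rw [tau_flow hX hV hz (chord_subset_Icc X z hrc), abs_mul, abs_of_pos hτ] at hr
      rw [le_div_iff₀ hτ]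
      linarith
    have hv : volume (chord X z) < ⊤ := by rw [volume_chord]; exact ENNReal.ofReal_lt_top
    have hint : IntegrableOn (fun r => σ (flow z r)) (chord X z) :=
      Measure.integrableOn_of_bounded hv.ne
        (hσm.comp (measurable_flow_right z)).aestronglyMeasurable h'
    refine ⟨hz, hint, ?_, h'⟩
    have := integral_mono_ae hint.abs (integrableOn_const hv.ne (C := M / tau X z)) h'
    refine this.trans ?_
    rw [setIntegral_const, measureReal_def, volume_chord, ENNReal.toReal_ofReal hτ.le, smul_eq_mul,
      mul_div_cancel₀ _ hτ.ne']
  refine ⟨M, ?_, ?_⟩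
  · filter_upwards [ae_phase_goodSet hX hV, ae_phase_chord hX hV hb] with z h1 h2 using key z h1 h2
  · filter_upwards [ae_xi_goodSet hX hV, ae_xi_Gamma_chord hX hV hb] with z h1 h2
      using key z h1 h2

omit hX hV in
lemma measurable_lineInt (hσm : Measurable σ) :
    Measurable fun w : (Euc d × Euc d) × ℝ => lineInt σ w.1 w.2 :=
  measurable_intervalIntegral (h := fun (w : (Euc d × Euc d) × ℝ) s => σ (flow w.1 s))
    (hσm.comp (measurable_flow.comp
      ((measurable_fst.comp measurable_fst).prodMk measurable_snd))) measurable_snd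

variable {G : Set (Euc d × Euc d)} (hG : IsSection X V G)

omit hV in
lemma measurable_endPoint (hG : MeasurableSet G) :
    Measurable fun z => flow z (lineEnd X G z) :=
  measurable_flow.comp (measurable_id.prodMk (measurable_lineEnd hX hG))

variable {ν : Measure (Euc d × Euc d)} (hν : ν ≪ phaseMeasure X m + xi X m)

include hG hν in
lemma aestronglyMeasurable_transportInv (hσm : Measurable σ) {f : Euc d × Euc d → ℝ}
    (hf : Measurable f) : AEStronglyMeasurable (transportInv X V σ G f) ν := by
  have h : Measurable fun z => -∫ r in (0 : ℝ)..lineEnd X G z,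
      Real.exp (lineInt σ z r) * f (flow z r) :=
    (measurable_intervalIntegral (h := fun z r => Real.exp (lineInt σ z r) * f (flow z r))
      ((measurable_lineInt hσm).exp.mul (hf.comp measurable_flow))
      (measurable_lineEnd hX hG.measurableSet)).neg
  refine h.aestronglyMeasurable.congr ?_
  exact ae_of_absolutelyContinuous hX hV hν
    ((ae_phase_goodSet hX hV).mono fun z hz => (transportInv_eq hG hz f).symm)
    ((ae_xi_goodSet hX hV).mono fun z hz => (transportInv_eq hG hz f).symm)

include hG hν in
lemma aestronglyMeasurable_lifting (hσm : Measurable σ) {g : Euc d × Euc d → ℝ}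
    (hg : Measurable g) : AEStronglyMeasurable (lifting X V σ G g) ν := by
  have h : Measurable fun z => g (flow z (lineEnd X G z)) *
      Real.exp (lineInt σ z (lineEnd X G z)) :=
    (hg.comp (measurable_endPoint hX hG.measurableSet)).mul
      ((measurable_lineInt hσm).comp
        (measurable_id.prodMk (measurable_lineEnd hX hG.measurableSet))).exp
  refine h.aestronglyMeasurable.congr ?_
  exact ae_of_absolutelyContinuous hX hV hν
    ((ae_phase_goodSet hX hV).mono fun z hz => (lifting_eq hG hz g).symm)
    ((ae_xi_goodSet hX hV).mono fun z hz => (lifting_eq hG hz g).symm)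

include hG hν in
lemma ae_transportInv_congr {f₁ f₂ : Euc d × Euc d → ℝ} (h : f₁ =ᵐ[phaseMeasure X m] f₂) :
    transportInv X V σ G f₁ =ᵐ[ν] transportInv X V σ G f₂ := by
  refine ae_of_absolutelyContinuous hX hV hν ?_ ?_
  · filter_upwards [ae_phase_goodSet hX hV, ae_phase_chord hX hV h] with z h1 h2
      using transportInv_congr hG h1 h2
  · filter_upwards [ae_xi_goodSet hX hV, ae_xi_Gamma_chord hX hV h] with z h1 h2
      using transportInv_congr hG h1 h2

variable {p : ℝ≥0∞} [Fact (1 ≤ p)] (hp1 : 1 < p) (hp : p ≠ ⊤)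

omit hV in
lemma Lp_integrable (hV : VelocityBounds V m) (f : Lp ℝ p (phaseMeasure X m)) :
    Integrable f (phaseMeasure X m) := by
  have := isFiniteMeasure_phaseMeasure hX hV
  exact (Lp.memLp f).integrable Fact.out

include hG hν hp1 hp in
/-- The inverse transport operator, from `L^p(X × V)` to any space `L^p(ν)` in which integrals
along lines are controlled. -/
theorem exists_transportInv_clm (hσm : Measurable σ)
    (hσ : MemLp (fun z => tau X z * σ z) ⊤ (phaseMeasure X m))
    (hfib : ∃ C : ℝ≥0∞, C ≠ ⊤ ∧ ∀ F : Euc d × Euc d → ℝ≥0∞, Measurable F →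
      ∫⁻ z, fib X F z ∂ν ≤ C * ∫⁻ z, F z ∂(phaseMeasure X m)) :
    ∃ T : Lp ℝ p (phaseMeasure X m) →L[ℝ] Lp ℝ p ν, ∀ f, T f =ᵐ[ν] transportInv X V σ G f := by
  obtain ⟨C, hC, hfib⟩ := hfib
  obtain ⟨M, hM1, hM2⟩ := exists_ae_isRegularLine hX hV hσm hσ
  obtain ⟨D, hD, hτ⟩ := exists_tau_le hX hV
  have hreg := ae_of_absolutelyContinuous hX hV hν hM1 hM2
  have hlm : ∀ f : Lp ℝ p (phaseMeasure X m), Measurable f := fun f =>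
    (Lp.stronglyMeasurable f).measurable
  have hint : ∀ f : Lp ℝ p (phaseMeasure X m), ∀ᵐ z ∂ν,
      IntegrableOn (fun r => f (flow z r)) (chord X z) := fun f => by
    have := ae_integrableOn_chord hX hV (hlm f) (Lp_integrable hX hV f)
    exact ae_of_absolutelyContinuous hX hV hν this.1 this.2
  have hp0 : p ≠ 0 := (zero_lt_one.trans hp1).ne'
  have hq : 1 < p.toReal := by
    rw [← ENNReal.toReal_one]; exact ENNReal.toReal_strict_mono hp hp1
  set q := p.toReal with hqdef
  -- The exponential bounds the attenuation, D^(q-1) comes from Hölder's inequality on a chord of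
  -- length at most D, and C from the control of line integrals in ν.
  have hδ : ENNReal.ofReal (Real.exp M) ^ q * ENNReal.ofReal D ^ (q - 1) * C ≠ ⊤ :=
    ENNReal.mul_ne_top (ENNReal.mul_ne_top (ENNReal.rpow_ne_top_of_nonneg (by linarith)
      ENNReal.ofReal_ne_top) (ENNReal.rpow_ne_top_of_nonneg (by linarith)
      ENNReal.ofReal_ne_top)) hC
  obtain ⟨T, hT, -⟩ := exists_clm_of_formula (μ := phaseMeasure X m) (ν := ν) (p := p)
    (transportInv X V σ G)
    ((ENNReal.ofReal (Real.exp M) ^ q * ENNReal.ofReal D ^ (q - 1) * C).toReal ^ (1 / q))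
    (by positivity)
    (fun f => aestronglyMeasurable_transportInv hX hV hG hν hσm (hlm f))
    (fun f => by
      refine eLpNorm_le_of_lintegral_rpow_le hp0 hp ENNReal.toReal_nonneg ?_
      rw [ENNReal.ofReal_toReal hδ, mul_assoc]
      have hfm : Measurable fun z => ‖f z‖ₑ ^ q := (hlm f).enorm.pow_const q
      refine le_trans ?_ (mul_le_mul_right (hfib _ hfm) _)
      rw [← lintegral_const_mul _ (measurable_fib hX hfm)]
      refine lintegral_mono_ae ?_
      filter_upwards [hreg, hint f] with z hz hi
      have h1 : ‖transportInv X V σ G f z‖ₑ ≤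
          ENNReal.ofReal (Real.exp M) * fib X (fun z => ‖f z‖ₑ) z := by
        rw [Real.enorm_eq_ofReal_abs, fib]
        refine (ENNReal.ofReal_le_ofReal (abs_transportInv_le hG hz hi)).trans_eq ?_
        rw [ENNReal.ofReal_mul (Real.exp_pos M).le, ofReal_integral_eq_lintegral_ofReal hi.abs
          (ae_of_all _ fun _ => abs_nonneg _)]
        simp only [Real.enorm_eq_ofReal_abs]
      calc ‖transportInv X V σ G f z‖ₑ ^ q
          ≤ (ENNReal.ofReal (Real.exp M) * fib X (fun z => ‖f z‖ₑ) z) ^ q := by gcongr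
        _ = ENNReal.ofReal (Real.exp M) ^ q * fib X (fun z => ‖f z‖ₑ) z ^ q :=
          ENNReal.mul_rpow_of_nonneg _ _ (by linarith)
        _ ≤ ENNReal.ofReal (Real.exp M) ^ q * (ENNReal.ofReal D ^ (q - 1) *
            fib X (fun z => ‖f z‖ₑ ^ q) z) := by
          gcongr
          refine (lintegral_rpow_le _ ((hlm f).comp
            (measurable_flow_right z)).enorm.aemeasurable hq).trans ?_
          rw [Measure.restrict_apply_univ, volume_chord]
          refine mul_le_mul_left (ENNReal.rpow_le_rpow ?_ (by linarith)) _
          exact ENNReal.ofReal_le_ofReal (hτ z hz.good)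
        _ = _ := by rw [mul_assoc])
    (fun f g h => ae_transportInv_congr hX hV hG hν h)
    (fun f g => by
      filter_upwards [hreg, hint f, hint g] with z hz h1 h2
      have i1 := intervalIntegrable_of_chord (hz.integrableOn_exp_mul h1) (zero_mem_Icc X z)
        (lineEnd_mem_Icc X G z)
      have i2 := intervalIntegrable_of_chord (hz.integrableOn_exp_mul h2) (zero_mem_Icc X z)
        (lineEnd_mem_Icc X G z)
      rw [transportInv_eq hG hz.good, transportInv_eq hG hz.good, transportInv_eq hG hz.good,
        ← neg_add, ← intervalIntegral.integral_add i1 i2]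
      simp only [mul_add])
    (fun c f => by
      filter_upwards [hreg] with z hz
      rw [transportInv_eq hG hz.good, transportInv_eq hG hz.good, mul_neg,
        ← intervalIntegral.integral_const_mul]
      simp only [mul_left_comm])
  exact ⟨T, hT⟩

include hG hν hp1 hp in
/-- The lifting operator, from `L^p(G, ρ)` to any space `L^p(ν)` in which the values at the end
points of lines are controlled. -/
theorem exists_lifting_clm (hσm : Measurable σ)
    (hσ : MemLp (fun z => tau X z * σ z) ⊤ (phaseMeasure X m)) {ρ : Measure (Euc d × Euc d)}
    (hend : ∃ C : ℝ≥0∞, C ≠ ⊤ ∧ ∀ H : Euc d × Euc d → ℝ≥0∞, Measurable H →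
      ∫⁻ z, H (flow z (lineEnd X G z)) ∂ν ≤ C * ∫⁻ z in G, H z ∂ρ) :
    (∀ g₁ g₂ : Euc d × Euc d → ℝ, g₁ =ᵐ[ρ.restrict G] g₂ →
      lifting X V σ G g₁ =ᵐ[ν] lifting X V σ G g₂) ∧
    ∃ L : Lp ℝ p (ρ.restrict G) →L[ℝ] Lp ℝ p ν, ∀ g, L g =ᵐ[ν] lifting X V σ G g := by
  obtain ⟨C, hC, hend⟩ := hend
  obtain ⟨M, hM1, hM2⟩ := exists_ae_isRegularLine hX hV hσm hσ
  have hreg := ae_of_absolutelyContinuous hX hV hν hM1 hM2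
  have hp0 : p ≠ 0 := (zero_lt_one.trans hp1).ne'
  have hq : 0 < p.toReal := ENNReal.toReal_pos hp0 hp
  set q := p.toReal with hqdef
  have hcongr : ∀ g₁ g₂ : Euc d × Euc d → ℝ, g₁ =ᵐ[ρ.restrict G] g₂ →
      lifting X V σ G g₁ =ᵐ[ν] lifting X V σ G g₂ := fun g₁ g₂ h => by
    obtain ⟨N, hPN, hN, hN0⟩ := exists_measurable_superset_of_null (ae_iff.1 h)
    have h0 := hend _ (measurable_one.indicator hN : Measurable (N.indicator 1))
    have hme : Measurable fun z => N.indicator (1 : Euc d × Euc d → ℝ≥0∞)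
        (flow z (lineEnd X G z)) :=
      (measurable_one.indicator hN).comp (measurable_endPoint hX hG.measurableSet)
    rw [lintegral_indicator_one hN, hN0, mul_zero, nonpos_iff_eq_zero,
      lintegral_eq_zero_iff hme] at h0
    filter_upwards [h0, hreg] with z hz hg
    rw [lifting_eq hG hg.good, lifting_eq hG hg.good]
    congr 1
    by_contra hc
    have : flow z (lineEnd X G z) ∈ N := hPN hc
    simp [this] at hz
  refine ⟨hcongr, ?_⟩
  have hlm : ∀ g : Lp ℝ p (ρ.restrict G), Measurable g := fun g =>
    (Lp.stronglyMeasurable g).measurable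
  have hδ : ENNReal.ofReal (Real.exp M) ^ q * C ≠ ⊤ := ENNReal.mul_ne_top
    (ENNReal.rpow_ne_top_of_nonneg hq.le ENNReal.ofReal_ne_top) hC
  obtain ⟨L, hL, -⟩ := exists_clm_of_formula (μ := ρ.restrict G) (ν := ν) (p := p)
    (lifting X V σ G) ((ENNReal.ofReal (Real.exp M) ^ q * C).toReal ^ (1 / q)) (by positivity)
    (fun g => aestronglyMeasurable_lifting hX hV hG hν hσm (hlm g))
    (fun g => by
      refine eLpNorm_le_of_lintegral_rpow_le hp0 hp ENNReal.toReal_nonneg ?_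
      rw [ENNReal.ofReal_toReal hδ, mul_assoc]
      have hgm : Measurable fun z => ‖g z‖ₑ ^ q := (hlm g).enorm.pow_const q
      refine le_trans ?_ (mul_le_mul_right (hend _ hgm) _)
      have hme : Measurable fun z => ‖g (flow z (lineEnd X G z))‖ₑ ^ q :=
        hgm.comp (measurable_endPoint hX hG.measurableSet)
      rw [← lintegral_const_mul _ hme]
      refine lintegral_mono_ae ?_
      filter_upwards [hreg] with z hz
      rw [← ENNReal.mul_rpow_of_nonneg _ _ hq.le]
      gcongr
      rw [Real.enorm_eq_ofReal_abs, Real.enorm_eq_ofReal_abs,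
        ← ENNReal.ofReal_mul (Real.exp_pos M).le]
      exact ENNReal.ofReal_le_ofReal (abs_lifting_le hG hz))
    hcongr
    (fun f g => by
      filter_upwards [hreg] with z hz
      rw [lifting_eq hG hz.good, lifting_eq hG hz.good, lifting_eq hG hz.good, add_mul])
    (fun c g => by
      filter_upwards [hreg] with z hz
      rw [lifting_eq hG hz.good, lifting_eq hG hz.good, mul_assoc])
  exact ⟨L, hL⟩

end Generic

end

/-! ### Boundary sections and the two choices of weight. -/

section

variable {X V : Set (Euc d)} {m : Measure (Euc d)} (hX : IsC1Domain X) (hV : VelocityBounds V m)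

section Sections

lemma isSection_GammaMinus (hX : IsC1Domain X) (hV : VelocityBounds V m) :
    IsSection X V (GammaMinus X V) :=
  ⟨measurableSet_GammaMinus hX hV.measurableSet, subset_union_right, fun _ hz =>
    ⟨fun h => (disjoint_Gamma h hz.2.2).elim, fun h => absurd hz.2.1 h⟩⟩

-- The set 𝒞₋ is defined so that the entry point of a good line is selected exactly when its exit
-- point is not in 𝒞₊.
include hX hV in
lemma isSection_bdrySet {Cp : Set (Euc d × Euc d)} (hCp : Cp ⊆ GammaPlus X V)
    (hCpm : MeasurableSet Cp) : IsSection X V (bdrySet X V Cp) := by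
  have hm := measurableSet_GammaMinus hX hV.measurableSet
  refine ⟨(hm.diff (hm.inter (hCpm.preimage (measurable_exitPoint hX)))).union hCpm,
    union_subset (sdiff_subset.trans subset_union_right) (hCp.trans subset_union_left),
    fun z hz => ?_⟩
  have h1 : exitPoint X (entryPoint X z) = exitPoint X z := by
    rw [entryPoint_eq_flow]
    exact exitPoint_flow hX hV hz
      ⟨le_rfl, by linarith [tauMinus_nonneg X z, tauPlus_nonneg X z]⟩
  have h2 : exitPoint X z ∈ bdrySet X V Cp ↔ exitPoint X z ∈ Cp :=
    ⟨fun h => h.elim (fun h => (disjoint_Gamma h.1 hz.2.2).elim) id, Or.inr⟩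
  have h3 : entryPoint X z ∈ bdrySet X V Cp ↔ exitPoint X z ∉ Cp := by
    constructor
    · rintro (h | h)
      · exact fun hc => h.2 ⟨hz.2.1, by rwa [h1]⟩
      · exact (disjoint_Gamma hz.2.1 (hCp h)).elim
    · exact fun h => Or.inl ⟨hz.2.1, fun hc => h (by rw [← h1]; exact hc.2)⟩
  rw [h2, h3, not_not]

include hX hV in
lemma IsSection.compl {G : Set (Euc d × Euc d)} (hG : IsSection X V G) :
    IsSection X V (Gamma X V \ G) := by
  refine ⟨((measurableSet_GammaPlus hX hV.measurableSet).union
    (measurableSet_GammaMinus hX hV.measurableSet)).diff hG.measurableSet, sdiff_subset,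
    fun z hz => ?_⟩
  have h := hG.exit_mem_iff z hz
  have h1 : exitPoint X z ∈ Gamma X V := Or.inl hz.2.2
  have h2 : entryPoint X z ∈ Gamma X V := Or.inr hz.2.1
  simp only [Set.mem_sdiff, h1, h2, true_and, h, not_not]

end Sections

/-- Pairs consisting of a measure on `X × V` and a measure on `Γ`, with the same weight. -/
structure IsLinePair (X V : Set (Euc d)) (m : Measure (Euc d))
    (μ ρ : Measure (Euc d × Euc d)) : Prop where
  exists_phase_le : ∃ C : ℝ≥0∞, C ≠ ⊤ ∧ phaseMeasure X m ≤ C • μ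
  absolutelyContinuous : μ ≪ phaseMeasure X m
  ac_xi : ρ ≪ xi X m
  xi_ac : xi X m ≪ ρ
  exists_le_xi : ∃ C : ℝ≥0∞, C ≠ ⊤ ∧ ρ ≤ C • xi X m
  -- Dividing the line integral by τ makes it a mean over the chord, which is why the inequality has
  -- the same form for both weights.
  comparison : ∃ C : ℝ≥0∞, C ≠ ⊤ ∧ ∀ G, IsSection X V G →
    ∀ F : Euc d × Euc d → ℝ≥0∞, Measurable F →
    ∫⁻ z in G, (ENNReal.ofReal (tau X z))⁻¹ * fib X F z ∂ρ ≤ C * ∫⁻ z, F z ∂μ ∧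
      ∫⁻ z, F z ∂μ ≤ C * ∫⁻ z in G, (ENNReal.ofReal (tau X z))⁻¹ * fib X F z ∂ρ

section Pairs

include hX hV

lemma ofReal_tau_ne_zero {z : Euc d × Euc d} (hz : z ∈ goodSet X V) :
    ENNReal.ofReal (tau X z) ≠ 0 := by
  simpa using tau_pos hX hV hz

/-- The density τ of the boundary measure cancels the factor τ⁻¹, leaving
`exists_section_comparison`. The upper bound of τ gives the remaining domination. -/
lemma isLinePair_phase : IsLinePair X V m (phaseMeasure X m) (tauXi X m) := by
  have hτ : Measurable fun z => ENNReal.ofReal (tau X z) := hX.measurable_tau.ennreal_ofReal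
  obtain ⟨D, hD, hτD⟩ := exists_tau_le hX hV
  obtain ⟨C, hC, h⟩ := exists_section_comparison hX hV
  refine ⟨⟨1, ENNReal.one_ne_top, by rw [one_smul]⟩, Measure.AbsolutelyContinuous.rfl,
    withDensity_absolutelyContinuous _ _, ?_, ⟨ENNReal.ofReal D, ENNReal.ofReal_ne_top, ?_⟩,
    C, hC, fun G hG F hF => ?_⟩
  · exact withDensity_absolutelyContinuous' hτ.aemeasurable
      ((ae_xi_goodSet hX hV).mono fun z hz => ofReal_tau_ne_zero hX hV hz)
  · rw [← withDensity_const]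
    exact withDensity_mono ((ae_xi_goodSet hX hV).mono fun z hz =>
      ENNReal.ofReal_le_ofReal (hτD z hz))
  · have e : ∫⁻ z in G, (ENNReal.ofReal (tau X z))⁻¹ * fib X F z ∂(tauXi X m) =
        ∫⁻ z in G, fib X F z ∂(xi X m) := by
      have hm : Measurable fun z => (ENNReal.ofReal (tau X z))⁻¹ * fib X F z :=
        hτ.inv.mul (measurable_fib hX hF)
      rw [tauXi, restrict_withDensity hG.measurableSet,
        lintegral_withDensity_eq_lintegral_mul _ hτ hm]
      refine lintegral_congr_ae (ae_restrict_of_ae ?_)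
      filter_upwards [ae_xi_goodSet hX hV] with z hz
      simp only [Pi.mul_apply]
      rw [← mul_assoc, ENNReal.mul_inv_cancel (ofReal_tau_ne_zero hX hV hz)
        ENNReal.ofReal_ne_top, one_mul]
    rw [e]
    exact h G hG F hF

/-- Since τ is constant along chords, the weight τ⁻¹ can be moved into the line integral. -/
lemma isLinePair_weighted : IsLinePair X V m (weightedPhaseMeasure X m) (xi X m) := by
  have hτ : Measurable fun z => ENNReal.ofReal (tau X z)⁻¹ :=
    hX.measurable_tau.inv.ennreal_ofReal
  have hinv : ∀ z ∈ goodSet X V, ENNReal.ofReal (tau X z)⁻¹ = (ENNReal.ofReal (tau X z))⁻¹ :=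
    fun z hz => ENNReal.ofReal_inv_of_pos (tau_pos hX hV hz)
  obtain ⟨D, hD, hτD⟩ := exists_tau_le hX hV
  obtain ⟨C, hC, h⟩ := exists_section_comparison hX hV
  refine ⟨⟨ENNReal.ofReal D, ENNReal.ofReal_ne_top, ?_⟩, withDensity_absolutelyContinuous _ _,
    Measure.AbsolutelyContinuous.rfl, Measure.AbsolutelyContinuous.rfl,
    ⟨1, ENNReal.one_ne_top, by rw [one_smul]⟩, C, hC, fun G hG F hF => ?_⟩
  · rw [weightedPhaseMeasure, ← withDensity_smul _ hτ]
    conv_lhs => rw [← withDensity_one (μ := phaseMeasure X m)]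
    refine withDensity_mono ((ae_phase_goodSet hX hV).mono fun z hz => ?_)
    have hp := tau_pos hX hV hz
    rw [Pi.smul_apply, smul_eq_mul, ← ENNReal.ofReal_mul hD.le, Pi.one_apply,
      ENNReal.one_le_ofReal, ← div_eq_mul_inv, one_le_div hp]
    exact hτD z hz
  · have e1 : ∫⁻ z, F z ∂(weightedPhaseMeasure X m) =
        ∫⁻ z, ENNReal.ofReal (tau X z)⁻¹ * F z ∂(phaseMeasure X m) := by
      rw [weightedPhaseMeasure, lintegral_withDensity_eq_lintegral_mul _ hτ hF]
      rfl
    have e2 : ∫⁻ z in G, (ENNReal.ofReal (tau X z))⁻¹ * fib X F z ∂(xi X m) =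
        ∫⁻ z in G, fib X (fun z => ENNReal.ofReal (tau X z)⁻¹ * F z) z ∂(xi X m) := by
      refine lintegral_congr_ae (ae_restrict_of_ae ?_)
      filter_upwards [ae_xi_goodSet hX hV] with z hz
      rw [← hinv z hz]
      exact (fib_mul_of_const hF fun r hr => by
        rw [tau_flow hX hV hz (chord_subset_Icc X z hr)]).symm
    rw [e1, e2]
    exact h G hG _ (hτ.mul hF)

omit hX hV in
lemma lintegral_le_of_le_smul {α : Type*} [MeasurableSpace α] {μ ν : Measure α} {C : ℝ≥0∞}
    (h : μ ≤ C • ν) (F : α → ℝ≥0∞) (G : Set α) :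
    ∫⁻ z in G, F z ∂μ ≤ C * ∫⁻ z in G, F z ∂ν := by
  refine (lintegral_mono' (Measure.restrict_mono le_rfl h) le_rfl).trans_eq ?_
  rw [Measure.restrict_smul, lintegral_smul_measure, smul_eq_mul]

variable {μ ρ : Measure (Euc d × Euc d)} (hP : IsLinePair X V m μ ρ) {G G' : Set (Euc d × Euc d)}

lemma IsSection.endPoint_flow (hG : IsSection X V G) {z : Euc d × Euc d} (hz : z ∈ goodSet X V)
    {r : ℝ} (hr : r ∈ Icc (-tauMinus X z) (tauPlus X z)) :
    flow (flow z r) (lineEnd X G (flow z r)) = flow z (lineEnd X G z) := by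
  rw [lineEnd_flow hX hV hG hz hr, flow_flow, add_sub_cancel]

include hP

omit hX hV in
lemma IsLinePair.ac_add : μ ≪ phaseMeasure X m + xi X m :=
  hP.absolutelyContinuous.trans (Measure.absolutelyContinuous_of_le (Measure.le_add_right le_rfl))

omit hX hV in
lemma IsLinePair.restrict_ac_add : ρ.restrict G ≪ phaseMeasure X m + xi X m :=
  (Measure.absolutelyContinuous_of_le Measure.restrict_le_self).trans
    (hP.ac_xi.trans (Measure.absolutelyContinuous_of_le (Measure.le_add_left le_rfl)))

lemma IsLinePair.ae_good : ∀ᵐ z ∂ρ, z ∈ goodSet X V := hP.ac_xi.ae_le (ae_xi_goodSet hX hV)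

omit hP in
lemma tau_inv_mul {z : Euc d × Euc d} (hz : z ∈ goodSet X V) (c : ℝ≥0∞) :
    (ENNReal.ofReal (tau X z))⁻¹ * (ENNReal.ofReal (tau X z) * c) = c := by
  rw [← mul_assoc, ENNReal.inv_mul_cancel (ofReal_tau_ne_zero hX hV hz) ENNReal.ofReal_ne_top,
    one_mul]

lemma IsLinePair.fib_boundary_le (hG : IsSection X V G) : ∃ C : ℝ≥0∞, C ≠ ⊤ ∧
    ∀ F : Euc d × Euc d → ℝ≥0∞, Measurable F →
      ∫⁻ z in G, fib X F z ∂ρ ≤ C * ∫⁻ z, F z ∂(phaseMeasure X m) := by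
  obtain ⟨C, hC, h⟩ := exists_section_comparison hX hV
  obtain ⟨D, hD, hρ⟩ := hP.exists_le_xi
  refine ⟨D * C, ENNReal.mul_ne_top hD hC, fun F hF => ?_⟩
  rw [mul_assoc]
  exact (lintegral_le_of_le_smul hρ _ G).trans (mul_le_mul_right (h G hG F hF).1 _)

/-- A line integral is itself constant along its chord, so it equals its own mean there, and the
claim reduces to `fib_boundary_le`. The same idea, with the value at the end point in G in place of
the line integral, gives `end_le` and `end_boundary_le`. -/
lemma IsLinePair.fib_le : ∃ C : ℝ≥0∞, C ≠ ⊤ ∧ ∀ F : Euc d × Euc d → ℝ≥0∞, Measurable F →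
    ∫⁻ z, fib X F z ∂μ ≤ C * ∫⁻ z, F z ∂(phaseMeasure X m) := by
  have hG := isSection_GammaMinus hX hV
  obtain ⟨C, hC, h⟩ := hP.comparison
  obtain ⟨D, hD, hD'⟩ := hP.fib_boundary_le hX hV hG
  refine ⟨C * D, ENNReal.mul_ne_top hC hD, fun F hF => ?_⟩
  refine ((h _ hG _ (measurable_fib hX hF)).2).trans ?_
  rw [mul_assoc]
  refine mul_le_mul_right (le_trans (le_of_eq ?_) (hD' F hF)) _
  refine lintegral_congr_ae (ae_restrict_of_ae ?_)
  filter_upwards [hP.ae_good hX hV] with z hz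
  rw [fib_of_const fun r hr => fib_flow hX hV hz (chord_subset_Icc X z hr) F,
    tau_inv_mul hX hV hz]

lemma IsLinePair.end_le (hG : IsSection X V G) : ∃ C : ℝ≥0∞, C ≠ ⊤ ∧
    ∀ H : Euc d × Euc d → ℝ≥0∞, Measurable H →
      ∫⁻ z, H (flow z (lineEnd X G z)) ∂μ ≤ C * ∫⁻ z in G, H z ∂ρ := by
  obtain ⟨C, hC, h⟩ := hP.comparison
  refine ⟨C, hC, fun H hH => ?_⟩
  have hme : Measurable fun z => H (flow z (lineEnd X G z)) :=
    hH.comp (measurable_endPoint hX hG.measurableSet)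
  refine ((h _ hG _ hme).2).trans (mul_le_mul_right (le_of_eq ?_) _)
  rw [← lintegral_indicator hG.measurableSet, ← lintegral_indicator hG.measurableSet]
  refine lintegral_congr_ae ?_
  filter_upwards [hP.ae_good hX hV] with z hz
  by_cases hzG : z ∈ G
  · rw [indicator_of_mem hzG, indicator_of_mem hzG,
      fib_of_const fun r hr => by rw [hG.endPoint_flow hX hV hz (chord_subset_Icc X z hr)],
      tau_inv_mul hX hV hz, lineEnd_eq_zero hX hG hz hzG, flow_zero]
  · rw [indicator_of_notMem hzG, indicator_of_notMem hzG]

lemma IsLinePair.end_boundary_le (hG : IsSection X V G) (hG' : IsSection X V G') :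
    ∃ C : ℝ≥0∞, C ≠ ⊤ ∧ ∀ H : Euc d × Euc d → ℝ≥0∞, Measurable H →
      ∫⁻ z in G', H (flow z (lineEnd X G z)) ∂ρ ≤ C * ∫⁻ z in G, H z ∂ρ := by
  obtain ⟨C, hC, h⟩ := hP.comparison
  obtain ⟨D, hD, hD'⟩ := hP.end_le hX hV hG
  refine ⟨C * D, ENNReal.mul_ne_top hC hD, fun H hH => ?_⟩
  have hme : Measurable fun z => H (flow z (lineEnd X G z)) :=
    hH.comp (measurable_endPoint hX hG.measurableSet)
  rw [mul_assoc]
  refine le_trans (le_of_eq ?_) (((h _ hG' _ hme).1).trans (mul_le_mul_right (hD' H hH) _))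
  refine lintegral_congr_ae (ae_restrict_of_ae ?_)
  filter_upwards [hP.ae_good hX hV] with z hz
  rw [fib_of_const fun r hr => by rw [hG.endPoint_flow hX hV hz (chord_subset_Icc X z hr)],
    tau_inv_mul hX hV hz]

end Pairs

/-! ### Traces on the boundary. -/

section Trace

/-- A right neighbourhood of 0 has positive measure and so meets every set of full measure. This
makes limits off null sets, and therefore traces, unique. -/
instance neBot_nhdsGT_inf_ae : (𝓝[>] (0 : ℝ) ⊓ ae volume).NeBot := by
  rw [inf_neBot_iff]
  intro s hs t ht
  obtain ⟨ε, hε, h⟩ := mem_nhdsGT_iff_exists_Ioo_subset.1 hs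
  have h1 : volume (Ioo (0 : ℝ) ε ∩ t) ≠ 0 := by
    rw [measure_inter_conull' (measure_mono_null (sdiff_subset_compl _ _) (mem_ae_iff.1 ht))]
    simpa using hε
  obtain ⟨x, hx⟩ := nonempty_of_measure_ne_zero h1
  exact ⟨x, h hx.1, hx.2⟩

variable {G G' : Set (Euc d × Euc d)} {σ f g u : Euc d × Euc d → ℝ}
include hX hV

/-- Along the chord u agrees almost everywhere with the explicit function W given by
`transportInv_flow` and `lifting_flow`. This W is continuous on the closed chord, so the limit is W
0. -/
lemma tendsto_line_of_ae_eq {z : Euc d × Euc d} {M : ℝ} (hz : IsRegularLine X V σ M z)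
    (hf : IntegrableOn (fun r => f (flow z r)) (chord X z)) (hG : IsSection X V G)
    (hu : ∀ᵐ r ∂volume.restrict (chord X z),
      u (flow z r) = transportInv X V σ G f (flow z r) + lifting X V σ G g (flow z r)) :
    (z ∈ GammaMinus X V → Tendsto (fun t : ℝ => u (z.1 + t • z.2, z.2)) (𝓝[>] 0 ⊓ ae volume)
      (𝓝 (transportInv X V σ G f z + lifting X V σ G g z))) ∧
    (z ∈ GammaPlus X V → Tendsto (fun t : ℝ => u (z.1 - t • z.2, z.2)) (𝓝[>] 0 ⊓ ae volume)
      (𝓝 (transportInv X V σ G f z + lifting X V σ G g z))) := by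
  set U := transportInv X V σ G f z + lifting X V σ G g z with hU
  set I := Icc (-tauMinus X z) (tauPlus X z) with hI
  set W : ℝ → ℝ := fun r => Real.exp (-lineInt σ z r) *
    (U + ∫ s in (0 : ℝ)..r, Real.exp (lineInt σ z s) * f (flow z s)) with hW
  have hi := hz.integrableOn_exp_mul hf
  have h0 := zero_mem_Icc X z
  have hc : ContinuousOn W I := by
    have hle : -tauMinus X z ≤ tauPlus X z := h0.1.trans h0.2
    refine hz.continuousOn.neg.rexp.mul (continuousOn_const.add ?_)
    rw [← uIcc_of_le hle]
    rw [← uIcc_of_le hle] at h0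
    exact intervalIntegral.continuousOn_primitive_interval'
      (intervalIntegrable_of_chord hi ⟨le_rfl, hle⟩ ⟨hle, le_rfl⟩) h0
  have hW0 : W 0 = U := by simp [hW, lineInt]
  have hlim : Tendsto W (𝓝[I] 0) (𝓝 U) := hW0 ▸ hc 0 h0
  have hev : ∀ᵐ r ∂volume, r ∈ chord X z → u (flow z r) = W r := by
    rw [ae_restrict_iff' (measurableSet_chord X z)] at hu
    filter_upwards [hu] with r hr hrc
    have hrI := chord_subset_Icc X z hrc
    rw [hr hrc, transportInv_flow hX hV hG hz hf hrI, lifting_flow hX hV hG hz hrI, hW, hU]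
    ring
  refine ⟨fun hzm => ?_, fun hzp => ?_⟩
  · have hp := tauPlus_pos_of_goodSet_of_mem_GammaMinus hX hV hzm
    have hm := tauMinus_of_mem_GammaMinus hX hzm
    have hIoo : Ioo 0 (tauPlus X z) ∈ 𝓝[>] (0 : ℝ) := Ioo_mem_nhdsGT hp
    have h1 : Tendsto W (𝓝[>] 0 ⊓ ae volume) (𝓝 U) := by
      refine (hlim.mono_left ?_).mono_left inf_le_left
      refine nhdsWithin_le_of_mem (mem_of_superset hIoo ?_)
      rw [hI, hm, neg_zero]; exact Ioo_subset_Icc_self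
    refine h1.congr' ?_
    filter_upwards [mem_inf_of_left hIoo, mem_inf_of_right hev] with t ht hte
    exact (hte (by rwa [chord, hm, neg_zero])).symm
  · have hp := tauMinus_pos_of_mem_GammaPlus hX hV hzp
    have hm := tauPlus_of_mem_GammaPlus hX hzp
    have hIoo : Ioo 0 (tauMinus X z) ∈ 𝓝[>] (0 : ℝ) := Ioo_mem_nhdsGT hp
    have hneg : Tendsto (fun t : ℝ => -t) (𝓝[>] 0) (𝓝[I] 0) := by
      refine tendsto_nhdsWithin_iff.2 ⟨?_, ?_⟩
      · have : Tendsto (fun t : ℝ => -t) (𝓝 0) (𝓝 (-0)) := tendsto_id.neg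
        rw [neg_zero] at this
        exact this.mono_left nhdsWithin_le_nhds
      · filter_upwards [hIoo] with t ht
        exact ⟨by linarith [ht.2], by linarith [ht.1]⟩
    have h1 : Tendsto (fun t => W (-t)) (𝓝[>] 0 ⊓ ae volume) (𝓝 U) :=
      (hlim.comp hneg).mono_left inf_le_left
    have hev' : ∀ᵐ t ∂(volume : Measure ℝ), -t ∈ chord X z → u (flow z (-t)) = W (-t) :=
      (Measure.measurePreserving_neg (volume : Measure ℝ)).quasiMeasurePreserving.ae hev
    refine h1.congr' ?_
    filter_upwards [mem_inf_of_left hIoo, mem_inf_of_right hev'] with t ht hte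
    have e : u (z.1 - t • z.2, z.2) = u (flow z (-t)) := by simp [flow, sub_eq_add_neg]
    rw [e]
    exact (hte (by rw [chord, hm]; exact ⟨by linarith [ht.2], by linarith [ht.1]⟩)).symm

/-- Solutions of the transport equation have traces, given by the formulas for the solution. -/
lemma hasTrace_of_ae_eq (hσm : Measurable σ)
    (hσ : MemLp (fun z => tau X z * σ z) ⊤ (phaseMeasure X m)) (hG : IsSection X V G)
    (hfm : Measurable f) (hf : Integrable f (phaseMeasure X m))
    (hu : ∀ᵐ z ∂(phaseMeasure X m), u z = transportInv X V σ G f z + lifting X V σ G g z)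
    {h : Euc d × Euc d → ℝ} (hh : ∀ᵐ z ∂(xi X m).restrict G',
      h z = transportInv X V σ G f z + lifting X V σ G g z) :
    HasTrace X V m G' u h := by
  obtain ⟨M, -, hM⟩ := exists_ae_isRegularLine hX hV hσm hσ
  filter_upwards [ae_restrict_of_ae hM, hh,
    ae_restrict_of_ae (ae_xi_Gamma_chord hX hV hu),
    ae_restrict_of_ae (ae_integrableOn_chord hX hV hfm hf).2] with z h1 h2 h3 h4
  rw [h2]
  exact tendsto_line_of_ae_eq hX hV h1 h4 hG h3

omit hX hV in
lemma HasTrace.ae_eq {h₁ h₂ : Euc d × Euc d → ℝ} (hG : MeasurableSet G) (hGs : G ⊆ Gamma X V)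
    (H₁ : HasTrace X V m G u h₁) (H₂ : HasTrace X V m G u h₂) :
    h₁ =ᵐ[(xi X m).restrict G] h₂ := by
  filter_upwards [H₁, H₂, ae_restrict_mem hG] with z a b c
  rcases hGs c with c | c
  · exact tendsto_nhds_unique (a.2 c) (b.2 c)
  · exact tendsto_nhds_unique (a.1 c) (b.1 c)

end Trace

end

/-! ### Construction and uniqueness of the albedo operator. -/

section

variable {X V : Set (Euc d)} {m : Measure (Euc d)}

lemma scattering_congr [SFinite m] (k : Euc d → Euc d → Euc d → ℝ) {u₁ u₂ : Euc d × Euc d → ℝ}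
    (h : u₁ =ᵐ[phaseMeasure X m] u₂) :
    scattering m k u₁ =ᵐ[phaseMeasure X m] scattering m k u₂ := by
  have h1 := Measure.ae_ae_of_ae_prod h
  filter_upwards [Measure.quasiMeasurePreserving_fst.ae h1] with z hz
  refine integral_congr_ae ?_
  filter_upwards [hz] with v hv
  rw [hv]

lemma IsLinePair.phase_ac {μ ρ : Measure (Euc d × Euc d)} (hP : IsLinePair X V m μ ρ) :
    phaseMeasure X m ≪ μ := by
  obtain ⟨C, -, h⟩ := hP.exists_phase_le
  exact (Measure.absolutelyContinuous_of_le h).trans (Measure.smul_absolutelyContinuous)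

lemma IsLinePair.exists_inclusion {μ ρ : Measure (Euc d × Euc d)} (hP : IsLinePair X V m μ ρ)
    {p : ℝ≥0∞} [Fact (1 ≤ p)] (hp : p ≠ ⊤) :
    ∃ ι : Lp ℝ p μ →L[ℝ] Lp ℝ p (phaseMeasure X m), ∀ u, ι u =ᵐ[phaseMeasure X m] u := by
  obtain ⟨C, hC, hle⟩ := hP.exists_phase_le
  have hp0 : p ≠ 0 := (zero_lt_one.trans_le (Fact.out : 1 ≤ p)).ne'
  obtain ⟨ι, hι, -⟩ := exists_clm_of_formula (μ := μ) (ν := phaseMeasure X m) (p := p) id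
    (C.toReal ^ (1 / p.toReal)) (by positivity)
    (fun f => (Lp.stronglyMeasurable f).aestronglyMeasurable)
    (fun f => by
      refine eLpNorm_le_of_lintegral_rpow_le hp0 hp ENNReal.toReal_nonneg ?_
      rw [ENNReal.ofReal_toReal hC]
      simpa using lintegral_le_of_le_smul hle (fun z => ‖f z‖ₑ ^ p.toReal) univ)
    (fun f g h => hP.phase_ac.ae_eq h) (fun f g => Eventually.of_forall fun _ => rfl)
    (fun c f => Eventually.of_forall fun _ => rfl)
  exact ⟨ι, hι⟩

/-- The albedo operator between the boundary spaces of a pair of measures with the same weight. -/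
theorem exists_albedo (hX : IsC1Domain X) (hV : VelocityBounds V m) {Cp : Set (Euc d × Euc d)}
    (hCp : Cp ⊆ GammaPlus X V) (hCpm : MeasurableSet Cp) {p : ℝ≥0∞} [Fact (1 ≤ p)] (hp1 : 1 < p)
    (hp : p ≠ ⊤) {σ : Euc d × Euc d → ℝ} (hσm : Measurable σ)
    (hσ : MemLp (fun z => tau X z * σ z) ⊤ (phaseMeasure X m)) {k : Euc d → Euc d → Euc d → ℝ}
    (K Q : Lp ℝ p (phaseMeasure X m) →L[ℝ] Lp ℝ p (phaseMeasure X m))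
    (hK : ∀ u, K u =ᵐ[phaseMeasure X m] scattering m k u)
    (hQ : ∀ u, Q u =ᵐ[phaseMeasure X m]
      scattering m k (transportInv X V σ (coBdrySet X V Cp) u))
    (hfred : IsFredholmIndexZero (1 - Q)) {μ ρ : Measure (Euc d × Euc d)}
    (hP : IsLinePair X V m μ ρ) :
    ∃ B : Lp ℝ p μ →L[ℝ] Lp ℝ p μ,
      Realizes B (fun u => transportInv X V σ (bdrySet X V Cp) (scattering m k u)) ∧
      (IsUnit (1 - B) →
        ∃ A : Lp ℝ p (ρ.restrict (bdrySet X V Cp)) →L[ℝ] Lp ℝ p (ρ.restrict (coBdrySet X V Cp)),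
          IsAlbedo X V m Cp σ k μ A ∧ (∀ A', IsAlbedo X V m Cp σ k μ A' → A' = A) ∧
          IsFredholmIndexZero A ∧ Module.rank ℝ A.ker = Module.rank ℝ (1 - Q).ker) := by
  have := hV.isFiniteMeasure
  have hG := isSection_bdrySet hX hV hCp hCpm
  have hG' : IsSection X V (coBdrySet X V Cp) := hG.compl hX hV
  set G := bdrySet X V Cp
  set G' := coBdrySet X V Cp
  have hμ := hP.ac_add
  have hρG := hP.restrict_ac_add (G := G)
  have hρG' := hP.restrict_ac_add (G := G')
  obtain ⟨M, hM1, hM2⟩ := exists_ae_isRegularLine hX hV hσm hσ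
  have hregμ := ae_of_absolutelyContinuous hX hV hμ hM1 hM2
  have hregG := ae_of_absolutelyContinuous hX hV hρG hM1 hM2
  have hregG' := ae_of_absolutelyContinuous hX hV hρG' hM1 hM2
  obtain ⟨T, hT⟩ := exists_transportInv_clm (p := p) hX hV hG hμ hp1 hp hσm hσ (hP.fib_le hX hV)
  obtain ⟨T', hT'⟩ := exists_transportInv_clm (p := p) hX hV hG' hμ hp1 hp hσm hσ
    (hP.fib_le hX hV)
  obtain ⟨R, hR⟩ := exists_transportInv_clm (p := p) hX hV hG hρG' hp1 hp hσm hσ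
    (hP.fib_boundary_le hX hV hG')
  obtain ⟨-, L, hL⟩ := exists_lifting_clm (p := p) hX hV hG hμ hp1 hp hσm hσ (hP.end_le hX hV hG)
  obtain ⟨cL', L', hL'⟩ := exists_lifting_clm (p := p) hX hV hG' hμ hp1 hp hσm hσ
    (hP.end_le hX hV hG')
  obtain ⟨-, J, hJ⟩ := exists_lifting_clm (p := p) hX hV hG hρG' hp1 hp hσm hσ
    (hP.end_boundary_le hX hV hG hG')
  obtain ⟨cJ, -⟩ := exists_lifting_clm (p := p) hX hV hG hρG' hp1 hp hσm hσ
    (hP.end_boundary_le hX hV hG hG')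
  obtain ⟨cJ', J', hJ'⟩ := exists_lifting_clm (p := p) hX hV hG' hρG hp1 hp hσm hσ
    (hP.end_boundary_le hX hV hG' hG)
  -- Through this inclusion K maps L^p(μ) to L^p(X × V), while T and T' go back. So KT' acts on the
  -- unweighted space for either weight.
  obtain ⟨ι, hι⟩ := hP.exists_inclusion hp
  have hphase := hP.phase_ac
  have hKw : ∀ u, (K ∘L ι) u =ᵐ[phaseMeasure X m] scattering m k u := fun u =>
    (hK (ι u)).trans (scattering_congr k (hι u))
  have hJJ' : ∀ g, J' (J g) = g := fun g => Lp.ext <| by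
    filter_upwards [hJ' (J g), cJ' _ _ (hJ g), hregG, ae_restrict_mem hG.measurableSet]
      with z h1 h2 h3 h4
    rw [h1, h2, lifting_lifting hX hV hG hG' h3, lifting_of_mem hX hV hG h3.good h4]
  have hJ'J : ∀ g, J (J' g) = g := fun g => Lp.ext <| by
    filter_upwards [hJ (J' g), cJ _ _ (hJ' g), hregG', ae_restrict_mem hG'.measurableSet]
      with z h1 h2 h3 h4
    rw [h1, h2, lifting_lifting hX hV hG' hG h3, lifting_of_mem hX hV hG' h3.good h4]
  -- The inverse carries boundary values along the same lines in the other direction.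
  let Je : Lp ℝ p (ρ.restrict G) ≃L[ℝ] Lp ℝ p (ρ.restrict G') :=
    ContinuousLinearEquiv.equivOfInverse J J' hJJ' hJ'J
  have eL : L' ∘L (Je : Lp ℝ p (ρ.restrict G) →L[ℝ] Lp ℝ p (ρ.restrict G')) = L := by
    refine ContinuousLinearMap.ext fun g => Lp.ext ?_
    change L' (J g) =ᵐ[μ] L g
    filter_upwards [hL' (J g), cL' _ _ (hJ g), hregμ, hL g] with z h1 h2 h3 h4
    rw [h1, h2, lifting_lifting hX hV hG hG' h3, h4]
  have hlm : ∀ f : Lp ℝ p (phaseMeasure X m), Measurable f := fun f =>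
    (Lp.stronglyMeasurable f).measurable
  have eT : T = T' + L' ∘L R := by
    refine ContinuousLinearMap.ext fun f => Lp.ext ?_
    have hint := ae_integrableOn_chord hX hV (hlm f) (Lp_integrable hX hV f)
    have e1 : (T' + L' ∘L R) f =ᵐ[μ] fun z => T' f z + L' (R f) z := Lp.coeFn_add _ _
    filter_upwards [e1, hT f, hT' f, hL' (R f), cL' _ _ (hR f), hregμ,
      ae_of_absolutelyContinuous hX hV hμ hint.1 hint.2] with z h0 h1 h2 h3 h4 h5 h6
    rw [h0, h1, h2, h3, h4, transportInv_eq_add_lifting hX hV hG hG' h5 h6]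
  have eQ : (K ∘L ι) ∘L T' = Q := by
    refine ContinuousLinearMap.ext fun f => Lp.ext ?_
    exact ((hKw (T' f)).trans (scattering_congr k (hphase.ae_eq (hT' f)))).trans (hQ f).symm
  have hB : ∀ u, (T ∘L (K ∘L ι)) u =ᵐ[μ] transportInv X V σ G (scattering m k u) := fun u =>
    (hT _).trans (ae_transportInv_congr hX hV hG hμ (hKw u))
  refine ⟨T ∘L (K ∘L ι), hB, fun hunit => ?_⟩
  obtain ⟨A, hA, hAf, hAk⟩ := fredholm_response T T' (K ∘L ι) L L' Je R eL eT hunit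
    (by rw [eQ]; exact hfred)
  rw [eQ] at hAk
  have hAlb : IsAlbedo X V m Cp σ k μ A := fun g => by
    obtain ⟨u, hu, hAg⟩ := hA g
    refine ⟨u, ?_, ?_⟩
    · have e1 : (u - T ((K ∘L ι) u) : Lp ℝ p μ) =ᵐ[μ] fun z => u z - T ((K ∘L ι) u) z :=
        Lp.coeFn_sub _ _
      rw [hu] at e1
      filter_upwards [e1, hL g, hB u] with z h1 h2 h3
      rw [← h2, h1, ← h3]
      rfl
    · have hu' : u = T ((K ∘L ι) u) + L g := by rw [← hu, add_sub_cancel]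
      have e1 : u =ᵐ[μ] fun z => T ((K ∘L ι) u) z + L g z := by
        conv_lhs => rw [hu']
        exact Lp.coeFn_add _ _
      have e2 : A g =ᵐ[ρ.restrict G'] fun z => J g z + R ((K ∘L ι) u) z := by
        rw [hAg]
        exact Lp.coeFn_add _ _
      refine hasTrace_of_ae_eq hX hV hσm hσ hG (hlm ((K ∘L ι) u))
        (Lp_integrable hX hV ((K ∘L ι) u)) (g := g) ?_ ?_
      · refine hphase.ae_le ?_
        filter_upwards [e1, hT ((K ∘L ι) u), hL g] with z h1 h2 h3
        rw [h1, h2, h3]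
      · refine (hP.xi_ac.restrict G').ae_le ?_
        filter_upwards [e2, hJ g, hR ((K ∘L ι) u)] with z h1 h2 h3
        rw [h1, h2, h3, add_comm]
  refine ⟨A, hAlb, fun A' hA' => ?_, hAf, hAk⟩
  refine ContinuousLinearMap.ext fun g => Lp.ext ?_
  obtain ⟨u, hu, htr⟩ := hAlb g
  obtain ⟨u', hu', htr'⟩ := hA' g
  -- Any function admitted in the definition of the albedo operator solves (1 - B)w = Lg. By
  -- invertibility it is determined by g, and so is its trace.
  have key : ∀ w : Lp ℝ p μ, (fun z => w z - transportInv X V σ G (scattering m k w) z)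
      =ᵐ[μ] lifting X V σ G g → (1 - T ∘L (K ∘L ι)) w = L g := fun w hw => Lp.ext <| by
    have e1 : (1 - T ∘L (K ∘L ι)) w =ᵐ[μ] fun z => w z - (T ∘L (K ∘L ι)) w z :=
      Lp.coeFn_sub _ _
    filter_upwards [e1, hw, hL g, hB w] with z h1 h2 h3 h4
    rw [h1, h3, ← h2, h4]
  obtain ⟨U, hU⟩ := hunit
  have huu : u' = u := by
    have h1 := (key u' hu').trans (key u hu).symm
    rw [← hU] at h1
    have h2 := congrArg (↑U⁻¹ : Lp ℝ p μ →L[ℝ] Lp ℝ p μ) h1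
    have h3 : ∀ w, (↑U⁻¹ : Lp ℝ p μ →L[ℝ] Lp ℝ p μ) ((U : Lp ℝ p μ →L[ℝ] Lp ℝ p μ) w) = w :=
      fun w => by
        have := U.inv_mul
        exact DFunLike.congr_fun this w
    rwa [h3, h3] at h2
  rw [huu] at htr'
  exact (hP.ac_xi.restrict G').ae_eq (htr'.ae_eq hG'.measurableSet hG'.subset htr)

end

/-! ### Solutions compared with their averages over short backward segments. -/

section

variable {X V : Set (Euc d)} {m : Measure (Euc d)} (hX : IsC1Domain X) (hV : VelocityBounds V m)

lemma abs_exp_sub_one_le_mul (x : ℝ) : |Real.exp x - 1| ≤ |x| * Real.exp |x| := by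
  have h1 := Real.add_one_le_exp x
  rcases le_total 0 x with h | h
  · rw [abs_of_nonneg h, abs_of_nonneg (by linarith)]
    have h2 := mul_le_mul_of_nonneg_right (Real.add_one_le_exp (-x)) (Real.exp_pos x).le
    rw [← Real.exp_add, neg_add_cancel, Real.exp_zero] at h2
    linarith
  · rw [abs_of_nonpos h, abs_of_nonpos (by linarith [Real.exp_le_one_iff.2 h])]
    have h2 := Real.one_le_exp (neg_nonneg.2 h)
    nlinarith

/-- The points from which `X` is entered or left within time `h`. -/
def nearBoundary (X : Set (Euc d)) (h : ℝ) : Set (Euc d × Euc d) :=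
  {z | tauMinus X z ≤ h ∨ tauPlus X z ≤ h}

/-- The average over the backward segment of length `h`, of the restriction of `g` to the points
of `X` from which `X` is not left within time `h`. -/
def backwardAvg (X : Set (Euc d)) (h : ℝ) (g : Euc d × Euc d → ℝ) (z : Euc d × Euc d) : ℝ :=
  h⁻¹ * ∫ s in Ioc 0 h, extendZero X ({z | h < tauPlus X z}.indicator g) (z.1 - s • z.2, z.2)

include hX in
lemma measurableSet_nearBoundary (h : ℝ) : MeasurableSet (nearBoundary X h) :=
  (measurableSet_le hX.measurable_tauMinus measurable_const).union
    (measurableSet_le hX.measurable_tauPlus measurable_const)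

include hX hV

/-- On each chord the points within time h of an end fill a length of at most 2h, while the line
integral of F is constant along the chord. -/
lemma exists_lintegral_nearBoundary_le : ∃ C : ℝ≥0∞, C ≠ ⊤ ∧ ∀ (h : ℝ)
    (F : Euc d × Euc d → ℝ≥0∞), Measurable F →
      ∫⁻ z, (nearBoundary X h).indicator (fib X F) z ∂(phaseMeasure X m) ≤
        C * ENNReal.ofReal h * ∫⁻ z, F z ∂(phaseMeasure X m) := by
  obtain ⟨C, hC, hcmp⟩ := exists_section_comparison hX hV
  have hG := isSection_GammaMinus hX hV
  refine ⟨C * (2 * C), ENNReal.mul_ne_top hC (ENNReal.mul_ne_top ENNReal.ofNat_ne_top hC),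
    fun h F hF => ?_⟩
  have hN := measurableSet_nearBoundary hX h
  have h1 : Measurable ((nearBoundary X h).indicator (1 : Euc d × Euc d → ℝ≥0∞)) :=
    measurable_one.indicator hN
  refine (hcmp _ hG _ ((measurable_fib hX hF).indicator hN)).2.trans ?_
  have h2 : ∫⁻ z in GammaMinus X V, fib X ((nearBoundary X h).indicator (fib X F)) z ∂(xi X m) ≤
      2 * ENNReal.ofReal h * ∫⁻ z in GammaMinus X V, fib X F z ∂(xi X m) := by
    rw [← lintegral_const_mul _ (measurable_fib hX hF)]
    refine lintegral_mono_ae (ae_restrict_of_ae ?_)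
    filter_upwards [ae_xi_goodSet hX hV] with z hz
    have e : fib X ((nearBoundary X h).indicator (fib X F)) z =
        ∫⁻ r in chord X z, fib X F z * (nearBoundary X h).indicator 1 (flow z r) := by
      refine setLIntegral_congr_fun (measurableSet_chord X z) fun r hr => ?_
      have e2 := fib_flow hX hV hz (chord_subset_Icc X z hr) F
      by_cases hn : flow z r ∈ nearBoundary X h
      · simp only [indicator_of_mem hn, e2, Pi.one_apply, mul_one]
      · simp only [indicator_of_notMem hn, mul_zero]
    have hm1 : Measurable fun r => (nearBoundary X h).indicator (1 : Euc d × Euc d → ℝ≥0∞)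
        (flow z r) := h1.comp (measurable_flow_right z)
    rw [e, lintegral_const_mul _ hm1, mul_comm]
    gcongr
    have hS : MeasurableSet (flow z ⁻¹' nearBoundary X h) := hN.preimage (measurable_flow_right z)
    have e3 : (fun r => (nearBoundary X h).indicator (1 : Euc d × Euc d → ℝ≥0∞) (flow z r)) =
        (flow z ⁻¹' nearBoundary X h).indicator 1 := rfl
    rw [e3, lintegral_indicator_one hS, Measure.restrict_apply hS]
    refine (measure_mono (t := Icc (-tauMinus X z) (h - tauMinus X z) ∪
      Icc (tauPlus X z - h) (tauPlus X z)) ?_).trans ((measure_union_le _ _).trans_eq ?_)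
    · rintro r ⟨hr1, hr2⟩
      have hr3 := chord_subset_Icc X z hr2
      rcases hr1 with hr1 | hr1
      · rw [tauMinus_flow hX hV hz hr3] at hr1
        exact Or.inl ⟨hr3.1, by linarith⟩
      · rw [tauPlus_flow hX hV hz hr3] at hr1
        exact Or.inr ⟨by linarith, hr3.2⟩
    · rw [Real.volume_Icc, Real.volume_Icc, two_mul]
      congr 2 <;> ring
  calc C * ∫⁻ z in GammaMinus X V, fib X ((nearBoundary X h).indicator (fib X F)) z ∂(xi X m)
      ≤ C * (2 * ENNReal.ofReal h * (C * ∫⁻ z, F z ∂(phaseMeasure X m))) := by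
        gcongr
        exact h2.trans (mul_le_mul_right (hcmp _ hG F hF).1 _)
    _ = _ := by ring

/-- X need not be convex, so z - s v might lie in X on another chord of the same line. If X is not
left within time h ≥ s from there, the whole segment up to z is in X, which excludes this. It is the
reason for the cutoff h < τ₊ in `backwardAvg`. -/
lemma neg_mem_chord {z : Euc d × Euc d} (hz : z ∈ goodSet X V) {s h : ℝ} (hs : 0 < s)
    (hsh : s ≤ h) (h1 : (flow z (-s)).1 ∈ X) (h2 : h < tauPlus X (flow z (-s))) :
    -s ∈ chord X z := by
  have hent : (flow z (-tauMinus X z)).1 ∉ X := by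
    rw [← entryPoint_eq_flow]; exact frontier_notMem hX hz.2.1.1
  refine ⟨?_, by linarith [tauPlus_nonneg X z]⟩
  by_contra hc
  rcases (show tauMinus X z ≤ s by linarith).eq_or_lt with h3 | h3
  · exact hent (by rwa [h3])
  · have h4 := mem_of_lt_tauPlus (X := X) (z := flow z (-s)) (t := s - tauMinus X z)
      (by linarith) (by linarith [tauMinus_nonneg X z])
    have e : flow z (-tauMinus X z) = flow (flow z (-s)) (s - tauMinus X z) := by
      rw [flow_flow]; congr 1; ring
    rw [e] at hent
    exact hent h4

variable {σ f g : Euc d × Euc d → ℝ} {G : Set (Euc d × Euc d)} (hG : IsSection X V G) {M h : ℝ}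
  {z : Euc d × Euc d} (hz : IsRegularLine X V σ M z)
  (hf : IntegrableOn (fun r => f (flow z r)) (chord X z))
  (hg : ∀ᵐ r ∂volume.restrict (chord X z), g (flow z r) = transportInv X V σ G f (flow z r))
  (hgz : g z = transportInv X V σ G f z) (hh : 0 < h)

omit hX hV in
lemma abs_inv_mul_setIntegral_le {φ : ℝ → ℝ} {h b : ℝ} (hh : 0 < h)
    (hb : ∀ᵐ s ∂volume.restrict (Ioc 0 h), |φ s| ≤ b) :
    |h⁻¹ * ∫ s in Ioc 0 h, φ s| ≤ b := by
  have h1 : ‖∫ s in Ioc 0 h, φ s‖ ≤ b * (volume : Measure ℝ).real (Ioc 0 h) :=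
    norm_setIntegral_le_of_norm_le_const_ae' (by simp)
      ((ae_restrict_iff' measurableSet_Ioc).1 hb)
  rw [Real.volume_real_Ioc_of_le hh.le, sub_zero, Real.norm_eq_abs] at h1
  rw [abs_mul, abs_inv, abs_of_pos hh, inv_mul_le_iff₀ hh]
  linarith

omit hX hV in
include hz in
lemma nonneg_of_isRegularLine : 0 ≤ M :=
  (integral_nonneg fun _ => abs_nonneg _).trans hz.integral_le

include hG hz hf in
lemma abs_transportInv_flow_le {r : ℝ} (hr : r ∈ Icc (-tauMinus X z) (tauPlus X z)) :
    |transportInv X V σ G f (flow z r)| ≤ Real.exp M * ∫ r in chord X z, |f (flow z r)| := by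
  have h1 := abs_transportInv_le hG (hz.flow hX hV hr)
    ((integrableOn_flow_iff hX hV hz.good hr).2 hf)
  have h2 := (measurePreserving_chord hX hV hz.good hr).integral_comp
    (MeasurableEquiv.addLeft r).measurableEmbedding fun s => |f (flow z s)|
  simp only [flow_flow] at h1
  rwa [h2] at h1

omit hX hV in
lemma ae_neg_of_ae_chord {P : ℝ → Prop} (hP : ∀ᵐ r ∂volume.restrict (chord X z), P r) :
    ∀ᵐ s ∂(volume : Measure ℝ), -s ∈ chord X z → P (-s) :=
  (Measure.measurePreserving_neg (volume : Measure ℝ)).quasiMeasurePreserving.ae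
    ((ae_restrict_iff' (measurableSet_chord X z)).1 hP)

omit hX hV in
lemma extendZero_indicator_eq (s : ℝ) (hs : (flow z (-s)).1 ∈ X)
    (hs' : h < tauPlus X (flow z (-s))) :
    extendZero X ({z | h < tauPlus X z}.indicator g) (z.1 - s • z.2, z.2) = g (flow z (-s)) := by
  have e : ((z.1 - s • z.2, z.2) : Euc d × Euc d) = flow z (-s) := by
    simp [flow, sub_eq_add_neg]
  rw [e, extendZero, indicator_of_mem (show flow z (-s) ∈ X ×ˢ (univ : Set (Euc d)) from
    ⟨hs, trivial⟩), indicator_of_mem (show flow z (-s) ∈ {z | h < tauPlus X z} from hs')]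

omit hX hV in
lemma extendZero_indicator_eq_zero (s : ℝ)
    (hs : ¬ ((flow z (-s)).1 ∈ X ∧ h < tauPlus X (flow z (-s)))) :
    extendZero X ({z | h < tauPlus X z}.indicator g) (z.1 - s • z.2, z.2) = 0 := by
  have e : ((z.1 - s • z.2, z.2) : Euc d × Euc d) = flow z (-s) := by
    simp [flow, sub_eq_add_neg]
  rw [e, extendZero]
  by_cases h1 : flow z (-s) ∈ X ×ˢ (univ : Set (Euc d))
  · rw [indicator_of_mem h1, indicator_of_notMem
      (show flow z (-s) ∉ {z | h < tauPlus X z} from fun h2 => hs ⟨h1.1, h2⟩)]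
  · rw [indicator_of_notMem h1]

-- A bound without gain in h, used only near the ends of chords, where the thinness of the set
-- provides the smallness. The solution and its backward average are each bounded by e^M times the
-- integral of |f| over the chord.
include hG hz hf hg hgz hh in
lemma abs_sub_backwardAvg_le :
    |g z - backwardAvg X h g z| ≤ 2 * Real.exp M * ∫ r in chord X z, |f (flow z r)| := by
  have h1 := abs_transportInv_flow_le hX hV hG hz hf (zero_mem_Icc X z)
  rw [flow_zero, ← hgz] at h1
  have h0 : 0 ≤ Real.exp M * ∫ r in chord X z, |f (flow z r)| := (abs_nonneg _).trans h1
  have h2 : |backwardAvg X h g z| ≤ Real.exp M * ∫ r in chord X z, |f (flow z r)| := by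
    refine abs_inv_mul_setIntegral_le hh ?_
    filter_upwards [ae_restrict_of_ae (ae_neg_of_ae_chord hg), ae_restrict_mem measurableSet_Ioc]
      with s hs hsh
    by_cases hc : (flow z (-s)).1 ∈ X ∧ h < tauPlus X (flow z (-s))
    · have hr := neg_mem_chord hX hV hz.good hsh.1 hsh.2 hc.1 hc.2
      rw [extendZero_indicator_eq s hc.1 hc.2, hs hr]
      exact abs_transportInv_flow_le hX hV hG hz hf (chord_subset_Icc X z hr)
    · rw [extendZero_indicator_eq_zero s hc, abs_zero]
      exact h0
  have h3 := abs_sub (g z) (backwardAvg X h g z)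
  linarith

-- Away from the ends, Duhamel's formula writes the increment over time s as (1 - e^(-a)) g z -
-- e^(-a) I. Here |a| ≤ M h/τ because |σ| ≤ M/τ on the chord, and I involves f only on the last
-- segment of length h.
include hG hz hf hg hgz hh in
lemma abs_sub_backwardAvg_le_of_notMem (hn : z ∉ nearBoundary X h) :
    |g z - backwardAvg X h g z| ≤ (M + 1) * Real.exp (2 * M) *
      (h / tau X z * (∫ r in chord X z, |f (flow z r)|) +
        ∫ r in Ioc (-h) 0, |f (flow z r)|) := by
  simp only [nearBoundary, mem_ofPred_eq, not_or, not_le] at hn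
  obtain ⟨hn1, hn2⟩ := hn
  have hM := nonneg_of_isRegularLine hz
  have hτ := tau_pos hX hV hz.good
  have hsub : Ioc (-h) 0 ⊆ chord X z := fun r hr =>
    ⟨by linarith [hr.1], lt_of_le_of_lt hr.2 (hh.trans hn2)⟩
  have hfi : IntegrableOn (fun r => f (flow z r)) (Ioc (-h) 0) := hf.mono_set hsub
  set Φ := ∫ r in chord X z, |f (flow z r)| with hΦ
  set Φh := ∫ r in Ioc (-h) 0, |f (flow z r)| with hΦh
  have hΦ0 : 0 ≤ Φ := integral_nonneg fun _ => abs_nonneg _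
  have hΦh0 : 0 ≤ Φh := integral_nonneg fun _ => abs_nonneg _
  have key : ∀ s ∈ Ioc 0 h, |g z - transportInv X V σ G f (flow z (-s))| ≤
      (M + 1) * Real.exp (2 * M) * (h / tau X z * Φ + Φh) := by
    intro s hs
    have hsc : -s ∈ chord X z := ⟨by linarith [hs.2], by linarith [hs.1, tauPlus_nonneg X z]⟩
    have hsI := chord_subset_Icc X z hsc
    have hs0 : -s ≤ 0 := by linarith [hs.1]
    have hIoc : Ioc (-s) 0 ⊆ Ioc (-h) 0 := Ioc_subset_Ioc_left (by linarith [hs.2])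
    set a := lineInt σ z (-s) with ha
    set I := ∫ r in (0 : ℝ)..(-s), Real.exp (lineInt σ z r) * f (flow z r) with hI
    have ha1 : |a| ≤ M := hz.abs_lineInt_le hsI
    have ha2 : |a| ≤ M * (h / tau X z) := by
      have h1 : ‖∫ r in (0 : ℝ)..(-s), σ (flow z r)‖ ≤ M / tau X z * |(-s) - 0| := by
        refine intervalIntegral.norm_integral_le_of_norm_le_const_ae ?_
        filter_upwards [(ae_restrict_iff' (measurableSet_chord X z)).1 hz.ae_le] with r hr hr'
        rw [uIoc_of_ge hs0] at hr'
        exact hr (hsub (hIoc hr'))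
      rw [Real.norm_eq_abs, sub_zero, abs_neg, abs_of_pos hs.1] at h1
      refine h1.trans ?_
      rw [mul_div_assoc', div_mul_eq_mul_div]
      gcongr
      exact hs.2
    have hI1 : |I| ≤ Real.exp M * Φh := by
      rw [hI, intervalIntegral.integral_symm, abs_neg, intervalIntegral.integral_of_le hs0, hΦh,
        ← integral_const_mul]
      have hint := (hz.integrableOn_exp_mul hf).mono_set hsub
      refine (abs_integral_le_integral_abs).trans ?_
      refine (setIntegral_mono_set hint.abs (ae_of_all _ fun _ => abs_nonneg _)
        (Eventually.of_forall hIoc)).trans ?_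
      refine setIntegral_mono_on hint.abs (hfi.abs.const_mul _) measurableSet_Ioc fun r hr => ?_
      rw [abs_mul, Real.abs_exp]
      gcongr
      exact (le_abs_self _).trans (hz.abs_lineInt_le (chord_subset_Icc X z (hsub hr)))
    have hg1 : |g z| ≤ Real.exp M * Φ := by
      have h1 := abs_transportInv_flow_le hX hV hG hz hf (zero_mem_Icc X z)
      rwa [flow_zero, ← hgz] at h1
    have he : |1 - Real.exp (-a)| ≤ M * (h / tau X z) * Real.exp M := by
      have h1 : |Real.exp (-a) - 1| ≤ |a| * Real.exp |a| := by
        have := abs_exp_sub_one_le_mul (-a)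
        rwa [abs_neg] at this
      rw [abs_sub_comm]
      refine h1.trans ?_
      gcongr
    have hea : Real.exp (-a) ≤ Real.exp M :=
      Real.exp_le_exp.2 ((neg_le_abs a).trans ha1)
    have e : g z - transportInv X V σ G f (flow z (-s)) =
        (1 - Real.exp (-a)) * g z - Real.exp (-a) * I := by
      rw [transportInv_flow hX hV hG hz hf hsI, ← hgz]; ring
    rw [e]
    have hx : 0 ≤ h / tau X z := by positivity
    have hE : 1 ≤ Real.exp M := Real.one_le_exp hM
    have hE2 : Real.exp (2 * M) = Real.exp M * Real.exp M := by rw [← Real.exp_add]; ring_nf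
    calc |(1 - Real.exp (-a)) * g z - Real.exp (-a) * I|
        ≤ |1 - Real.exp (-a)| * |g z| + Real.exp (-a) * |I| := by
          refine (abs_sub _ _).trans ?_
          rw [abs_mul, abs_mul, Real.abs_exp]
      _ ≤ M * (h / tau X z) * Real.exp M * (Real.exp M * Φ) +
          Real.exp M * (Real.exp M * Φh) := by gcongr
      _ = Real.exp (2 * M) * (M * (h / tau X z * Φ) + Φh) := by rw [hE2]; ring
      _ ≤ Real.exp (2 * M) * ((M + 1) * (h / tau X z * Φ) + (M + 1) * Φh) := by
          gcongr
          · linarith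
          · nlinarith
      _ = _ := by ring
  have hgm : g z - backwardAvg X h g z = h⁻¹ * ∫ s in Ioc 0 h,
      (g z - transportInv X V σ G f (flow z (-s))) := by
    have hint : IntegrableOn (fun s => transportInv X V σ G f (flow z (-s))) (Ioc 0 h) := by
      have hc : ContinuousOn (fun s => transportInv X V σ G f (flow z (-s))) (Icc 0 h) := by
        have hle : -tauMinus X z ≤ tauPlus X z := by linarith [tauPlus_nonneg X z]
        have hmaps : MapsTo (fun s : ℝ => -s) (Icc 0 h) (Icc (-tauMinus X z) (tauPlus X z)) :=
          fun s hs => ⟨by linarith [hs.2], by linarith [hs.1, tauPlus_nonneg X z]⟩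
        have h0 := zero_mem_Icc X z
        have hi := hz.integrableOn_exp_mul hf
        have hp : ContinuousOn (fun r => Real.exp (-lineInt σ z r) * (transportInv X V σ G f z +
            ∫ s in (0 : ℝ)..r, Real.exp (lineInt σ z s) * f (flow z s)))
            (Icc (-tauMinus X z) (tauPlus X z)) := by
          refine hz.continuousOn.neg.rexp.mul (continuousOn_const.add ?_)
          rw [← uIcc_of_le hle] at h0 ⊢
          exact intervalIntegral.continuousOn_primitive_interval'
            (intervalIntegrable_of_chord hi ⟨le_rfl, hle⟩ ⟨hle, le_rfl⟩) h0
        refine (hp.comp continuousOn_neg hmaps).congr fun s hs => ?_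
        exact transportInv_flow hX hV hG hz hf (hmaps hs)
      exact (hc.integrableOn_Icc).mono_set Ioc_subset_Icc_self
    rw [integral_sub (by simp) hint, setIntegral_const, Real.volume_real_Ioc_of_le hh.le, sub_zero,
      smul_eq_mul, mul_sub, ← mul_assoc, inv_mul_cancel₀ hh.ne', one_mul, backwardAvg]
    congr 2
    refine setIntegral_congr_ae measurableSet_Ioc ?_
    filter_upwards [ae_neg_of_ae_chord hg] with s hs hsh
    have hsc : -s ∈ chord X z := ⟨by linarith [hsh.2], by linarith [hsh.1, tauPlus_nonneg X z]⟩
    rw [← hs hsc]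
    refine extendZero_indicator_eq s (mem_of_mem_chord hX hz.good hsc) ?_
    rw [tauPlus_flow hX hV hz.good (chord_subset_Icc X z hsc)]
    linarith [hsh.1]
  rw [hgm]
  refine abs_inv_mul_setIntegral_le hh ?_
  filter_upwards [ae_restrict_mem measurableSet_Ioc] with s hs using key s hs

end

section

variable {X V : Set (Euc d)} {m : Measure (Euc d)}

section BackwardAverage

variable (hX : IsC1Domain X) (hV : VelocityBounds V m)
include hX hV

/-- Near the ends the q-th power is bounded by the full line integral, which only matters on a thin
set. Elsewhere h ≤ τ, and (h/τ)^q τ^(q-1) ≤ h^(q-1) produces a positive power of h. -/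
lemma exists_enorm_sub_backwardAvg_le {G : Set (Euc d × Euc d)} (hG : IsSection X V G)
    {σ : Euc d × Euc d → ℝ} (M : ℝ) {q : ℝ} (hq : 1 < q) : ∃ A B : ℝ≥0∞, A ≠ ⊤ ∧ B ≠ ⊤ ∧
    ∀ (h : ℝ) (f g : Euc d × Euc d → ℝ) (z : Euc d × Euc d), 0 < h → Measurable f →
      IsRegularLine X V σ M z → IntegrableOn (fun r => f (flow z r)) (chord X z) →
      (∀ᵐ r ∂volume.restrict (chord X z), g (flow z r) = transportInv X V σ G f (flow z r)) →
      g z = transportInv X V σ G f z →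
      ‖g z - backwardAvg X h g z‖ₑ ^ q ≤
        A * (nearBoundary X h).indicator (fib X fun z => ‖f z‖ₑ ^ q) z +
          B * ENNReal.ofReal h ^ (q - 1) * fib X (fun z => ‖f z‖ₑ ^ q) z := by
  obtain ⟨D, hD, hτD⟩ := exists_tau_le hX hV
  have hq0 : 0 ≤ q := by linarith
  have hq1 : 0 ≤ q - 1 := by linarith
  set c := (M + 1) * Real.exp (2 * M)
  refine ⟨ENNReal.ofReal (2 * Real.exp M) ^ q * ENNReal.ofReal D ^ (q - 1),
    ENNReal.ofReal c ^ q * (2 ^ (q - 1) * 2), ?_, ?_, fun h f g z hh hfm hz hf hg hgz => ?_⟩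
  · exact ENNReal.mul_ne_top (ENNReal.rpow_ne_top_of_nonneg hq0 ENNReal.ofReal_ne_top)
      (ENNReal.rpow_ne_top_of_nonneg hq1 ENNReal.ofReal_ne_top)
  · exact ENNReal.mul_ne_top (ENNReal.rpow_ne_top_of_nonneg hq0 ENNReal.ofReal_ne_top)
      (ENNReal.mul_ne_top (ENNReal.rpow_ne_top_of_nonneg hq1 ENNReal.ofNat_ne_top)
        ENNReal.ofNat_ne_top)
  set F := fib X (fun z => ‖f z‖ₑ ^ q) z with hF
  have hM := nonneg_of_isRegularLine hz
  have hτ := tau_pos hX hV hz.good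
  have hfr : Measurable fun r => ‖f (flow z r)‖ₑ := (hfm.comp (measurable_flow_right z)).enorm
  have hofReal : ∀ S : Set ℝ, IntegrableOn (fun r => f (flow z r)) S →
      ENNReal.ofReal (∫ r in S, |f (flow z r)|) = ∫⁻ r in S, ‖f (flow z r)‖ₑ := fun S hS => by
    rw [ofReal_integral_eq_lintegral_ofReal hS.abs (ae_of_all _ fun _ => abs_nonneg _)]
    simp only [Real.enorm_eq_ofReal_abs]
  have hfib : (∫⁻ r in chord X z, ‖f (flow z r)‖ₑ) ^ q ≤
      ENNReal.ofReal (tau X z) ^ (q - 1) * F := by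
    refine (lintegral_rpow_le _ hfr.aemeasurable hq).trans ?_
    rw [Measure.restrict_apply_univ, volume_chord]
    rfl
  by_cases hn : z ∈ nearBoundary X h
  · rw [indicator_of_mem hn]
    refine le_trans ?_ le_self_add
    have h1 := abs_sub_backwardAvg_le hX hV hG hz hf hg hgz hh
    rw [Real.enorm_eq_ofReal_abs]
    calc ENNReal.ofReal |g z - backwardAvg X h g z| ^ q
        ≤ (ENNReal.ofReal (2 * Real.exp M) * ∫⁻ r in chord X z, ‖f (flow z r)‖ₑ) ^ q := by
          gcongr
          rw [← hofReal _ hf, ← ENNReal.ofReal_mul (by positivity)]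
          exact ENNReal.ofReal_le_ofReal h1
      _ ≤ ENNReal.ofReal (2 * Real.exp M) ^ q * (ENNReal.ofReal (tau X z) ^ (q - 1) * F) := by
          rw [ENNReal.mul_rpow_of_nonneg _ _ hq0]
          gcongr
      _ ≤ ENNReal.ofReal (2 * Real.exp M) ^ q * (ENNReal.ofReal D ^ (q - 1) * F) := by
          gcongr
          exact hτD z hz.good
      _ = _ := by rw [mul_assoc]
  · rw [indicator_of_notMem hn, mul_zero, zero_add]
    have h1 := abs_sub_backwardAvg_le_of_notMem hX hV hG hz hf hg hgz hh hn
    simp only [nearBoundary, mem_ofPred_eq, not_or, not_le] at hn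
    have hsub : Ioc (-h) 0 ⊆ chord X z := fun r hr =>
      ⟨by linarith [hr.1, hn.1], lt_of_le_of_lt hr.2 (hh.trans hn.2)⟩
    have hfi : IntegrableOn (fun r => f (flow z r)) (Ioc (-h) 0) := hf.mono_set hsub
    have hhτ : h / tau X z ≤ 1 := by
      rw [div_le_one hτ, tau]; linarith [tauPlus_nonneg X z]
    have ha : (ENNReal.ofReal (h / tau X z) * ∫⁻ r in chord X z, ‖f (flow z r)‖ₑ) ^ q ≤
        ENNReal.ofReal h ^ (q - 1) * F := by
      calc (ENNReal.ofReal (h / tau X z) * ∫⁻ r in chord X z, ‖f (flow z r)‖ₑ) ^ q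
          ≤ ENNReal.ofReal (h / tau X z) ^ q * (ENNReal.ofReal (tau X z) ^ (q - 1) * F) := by
            rw [ENNReal.mul_rpow_of_nonneg _ _ hq0]
            gcongr
        _ ≤ ENNReal.ofReal (h / tau X z) ^ (q - 1) *
            (ENNReal.ofReal (tau X z) ^ (q - 1) * F) := by
            gcongr ?_ * _
            refine ENNReal.rpow_le_rpow_of_exponent_ge ?_ (by linarith)
            rwa [ENNReal.ofReal_le_one]
        _ = ENNReal.ofReal h ^ (q - 1) * F := by
            rw [← mul_assoc, ← ENNReal.mul_rpow_of_nonneg _ _ hq1,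
              ← ENNReal.ofReal_mul (by positivity), div_mul_cancel₀ _ hτ.ne']
    have hb : (∫⁻ r in Ioc (-h) 0, ‖f (flow z r)‖ₑ) ^ q ≤ ENNReal.ofReal h ^ (q - 1) * F := by
      refine (lintegral_rpow_le _ hfr.aemeasurable hq).trans ?_
      rw [Measure.restrict_apply_univ, Real.volume_Ioc, zero_sub, neg_neg]
      gcongr
      exact lintegral_mono_set hsub
    rw [Real.enorm_eq_ofReal_abs]
    calc ENNReal.ofReal |g z - backwardAvg X h g z| ^ q
        ≤ (ENNReal.ofReal c * (ENNReal.ofReal (h / tau X z) *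
            (∫⁻ r in chord X z, ‖f (flow z r)‖ₑ) + ∫⁻ r in Ioc (-h) 0, ‖f (flow z r)‖ₑ)) ^ q := by
          gcongr
          have hΦ : 0 ≤ ∫ r in chord X z, |f (flow z r)| := integral_nonneg fun _ => abs_nonneg _
          rw [← hofReal _ hf, ← hofReal _ hfi, ← ENNReal.ofReal_mul (by positivity),
            ← ENNReal.ofReal_add (by positivity) (integral_nonneg fun _ => abs_nonneg _),
            ← ENNReal.ofReal_mul (by positivity)]
          exact ENNReal.ofReal_le_ofReal h1
      _ ≤ ENNReal.ofReal c ^ q * (2 ^ (q - 1) * (ENNReal.ofReal h ^ (q - 1) * F +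
            ENNReal.ofReal h ^ (q - 1) * F)) := by
          rw [ENNReal.mul_rpow_of_nonneg _ _ hq0]
          gcongr
          exact (ENNReal.rpow_add_le_mul_rpow_add_rpow _ _ hq.le).trans
            (mul_le_mul_right (add_le_add ha hb) _)
      _ = _ := by ring

/-- Solutions of the transport equation are close to their averages over short segments. -/
theorem exists_lintegral_sub_backwardAvg_le {G : Set (Euc d × Euc d)} (hG : IsSection X V G)
    {σ : Euc d × Euc d → ℝ} (hσm : Measurable σ)
    (hσ : MemLp (fun z => tau X z * σ z) ⊤ (phaseMeasure X m)) {q : ℝ} (hq : 1 < q) {δ : ℝ}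
    (hδ : 0 < δ) : ∃ h > 0, ∀ f g : Euc d × Euc d → ℝ, Measurable f →
      Integrable f (phaseMeasure X m) → g =ᵐ[phaseMeasure X m] transportInv X V σ G f →
      ∫⁻ z, ‖g z - backwardAvg X h g z‖ₑ ^ q ∂(phaseMeasure X m) ≤
        ENNReal.ofReal δ * ∫⁻ z, ‖f z‖ₑ ^ q ∂(phaseMeasure X m) := by
  obtain ⟨M, hM, -⟩ := exists_ae_isRegularLine hX hV hσm hσ
  obtain ⟨A, B, hA, hB, hAB⟩ := exists_enorm_sub_backwardAvg_le hX hV hG (σ := σ) M hq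
  obtain ⟨C₁, hC₁, h1⟩ := exists_lintegral_nearBoundary_le hX hV
  obtain ⟨C₂, hC₂, h2⟩ := (isLinePair_phase hX hV).fib_le hX hV
  -- The first term is small because the neighbourhood of the chord ends is thin, the second because
  -- q > 1.
  have hlim : Tendsto (fun h : ℝ => A * C₁ * ENNReal.ofReal h +
      B * C₂ * ENNReal.ofReal h ^ (q - 1)) (𝓝[>] 0) (𝓝 0) := by
    have t0 : Tendsto (fun h : ℝ => ENNReal.ofReal h) (𝓝[>] 0) (𝓝 0) := by
      have := (ENNReal.continuous_ofReal.tendsto 0).mono_left (nhdsWithin_le_nhds (s := Ioi 0))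
      rwa [ENNReal.ofReal_zero] at this
    have t1 : Tendsto (fun h : ℝ => ENNReal.ofReal h ^ (q - 1)) (𝓝[>] 0) (𝓝 0) := by
      have := ((ENNReal.continuous_rpow_const (y := q - 1)).tendsto 0).comp t0
      rwa [ENNReal.zero_rpow_of_pos (by linarith)] at this
    have := (ENNReal.Tendsto.const_mul t0 (Or.inr (ENNReal.mul_ne_top hA hC₁))).add
      (ENNReal.Tendsto.const_mul t1 (Or.inr (ENNReal.mul_ne_top hB hC₂)))
    simpa using this
  have hpos : (0 : ℝ≥0∞) < ENNReal.ofReal δ := by simpa using hδ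
  obtain ⟨h, hh1, hh⟩ := ((hlim.eventually (gt_mem_nhds hpos)).and self_mem_nhdsWithin).exists
  refine ⟨h, hh, fun f g hfm hfi hg => ?_⟩
  have hFm : Measurable fun z => ‖f z‖ₑ ^ q := hfm.enorm.pow_const q
  have hfib := measurable_fib hX hFm
  calc ∫⁻ z, ‖g z - backwardAvg X h g z‖ₑ ^ q ∂(phaseMeasure X m)
      ≤ ∫⁻ z, (A * (nearBoundary X h).indicator (fib X fun z => ‖f z‖ₑ ^ q) z +
          B * ENNReal.ofReal h ^ (q - 1) * fib X (fun z => ‖f z‖ₑ ^ q) z)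
            ∂(phaseMeasure X m) := by
        refine lintegral_mono_ae ?_
        filter_upwards [hM, (ae_integrableOn_chord hX hV hfm hfi).1, hg, ae_phase_chord hX hV hg]
          with z a b c e using hAB h f g z hh hfm a b e c
    _ = A * ∫⁻ z, (nearBoundary X h).indicator (fib X fun z => ‖f z‖ₑ ^ q) z
          ∂(phaseMeasure X m) + B * ENNReal.ofReal h ^ (q - 1) *
            ∫⁻ z, fib X (fun z => ‖f z‖ₑ ^ q) z ∂(phaseMeasure X m) := by
        have hi := hfib.indicator (measurableSet_nearBoundary hX h)
        rw [lintegral_add_left (hi.const_mul A), lintegral_const_mul _ hi,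
          lintegral_const_mul _ hfib]
    _ ≤ A * (C₁ * ENNReal.ofReal h * ∫⁻ z, ‖f z‖ₑ ^ q ∂(phaseMeasure X m)) +
          B * ENNReal.ofReal h ^ (q - 1) * (C₂ * ∫⁻ z, ‖f z‖ₑ ^ q ∂(phaseMeasure X m)) := by
        gcongr
        · exact h1 h _ hFm
        · exact h2 _ hFm
    _ = (A * C₁ * ENNReal.ofReal h + B * C₂ * ENNReal.ofReal h ^ (q - 1)) *
          ∫⁻ z, ‖f z‖ₑ ^ q ∂(phaseMeasure X m) := by ring
    _ ≤ _ := by gcongr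

end BackwardAverage

end

section

variable {X V : Set (Euc d)} {m : Measure (Euc d)} {p : ℝ≥0∞} [Fact (1 ≤ p)]

/-! ### The mixed norm and the scattering operators it controls. -/

section Exponents

lemma conjExponent_ne_top (hp1 : 1 < p) : p.conjExponent ≠ ⊤ := by
  rw [ENNReal.conjExponent]
  exact ENNReal.add_ne_top.2 ⟨ENNReal.one_ne_top, ENNReal.inv_ne_top.2 (tsub_pos_of_lt hp1).ne'⟩

lemma conjExponent_ne_zero : p.conjExponent ≠ 0 := by
  rw [ENNReal.conjExponent]
  exact (zero_lt_one.trans_le le_self_add).ne'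

variable [IsFiniteMeasure m]

/-- The integral of the `p'`-th power in the variable `v'`. -/
def innerPow (m : Measure (Euc d)) (p : ℝ≥0∞) (κ : Euc d → Euc d → ℝ) (v : Euc d) : ℝ≥0∞ :=
  ∫⁻ v', ‖κ v' v‖ₑ ^ p.conjExponent.toReal ∂m

lemma eLpNorm_conj_eq (hp1 : 1 < p) (κ : Euc d → Euc d → ℝ) (v : Euc d) :
    eLpNorm (fun v' => κ v' v) p.conjExponent m =
      innerPow m p κ v ^ (1 / p.conjExponent.toReal) :=
  eLpNorm_eq_lintegral_rpow_enorm_toReal conjExponent_ne_zero (conjExponent_ne_top hp1)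

lemma mixedNorm_rpow (hp1 : 1 < p) (hp : p ≠ ⊤) (κ : Euc d → Euc d → ℝ) :
    mixedNorm m p κ ^ p.toReal =
      ∫⁻ v, (innerPow m p κ v ^ (1 / p.conjExponent.toReal)) ^ p.toReal ∂m := by
  have hp0 : p ≠ 0 := (zero_lt_one.trans hp1).ne'
  rw [mixedNorm, eLpNorm_eq_lintegral_rpow_enorm_toReal hp0 hp, ← ENNReal.rpow_mul,
    one_div_mul_cancel (ENNReal.toReal_pos hp0 hp).ne', ENNReal.rpow_one]
  simp only [enorm_eq_self, eLpNorm_conj_eq hp1]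

lemma measurable_innerPow {α : Type*} [MeasurableSpace α] {κ : α → Euc d → Euc d → ℝ}
    (hκ : Measurable fun w : α × Euc d × Euc d => κ w.1 w.2.1 w.2.2) :
    Measurable fun w : α × Euc d => innerPow m p (κ w.1) w.2 := by
  have h1 : Measurable fun w : (α × Euc d) × Euc d =>
      ‖κ w.1.1 w.2 w.1.2‖ₑ ^ p.conjExponent.toReal :=
    (hκ.comp (f := fun w : (α × Euc d) × Euc d => (w.1.1, w.2, w.1.2))
      (by fun_prop)).enorm.pow_const _
  exact h1.lintegral_prod_right'

lemma measurable_innerPow' {κ : Euc d → Euc d → ℝ} (hκ : Measurable (Function.uncurry κ)) :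
    Measurable (innerPow m p κ) :=
  (measurable_innerPow (α := Unit) (κ := fun _ => κ) (hκ.comp measurable_snd)).comp
    (measurable_const.prodMk measurable_id : Measurable fun v : Euc d => ((), v))

lemma mixedNorm_mono {κ₁ κ₂ : Euc d → Euc d → ℝ} (h : ∀ v' v, |κ₁ v' v| ≤ |κ₂ v' v|) :
    mixedNorm m p κ₁ ≤ mixedNorm m p κ₂ := by
  refine eLpNorm_mono_enorm fun v => ?_
  simp only [enorm_eq_self]
  exact eLpNorm_mono fun v' => h v' v

lemma mixedNorm_one_lt_top : mixedNorm m p (fun _ _ => 1) < ⊤ := by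
  have hp0 : p ≠ 0 := (zero_lt_one.trans_le (Fact.out : 1 ≤ p)).ne'
  have h1 : eLpNorm (fun _ : Euc d => (1 : ℝ)) p.conjExponent m < ⊤ :=
    (memLp_const (1 : ℝ)).2
  unfold mixedNorm
  refine (eLpNorm_le_of_ae_enorm_bound (C := eLpNorm (fun _ : Euc d => (1 : ℝ)) p.conjExponent m)
    (ae_of_all _ fun v => by simp only [enorm_eq_self]; exact le_rfl)).trans_lt ?_
  rw [smul_eq_mul]
  exact ENNReal.mul_lt_top h1 (ENNReal.rpow_lt_top_of_nonneg (by positivity) (measure_ne_top _ _))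

lemma innerPow_lt_top_ae (hp1 : 1 < p) (hp : p ≠ ⊤) {κ : Euc d → Euc d → ℝ}
    (hκ : Measurable (Function.uncurry κ)) (h : mixedNorm m p κ < ⊤) :
    ∀ᵐ v ∂m, innerPow m p κ v < ⊤ := by
  have hp0 : p ≠ 0 := (zero_lt_one.trans hp1).ne'
  have hq := ENNReal.toReal_pos hp0 hp
  have hq' := ENNReal.toReal_pos (conjExponent_ne_zero (p := p)) (conjExponent_ne_top hp1)
  have h1 := mixedNorm_rpow (m := m) hp1 hp κ
  have h2 : ∫⁻ v, (innerPow m p κ v ^ (1 / p.conjExponent.toReal)) ^ p.toReal ∂m ≠ ⊤ := by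
    rw [← h1]
    exact ENNReal.rpow_ne_top_of_nonneg hq.le h.ne
  filter_upwards [ae_lt_top (((measurable_innerPow' hκ).pow_const _).pow_const _) h2] with v hv
  rwa [ENNReal.rpow_lt_top_iff_of_pos hq, ENNReal.rpow_lt_top_iff_of_pos (by positivity)] at hv

/-- Dominated convergence for the mixed norm. -/
lemma tendsto_mixedNorm_zero (hp1 : 1 < p) (hp : p ≠ ⊤) {κ : ℕ → Euc d → Euc d → ℝ}
    {Φ : Euc d → Euc d → ℝ} (hκ : ∀ n, Measurable (Function.uncurry (κ n)))
    (hΦm : Measurable (Function.uncurry Φ)) (hΦ : mixedNorm m p Φ < ⊤)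
    (hb : ∀ n v' v, |κ n v' v| ≤ |Φ v' v|)
    (hlim : ∀ v' v, Tendsto (fun n => κ n v' v) atTop (𝓝 0)) :
    Tendsto (fun n => mixedNorm m p (κ n)) atTop (𝓝 0) := by
  have hp0 : p ≠ 0 := (zero_lt_one.trans hp1).ne'
  have hq := ENNReal.toReal_pos hp0 hp
  have hq' := ENNReal.toReal_pos (conjExponent_ne_zero (p := p)) (conjExponent_ne_top hp1)
  have hz : ∀ {u : ℕ → ℝ≥0∞} {r : ℝ}, 0 < r → Tendsto u atTop (𝓝 0) →
      Tendsto (fun n => u n ^ r) atTop (𝓝 0) := fun {u r} hr hu => by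
    have := ((ENNReal.continuous_rpow_const (y := r)).tendsto 0).comp hu
    rwa [ENNReal.zero_rpow_of_pos hr] at this
  have hle : ∀ n v, innerPow m p (κ n) v ≤ innerPow m p Φ v := fun n v => by
    refine lintegral_mono fun v' => ENNReal.rpow_le_rpow ?_ hq'.le
    rw [Real.enorm_eq_ofReal_abs, Real.enorm_eq_ofReal_abs]
    exact ENNReal.ofReal_le_ofReal (hb n v' v)
  have hin : ∀ᵐ v ∂m, Tendsto (fun n => innerPow m p (κ n) v) atTop (𝓝 0) := by
    filter_upwards [innerPow_lt_top_ae hp1 hp hΦm hΦ] with v hv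
    have h0 : (0 : ℝ≥0∞) = ∫⁻ _, 0 ∂m := by simp
    rw [h0]
    refine tendsto_lintegral_of_dominated_convergence
      (fun v' => ‖Φ v' v‖ₑ ^ p.conjExponent.toReal) (fun n => ?_) (fun n => ?_) hv.ne ?_
    · exact ((hκ n).comp (measurable_id.prodMk measurable_const)).enorm.pow_const _
    · refine ae_of_all _ fun v' => ENNReal.rpow_le_rpow ?_ hq'.le
      rw [Real.enorm_eq_ofReal_abs, Real.enorm_eq_ofReal_abs]
      exact ENNReal.ofReal_le_ofReal (hb n v' v)
    · refine ae_of_all _ fun v' => hz hq' ?_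
      have : Tendsto (fun n => ‖κ n v' v‖ₑ) atTop (𝓝 ‖(0 : ℝ)‖ₑ) :=
        (continuous_enorm.tendsto (0 : ℝ)).comp (hlim v' v)
      rwa [enorm_zero] at this
  have hout : Tendsto (fun n => mixedNorm m p (κ n) ^ p.toReal) atTop (𝓝 0) := by
    simp only [mixedNorm_rpow hp1 hp]
    have h0 : (0 : ℝ≥0∞) = ∫⁻ _, 0 ∂m := by simp
    rw [h0]
    refine tendsto_lintegral_of_dominated_convergence
      (fun v => (innerPow m p Φ v ^ (1 / p.conjExponent.toReal)) ^ p.toReal) (fun n => ?_)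
      (fun n => ?_) ?_ ?_
    · exact ((measurable_innerPow' (hκ n)).pow_const _).pow_const _
    · refine ae_of_all _ fun v => ?_
      exact ENNReal.rpow_le_rpow (ENNReal.rpow_le_rpow (hle n v) (by positivity)) hq.le
    · rw [← mixedNorm_rpow hp1 hp]
      exact ENNReal.rpow_ne_top_of_nonneg hq.le hΦ.ne
    · filter_upwards [hin] with v hv using hz hq (hz (by positivity) hv)
  have := hz (r := p.toReal⁻¹) (by positivity) hout
  refine this.congr fun n => ?_
  rw [← ENNReal.rpow_mul, mul_inv_cancel₀ hq.ne', ENNReal.rpow_one]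

end Exponents

section Scattering

variable [IsFiniteMeasure m] (hXm : MeasurableSet X)

/-- Measurable kernels whose mixed norm is at most `C` at every point of `X`. -/
structure IsBoundedKernel (X : Set (Euc d)) (m : Measure (Euc d)) (p : ℝ≥0∞)
    (k : Euc d → Euc d → Euc d → ℝ) (C : ℝ) : Prop where
  measurable : Measurable fun w : Euc d × Euc d × Euc d => k w.1 w.2.1 w.2.2
  le : ∀ x ∈ X, mixedNorm m p (k x) ≤ ENNReal.ofReal C

variable {k : Euc d → Euc d → Euc d → ℝ} {C : ℝ}

lemma IsBoundedKernel.measurable_curry (hk : IsBoundedKernel X m p k C) (x : Euc d) :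
    Measurable (Function.uncurry (k x)) :=
  hk.measurable.comp (measurable_const.prodMk measurable_id)

lemma enorm_integral_mul_le {κ w : Euc d → ℝ} (hκ : Measurable κ) (hw : Measurable w) :
    ‖∫ v, κ v * w v ∂m‖ₑ ≤ eLpNorm κ p.conjExponent m * eLpNorm w p m := by
  refine (enorm_integral_le_lintegral_enorm _).trans ?_
  have : ENNReal.HolderTriple p.conjExponent p 1 := inferInstance
  have h := eLpNorm_smul_le_mul_eLpNorm (p := p.conjExponent) (q := p) (r := 1) (μ := m)
    hw.aestronglyMeasurable hκ.aestronglyMeasurable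
  rw [eLpNorm_one_eq_lintegral_enorm] at h
  exact h

lemma ae_eLpNorm_lt_top (hp : p ≠ ⊤) {u : Euc d × Euc d → ℝ} (hu : Measurable u)
    (hLp : eLpNorm u p (phaseMeasure X m) < ⊤) :
    ∀ᵐ x ∂(volume.restrict X), eLpNorm (fun v => u (x, v)) p m < ⊤ := by
  have hp0 : p ≠ 0 := (zero_lt_one.trans_le (Fact.out : 1 ≤ p)).ne'
  rw [eLpNorm_lt_top_iff_lintegral_rpow_enorm_lt_top hp0 hp, phaseMeasure,
    lintegral_prod _ (hu.enorm.pow_const _).aemeasurable] at hLp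
  filter_upwards [ae_lt_top ((hu.enorm.pow_const _).lintegral_prod_right') hLp.ne] with x hx
  rwa [eLpNorm_lt_top_iff_lintegral_rpow_enorm_lt_top hp0 hp]

lemma lintegral_phase_fst {F : Euc d × Euc d → ℝ≥0∞} (hF : Measurable F) :
    ∫⁻ z, F z ∂(phaseMeasure X m) = ∫⁻ x in X, (∫⁻ v, F (x, v) ∂m) :=
  lintegral_prod _ hF.aemeasurable

include hXm

lemma IsBoundedKernel.ae_integrable (hp1 : 1 < p) (hp : p ≠ ⊤) (hk : IsBoundedKernel X m p k C)
    (u : Lp ℝ p (phaseMeasure X m)) :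
    ∀ᵐ z ∂(phaseMeasure X m), Integrable (fun v' => k z.1 v' z.2 * u (z.1, v')) m := by
  have hu : Measurable u := (Lp.stronglyMeasurable u).measurable
  have h1 : ∀ᵐ z ∂(phaseMeasure X m), innerPow m p (k z.1) z.2 < ⊤ := by
    have hm : MeasurableSet {z : Euc d × Euc d | innerPow m p (k z.1) z.2 < ⊤} :=
      measurableSet_lt (measurable_innerPow hk.measurable) measurable_const
    rw [phaseMeasure, Measure.ae_prod_iff_ae_ae hm]
    filter_upwards [ae_restrict_mem hXm] with x hx
    exact innerPow_lt_top_ae hp1 hp (hk.measurable_curry x)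
      ((hk.le x hx).trans_lt ENNReal.ofReal_lt_top)
  have h2 : ∀ᵐ z ∂(phaseMeasure X m), eLpNorm (fun v => u (z.1, v)) p m < ⊤ :=
    Measure.quasiMeasurePreserving_fst.ae (ae_eLpNorm_lt_top hp hu (Lp.eLpNorm_lt_top u))
  filter_upwards [h1, h2] with z a b
  have hκm : Measurable fun v' => k z.1 v' z.2 :=
    hk.measurable.comp (f := fun v' => (z.1, v', z.2)) (by fun_prop)
  have hκ : MemLp (fun v' => k z.1 v' z.2) p.conjExponent m := by
    refine ⟨hκm.aestronglyMeasurable, ?_⟩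
    rw [eLpNorm_conj_eq hp1]
    exact ENNReal.rpow_lt_top_of_nonneg (by positivity) a.ne
  have hw : MemLp (fun v' => u (z.1, v')) p m :=
    ⟨(hu.comp (by fun_prop)).aestronglyMeasurable, b⟩
  have : ENNReal.HolderTriple p.conjExponent p 1 := inferInstance
  exact hκ.integrable_mul hw

omit hXm in
lemma measurable_scattering (hk : Measurable fun w : Euc d × Euc d × Euc d => k w.1 w.2.1 w.2.2)
    {u : Euc d × Euc d → ℝ} (hu : Measurable u) : Measurable (scattering m k u) := by
  have h1 : Measurable fun w : (Euc d × Euc d) × Euc d => k w.1.1 w.2 w.1.2 * u (w.1.1, w.2) :=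
    (hk.comp (f := fun w : (Euc d × Euc d) × Euc d => (w.1.1, w.2, w.1.2)) (by fun_prop)).mul
      (hu.comp (by fun_prop))
  exact (h1.stronglyMeasurable.integral_prod_right').measurable

/-- The scattering operator is bounded by the largest mixed norm of its kernel. -/
theorem IsBoundedKernel.exists_scattering_clm (hp1 : 1 < p) (hp : p ≠ ⊤) (hC : 0 ≤ C)
    (hk : IsBoundedKernel X m p k C) :
    ∃ K : Lp ℝ p (phaseMeasure X m) →L[ℝ] Lp ℝ p (phaseMeasure X m),
      (∀ u, K u =ᵐ[phaseMeasure X m] scattering m k u) ∧ ‖K‖ ≤ C := by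
  have hp0 : p ≠ 0 := (zero_lt_one.trans hp1).ne'
  have hq := ENNReal.toReal_pos hp0 hp
  have hlm : ∀ u : Lp ℝ p (phaseMeasure X m), Measurable u := fun u =>
    (Lp.stronglyMeasurable u).measurable
  refine exists_clm_of_formula (scattering m k) C hC
    (fun u => (measurable_scattering hk.measurable (hlm u)).aestronglyMeasurable) (fun u => ?_)
    (fun u w h => scattering_congr k h) (fun u w => ?_) (fun c u => ?_)
  · have hCq : C = (C ^ p.toReal) ^ (1 / p.toReal) := by
      rw [← Real.rpow_mul hC, mul_one_div_cancel hq.ne', Real.rpow_one]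
    rw [hCq]
    refine eLpNorm_le_of_lintegral_rpow_le hp0 hp (by positivity) ?_
    rw [lintegral_phase_fst ((measurable_scattering hk.measurable (hlm u)).enorm.pow_const _),
      lintegral_phase_fst ((hlm u).enorm.pow_const _),
      ← lintegral_const_mul _ (((hlm u).enorm.pow_const _).lintegral_prod_right')]
    refine setLIntegral_mono' hXm fun x hx => ?_
    have hux : Measurable fun v => u (x, v) := (hlm u).comp (by fun_prop)
    have hU : eLpNorm (fun v => u (x, v)) p m ^ p.toReal =
        ∫⁻ v, ‖u (x, v)‖ₑ ^ p.toReal ∂m := by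
      rw [eLpNorm_eq_lintegral_rpow_enorm_toReal hp0 hp, ← ENNReal.rpow_mul,
        one_div_mul_cancel hq.ne', ENNReal.rpow_one]
    -- Hölder's inequality in v' at fixed (x, v) separates the norm of u(x, ·), which no longer
    -- depends on v; integrating in v gives the mixed norm.
    calc ∫⁻ v, ‖scattering m k u (x, v)‖ₑ ^ p.toReal ∂m
        ≤ ∫⁻ v, (innerPow m p (k x) v ^ (1 / p.conjExponent.toReal)) ^ p.toReal *
            eLpNorm (fun v => u (x, v)) p m ^ p.toReal ∂m := by
          refine lintegral_mono fun v => ?_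
          rw [← ENNReal.mul_rpow_of_nonneg _ _ hq.le, ← eLpNorm_conj_eq hp1]
          refine ENNReal.rpow_le_rpow ?_ hq.le
          exact enorm_integral_mul_le
            (hk.measurable.comp (f := fun v' => (x, v', v)) (by fun_prop)) hux
      _ = mixedNorm m p (k x) ^ p.toReal * ∫⁻ v, ‖u (x, v)‖ₑ ^ p.toReal ∂m := by
          rw [lintegral_mul_const _ (((measurable_innerPow' (hk.measurable_curry x)).pow_const
            _).pow_const _), mixedNorm_rpow hp1 hp, hU]
      _ ≤ _ := by
          gcongr
          rw [← ENNReal.ofReal_rpow_of_nonneg hC hq.le]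
          exact ENNReal.rpow_le_rpow (hk.le x hx) hq.le
  · filter_upwards [hk.ae_integrable hXm hp1 hp u, hk.ae_integrable hXm hp1 hp w] with z h1 h2
    simp only [scattering, mul_add]
    exact integral_add h1 h2
  · refine ae_of_all _ fun z => ?_
    simp only [scattering, mul_left_comm]
    exact integral_const_mul _ _

end Scattering

end

section

variable {X V : Set (Euc d)} {m : Measure (Euc d)} {p : ℝ≥0∞} [Fact (1 ≤ p)]

/-! ### Velocity averages of solutions. -/

section FiberIntegral

lemma one_lt_toReal (hp1 : 1 < p) (hp : p ≠ ⊤) : 1 < p.toReal := by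
  rw [← ENNReal.toReal_one]; exact ENNReal.toReal_strict_mono hp hp1

lemma opNorm_le_of_eLpNorm_le {α β : Type*} [MeasurableSpace α] [MeasurableSpace β]
    {μ : Measure α} {ν : Measure β} (A : Lp ℝ p μ →L[ℝ] Lp ℝ p ν) {C : ℝ} (hC : 0 ≤ C)
    (h : ∀ f, eLpNorm (A f) p ν ≤ ENNReal.ofReal C * eLpNorm f p μ) : ‖A‖ ≤ C := by
  refine A.opNorm_le_bound hC fun f => ?_
  rw [Lp.norm_def, Lp.norm_def, ← ENNReal.toReal_ofReal hC, ← ENNReal.toReal_mul]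
  exact ENNReal.toReal_mono (ENNReal.mul_ne_top ENNReal.ofReal_ne_top (Lp.eLpNorm_ne_top f)) (h f)

variable [IsFiniteMeasure m]

lemma lintegral_fiberIntegral_le (D : Set (Euc d)) {q : ℝ} (hq : 1 < q) {F : Euc d × Euc d → ℝ}
    (hF : Measurable F) :
    ∫⁻ x in X, ‖∫ v in D, F (x, v) ∂m‖ₑ ^ q ≤
      m univ ^ (q - 1) * ∫⁻ z, ‖F z‖ₑ ^ q ∂(phaseMeasure X m) := by
  rw [lintegral_phase_fst (hF.enorm.pow_const _),
    ← lintegral_const_mul _ ((hF.enorm.pow_const _).lintegral_prod_right')]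
  refine lintegral_mono fun x => ?_
  have hm : Measurable fun v => ‖F (x, v)‖ₑ := (hF.comp (by fun_prop)).enorm
  calc ‖∫ v in D, F (x, v) ∂m‖ₑ ^ q ≤ (∫⁻ v, ‖F (x, v)‖ₑ ∂m) ^ q := by
        refine ENNReal.rpow_le_rpow ?_ (by linarith)
        exact (enorm_integral_le_lintegral_enorm _).trans
          (lintegral_mono' Measure.restrict_le_self le_rfl)
    _ ≤ _ := lintegral_rpow_le m hm.aemeasurable hq

lemma measurable_fiberIntegral (D : Set (Euc d)) {F : Euc d × Euc d → ℝ} (hF : Measurable F) :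
    Measurable fun x => ∫ v in D, F (x, v) ∂m :=
  (hF.stronglyMeasurable.integral_prod_right').measurable

lemma ae_integrable_fiber {F : Euc d × Euc d → ℝ} (hF : Integrable F (phaseMeasure X m)) :
    ∀ᵐ x ∂(volume.restrict X), Integrable (fun v => F (x, v)) m := hF.prod_right_ae

lemma exists_fiberIntegral_clm (hV : VelocityBounds V m) (hX : IsC1Domain X) (D : Set (Euc d))
    (hp1 : 1 < p) (hp : p ≠ ⊤) :
    ∃ W : Lp ℝ p (phaseMeasure X m) →L[ℝ] Lp ℝ p (volume.restrict X),
      ∀ u, W u =ᵐ[volume.restrict X] fun x => ∫ v in D, u (x, v) ∂m := by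
  have hp0 : p ≠ 0 := (zero_lt_one.trans hp1).ne'
  have hq := one_lt_toReal hp1 hp
  have hlm : ∀ u : Lp ℝ p (phaseMeasure X m), Measurable u := fun u =>
    (Lp.stronglyMeasurable u).measurable
  obtain ⟨W, hW, -⟩ := exists_clm_of_formula (μ := phaseMeasure X m) (ν := volume.restrict X)
    (p := p) (fun u x => ∫ v in D, u (x, v) ∂m) ((m univ ^ (p.toReal - 1)).toReal ^ (1 / p.toReal))
    (by positivity) (fun u => (measurable_fiberIntegral D (hlm u)).aestronglyMeasurable)
    (fun u => by
      refine eLpNorm_le_of_lintegral_rpow_le hp0 hp ENNReal.toReal_nonneg ?_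
      rw [ENNReal.ofReal_toReal (ENNReal.rpow_ne_top_of_nonneg (by linarith) (measure_ne_top _ _))]
      exact lintegral_fiberIntegral_le D hq (hlm u))
    (fun f g h => by
      filter_upwards [Measure.ae_ae_of_ae_prod h] with x hx
      exact integral_congr_ae (ae_restrict_of_ae hx))
    (fun f g => by
      filter_upwards [ae_integrable_fiber (Lp_integrable hX hV f),
        ae_integrable_fiber (Lp_integrable hX hV g)] with x h1 h2
      exact integral_add h1.integrableOn h2.integrableOn)
    (fun c f => ae_of_all _ fun x => integral_const_mul _ _)
  exact ⟨W, hW⟩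

lemma exists_indicator_clm {S : Set (Euc d × Euc d)}
    (hS : MeasurableSet S) :
    ∃ M : Lp ℝ p (phaseMeasure X m) →L[ℝ] Lp ℝ p (phaseMeasure X m),
      ∀ u, M u =ᵐ[phaseMeasure X m] S.indicator u := by
  obtain ⟨M, hM, -⟩ := exists_clm_of_formula (μ := phaseMeasure X m) (ν := phaseMeasure X m)
    (p := p) (fun u => S.indicator u) 1 zero_le_one
    (fun u => ((Lp.stronglyMeasurable u).indicator hS).aestronglyMeasurable)
    (fun u => by
      rw [ENNReal.ofReal_one, one_mul]
      exact eLpNorm_indicator_le _)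
    (fun f g h => by
      filter_upwards [h] with z hz
      simp only [indicator, hz])
    (fun f g => ae_of_all _ fun z => by by_cases hz : z ∈ S <;> simp [hz])
    (fun c f => ae_of_all _ fun z => by by_cases hz : z ∈ S <;> simp [hz])
  exact ⟨M, hM⟩

lemma exists_embedding_clm (hp0 : p ≠ 0) (hp : p ≠ ⊤) {S : Set (Euc d × Euc d)}
    (hS : MeasurableSet S) :
    ∃ M : Lp ℝ p (volume.restrict X) →L[ℝ] Lp ℝ p (phaseMeasure X m),
      ∀ w, M w =ᵐ[phaseMeasure X m] S.indicator fun z => w z.1 := by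
  have hlm : ∀ u : Lp ℝ p (volume.restrict X), Measurable u := fun u =>
    (Lp.stronglyMeasurable u).measurable
  obtain ⟨M, hM, -⟩ := exists_clm_of_formula (μ := volume.restrict X) (ν := phaseMeasure X m)
    (p := p) (fun w => S.indicator fun z => w z.1) ((m univ).toReal ^ (1 / p.toReal))
    (by positivity)
    (fun u => (((hlm u).comp measurable_fst).indicator hS).aestronglyMeasurable)
    (fun u => by
      refine (eLpNorm_indicator_le _).trans ?_
      refine eLpNorm_le_of_lintegral_rpow_le hp0 hp ENNReal.toReal_nonneg ?_
      rw [lintegral_phase_fst (F := fun z => ‖u z.1‖ₑ ^ p.toReal)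
        (((hlm u).comp measurable_fst).enorm.pow_const _),
        ENNReal.ofReal_toReal (measure_ne_top _ _),
        ← lintegral_const_mul _ ((hlm u).enorm.pow_const _)]
      refine lintegral_mono fun x => ?_
      simp only [lintegral_const, mul_comm, le_refl])
    (fun f g h => by
      have h1 : ∀ᵐ z ∂(phaseMeasure X m), f z.1 = g z.1 :=
        Measure.quasiMeasurePreserving_fst.ae h
      filter_upwards [h1] with z hz
      simp only [indicator, hz])
    (fun f g => ae_of_all _ fun z => by by_cases hz : z ∈ S <;> simp [hz])
    (fun c f => ae_of_all _ fun z => by by_cases hz : z ∈ S <;> simp [hz])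
  exact ⟨M, hM⟩

/-- The velocity average of `g` minus that of its backward averages. -/
lemma ae_fiberIntegral_sub (hXm : MeasurableSet X) {D : Set (Euc d)} (hD : MeasurableSet D) (h : ℝ)
    {g : Euc d × Euc d → ℝ} (hg : Integrable g (phaseMeasure X m))
    (hτ : Measurable (tauPlus X)) :
    ∀ᵐ x ∂(volume.restrict X), (∫ v in D, g (x, v) ∂m) -
        h⁻¹ * velocityAvg X m h ({z | z.2 ∈ D ∧ h < tauPlus X z}.indicator g) x =
      ∫ v in D, (g (x, v) - backwardAvg X h g (x, v)) ∂m := by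
  set S : Set (Euc d × Euc d) := {z | z.2 ∈ D ∧ h < tauPlus X z}
  have hS : MeasurableSet S :=
    (measurable_snd hD).inter (measurableSet_lt measurable_const hτ)
  have hF : Integrable (extendZero X (S.indicator g)) (volume.prod m) :=
    integrable_extendZero hXm (hg.indicator hS)
  have hE : ∀ z : Euc d × Euc d, extendZero X (S.indicator g) z =
      D.indicator (fun _ => extendZero X ({z | h < tauPlus X z}.indicator g) z) z.2 := fun z => by
    by_cases h1 : z.1 ∈ X <;> by_cases h2 : z.2 ∈ D <;> by_cases h3 : h < tauPlus X z <;>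
      simp [extendZero, S, indicator, h1, h2, h3]
  filter_upwards [ae_integrable_fiber hg, ae_restrict_of_ae
    (integrable_comp_lineEquiv (h := h) hF).prod_right_ae] with x h1 h2
  have h3 : ∀ v, ∫ s in Ioc 0 h, extendZero X (S.indicator g) (x - s • v, v) =
      D.indicator (fun v => ∫ s in Ioc 0 h,
        extendZero X ({z | h < tauPlus X z}.indicator g) (x - s • v, v)) v := fun v => by
    simp only [hE]
    by_cases hv : v ∈ D <;> simp [hv]
  have h4 := h2.integral_prod_left
  simp only [h3] at h4
  rw [integrable_indicator_iff hD] at h4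
  have h5 : velocityAvg X m h (S.indicator g) x = ∫ v in D, (∫ s in Ioc 0 h,
        extendZero X ({z | h < tauPlus X z}.indicator g) (x - s • v, v)) ∂m := by
    rw [velocityAvg, lineAvg, integral_prod _ h2, ← integral_indicator hD]
    exact integral_congr_ae (ae_of_all _ fun v => h3 v)
  rw [h5, ← integral_const_mul, ← integral_sub h1.integrableOn (h4.const_mul _)]
  rfl

lemma measurable_backwardAvg (hXm : MeasurableSet X) (hτ : Measurable (tauPlus X)) (h : ℝ)
    {g : Euc d × Euc d → ℝ} (hg : Measurable g) : Measurable (backwardAvg X h g) := by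
  have h1 : Measurable (extendZero X ({z | h < tauPlus X z}.indicator g)) :=
    measurable_extendZero hXm (hg.indicator (measurableSet_lt measurable_const hτ))
  have h2 : Measurable fun w : (Euc d × Euc d) × ℝ =>
      extendZero X ({z | h < tauPlus X z}.indicator g) (w.1.1 - w.2 • w.1.2, w.1.2) :=
    h1.comp (by fun_prop)
  exact (h2.stronglyMeasurable.integral_prod_right').measurable.const_mul _

/-- Velocity averages of solutions of the transport equation depend compactly on the source. -/
theorem isFiniteRankLimit_fiberIntegral (hd : 1 ≤ d) (hX : IsC1Domain X)
    (hV : VelocityBounds V m) (hp1 : 1 < p)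
    (hp : p ≠ ⊤) {G : Set (Euc d × Euc d)} (hG : IsSection X V G)
    {σ : Euc d × Euc d → ℝ} (hσm : Measurable σ)
    (hσ : MemLp (fun z => tau X z * σ z) ⊤ (phaseMeasure X m))
    {T : Lp ℝ p (phaseMeasure X m) →L[ℝ] Lp ℝ p (phaseMeasure X m)}
    (hT : ∀ f, T f =ᵐ[phaseMeasure X m] transportInv X V σ G f) {D : Set (Euc d)}
    (hD : MeasurableSet D) {W : Lp ℝ p (phaseMeasure X m) →L[ℝ] Lp ℝ p (volume.restrict X)}
    (hW : ∀ u, W u =ᵐ[volume.restrict X] fun x => ∫ v in D, u (x, v) ∂m) :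
    IsFiniteRankLimit (W ∘L T) := by
  have hXm : MeasurableSet X := hX.isOpen.measurableSet
  have hp0 : p ≠ 0 := (zero_lt_one.trans hp1).ne'
  have hq := one_lt_toReal hp1 hp
  have hq0 : 0 < p.toReal := zero_lt_one.trans hq
  have hlm : ∀ u : Lp ℝ p (phaseMeasure X m), Measurable u := fun u =>
    (Lp.stronglyMeasurable u).measurable
  refine IsFiniteRankLimit.of_approx fun ε hε => ?_
  set c : ℝ := (m univ ^ (p.toReal - 1)).toReal with hc
  have hc0 : 0 ≤ c := ENNReal.toReal_nonneg
  have hcm : m univ ^ (p.toReal - 1) = ENNReal.ofReal c :=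
    (ENNReal.ofReal_toReal
      (ENNReal.rpow_ne_top_of_nonneg (by linarith) (measure_ne_top _ _))).symm
  -- Averaging over velocities costs the factor c in the p-th power; this δ makes c δ at most ε^p.
  obtain ⟨h, hh, hest⟩ := exists_lintegral_sub_backwardAvg_le hX hV hG hσm hσ hq
    (δ := ε ^ p.toReal / (c + 1)) (by positivity)
  obtain ⟨Th, hTh, hTh'⟩ := exists_velocityAvg_isFiniteRankLimit (m := m) hd hXm hX.isBounded
    hV.null_orthogonal hh.le hp1 hp
  have hτ := hX.measurable_tauPlus
  have hS : MeasurableSet {z : Euc d × Euc d | z.2 ∈ D ∧ h < tauPlus X z} :=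
    (measurable_snd hD).inter (measurableSet_lt measurable_const hτ)
  obtain ⟨M, hM⟩ := exists_indicator_clm (X := X) (m := m) (p := p) hS
  set J : Lp ℝ p (volume.restrict X) →L[ℝ] Lp ℝ p (volume.restrict X) :=
    h⁻¹ • ContinuousLinearMap.id ℝ (Lp ℝ p (volume.restrict X))
  -- The cutoff to velocities in D and to h < τ₊ makes this operator the integral over D of the
  -- backward averages of T f, so the error only involves T f minus its backward average.
  refine ⟨J ∘L (Th ∘L (M ∘L T)), (hTh.comp_right _).comp_left _, ?_⟩
  refine opNorm_le_of_eLpNorm_le _ hε.le fun f => ?_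
  have hae : (W ∘L T - J ∘L (Th ∘L (M ∘L T))) f
      =ᵐ[volume.restrict X]
      fun x => ∫ v in D, (T f (x, v) - backwardAvg X h (T f) (x, v)) ∂m := by
    have e : (W ∘L T - J ∘L (Th ∘L (M ∘L T))) f =
      W (T f) - h⁻¹ • Th (M (T f)) := rfl
    rw [e]
    filter_upwards [Lp.coeFn_sub (W (T f)) (h⁻¹ • Th (M (T f))),
      Lp.coeFn_smul h⁻¹ (Th (M (T f))), hW (T f), hTh' (M (T f)),
      velocityAvg_congr (h := h) hXm (hM (T f)),
      ae_fiberIntegral_sub hXm hD h (Lp_integrable hX hV (T f)) hτ] with x h1 h2 h3 h4 h5 h6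
    rw [h1, Pi.sub_apply, h2, Pi.smul_apply, h3, h4, h5, smul_eq_mul]
    exact h6
  rw [eLpNorm_congr_ae hae]
  have hεq : ε = (ε ^ p.toReal) ^ (1 / p.toReal) := by
    rw [← Real.rpow_mul hε.le, mul_one_div_cancel hq0.ne', Real.rpow_one]
  rw [hεq]
  refine eLpNorm_le_of_lintegral_rpow_le hp0 hp (by positivity) ?_
  refine (lintegral_fiberIntegral_le D hq ((hlm (T f)).sub
    (measurable_backwardAvg hXm hτ h (hlm (T f))))).trans ?_
  calc m univ ^ (p.toReal - 1) *
        ∫⁻ z, ‖T f z - backwardAvg X h (T f) z‖ₑ ^ p.toReal ∂(phaseMeasure X m)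
      ≤ ENNReal.ofReal c * (ENNReal.ofReal (ε ^ p.toReal / (c + 1)) *
          ∫⁻ z, ‖f z‖ₑ ^ p.toReal ∂(phaseMeasure X m)) := by
        rw [hcm]
        gcongr
        exact hest f (T f) (hlm f) (Lp_integrable hX hV f) (hT f)
    _ ≤ _ := by
        rw [← mul_assoc, ← ENNReal.ofReal_mul hc0]
        gcongr
        rw [mul_div_assoc', div_le_iff₀ (by positivity)]
        nlinarith [Real.rpow_nonneg hε.le p.toReal]

end FiberIntegral

end

section

variable {X V : Set (Euc d)} {m : Measure (Euc d)} {p : ℝ≥0∞} [Fact (1 ≤ p)]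

/-! ### From product kernels to continuous kernels. -/

section Compacting

/-- `K` is the scattering operator with kernel `k`, given by absolutely convergent integrals. -/
structure HasKernel (X : Set (Euc d)) (m : Measure (Euc d)) {p : ℝ≥0∞} [Fact (1 ≤ p)]
    (K : Lp ℝ p (phaseMeasure X m) →L[ℝ] Lp ℝ p (phaseMeasure X m))
    (k : Euc d → Euc d → Euc d → ℝ) : Prop where
  eq : ∀ u, K u =ᵐ[phaseMeasure X m] scattering m k u
  integrable : ∀ u : Lp ℝ p (phaseMeasure X m), ∀ᵐ z ∂(phaseMeasure X m),
    Integrable (fun v' => k z.1 v' z.2 * u (z.1, v')) m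

/-- The composition of the scattering operator with kernel `k` and `T` is compact. -/
def IsCompacting (X : Set (Euc d)) (m : Measure (Euc d)) {p : ℝ≥0∞} [Fact (1 ≤ p)]
    (T : Lp ℝ p (phaseMeasure X m) →L[ℝ] Lp ℝ p (phaseMeasure X m))
    (k : Euc d → Euc d → Euc d → ℝ) : Prop :=
  ∃ K : Lp ℝ p (phaseMeasure X m) →L[ℝ] Lp ℝ p (phaseMeasure X m),
    HasKernel X m K k ∧ IsFiniteRankLimit (K ∘L T)

variable {T : Lp ℝ p (phaseMeasure X m) →L[ℝ] Lp ℝ p (phaseMeasure X m)}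
  {K K₁ K₂ : Lp ℝ p (phaseMeasure X m) →L[ℝ] Lp ℝ p (phaseMeasure X m)}
  {k k₁ k₂ : Euc d → Euc d → Euc d → ℝ}

lemma HasKernel.add (h₁ : HasKernel X m K₁ k₁) (h₂ : HasKernel X m K₂ k₂) :
    HasKernel X m (K₁ + K₂) (fun x v' v => k₁ x v' v + k₂ x v' v) := by
  refine ⟨fun u => ?_, fun u => ?_⟩
  · filter_upwards [Lp.coeFn_add (K₁ u) (K₂ u), h₁.eq u, h₂.eq u, h₁.integrable u,
      h₂.integrable u] with z a b c e f
    have a' : (K₁ + K₂) u z = K₁ u z + K₂ u z := a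
    rw [a', b, c]
    simp only [scattering, add_mul]
    exact (integral_add e f).symm
  · filter_upwards [h₁.integrable u, h₂.integrable u] with z e f
    simp only [add_mul]
    exact e.add f

lemma HasKernel.const_mul (c : ℝ) (h : HasKernel X m K k) :
    HasKernel X m (c • K) (fun x v' v => c * k x v' v) := by
  refine ⟨fun u => ?_, fun u => ?_⟩
  · filter_upwards [Lp.coeFn_smul c (K u), h.eq u] with z a b
    have a' : (c • K) u z = c • K u z := a
    rw [a', b]
    simp only [scattering, mul_assoc]
    exact (integral_const_mul _ _).symm
  · filter_upwards [h.integrable u] with z e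
    simp only [mul_assoc]
    exact e.const_mul _

lemma HasKernel.unique (h₁ : HasKernel X m K₁ k) (h₂ : HasKernel X m K₂ k) : K₁ = K₂ :=
  ContinuousLinearMap.ext fun u => Lp.ext ((h₁.eq u).trans (h₂.eq u).symm)

lemma HasKernel.congr (h : HasKernel X m K k₁) (e : ∀ x v' v, k₁ x v' v = k₂ x v' v) :
    HasKernel X m K k₂ := by
  have : k₁ = k₂ := by ext x v' v; exact e x v' v
  rwa [← this]

lemma IsCompacting.congr (h : IsCompacting X m T k₁) (e : ∀ x v' v, k₁ x v' v = k₂ x v' v) :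
    IsCompacting X m T k₂ := by
  obtain ⟨K, hK, hKT⟩ := h
  exact ⟨K, hK.congr e, hKT⟩

lemma IsCompacting.add (h₁ : IsCompacting X m T k₁) (h₂ : IsCompacting X m T k₂) :
    IsCompacting X m T (fun x v' v => k₁ x v' v + k₂ x v' v) := by
  obtain ⟨K₁, hK₁, hT₁⟩ := h₁
  obtain ⟨K₂, hK₂, hT₂⟩ := h₂
  refine ⟨K₁ + K₂, hK₁.add hK₂, ?_⟩
  rw [ContinuousLinearMap.add_comp]
  exact hT₁.add hT₂

lemma IsCompacting.const_mul (c : ℝ) (h : IsCompacting X m T k) :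
    IsCompacting X m T (fun x v' v => c * k x v' v) := by
  obtain ⟨K, hK, hKT⟩ := h
  refine ⟨c • K, hK.const_mul c, ?_⟩
  have := hKT.comp_left (c • ContinuousLinearMap.id ℝ _)
  rwa [ContinuousLinearMap.smul_comp, ContinuousLinearMap.id_comp] at this

lemma IsCompacting.zero : IsCompacting X m T (fun _ _ _ => 0) := by
  refine ⟨0, ⟨fun u => ?_, fun u => ?_⟩, ?_⟩
  · filter_upwards [Lp.coeFn_zero ℝ p (phaseMeasure X m)] with z hz
    simpa [scattering] using hz
  · simp
  · rw [ContinuousLinearMap.zero_comp]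
    exact IsFiniteRankLimit.zero

lemma IsCompacting.sum {k : ℕ → Euc d → Euc d → Euc d → ℝ} (N : ℕ)
    (h : ∀ i < N, IsCompacting X m T (k i)) :
    IsCompacting X m T (fun x v' v => ∑ i ∈ Finset.range N, k i x v' v) := by
  induction N with
  | zero => exact IsCompacting.zero.congr fun _ _ _ => by simp
  | succ n ih =>
    exact ((ih fun i hi => h i (by omega)).add (h n (by omega))).congr fun _ _ _ => by
      rw [Finset.sum_range_succ]

variable [IsFiniteMeasure m]

lemma IsBoundedKernel.exists_hasKernel (hXm : MeasurableSet X) (hp1 : 1 < p) (hp : p ≠ ⊤) {C : ℝ}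
    (hC : 0 ≤ C) (hk : IsBoundedKernel X m p k C) :
    ∃ K : Lp ℝ p (phaseMeasure X m) →L[ℝ] Lp ℝ p (phaseMeasure X m),
      HasKernel X m K k ∧ ‖K‖ ≤ C := by
  obtain ⟨K, hK, hC⟩ := hk.exists_scattering_clm hXm hp1 hp hC
  exact ⟨K, ⟨hK, hk.ae_integrable hXm hp1 hp⟩, hC⟩

/-- Closeness of kernels in the mixed norm, uniformly in x, bounds the operator norm of the
difference. The operator for k is obtained as that of an approximant plus that of the difference,
and is independent of the approximant by uniqueness. -/
lemma IsCompacting.of_approx (hXm : MeasurableSet X) (hp1 : 1 < p) (hp : p ≠ ⊤)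
    (h : ∀ ε > 0, ∃ k', IsCompacting X m T k' ∧
      IsBoundedKernel X m p (fun x v' v => k x v' v - k' x v' v) ε) : IsCompacting X m T k := by
  have h' : ∀ ε > 0, ∃ K K' : Lp ℝ p (phaseMeasure X m) →L[ℝ] Lp ℝ p (phaseMeasure X m),
      HasKernel X m K k ∧ IsFiniteRankLimit (K' ∘L T) ∧ ‖K - K'‖ ≤ ε := by
    intro ε hε
    obtain ⟨k', ⟨K', hK', hK'T⟩, hb⟩ := h ε hε
    obtain ⟨D, hD, hDn⟩ := hb.exists_hasKernel hXm hp1 hp hε.le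
    exact ⟨K' + D, K', (hK'.add hD).congr fun _ _ _ => by ring, hK'T, by simpa using hDn⟩
  obtain ⟨K, -, hK, -⟩ := h' 1 one_pos
  refine ⟨K, hK, IsFiniteRankLimit.of_approx fun ε hε => ?_⟩
  obtain ⟨K₂, K', hK₂, hK'T, hn⟩ := h' (ε / (‖T‖ + 1)) (by positivity)
  obtain rfl := hK.unique hK₂
  refine ⟨K' ∘L T, hK'T, ?_⟩
  rw [← ContinuousLinearMap.sub_comp]
  calc ‖(K - K') ∘L T‖ ≤ (ε / (‖T‖ + 1)) * ‖T‖ :=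
        (ContinuousLinearMap.opNorm_comp_le _ _).trans (by gcongr)
    _ ≤ (ε / (‖T‖ + 1)) * (‖T‖ + 1) := by gcongr; linarith
    _ = ε := by field_simp

/-- Dominated limits, for kernels that are constant in `x` on a set `P`. -/
lemma IsCompacting.of_dominated (hXm : MeasurableSet X) (hp1 : 1 < p) (hp : p ≠ ⊤)
    {P : Set (Euc d)} (hP : MeasurableSet P) {κ Φ : Euc d → Euc d → ℝ}
    {κs : ℕ → Euc d → Euc d → ℝ} (hκ : Measurable (Function.uncurry κ))
    (hκs : ∀ n, Measurable (Function.uncurry (κs n))) (hΦm : Measurable (Function.uncurry Φ))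
    (hΦ : mixedNorm m p Φ < ⊤) (hb : ∀ n v' v, |κ v' v - κs n v' v| ≤ |Φ v' v|)
    (hlim : ∀ v' v, Tendsto (fun n => κs n v' v) atTop (𝓝 (κ v' v)))
    (h : ∀ n, IsCompacting X m T fun x v' v => P.indicator 1 x * κs n v' v) :
    IsCompacting X m T fun x v' v => P.indicator 1 x * κ v' v := by
  refine IsCompacting.of_approx hXm hp1 hp fun ε hε => ?_
  have h1 := tendsto_mixedNorm_zero (m := m) (κ := fun n v' v => κ v' v - κs n v' v) hp1 hp
    (fun n => hκ.sub (hκs n)) hΦm hΦ hb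
    (fun v' v => by simpa using (tendsto_const_nhds (x := κ v' v)).sub (hlim v' v))
  obtain ⟨n, hn⟩ := (h1.eventually (gt_mem_nhds (ENNReal.ofReal_pos.2 hε))).exists
  refine ⟨_, h n, ?_, fun x _ => (mixedNorm_mono fun v' v => ?_).trans hn.le⟩
  · have hPm : Measurable fun w : Euc d × Euc d × Euc d => P.indicator (1 : Euc d → ℝ) w.1 :=
      (measurable_one.indicator hP).comp measurable_fst
    exact (hPm.mul (hκ.comp measurable_snd)).sub (hPm.mul ((hκs n).comp measurable_snd))
  · rw [← mul_sub, abs_mul]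
    refine mul_le_of_le_one_left (abs_nonneg _) ?_
    by_cases hx : x ∈ P <;> simp [hx]

variable (hT : ∀ D : Set (Euc d), MeasurableSet D →
  ∀ W : Lp ℝ p (phaseMeasure X m) →L[ℝ] Lp ℝ p (volume.restrict X),
    (∀ u, W u =ᵐ[volume.restrict X] fun x => ∫ v in D, u (x, v) ∂m) → IsFiniteRankLimit (W ∘L T))
  (hX : IsC1Domain X) (hV : VelocityBounds V m) (hp1 : 1 < p) (hp : p ≠ ⊤)
include hT hX hV hp1 hp

/-- For a product of indicators, scattering is the velocity average over D followed by
multiplication with the indicator of P × E, so `hT` applies. -/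
lemma isCompacting_rectangle {P D E : Set (Euc d)} (hP : MeasurableSet P) (hD : MeasurableSet D)
    (hE : MeasurableSet E) :
    IsCompacting X m T fun x v' v => P.indicator 1 x * (D ×ˢ E).indicator 1 (v', v) := by
  have hp0 : p ≠ 0 := (zero_lt_one.trans hp1).ne'
  obtain ⟨W, hW⟩ := exists_fiberIntegral_clm hV hX D hp1 hp
  obtain ⟨J, hJ⟩ := exists_embedding_clm (X := X) (m := m) hp0 hp (hP.prod hE)
  have hker : ∀ (z : Euc d × Euc d) (u : Euc d × Euc d → ℝ) (v' : Euc d),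
      P.indicator (1 : Euc d → ℝ) z.1 * (D ×ˢ E).indicator (1 : Euc d × Euc d → ℝ) (v', z.2) *
        u (z.1, v') =
      (P ×ˢ E).indicator (1 : Euc d × Euc d → ℝ) z * D.indicator (fun v => u (z.1, v)) v' :=
    fun z u v' => by
      by_cases h1 : z.1 ∈ P <;> by_cases h2 : z.2 ∈ E <;> by_cases h3 : v' ∈ D <;>
        simp [indicator, h1, h2, h3]
  refine ⟨J ∘L W, ⟨fun u => ?_, fun u => ?_⟩, (hT D hD W hW).comp_left J⟩
  · have h1 : ∀ᵐ z ∂(phaseMeasure X m), W u z.1 = ∫ v in D, u (z.1, v) ∂m :=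
      Measure.quasiMeasurePreserving_fst.ae (hW u)
    filter_upwards [hJ (W u), h1] with z a b
    rw [ContinuousLinearMap.comp_apply, a]
    simp only [scattering, hker]
    rw [integral_const_mul, integral_indicator hD, ← b]
    by_cases hz : z ∈ P ×ˢ E <;> simp only [hz, indicator_of_mem, indicator_of_notMem,
      not_false_eq_true, Pi.one_apply, one_mul, zero_mul]
  · have h1 : ∀ᵐ z ∂(phaseMeasure X m), Integrable (fun v => u (z.1, v)) m :=
      Measure.quasiMeasurePreserving_fst.ae (ae_integrable_fiber (Lp_integrable hX hV u))
    filter_upwards [h1] with z hz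
    simp only [hker]
    exact (hz.indicator hD).const_mul _

/-- A π-λ argument starting from rectangles: complements are differences with the full rectangle,
and countable disjoint unions are dominated limits of finite sums, with the constant 1 as a majorant
because m is finite. -/
lemma isCompacting_indicator {P : Set (Euc d)} (hP : MeasurableSet P) {A : Set (Euc d × Euc d)}
    (hA : MeasurableSet A) :
    IsCompacting X m T fun x v' v => P.indicator 1 x * A.indicator 1 (v', v) := by
  have hXm := hX.isOpen.measurableSet
  refine MeasurableSpace.induction_on_inter (C := fun A _ => IsCompacting X m T fun x v' v =>
    P.indicator 1 x * A.indicator 1 (v', v)) generateFrom_prod.symm isPiSystem_prod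
    ?_ ?_ ?_ ?_ A hA
  · exact IsCompacting.zero.congr fun _ _ _ => by simp
  · rintro _ ⟨D, hD, E, hE, rfl⟩
    exact isCompacting_rectangle hT hX hV hp1 hp hP hD hE
  · intro A hA ih
    refine ((isCompacting_rectangle hT hX hV hp1 hp hP MeasurableSet.univ
      MeasurableSet.univ).add (ih.const_mul (-1))).congr fun x v' v => ?_
    by_cases h : (v', v) ∈ A <;> simp [h]
  · intro A hdis hA ih
    have hsum : ∀ (n : ℕ) (w : Euc d × Euc d), (∀ i, w ∉ A i) →
        ∑ i ∈ Finset.range n, (A i).indicator (1 : Euc d × Euc d → ℝ) w = 0 := fun n w hw =>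
      Finset.sum_eq_zero fun i _ => indicator_of_notMem (hw i) _
    have hsum' : ∀ (n j : ℕ) (w : Euc d × Euc d), w ∈ A j →
        ∑ i ∈ Finset.range n, (A i).indicator (1 : Euc d × Euc d → ℝ) w =
          if j < n then 1 else 0 := fun n j w hw => by
      have : ∀ i, (A i).indicator (1 : Euc d × Euc d → ℝ) w = if i = j then 1 else 0 := fun i => by
        split_ifs with h
        · rw [h, indicator_of_mem hw, Pi.one_apply]
        · exact indicator_of_notMem (fun hi => (Set.disjoint_left.1 (hdis h) hi) hw) _
      simp only [this, Finset.sum_ite_eq', Finset.mem_range]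
    have hm : ∀ A : Set (Euc d × Euc d), MeasurableSet A →
        Measurable (A.indicator (1 : Euc d × Euc d → ℝ)) := fun A hA => measurable_one.indicator hA
    refine IsCompacting.of_dominated hXm hp1 hp hP (Φ := fun _ _ => 1)
      (κ := fun v' v => (⋃ i, A i).indicator 1 (v', v))
      (κs := fun n v' v => ∑ i ∈ Finset.range n, (A i).indicator 1 (v', v))
      (hm _ (MeasurableSet.iUnion hA)) (fun n => ?_) measurable_const mixedNorm_one_lt_top
      (fun n v' v => ?_) (fun v' v => ?_) (fun n => ?_)
    · exact Finset.measurable_sum _ fun i _ => hm _ (hA i)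
    · by_cases h : ∃ j, (v', v) ∈ A j
      · obtain ⟨j, hj⟩ := h
        rw [hsum' n j _ hj, indicator_of_mem (mem_iUnion.2 ⟨j, hj⟩)]
        split_ifs <;> simp
      · push Not at h
        rw [hsum n _ h, indicator_of_notMem (by simpa using h)]
        simp
    · by_cases h : ∃ j, (v', v) ∈ A j
      · obtain ⟨j, hj⟩ := h
        refine tendsto_const_nhds.congr' ?_
        filter_upwards [eventually_gt_atTop j] with n hn
        rw [hsum' n j _ hj, indicator_of_mem (mem_iUnion.2 ⟨j, hj⟩), if_pos hn, Pi.one_apply]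
      · push Not at h
        refine tendsto_const_nhds.congr fun n => ?_
        rw [hsum n _ h, indicator_of_notMem (by simpa using h)]
    · exact (IsCompacting.sum n fun i _ => ih i).congr fun _ _ _ => by rw [Finset.mul_sum]

lemma isCompacting_simpleFunc {P : Set (Euc d)} (hP : MeasurableSet P)
    (f : SimpleFunc (Euc d × Euc d) ℝ) :
    IsCompacting X m T fun x v' v => P.indicator 1 x * f (v', v) := by
  induction f using SimpleFunc.induction with
  | const c hs =>
    rename_i s
    refine ((isCompacting_indicator hT hX hV hp1 hp hP hs).const_mul c).congr fun x v' v => ?_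
    by_cases h : (v', v) ∈ s <;> simp [h, mul_comm, SimpleFunc.piecewise_apply]
  | add _ h₁ h₂ => exact (h₁.add h₂).congr fun _ _ _ => by simp [mul_add]

lemma isCompacting_const_on {P : Set (Euc d)} (hP : MeasurableSet P) {κ : Euc d → Euc d → ℝ}
    (hκ : Measurable (Function.uncurry κ)) (hfin : mixedNorm m p κ < ⊤) :
    IsCompacting X m T fun x v' v => P.indicator 1 x * κ v' v := by
  let f := SimpleFunc.approxOn (Function.uncurry κ) hκ univ 0 (mem_univ _)
  refine IsCompacting.of_dominated hX.isOpen.measurableSet hp1 hp hP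
    (κs := fun n v' v => f n (v', v)) hκ (fun n => (f n).measurable) hκ hfin (fun n v' v => ?_)
    (fun v' v => SimpleFunc.tendsto_approxOn hκ (mem_univ _) (by simp))
    (fun n => isCompacting_simpleFunc hT hX hV hp1 hp hP (f n))
  -- The approximants are never further from κ than the initial value 0 is, so |κ| itself dominates
  -- the errors.
  have := SimpleFunc.edist_approxOn_le hκ (mem_univ (0 : ℝ)) (v', v) n
  rw [edist_dist, edist_dist, ENNReal.ofReal_le_ofReal_iff dist_nonneg, dist_comm, Real.dist_eq,
    dist_comm, Real.dist_eq, sub_zero] at this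
  exact this

/-- The scattering operator with a continuous kernel turns `T` into a compact operator. -/
theorem IsContinuousKernel.isCompacting (hk : IsContinuousKernel X m p k) :
    IsCompacting X m T k := by
  have hXm := hX.isOpen.measurableSet
  refine IsCompacting.of_approx hXm hp1 hp fun ε hε => ?_
  obtain ⟨N, c, x, hc, -, hx, hU⟩ := exists_measurable_index hX.isBounded.isCompact_closure
    (fun y => {x | x ∈ closure X →
      mixedNorm m p (fun v' v => k x v' v - k y v' v) < ENNReal.ofReal ε}) (fun y hy => by
      have := (hk.continuous y hy).eventually (gt_mem_nhds (ENNReal.ofReal_pos.2 hε))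
      exact eventually_nhdsWithin_iff.1 this)
  have hcm : ∀ i, MeasurableSet {y | c y = i} := fun i => hc (measurableSet_singleton i)
  have hkm : ∀ y, Measurable (Function.uncurry (k y)) := fun y =>
    hk.measurable.comp (measurable_const.prodMk measurable_id)
  -- On the cell of index i the kernel is replaced by its value at the centre x i; continuity in the
  -- mixed norm keeps the error below ε, and exactly one term of the sum is nonzero on X.
  refine ⟨fun y v' v => ∑ i ∈ Finset.range N, {y | c y = i}.indicator 1 y * k (x i) v' v,
    IsCompacting.sum N fun i hi => isCompacting_const_on hT hX hV hp1 hp (hcm i) (hkm _)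
      (hk.finite _ (hx i hi)), hk.measurable.sub (Finset.measurable_sum _ fun i _ => ?_), ?_⟩
  · exact ((measurable_one.indicator (hcm i)).comp measurable_fst).mul
      ((hkm (x i)).comp measurable_snd)
  · intro y hy
    obtain ⟨h1, h2⟩ := hU y (subset_closure hy)
    have e : ∀ v' v, ∑ i ∈ Finset.range N, {y | c y = i}.indicator (1 : Euc d → ℝ) y *
        k (x i) v' v = k (x (c y)) v' v := fun v' v => by
      rw [Finset.sum_eq_single (c y)]
      · simp
      · intro i _ hi
        rw [indicator_of_notMem (fun h => hi h.symm), zero_mul]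
      · intro h
        exact absurd (Finset.mem_range.2 h1) h
    simp only [e]
    exact (h2 (subset_closure hy)).le

end Compacting

end

end Transport

end

theorem theorem3 {d : ℕ} (hd : 1 ≤ d)
    -- the domain, the velocity set with its measure, the boundary set, the coefficients
    (X : Set (Euc d)) (hX : IsC1Domain X)
    (V : Set (Euc d)) (m : Measure (Euc d)) (hV : IsVelocitySet V m)
    (Cp : Set (Euc d × Euc d)) (hCp : Cp ⊆ GammaPlus X V) (hCpm : MeasurableSet Cp)
    (p : ℝ≥0∞) [Fact (1 ≤ p)] (hp1 : 1 < p) (hp : p ≠ ⊤)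
    (σ : Euc d × Euc d → ℝ) (hσm : Measurable σ)
    (hσ : MemLp (fun z => tau X z * σ z) ⊤ (phaseMeasure X m))
    (k : Euc d → Euc d → Euc d → ℝ) (hk : IsContinuousKernel X m p k) :
    -- the operators `T_𝒞⁻¹ K` on `L^p` and on `τ^{1/p} L^p`, and `K T_{Γ \ 𝒞}⁻¹` on `L^p`
    ∃ (B : Lp ℝ p (phaseMeasure X m) →L[ℝ] Lp ℝ p (phaseMeasure X m))
      (Bw : Lp ℝ p (weightedPhaseMeasure X m) →L[ℝ] Lp ℝ p (weightedPhaseMeasure X m))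
      (Q : Lp ℝ p (phaseMeasure X m) →L[ℝ] Lp ℝ p (phaseMeasure X m)),
      Realizes B (fun u => transportInv X V σ (bdrySet X V Cp) (scattering m k u)) ∧
      Realizes Bw (fun u => transportInv X V σ (bdrySet X V Cp) (scattering m k u)) ∧
      Realizes Q (fun u => scattering m k (transportInv X V σ (coBdrySet X V Cp) u)) ∧
      -- the albedo operator from `L^p(𝒞, τ dξ)` to `L^p(Γ \ 𝒞, τ dξ)`
      (IsUnit (1 - B) →
        ∃ A : Lp ℝ p ((tauXi X m).restrict (bdrySet X V Cp)) →L[ℝ]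
            Lp ℝ p ((tauXi X m).restrict (coBdrySet X V Cp)),
          IsAlbedo X V m Cp σ k (phaseMeasure X m) A ∧
          (∀ A', IsAlbedo X V m Cp σ k (phaseMeasure X m) A' → A' = A) ∧
          IsFredholmIndexZero A ∧
          Module.rank ℝ A.ker = Module.rank ℝ (1 - Q).ker) ∧
      -- the albedo operator from `L^p(𝒞, dξ)` to `L^p(Γ \ 𝒞, dξ)`
      (IsUnit (1 - Bw) →
        ∃ A : Lp ℝ p ((xi X m).restrict (bdrySet X V Cp)) →L[ℝ]
            Lp ℝ p ((xi X m).restrict (coBdrySet X V Cp)),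
          IsAlbedo X V m Cp σ k (weightedPhaseMeasure X m) A ∧
          (∀ A', IsAlbedo X V m Cp σ k (weightedPhaseMeasure X m) A' → A' = A) ∧
          IsFredholmIndexZero A ∧
          Module.rank ℝ A.ker = Module.rank ℝ (1 - Q).ker) := by
  have hV' := hV.velocityBounds
  have := hV'.isFiniteMeasure
  have hG : IsSection X V (coBdrySet X V Cp) := (isSection_bdrySet hX hV' hCp hCpm).compl hX hV'
  have hphase := isLinePair_phase hX hV'
  -- This T belongs to the complementary set Γ \ 𝒞, so K T is the operator Q of the statement.
  obtain ⟨T, hT⟩ := exists_transportInv_clm (p := p) hX hV' hG hphase.ac_add hp1 hp hσm hσ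
    (hphase.fib_le hX hV')
  obtain ⟨K, hK, hKT⟩ := hk.isCompacting (T := T)
    (fun D hD W hW => isFiniteRankLimit_fiberIntegral hd hX hV' hp1 hp hG hσm hσ hT hD hW)
    hX hV' hp1 hp
  have hQ : ∀ u, (K ∘L T) u =ᵐ[phaseMeasure X m]
      scattering m k (transportInv X V σ (coBdrySet X V Cp) u) := fun u =>
    (hK.eq (T u)).trans (scattering_congr k (hT u))
  -- The same K and K T on the unweighted space serve for both weights, so both kernels are compared
  -- with the same operator.
  obtain ⟨B, hB, hA⟩ := exists_albedo hX hV' hCp hCpm hp1 hp hσm hσ K (K ∘L T) hK.eq hQ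
    hKT.isFredholmIndexZero hphase
  obtain ⟨Bw, hBw, hAw⟩ := exists_albedo hX hV' hCp hCpm hp1 hp hσm hσ K (K ∘L T) hK.eq hQ
    hKT.isFredholmIndexZero (isLinePair_weighted hX hV')
  exact ⟨B, Bw, K ∘L T, hB, hBw, hQ, hA, hAw⟩
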